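/- Let $\Omega$ be $[0,\infty)$ or $[0,1]$ with Lebesgue measure, or $\mathbb N=\{1,2,\dots\}$ with counting measure $\mu$. A Köthe function space on $\Omega$ is a Banach space $X\subset L_0(\mu)$ of (classes of) real measurable functions that contains $\chi_B$ whenever $\mu(B)<\infty$, satisfies $\|f\|_X\le\|g\|_X$ whenever $|f|\le|g|$ a.e., and whose closed unit ball is closed in $L_0(\mu)$ for convergence in measure on sets of finite measure; put $\|f\|_X=\infty$ for $f\notin X$. With $f^*(t)=\sup_{\mu(B)\ge t}\inf_{s\in B}|f(s)|$ ($t>0$), $X$ is rearrangement-invariant (r.i.; a symmetric sequence space if $\Omega=\mathbb N$) if $\|f^*\|_X=\|f\|_X$ for all $f$. For $a>0$ let $D_af(t)=f(t/a)$ if $\Omega=[0,\infty)$ or $[0,1]$ (with $f=0$ outside $\Omega$), and $D_af(n)=f^*(n/a)$ if $\Omega=\mathbb N$; let $\|D_a\|_X=\sup\{\|D_af\|_X:\|f\|_X\le1\}$. The Boyd indices of $X$ are $$p_X=\lim_{a\to\infty}\frac{\log a}{\log\|D_a\|_X},\qquad q_X=\lim_{a\to0+}\frac{\log a}{\log\|D_a\|_X}$$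 in $[1,\infty]$, where quotients with $\|D_a\|_X=1$ are read as $\infty$. For r.i. spaces $X,Y$ on $\Omega$, $f\in X+Y$ and $t>0$, let $K(t,f)=\inf\{\|x\|_X+t\|y\|_Y:x+y=f\}$. The pair $(X,Y)$ is a Calderón couple if for all $f,g\in X+Y$ with $K(t,g)\le K(t,f)$ for every $t>0$ there is a linear operator $T:X+Y\to X+Y$ that is bounded on $X$ and on $Y$ and satisfies $Tf=g$. Let $J$ be $\mathbb Z$, $\{n\in\mathbb Z:n<0\}$, $\{n\in\mathbb Z:n\ge0\}$ for $\Omega=[0,\infty),[0,1],\mathbb N$ respectively, and for $x\in\mathbb R^J$ put $\|x\|_{E_X}=\big\|\sum_{k\in J}x(k)\chi_{[2^k,2^{k+1})}\big\|_X$. An interlaced pair is a family $(x_n,y_n)_{n\in I}$, indexed by an interval $I$ of $\mathbb Z$, of nonzero finitely supported $x_n,y_n\in\mathbb R^J$ such that every element of $\operatorname{supp}x_n$ is less than every element of $\operatorname{supp}y_n$ for $n\in I$, and every element of $\operatorname{supp}y_n$ is less than every element of $\operatorname{supp}x_{n+1}$ whenever $n,n+1\in I$. The space $X$ is stretchable if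 there is a constant $C$ such that for every interlaced pair with $\|y_n\|_{E_X}\le\|x_n\|_{E_X}=1$ $(n\in I)$ and all finitely nonzero scalars $(\alpha_n)_{n\in I}$, $$\Big\|\sum_{n\in I}\alpha_ny_n\Big\|_{E_X}\le C\Big\|\sum_{n\in I}\alpha_nx_n\Big\|_{E_X}.$$ It is compressible if there is a constant $C$ such that for every interlaced pair with $\|x_n\|_{E_X}\le\|y_n\|_{E_X}=1$ $(n\in I)$ and all such $(\alpha_n)$, $$\Big\|\sum_{n\in I}\alpha_nx_n\Big\|_{E_X}\le C\Big\|\sum_{n\in I}\alpha_ny_n\Big\|_{E_X}.$$ **Theorem.** Let $X,Y$ be r.i. spaces on $\Omega$ whose Boyd indices satisfy $p_Y>q_X$. Then $(X,Y)$ is a Calderón couple if and only if $X$ is stretchable and $Y$ is compressible. -/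

import Mathlib

open MeasureTheory Filter Topology Set
open scoped ENNReal

noncomputable section

namespace Calderon

/-! ## Köthe function spaces -/

section Kothe

variable {α : Type*} [MeasurableSpace α] {μ : Measure α}

/-- The class in `L₀(μ)` of the characteristic function of a measurable set. -/
def chi (μ : Measure α) (B : Set α) (hB : MeasurableSet B) : α →ₘ[μ] ℝ :=
  AEEqFun.mk (B.indicator fun _ => (1 : ℝ))
    (stronglyMeasurable_const.indicator hB).aestronglyMeasurable

/-- Convergence of a sequence in the topology of `L₀(μ)`: convergence in measure on every
set of finite measure. -/
def TendstoInL0 (f : ℕ → α →ₘ[μ] ℝ) (g : α →ₘ[μ] ℝ) : Prop :=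
  ∀ B : Set α, MeasurableSet B → μ B < ∞ →
    TendstoInMeasure (μ.restrict B) (fun n => (f n : α → ℝ)) atTop (g : α → ℝ)

/-- A Köthe function space on `(α, μ)`, given by its norm extended to all of `L₀(μ)` by the
value `∞` outside the space: the space itself is `{f | eNorm f < ∞}`. -/
structure KotheSpace (μ : Measure α) where
  /-- the norm, `∞` off the space -/
  eNorm : (α →ₘ[μ] ℝ) → ℝ≥0∞
  eNorm_eq_zero_iff : ∀ f, eNorm f = 0 ↔ f = 0
  eNorm_smul : ∀ (c : ℝ) f, eNorm (c • f) = ‖c‖ₑ * eNorm f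
  eNorm_add_le : ∀ f g, eNorm (f + g) ≤ eNorm f + eNorm g
  /-- the space is complete -/
  complete : ∀ f : ℕ → α →ₘ[μ] ℝ, (∀ n, eNorm (f n) < ∞) →
    (∀ ε : ℝ≥0∞, 0 < ε → ∃ N, ∀ m ≥ N, ∀ n ≥ N, eNorm (f m - f n) ≤ ε) →
    ∃ g, eNorm g < ∞ ∧ Tendsto (fun n => eNorm (f n - g)) atTop (𝓝 0)
  /-- the space contains the characteristic functions of sets of finite measure -/
  eNorm_chi_lt_top : ∀ (B : Set α) (hB : MeasurableSet B), μ B < ∞ → eNorm (chi μ B hB) < ∞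
  /-- the norm is a lattice norm -/
  eNorm_mono : ∀ f g : α →ₘ[μ] ℝ, (∀ᵐ s ∂μ, |f s| ≤ |g s|) → eNorm f ≤ eNorm g
  /-- Fatou property: the closed unit ball is closed in `L₀(μ)`; as `L₀(μ)` is metrizable for
  σ-finite `μ`, closedness is expressed by sequences -/
  fatou : ∀ (f : ℕ → α →ₘ[μ] ℝ) (g : α →ₘ[μ] ℝ), (∀ n, eNorm (f n) ≤ 1) →
    TendstoInL0 f g → eNorm g ≤ 1

/-- The space `X` as a linear subspace of `L₀(μ)`. -/
def KotheSpace.toSubmodule (X : KotheSpace μ) : Submodule ℝ (α →ₘ[μ] ℝ) where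
  carrier := {f | X.eNorm f < ∞}
  add_mem' := fun {f g} hf hg => (X.eNorm_add_le f g).trans_lt (ENNReal.add_lt_top.2 ⟨hf, hg⟩)
  zero_mem' := by simp [(X.eNorm_eq_zero_iff 0).2 rfl]
  smul_mem' := fun c f hf => by
    simp only [mem_ofPred_eq] at hf ⊢
    rw [X.eNorm_smul]
    exact ENNReal.mul_lt_top enorm_lt_top hf

/-- The sum `X + Y` inside `L₀(μ)`. -/
def sumSpace (X Y : KotheSpace μ) : Submodule ℝ (α →ₘ[μ] ℝ) :=
  X.toSubmodule ⊔ Y.toSubmodule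

/-- The Peetre K-functional
`K(t, f; X, Y) = inf {‖x‖_X + t ‖y‖_Y : x + y = f}` (used for `t > 0` only). -/
def kFunctional (X Y : KotheSpace μ) (t : ℝ) (f : α →ₘ[μ] ℝ) : ℝ≥0∞ :=
  ⨅ (x : α →ₘ[μ] ℝ) (y : α →ₘ[μ] ℝ) (_ : x + y = f),
    X.eNorm x + ENNReal.ofReal t * Y.eNorm y

/-- `‖T‖_Z = sup {‖T f‖_Z : ‖f‖_Z ≤ 1}` for a linear operator `T` on a subspace `V` of
`L₀(μ)`. -/
def opNormOn {V : Submodule ℝ (α →ₘ[μ] ℝ)} (Z : KotheSpace μ) (T : V →ₗ[ℝ] V) : ℝ≥0∞ :=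
  ⨆ (f : V) (_ : Z.eNorm f ≤ 1), Z.eNorm (T f)

/-- `(X, Y)` is a Calderón couple: whenever `K(t, g) ≤ K(t, f)` for all `t`, there is a linear
`T : X + Y → X + Y` bounded on `X` and on `Y` with `T f = g`. -/
def IsCalderonCouple (X Y : KotheSpace μ) : Prop :=
  ∀ f g : sumSpace X Y,
    (∀ t : ℝ, 0 < t → kFunctional X Y t g ≤ kFunctional X Y t f) →
    ∃ T : sumSpace X Y →ₗ[ℝ] sumSpace X Y,
      opNormOn X T < ∞ ∧ opNormOn Y T < ∞ ∧ T f = g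

/-- The decreasing rearrangement `f*(t) = sup {inf_{s ∈ B} |f(s)| : μ(B) ≥ t}`, `t > 0`. It is
the left-continuous one, so that for counting measure `f*(n)` is the `n`-th largest value. -/
def rearr (f : α →ₘ[μ] ℝ) (t : ℝ) : ℝ≥0∞ :=
  ⨆ (B : Set α) (_ : MeasurableSet B) (_ : ENNReal.ofReal t ≤ μ B), ⨅ s ∈ B, ‖f s‖ₑ

theorem rearr_antitone (f : α →ₘ[μ] ℝ) : Antitone (rearr f) := fun _ _ h =>
  iSup_mono fun _ => iSup_mono fun _ =>
    iSup_le fun hB => le_iSup_of_le ((ENNReal.ofReal_le_ofReal h).trans hB) le_rfl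

end Kothe

/-! ## The domains `[0, ∞)`, `[0, 1]`, `ℕ = {1, 2, …}` and their r.i. spaces -/

/-- The three underlying sets. -/
inductive Domain
  | halfLine
  | unitInterval
  | naturals

/-- The underlying set, as a subset of `ℝ`. -/
def Domain.carrier : Domain → Set ℝ
  | .halfLine => Ici 0
  | .unitInterval => Icc 0 1
  | .naturals => {t | ∃ n : ℕ, 1 ≤ n ∧ t = n}

/-- Lebesgue measure on `[0, ∞)` and on `[0, 1]`, counting measure on `ℕ`, each regarded as a
measure on `ℝ` that vanishes off the underlying set. -/
def Domain.measure : Domain → Measure ℝ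
  | .halfLine => volume.restrict (Domain.carrier .halfLine)
  | .unitInterval => volume.restrict (Domain.carrier .unitInterval)
  | .naturals => Measure.count.restrict (Domain.carrier .naturals)

/-- The index set `J`: `ℤ`, the negative integers, the nonnegative integers. -/
def Domain.index : Domain → Set ℤ
  | .halfLine => univ
  | .unitInterval => Iio 0
  | .naturals => Ici 0

/-- `L₀` of the domain. -/
abbrev Domain.L0 (Ω : Domain) : Type := ℝ →ₘ[Ω.measure] ℝ

/-- A rearrangement-invariant space on `Ω` (a symmetric sequence space for `Ω = ℕ`): a Köthe
function space with `‖f*‖ = ‖f‖`. -/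
structure RISpace (Ω : Domain) extends KotheSpace Ω.measure where
  eNorm_rearr : ∀ f g : Ω.L0, (∀ᵐ t ∂Ω.measure, ‖g t‖ₑ = rearr f t) → eNorm g = eNorm f

theorem measurableSet_carrier (Ω : Domain) : MeasurableSet Ω.carrier := by
  cases Ω with
  | halfLine => exact measurableSet_Ici
  | unitInterval => exact measurableSet_Icc
  | naturals =>
    refine ((countable_range (fun n : ℕ => (n : ℝ))).mono ?_).measurableSet
    rintro t ⟨n, _, rfl⟩
    exact ⟨n, rfl⟩

/-- `t ↦ f (t / a)`, with `f` regarded as vanishing outside the domain. -/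
def funDilate (Ω : Domain) (a : ℝ) (f : Ω.L0) : Ω.L0 :=
  AEEqFun.mk (fun t => Ω.carrier.indicator (f : ℝ → ℝ) (t / a))
    ((f.stronglyMeasurable.measurable.indicator (measurableSet_carrier Ω)).comp
      (measurable_id.div_const a)).aestronglyMeasurable

/-- `t ↦ f* (t / a)`. -/
def rearrDilate (Ω : Domain) (a : ℝ) (f : Ω.L0) : Ω.L0 :=
  AEEqFun.mk (fun t => (rearr f (t / a)).toReal)
    (((rearr_antitone f).measurable.comp
      (measurable_id.div_const a)).ennreal_toReal).aestronglyMeasurable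

/-- The dilation `D_a`, `a > 0`: `D_a f(t) = f(t/a)` on `[0, ∞)` and `[0, 1]`, and the nonlinear
`D_a f(n) = f*(n/a)` on `ℕ`. -/
def dilate : (Ω : Domain) → ℝ → Ω.L0 → Ω.L0
  | .halfLine => funDilate .halfLine
  | .unitInterval => funDilate .unitInterval
  | .naturals => rearrDilate .naturals

variable {Ω : Domain}

/-- `‖D_a‖_X`. -/
def dilationNorm (X : RISpace Ω) (a : ℝ) : ℝ≥0∞ :=
  ⨆ (f : Ω.L0) (_ : X.eNorm f ≤ 1), X.eNorm (dilate Ω a f)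

/-- The Boyd index `p_X = lim_{a → ∞} log a / log ‖D_a‖_X ∈ [1, ∞]`, where a quotient with
`‖D_a‖_X = 1` is `∞`. The limit always exists by submultiplicativity; the upper limit is written
so that the definition does not depend on this fact. -/
def lowerBoydIndex (X : RISpace Ω) : ℝ≥0∞ :=
  limsup (fun a : ℝ => ENNReal.ofReal (Real.log a) /
    ENNReal.ofReal (Real.log (dilationNorm X a).toReal)) atTop

/-- The Boyd index `q_X = lim_{a → 0+} log a / log ‖D_a‖_X ∈ [1, ∞]`, where a quotient with
`‖D_a‖_X = 1` is `∞`; both logarithms are `≤ 0` for `a < 1`, hence the signs. The limit always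
exists; the lower limit is written so that the definition does not depend on this fact. -/
def upperBoydIndex (X : RISpace Ω) : ℝ≥0∞ :=
  liminf (fun a : ℝ => ENNReal.ofReal (-Real.log a) /
    ENNReal.ofReal (-Real.log (dilationNorm X a).toReal)) (𝓝[>] 0)

/-! ## The sequence space `E_X`, stretchable and compressible spaces -/

/-- The block `[2^k, 2^(k+1))`. -/
def dyadicBlock (k : ℤ) : Set ℝ := Ico ((2 : ℝ) ^ k) ((2 : ℝ) ^ (k + 1))

/-- `∑_{k ∈ J} x(k) χ_{[2^k, 2^(k+1))}` as a function; at most one term is nonzero at each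
point. -/
def stepFun (Ω : Domain) (x : Ω.index → ℝ) (t : ℝ) : ℝ :=
  ∑' k : Ω.index, x k * (dyadicBlock k).indicator (fun _ => (1 : ℝ)) t

theorem measurable_stepFun (Ω : Domain) (x : Ω.index → ℝ) : Measurable (stepFun Ω x) :=
  Measurable.tsum fun _ =>
    measurable_const.mul (measurable_const.indicator measurableSet_Ico)

/-- The norm of `E_X` on sequences modelled on `J`:
`‖x‖_{E_X} = ‖∑_{k ∈ J} x(k) χ_{[2^k, 2^(k+1))}‖_X`. -/
def seqNorm (X : RISpace Ω) (x : Ω.index → ℝ) : ℝ≥0∞ :=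
  X.eNorm (AEEqFun.mk (stepFun Ω x) (measurable_stepFun Ω x).aestronglyMeasurable)

section Shift

variable {J : Set ℤ}

/-- `supp x < supp y`. -/
def SuppLT (x y : J → ℝ) : Prop :=
  ∀ a ∈ Function.support x, ∀ b ∈ Function.support y, a < b

/-- `(x_n, y_n)_{n ∈ I}` is an interlaced pair of sequences of nonzero finitely supported vectors:
`supp x_n < supp y_n < supp x_{n+1}`. -/
structure Interlaced (I : Set ℤ) (x y : ℤ → J → ℝ) : Prop where
  ne_zero_left : ∀ n ∈ I, x n ≠ 0
  ne_zero_right : ∀ n ∈ I, y n ≠ 0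
  finite_left : ∀ n ∈ I, (Function.support (x n)).Finite
  finite_right : ∀ n ∈ I, (Function.support (y n)).Finite
  lt : ∀ n ∈ I, SuppLT (x n) (y n)
  lt_succ : ∀ n, n ∈ I → n + 1 ∈ I → SuppLT (y n) (x (n + 1))

/-- The right-shift property of a sequence space on `J` with norm `N`; `I` runs over all intervals
of `ℤ` and `α` over the finitely nonzero families of scalars on `I`. -/
def RightShiftProperty (N : (J → ℝ) → ℝ≥0∞) : Prop :=
  ∃ C : ℝ, ∀ (I : Set ℤ) (x y : ℤ → J → ℝ), I.OrdConnected → Interlaced I x y →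
    (∀ n ∈ I, N (y n) ≤ N (x n) ∧ N (x n) = 1) →
    ∀ α : ℤ →₀ ℝ, ↑α.support ⊆ I →
      N (α.sum fun n c => c • y n) ≤ ENNReal.ofReal C * N (α.sum fun n c => c • x n)

/-- The left-shift property. -/
def LeftShiftProperty (N : (J → ℝ) → ℝ≥0∞) : Prop :=
  ∃ C : ℝ, ∀ (I : Set ℤ) (x y : ℤ → J → ℝ), I.OrdConnected → Interlaced I x y →
    (∀ n ∈ I, N (x n) ≤ N (y n) ∧ N (y n) = 1) →
    ∀ α : ℤ →₀ ℝ, ↑α.support ⊆ I →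
      N (α.sum fun n c => c • x n) ≤ ENNReal.ofReal C * N (α.sum fun n c => c • y n)

end Shift

/-- `X` is stretchable if `E_X` has the right-shift property. -/
def IsStretchable (X : RISpace Ω) : Prop := RightShiftProperty (seqNorm X)

/-- `X` is compressible if `E_X` has the left-shift property. -/
def IsCompressible (X : RISpace Ω) : Prop := LeftShiftProperty (seqNorm X)

end Calderon

end

noncomputable section

namespace Calderon

/-! ## Lattice norms on sequences indexed by a set of integers -/

/-! On step functions over the dyadic blocks, `X` and `Y` become sequence lattices `E` and `F` on
`J`, and dilations become translations. Roughly, translating left by `d` costs `2 ^ (-d / q_X)` on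
`E` and translating right by `d` costs `2 ^ (d / p_Y)` on `F`. So `p_Y > q_X` makes the product of
the two norms decay like `q ^ d` with `q < 1`. The Boyd indices enter only through this separation
(`SepPair`, `exists_sepPair_of_boyd`). It makes cutting at a coordinate an almost optimal
decomposition: up to constants the K-functional at the ratio of the fundamental functions is
`kappa`, a left part in `E` plus a right part in `F`.

Functions and sequences are exchanged by operators bounded on all r.i. spaces at once. Averages over
suitable sets send `f` to a sequence that dominates `f*(2 ^ k)` up to a factor
(`exists_discretization`), and composition with the level sets of `f`, followed by a multiplication,
recovers `f` from it (`exists_synthesis`). Hence the Calderón property of `(X, Y)` is equivalent to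
that of `(E, F)` (`SepPair.isCalderonCouple`, `SepPair.seqCalderon`).

Sufficiency (`seqCalderon_of_shift`). Let `kappa` of `b` be dominated by `kappa` of `a`, first at
coordinates where the `E`-term of `a` prevails. Divide `J` into levels on which the norm of the left
part of `a` lies between consecutive powers of a constant. Hahn–Banach provides functionals, each
controlled by the preceding level and equal to `1` at `a`; using them as coefficients of the pieces
of `b` gives an operator taking `a` to `b` (`exists_operator_of_left`). It moves each level into the
next one to the right, so the right-shift property bounds it on `E`, while on `F` it is bounded by
separation alone. Where the `F`-term prevails the reflected argument applies, with the left-shift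
property of `F`.

Necessity (`SepPair.seqRSPInterval_of_seqCalderon`). If the right-shift property fails in `E`, there
are finite families of blocks `u_i`, `v_i` violating it with every constant `j`, with mutual gaps
growing with `j`. Rescale them by weights that grow like `q ^ (-c / 2)` in a coordinate `c`
contracting each block to a point. Sums to the left in `E` and to the right in `F` are then both
geometric, so the glued `v` has `kappa` dominated by that of the glued `u`. An operator taking one
to the other must, thanks to the gaps, almost take each `u_i` to `v_i`. Passing to the block
diagonal (`exists_block_diagonal`) keeps the norm, and the errors are absorbed because the `v_i`
were chosen almost optimal; this contradicts the violation. Reflection yields the statement for `F`.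
-/

/-- A lattice norm with the Fatou property on real sequences modelled on `J`; coordinates
off `J` are ignored. -/
structure SeqLattice (J : Set ℤ) where
  N : (ℤ → ℝ) → ℝ≥0∞
  smul : ∀ (c : ℝ) x, N (c • x) = ‖c‖ₑ * N x
  add_le : ∀ x y, N (x + y) ≤ N x + N y
  mono : ∀ x y, (∀ k ∈ J, |x k| ≤ |y k|) → N x ≤ N y
  fatou : ∀ x M, (∀ n : ℕ, N ((Icc (-n : ℤ) n).indicator x) ≤ M) → N x ≤ M
  single_ne_zero : ∀ k ∈ J, N (Pi.single k 1) ≠ 0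
  single_ne_top : ∀ k ∈ J, N (Pi.single k 1) ≠ ⊤

/-- The translate `k ↦ x (k - d)`. -/
def shift (d : ℤ) (x : ℤ → ℝ) : ℤ → ℝ := fun k => x (k - d)

namespace SeqLattice

variable {J : Set ℤ} (E : SeqLattice J)

theorem zero : E.N 0 = 0 := by
  have := E.smul 0 0
  simpa using this

theorem congr {x y : ℤ → ℝ} (h : ∀ k ∈ J, |x k| = |y k|) : E.N x = E.N y :=
  le_antisymm (E.mono _ _ fun k hk => (h k hk).le) (E.mono _ _ fun k hk => (h k hk).ge)

theorem eq_zero {x : ℤ → ℝ} (h : ∀ k ∈ J, x k = 0) : E.N x = 0 := by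
  rw [← E.zero]; exact E.congr fun k hk => by simp [h k hk]

theorem indicator_le (A : Set ℤ) (x : ℤ → ℝ) : E.N (A.indicator x) ≤ E.N x :=
  E.mono _ _ fun k _ => by by_cases h : k ∈ A <;> simp [h]

theorem indicator_mono {A A' : Set ℤ} (h : A ∩ J ⊆ A') (x : ℤ → ℝ) :
    E.N (A.indicator x) ≤ E.N (A'.indicator x) :=
  E.mono _ _ fun k hk => by
    by_cases h1 : k ∈ A
    · simp [h1, h ⟨h1, hk⟩]
    · simp [h1]

theorem _root_.Set.indicator_real_smul {ι : Type*} (A : Set ι) (c : ℝ) (x : ι → ℝ) :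
    A.indicator (c • x) = c • A.indicator x := by
  ext k; by_cases h : k ∈ A <;> simp [h]

theorem sum_le {ι : Type*} (s : Finset ι) (w : ι → ℤ → ℝ) :
    E.N (∑ i ∈ s, w i) ≤ ∑ i ∈ s, E.N (w i) := by
  classical
  induction s using Finset.induction_on with
  | empty => simp [E.zero]
  | insert i s hi ih =>
    rw [Finset.sum_insert hi, Finset.sum_insert hi]
    exact (E.add_le _ _).trans (by gcongr)

theorem abs_eq (x : ℤ → ℝ) : E.N (fun k => |x k|) = E.N x := E.congr fun k _ => by simp

theorem mul_single_le (x : ℤ → ℝ) {k : ℤ} : ‖x k‖ₑ * E.N (Pi.single k 1) ≤ E.N x := by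
  rw [← E.smul]
  refine E.mono _ _ fun j _ => ?_
  by_cases h : j = k
  · subst h; simp
  · simp [h]

theorem mono_smul {x y : ℤ → ℝ} {c : ℝ} (hc : 0 ≤ c) (h : ∀ k ∈ J, |x k| ≤ c * |y k|) :
    E.N x ≤ ENNReal.ofReal c * E.N y := by
  rw [← Real.enorm_of_nonneg hc, ← E.smul]
  refine E.mono _ _ fun k hk => ?_
  simpa [abs_mul, abs_of_nonneg hc] using h k hk

/-- Countable subadditivity, up to a factor. -/
theorem le_tsum {ι : Type*} (z : ℤ → ℝ) (w : ι → ℤ → ℝ)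
    (h : ∀ k ∈ J, ‖z k‖ₑ ≤ ∑' i, ‖w i k‖ₑ) : E.N z ≤ 2 * ∑' i, E.N (w i) := by
  classical
  refine E.fatou _ _ fun n => ?_
  -- Halving `z k` makes the inequality with the infinite sum strict, so finitely many terms suffice
  -- at `k`. By the Fatou property only finitely many `k` matter, and one finite index set serves
  -- them all.
  have key : ∀ k : ℤ, ∃ D : Finset ι, k ∈ J → |z k| ≤ 2 * ∑ i ∈ D, |w i k| := by
    intro k
    by_cases hk : k ∈ J
    · by_cases h0 : z k = 0
      · exact ⟨∅, fun _ => by simp [h0]⟩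
      · have h1 : ‖z k / 2‖ₑ < ∑' i, ‖w i k‖ₑ := by
          refine lt_of_lt_of_le ?_ (h k hk)
          rw [Real.enorm_eq_ofReal_abs, Real.enorm_eq_ofReal_abs, ENNReal.ofReal_lt_ofReal_iff]
          · rw [abs_div, abs_of_pos (two_pos : (0 : ℝ) < 2)]
            have := abs_pos.2 h0
            linarith
          · exact abs_pos.2 h0
        rw [ENNReal.tsum_eq_iSup_sum, lt_iSup_iff] at h1
        obtain ⟨D, hD⟩ := h1
        refine ⟨D, fun _ => ?_⟩
        simp only [Real.enorm_eq_ofReal_abs] at hD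
        rw [← ENNReal.ofReal_sum_of_nonneg (fun _ _ => abs_nonneg _)] at hD
        have := (ENNReal.ofReal_lt_ofReal_iff'.1 hD).1
        rw [abs_div, abs_of_pos (two_pos : (0 : ℝ) < 2)] at this
        linarith
    · exact ⟨∅, fun h => absurd h hk⟩
  choose D hD using key
  set T : Finset ι := (Finset.Icc (-n : ℤ) n).biUnion D
  calc E.N ((Icc (-n : ℤ) n).indicator z)
      ≤ ENNReal.ofReal 2 * E.N (∑ i ∈ T, fun k => |w i k|) := by
        refine E.mono_smul two_pos.le fun k hk => ?_
        by_cases hkn : k ∈ Icc (-n : ℤ) n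
        · rw [indicator_of_mem hkn, Finset.sum_apply,
            abs_of_nonneg (a := ∑ i ∈ T, |w i k|) (Finset.sum_nonneg fun _ _ => abs_nonneg _)]
          refine (hD k hk).trans ?_
          gcongr
          exact Finset.subset_biUnion_of_mem D (by simpa using hkn)
        · rw [indicator_of_notMem hkn]; simp
    _ ≤ 2 * ∑ i ∈ T, E.N (w i) := by
        rw [ENNReal.ofReal_ofNat]
        gcongr
        refine (E.sum_le _ _).trans (le_of_eq ?_)
        exact Finset.sum_congr rfl fun i _ => E.abs_eq _
    _ ≤ 2 * ∑' i, E.N (w i) := by gcongr; exact ENNReal.sum_le_tsum T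

theorem single_lt_of_finite {x : ℤ → ℝ} (hx : (Function.support x ∩ J).Finite) : E.N x < ⊤ := by
  classical
  have : E.N x ≤ E.N (∑ k ∈ hx.toFinset, x k • Pi.single k 1) := by
    refine E.mono _ _ fun k hk => ?_
    by_cases h0 : x k = 0
    · simp [h0]
    · rw [Finset.sum_apply, Finset.sum_eq_single k]
      · simp
      · intro b _ hb; simp [hb.symm]
      · intro h; exact absurd (by simp [h0, hk]) h
  refine (this.trans (E.sum_le _ _)).trans_lt ?_
  refine ENNReal.sum_lt_top.2 fun k hk => ?_
  rw [E.smul]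
  have : k ∈ J := by simp at hk; exact hk.2
  exact ENNReal.mul_lt_top enorm_lt_top (lt_top_iff_ne_top.2 (E.single_ne_top k this))

theorem ne_zero_of {x : ℤ → ℝ} {k : ℤ} (hk : k ∈ J) (hx : x k ≠ 0) : E.N x ≠ 0 := by
  intro h
  have := E.mul_single_le x (k := k)
  rw [h] at this
  simp only [nonpos_iff_eq_zero, mul_eq_zero, enorm_eq_zero] at this
  rcases this with h | h
  · exact hx h
  · exact E.single_ne_zero k hk h

theorem exists_truncation_lt {x : ℤ → ℝ} {M : ℝ≥0∞} (h : M < E.N x) :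
    ∃ n : ℕ, M < E.N ((Icc (-n : ℤ) n).indicator x) := by
  by_contra! hc
  exact absurd (E.fatou x M hc) (not_le.2 h)

/-- The reflected norm. -/
def mirror : SeqLattice (Neg.neg ⁻¹' J) where
  N x := E.N fun k => x (-k)
  smul c x := E.smul c fun k => x (-k)
  add_le x y := E.add_le (fun k => x (-k)) fun k => y (-k)
  mono x y h := E.mono _ _ fun k hk => h (-k) (by simpa using hk)
  fatou x M h := E.fatou _ _ fun n => by
    refine le_of_eq_of_le ?_ (h n)
    congr 1
    ext k
    by_cases hk : k ∈ Icc (-n : ℤ) n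
    · have : -k ∈ Icc (-n : ℤ) n := ⟨by have := hk.2; omega, by have := hk.1; omega⟩
      simp only [indicator_of_mem hk, indicator_of_mem this]
    · have : -k ∉ Icc (-n : ℤ) n := fun h => hk ⟨by have := h.2; omega, by have := h.1; omega⟩
      simp only [indicator_of_notMem hk, indicator_of_notMem this]
  single_ne_zero k hk := by
    have : (fun j : ℤ => (Pi.single k (1 : ℝ) : ℤ → ℝ) (-j)) = Pi.single (-k) 1 := by
      ext j; simp [Pi.single_apply, neg_eq_iff_eq_neg]
    rw [this]; exact E.single_ne_zero _ hk
  single_ne_top k hk := by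
    have : (fun j : ℤ => (Pi.single k (1 : ℝ) : ℤ → ℝ) (-j)) = Pi.single (-k) 1 := by
      ext j; simp [Pi.single_apply, neg_eq_iff_eq_neg]
    rw [this]; exact E.single_ne_top _ hk

theorem mirror_single (k : ℤ) : E.mirror.N (Pi.single k 1) = E.N (Pi.single (-k) 1) := by
  have : (fun j : ℤ => (Pi.single k (1 : ℝ) : ℤ → ℝ) (-j)) = Pi.single (-k) 1 := by
    ext j; simp [Pi.single_apply, neg_eq_iff_eq_neg]
  change E.N _ = _
  rw [this]

theorem mirror_apply (x : ℤ → ℝ) : E.mirror.N x = E.N fun k => x (-k) := rfl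

theorem mirror_indicator (A : Set ℤ) (x : ℤ → ℝ) :
    E.mirror.N (A.indicator x) = E.N ((Neg.neg ⁻¹' A).indicator fun k => x (-k)) := rfl

end SeqLattice

/-! ### Separated pairs of sequence lattices -/

/-- Exponentially separated pairs: left translates decay on `E` faster than right translates
grow on `F`. -/
structure SepPair {J : Set ℤ} (E F : SeqLattice J) where
  B : NNReal
  C : NNReal
  q : NNReal
  α : ℕ → NNReal
  γ : ℕ → NNReal
  q_pos : 0 < q
  q_lt_one : q < 1
  one_le_B : 1 ≤ B
  ordConnected : J.OrdConnected
  nonempty : J.Nonempty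
  stepE : ∀ x, E.N (shift 1 (J.indicator x)) ≤ B * E.N x
  stepE' : ∀ x, E.N (shift (-1) (J.indicator x)) ≤ B * E.N x
  stepF : ∀ x, F.N (shift 1 (J.indicator x)) ≤ B * F.N x
  stepF' : ∀ x, F.N (shift (-1) (J.indicator x)) ≤ B * F.N x
  leftE : ∀ (d : ℕ) x, E.N (shift (-d) (J.indicator x)) ≤ α d * E.N x
  rightF : ∀ (d : ℕ) x, F.N (shift d (J.indicator x)) ≤ γ d * F.N x
  decay : ∀ d, α d * γ d ≤ C * q ^ d

/-- Reflection turns right translations into left ones; this is why the reflected pair exchanges the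
two lattices. -/
theorem shift_comp_neg (J : Set ℤ) (d : ℤ) (x : ℤ → ℝ) :
    (fun k => shift d ((Neg.neg ⁻¹' J).indicator x) (-k)) =
      shift (-d) (J.indicator fun k => x (-k)) := by
  ext k
  have : -k - d = -(k - -d) := by ring
  simp only [shift, this]
  by_cases h : k - -d ∈ J
  · rw [indicator_of_mem (by simpa only [mem_preimage, neg_neg] using h), indicator_of_mem h]
  · rw [indicator_of_notMem (by simpa only [mem_preimage, neg_neg] using h),
      indicator_of_notMem h]

namespace SepPair

variable {J : Set ℤ} {E F : SeqLattice J} (P : SepPair E F)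

/-- The reflected pair. -/
def mirror : SepPair F.mirror E.mirror where
  B := P.B
  C := P.C
  q := P.q
  α := P.γ
  γ := P.α
  q_pos := P.q_pos
  q_lt_one := P.q_lt_one
  one_le_B := P.one_le_B
  ordConnected := by
    refine ⟨fun a ha b hb c hc => ?_⟩
    exact P.ordConnected.out hb ha ⟨by have := hc.2; omega, by have := hc.1; omega⟩
  nonempty := by
    obtain ⟨k, hk⟩ := P.nonempty
    exact ⟨-k, by simpa using hk⟩
  stepE x := by
    rw [F.mirror_apply, shift_comp_neg]; exact P.stepF' _
  stepE' x := by
    rw [F.mirror_apply, shift_comp_neg]; simpa [SeqLattice.mirror_apply] using P.stepF fun k => x (-k)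
  stepF x := by
    rw [E.mirror_apply, shift_comp_neg]; exact P.stepE' _
  stepF' x := by
    rw [E.mirror_apply, shift_comp_neg]; simpa [SeqLattice.mirror_apply] using P.stepE fun k => x (-k)
  leftE d x := by
    rw [F.mirror_apply, shift_comp_neg]; simpa [SeqLattice.mirror_apply] using P.rightF d fun k => x (-k)
  rightF d x := by
    rw [E.mirror_apply, shift_comp_neg]; exact P.leftE d _
  decay d := by rw [mul_comm]; exact P.decay d

theorem shift_single {J : Set ℤ} {k : ℤ} (hk : k ∈ J) (d : ℤ) :
    shift d (J.indicator (Pi.single k (1 : ℝ))) = Pi.single (k + d) 1 := by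
  ext j
  by_cases h : j = k + d
  · subst h; simp [shift, hk]
  · have : j - d ≠ k := fun h' => h (by omega)
    by_cases h2 : j - d ∈ J <;> simp [shift, h, this, h2]

theorem E_single_le {j : ℤ} {d : ℕ} (hk : j + d ∈ J) :
    E.N (Pi.single j 1) ≤ P.α d * E.N (Pi.single (j + d) 1) := by
  have := P.leftE d (Pi.single (j + d) 1)
  rwa [shift_single hk, add_neg_cancel_right] at this

theorem F_single_le {j : ℤ} {d : ℕ} (hj : j ∈ J) :
    F.N (Pi.single (j + d) 1) ≤ P.γ d * F.N (Pi.single j 1) := by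
  have := P.rightF d (Pi.single j 1)
  rwa [shift_single hj] at this

theorem E_single_succ_le {j : ℤ} (hj : j ∈ J) :
    E.N (Pi.single (j + 1) 1) ≤ P.B * E.N (Pi.single j 1) := by
  have := P.stepE (Pi.single j 1)
  rwa [shift_single hj] at this

/-- The ratio of the fundamental functions grows exponentially. -/
theorem single_cross {j : ℤ} {d : ℕ} (hj : j ∈ J) (hk : j + d ∈ J) :
    E.N (Pi.single j 1) * F.N (Pi.single (j + d) 1) ≤
      P.C * P.q ^ d * (E.N (Pi.single (j + d) 1) * F.N (Pi.single j 1)) := by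
  calc _ ≤ (P.α d * E.N (Pi.single (j + d) 1)) * (P.γ d * F.N (Pi.single j 1)) := by
        gcongr
        · exact P.E_single_le hk
        · exact P.F_single_le hj
    _ = ((P.α d * P.γ d : NNReal) : ℝ≥0∞) * (E.N (Pi.single (j + d) 1) * F.N (Pi.single j 1)) := by
        push_cast; ring
    _ ≤ _ := by
        gcongr
        exact_mod_cast P.decay d

/-- `∑ q ^ d`. -/
def G : ℝ≥0∞ := ∑' d : ℕ, (P.q : ℝ≥0∞) ^ d

theorem G_ne_top : P.G ≠ ⊤ := by
  rw [G, ENNReal.tsum_geometric]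
  simpa [tsub_eq_zero_iff_le] using P.q_lt_one

/-- The constant in the comparison of `E` and `F` on half lines. -/
def K : ℝ≥0∞ := 2 * P.C * P.G

theorem K_ne_top : P.K ≠ ⊤ := by
  unfold K
  exact ENNReal.mul_ne_top (by finiteness) P.G_ne_top

theorem mirror_K : P.mirror.K = P.K := rfl

/-- Split the left part of `h` into single coordinates. By `single_cross` the one at distance `d`
from `k` costs a factor `C q ^ d` when its `E`-norm is exchanged for its `F`-norm, and each is
dominated by the whole in `F`. The geometric series, with the factor 2 of `le_tsum`, is `K`. -/
theorem E_Iic_le (h : ℤ → ℝ) {k : ℤ} (hk : k ∈ J) :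
    F.N (Pi.single k 1) * E.N ((Iic k).indicator h) ≤
      P.K * (E.N (Pi.single k 1) * F.N ((Iic k).indicator h)) := by
  have h1 : E.N ((Iic k).indicator h) ≤
      2 * ∑' d : ℕ, E.N ((J.indicator h (k - d)) • Pi.single (k - d : ℤ) 1) := by
    refine E.le_tsum _ _ fun j hj => ?_
    by_cases hjk : j ≤ k
    · refine le_trans ?_ (ENNReal.le_tsum (k - j).toNat)
      have : k - ((k - j).toNat : ℤ) = j := by omega
      rw [this]
      simp [hjk, hj]
    · simp [hjk]
  refine (mul_le_mul_right h1 _).trans ?_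
  rw [K, mul_left_comm, mul_assoc, mul_assoc]
  gcongr 2 * ?_
  rw [← mul_assoc, G, ← ENNReal.tsum_mul_left, ← ENNReal.tsum_mul_left,
    ← ENNReal.tsum_mul_right]
  refine ENNReal.tsum_le_tsum fun d => ?_
  by_cases hd : k - d ∈ J
  · rw [indicator_of_mem hd, E.smul]
    have h2 := P.single_cross (j := k - d) (d := d) hd (by simpa using hk)
    rw [sub_add_cancel] at h2
    have h3 := F.mul_single_le ((Iic k).indicator h) (k := k - d)
    rw [indicator_of_mem (by simp)] at h3
    calc _ = ‖h (k - d)‖ₑ * (E.N (Pi.single (k - d : ℤ) 1) * F.N (Pi.single k 1)) := by ring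
      _ ≤ ‖h (k - d)‖ₑ * (P.C * P.q ^ d * (E.N (Pi.single k 1) * F.N (Pi.single (k - d : ℤ) 1))) := by
          gcongr
      _ = (P.C * P.q ^ d * E.N (Pi.single k 1)) * (‖h (k - d)‖ₑ * F.N (Pi.single (k - d : ℤ) 1)) := by
          ring
      _ ≤ (P.C * P.q ^ d * E.N (Pi.single k 1)) * F.N ((Iic k).indicator h) := by gcongr
      _ = _ := by ring
  · rw [indicator_of_notMem hd]
    simp [E.zero]

theorem neg_preimage_Iic (k : ℤ) : (Neg.neg ⁻¹' Iic (-k) : Set ℤ) = Ici k := by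
  ext j; simp

theorem neg_preimage_Ici (k : ℤ) : (Neg.neg ⁻¹' Ici (-k) : Set ℤ) = Iic k := by
  ext j; simp

/-- The reflection of `E_Iic_le`. -/
theorem F_Ici_le (h : ℤ → ℝ) {k : ℤ} (hk : k ∈ J) :
    E.N (Pi.single k 1) * F.N ((Ici k).indicator h) ≤
      P.K * (F.N (Pi.single k 1) * E.N ((Ici k).indicator h)) := by
  have := P.mirror.E_Iic_le (fun k => h (-k)) (k := -k) (by simpa using hk)
  simpa only [SeqLattice.mirror_single, SeqLattice.mirror_indicator, neg_neg, neg_preimage_Iic,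
    mirror_K] using this

/-- A sequence dominated coordinatewise by the left parts of `h` in `E` is dominated by `h`
in `F`. -/
theorem F_le_of_E_Iic {h z : ℤ → ℝ} {D : ℝ≥0∞}
    (hD : D ≠ ⊤)
    (hz : ∀ k ∈ J, ‖z k‖ₑ * E.N (Pi.single k 1) ≤ D * E.N ((Iic k).indicator h)) :
    F.N z ≤ 4 * D * P.C * P.G * F.N h := by
  -- Moving the coordinate `k - d` of `h` to `k` costs `α d` in `E`, so `z` is dominated by the sum
  -- over `d` of `α d` times the right translate of `h` by `d`. In `F` that translate costs `γ d`,
  -- and the products `α d * γ d` are summable.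
  have h1 : ∀ k ∈ J, ‖z k‖ₑ ≤
      ∑' d : ℕ, ‖((2 * D * P.α d).toReal • shift d (J.indicator h)) k‖ₑ := by
    intro k hk
    have h0 := E.single_ne_zero k hk
    have ht := E.single_ne_top k hk
    have h2 : E.N ((Iic k).indicator h) ≤
        2 * ∑' d : ℕ, E.N ((J.indicator h (k - d)) • Pi.single (k - d : ℤ) 1) := by
      refine E.le_tsum _ _ fun j hj => ?_
      by_cases hjk : j ≤ k
      · refine le_trans ?_ (ENNReal.le_tsum (k - j).toNat)
        have : k - ((k - j).toNat : ℤ) = j := by omega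
        rw [this]
        simp [hjk, hj]
      · simp [hjk]
    rw [← ENNReal.mul_le_mul_iff_left h0 ht]
    refine (hz k hk).trans ((mul_le_mul_right h2 _).trans ?_)
    rw [← mul_assoc, ← ENNReal.tsum_mul_left, ← ENNReal.tsum_mul_right]
    refine ENNReal.tsum_le_tsum fun d => ?_
    have h3 := P.E_single_le (j := k - d) (d := d) (by simpa using hk)
    rw [sub_add_cancel] at h3
    have h4 : ‖(2 * D * P.α d).toReal‖ₑ = 2 * D * P.α d := by
      rw [Real.enorm_of_nonneg ENNReal.toReal_nonneg, ENNReal.ofReal_toReal (by finiteness)]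
    rw [Pi.smul_apply, smul_eq_mul, enorm_mul, h4, E.smul]
    change _ ≤ 2 * D * P.α d * ‖J.indicator h (k - d)‖ₑ * E.N (Pi.single k 1)
    calc _ ≤ D * 2 * (‖J.indicator h (k - d)‖ₑ * (P.α d * E.N (Pi.single k 1))) := by gcongr
      _ = _ := by ring
  refine (F.le_tsum z _ h1).trans ?_
  rw [G, ← ENNReal.tsum_mul_left, ← ENNReal.tsum_mul_left, ← ENNReal.tsum_mul_right]
  refine ENNReal.tsum_le_tsum fun d => ?_
  rw [F.smul]
  have h4 : ‖(2 * D * P.α d).toReal‖ₑ = 2 * D * P.α d := by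
    rw [Real.enorm_of_nonneg ENNReal.toReal_nonneg, ENNReal.ofReal_toReal (by finiteness)]
  rw [h4]
  calc 2 * (2 * D * P.α d * F.N (shift d (J.indicator h)))
      ≤ 2 * (2 * D * P.α d * (P.γ d * F.N h)) := by gcongr; exact P.rightF d h
    _ = 4 * (D * (((P.α d * P.γ d : NNReal) : ℝ≥0∞) * F.N h)) := by push_cast; ring
    _ ≤ 4 * (D * (((P.C * P.q ^ d : NNReal) : ℝ≥0∞) * F.N h)) := by
        gcongr 4 * (D * (?_ * _)); exact_mod_cast P.decay d
    _ = _ := by push_cast; ring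

end SepPair

/-! ### The discretized K-functional and the Calderón property of sequences -/

/-- The discretized `K`-functional of `f` at the coordinate `k`. -/
def kappa {J : Set ℤ} (E F : SeqLattice J) (k : ℤ) (f : ℤ → ℝ) : ℝ≥0∞ :=
  F.N (Pi.single k 1) * E.N ((Iic k).indicator f) + E.N (Pi.single k 1) * F.N ((Ici k).indicator f)

theorem kappa_mirror {J : Set ℤ} (E F : SeqLattice J) (k : ℤ) (f : ℤ → ℝ) :
    kappa F.mirror E.mirror (-k) (fun j => f (-j)) = kappa E F k f := by
  simp only [kappa, SeqLattice.mirror_single, SeqLattice.mirror_indicator, neg_neg,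
    SepPair.neg_preimage_Iic, SepPair.neg_preimage_Ici, add_comm]

/-- The Calderón property of a pair of sequence spaces, in terms of the discretized
`K`-functional. -/
def SeqCalderon {J : Set ℤ} (E F : SeqLattice J) : Prop :=
  ∀ f g : ℤ → ℝ, (∀ k ∈ J, kappa E F k f ≠ ⊤) →
    (∃ C : NNReal, ∀ k ∈ J, kappa E F k g ≤ C * kappa E F k f) →
    ∃ (S : (ℤ → ℝ) →ₗ[ℝ] (ℤ → ℝ)) (D : NNReal), (∀ h, E.N (S h) ≤ D * E.N h) ∧
      (∀ h, F.N (S h) ≤ D * F.N h) ∧ ∀ k ∈ J, S f k = g k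

/-- Reflection of sequences. -/
def reflect : (ℤ → ℝ) →ₗ[ℝ] (ℤ → ℝ) where
  toFun x k := x (-k)
  map_add' _ _ := rfl
  map_smul' _ _ := rfl

theorem SeqCalderon.mirror {J : Set ℤ} {E F : SeqLattice J} (h : SeqCalderon E F) :
    SeqCalderon F.mirror E.mirror := by
  intro f g hf ⟨C, hC⟩
  have hk : ∀ (f : ℤ → ℝ) (k : ℤ), kappa E F k (fun j => f (-j)) = kappa F.mirror E.mirror (-k) f := by
    intro f k
    rw [← kappa_mirror]; simp
  obtain ⟨S, D, hE, hF, hS⟩ := h (fun k => f (-k)) (fun k => g (-k))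
    (fun k hkJ => by rw [hk]; exact hf _ (by simpa using hkJ))
    ⟨C, fun k hkJ => by rw [hk, hk]; exact hC _ (by simpa using hkJ)⟩
  refine ⟨reflect ∘ₗ S ∘ₗ reflect, D, fun x => ?_, fun x => ?_, fun k hkJ => ?_⟩
  · simpa [SeqLattice.mirror_apply, reflect] using hF fun k => x (-k)
  · simpa [SeqLattice.mirror_apply, reflect] using hE fun k => x (-k)
  · simpa [reflect] using hS (-k) hkJ

/-- A Hahn–Banach functional for an extended seminorm, defined on the whole space. -/
theorem exists_norming_functional {W : Type*} [AddCommGroup W] [Module ℝ W] (V : Submodule ℝ W)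
    (q : W → ℝ≥0∞) (hq : ∀ h ∈ V, q h ≠ ⊤) (hadd : ∀ x y, q (x + y) ≤ q x + q y)
    (hsmul : ∀ (c : ℝ) x, q (c • x) = ‖c‖ₑ * q x) {a : W} (ha : a ∈ V) :
    ∃ φ : W →ₗ[ℝ] ℝ, φ a = (q a).toReal ∧ ∀ h ∈ V, ‖φ h‖ₑ ≤ q h := by
  by_cases h0 : (q a).toReal = 0
  · exact ⟨0, by simp [h0], by simp⟩
  have ha0 : (⟨a, ha⟩ : V) ≠ 0 := by
    intro h
    have : a = 0 := congrArg Subtype.val h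
    have h2 := hsmul 0 0
    simp only [zero_smul, enorm_zero, zero_mul] at h2
    rw [this, h2] at h0
    simp at h0
  have hsm : ∀ (c : ℝ) (x : V), (q (c • x : V)).toReal = |c| * (q x).toReal := by
    intro c x
    rw [Submodule.coe_smul, hsmul, ENNReal.toReal_mul]
    simp
  -- The seminorm is finite on `V` only, so the dominated extension takes place there; the further
  -- extension to `W` is purely algebraic.
  obtain ⟨g, hg1, hg2⟩ := exists_extension_of_le_sublinear
    (LinearPMap.mkSpanSingleton (⟨a, ha⟩ : V) (q a).toReal ha0) (fun x : V => (q x).toReal)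
    (fun c hc x => by rw [hsm, abs_of_pos hc])
    (fun x y => by
      rw [← ENNReal.toReal_add (hq _ x.2) (hq _ y.2)]
      exact ENNReal.toReal_mono (ENNReal.add_ne_top.2 ⟨hq _ x.2, hq _ y.2⟩) (hadd _ _))
    (by
      rintro ⟨x, hx⟩
      obtain ⟨c, rfl⟩ := Submodule.mem_span_singleton.1 hx
      erw [LinearPMap.mkSpanSingleton'_apply]
      rw [hsm]
      simp only [RingHom.id_apply, smul_eq_mul]
      exact mul_le_mul_of_nonneg_right (le_abs_self c) ENNReal.toReal_nonneg)
  obtain ⟨φ, hφ⟩ := LinearMap.exists_extend g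
  have hφ' : ∀ x : V, φ x = g x := fun x => by rw [← hφ]; rfl
  refine ⟨φ, ?_, fun h hh => ?_⟩
  · have h1 := hg1 ⟨⟨a, ha⟩, Submodule.mem_span_singleton_self _⟩
    rw [hφ' ⟨a, ha⟩, h1]
    have := LinearPMap.mkSpanSingleton_apply ℝ ℝ (σ := RingHom.id ℝ) ha0 (q a).toReal
    simpa using this
  · rw [hφ' ⟨h, hh⟩, Real.enorm_eq_ofReal_abs, ENNReal.ofReal_le_iff_le_toReal (hq h hh), abs_le]
    constructor
    · have h1 := hg2 (-⟨h, hh⟩)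
      have h2 := hsm (-1) ⟨h, hh⟩
      simp only [neg_smul, one_smul, abs_neg, abs_one, one_mul] at h2
      rw [map_neg, h2] at h1
      linarith
    · exact hg2 ⟨h, hh⟩

/-! ### Operators built from the right-shift property -/

/-- The right-shift property for finite families of blocks. -/
def SeqRSP {J : Set ℤ} (E : SeqLattice J) : Prop :=
  ∃ C : NNReal, ∀ (s : Finset ℤ) (u v : ℤ → ℤ → ℝ),
    (∀ n ∈ s, (Function.support (u n)).Finite ∧ Function.support (u n) ⊆ J ∧
      (Function.support (v n)).Finite ∧ Function.support (v n) ⊆ J) →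
    (∀ n ∈ s, ∀ a ∈ Function.support (u n), ∀ b ∈ Function.support (v n), a < b) →
    (∀ n ∈ s, ∀ m ∈ s, n < m → ∀ a ∈ Function.support (u n) ∪ Function.support (v n),
      ∀ b ∈ Function.support (u m) ∪ Function.support (v m), a < b) →
    (∀ n ∈ s, E.N (v n) ≤ E.N (u n)) →
    E.N (∑ n ∈ s, v n) ≤ C * E.N (∑ n ∈ s, u n)

/-- The right-shift property for the blocks of a monotone level function, moving each block of a
given parity into the next one. -/
theorem SeqRSP.levels {J : Set ℤ} {E : SeqLattice J} (hE : SeqRSP E) :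
    ∃ C : NNReal, ∀ (β : ℤ → ℤ), MonotoneOn β J → ∀ (e : ℤ) (y h : ℤ → ℝ),
      (∀ n, n % 2 = e → E.N ({k | β k = n + 1}.indicator y) ≤ E.N ({k | β k = n}.indicator h)) →
      E.N ({k | (β k - 1) % 2 = e}.indicator y) ≤ C * E.N h := by
  classical
  obtain ⟨C, hC⟩ := hE
  refine ⟨C * 2, fun β hβ e y h hyp => E.fatou _ _ fun m => ?_⟩
  set v : ℤ → ℤ → ℝ := fun n => (Icc (-m : ℤ) m ∩ J ∩ {k | β k = n + 1}).indicator y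
  -- The levels of `h` may be infinite while the right-shift property concerns finite supports. By
  -- the Fatou property a finite window keeps more than half of the norm needed, whence the factor
  -- 2.
  have key : ∀ n, ∃ L : ℕ, n % 2 = e → E.N (v n) ≤
      E.N ((2 : ℝ) • (Icc (-L : ℤ) L).indicator ({k | β k = n}.indicator h)) := by
    intro n
    by_cases hn : n % 2 = e
    · by_cases h0 : E.N (v n) = 0
      · exact ⟨0, fun _ => by simp [h0]⟩
      have hle : E.N (v n) ≤ E.N ({k | β k = n}.indicator h) :=
        (E.indicator_mono (fun k hk => hk.1.2) y).trans (hyp n hn)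
      have hfin : E.N (v n) ≠ ⊤ := by
        refine (E.single_lt_of_finite ?_).ne
        refine (Set.finite_Icc (-m : ℤ) m).subset fun k hk => ?_
        have : k ∈ (Icc (-m : ℤ) m ∩ J ∩ {k | β k = n + 1}) := by
          by_contra hc
          exact hk.1 (indicator_of_notMem hc _)
        exact this.1.1
      obtain ⟨L, hL⟩ := E.exists_truncation_lt ((ENNReal.half_lt_self h0 hfin).trans_le hle)
      refine ⟨L, fun _ => ?_⟩
      rw [E.smul]
      have h2 : ‖(2 : ℝ)‖ₑ = 2 := by rw [Real.enorm_of_nonneg two_pos.le]; simp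
      rw [h2]
      rw [ENNReal.div_lt_iff (by simp) (by simp)] at hL
      rw [mul_comm]; exact hL.le
    · exact ⟨0, fun h => absurd h hn⟩
  choose L hL using key
  set u : ℤ → ℤ → ℝ := fun n =>
    (2 : ℝ) • (Icc (-L n : ℤ) (L n) ∩ J ∩ {k | β k = n}).indicator h
  -- Only levels met by the window of `v` occur. The pair with index `n` occupies levels `n` and `n
  -- + 1`, so indices of one parity give disjoint, ordered pairs.
  set s : Finset ℤ := ((Finset.Icc (-m : ℤ) m).image (fun k => β k - 1)).filter (· % 2 = e)
  have hs : ∀ n ∈ s, n % 2 = e := fun n hn => (Finset.mem_filter.1 hn).2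
  have hu : ∀ n k, k ∈ Function.support (u n) → k ∈ Icc (-L n : ℤ) (L n) ∧ k ∈ J ∧ β k = n := by
    intro n k hk
    by_contra hc
    refine hk ?_
    have : k ∉ (Icc (-L n : ℤ) (L n) ∩ J ∩ {k | β k = n}) := fun h => hc ⟨h.1.1, h.1.2, h.2⟩
    simp only [u, Pi.smul_apply, indicator_of_notMem this, smul_zero]
  have hv : ∀ n k, k ∈ Function.support (v n) → k ∈ Icc (-m : ℤ) m ∧ k ∈ J ∧ β k = n + 1 := by
    intro n k hk
    by_contra hc
    exact hk (indicator_of_notMem (fun h => hc ⟨h.1.1, h.1.2, h.2⟩) _)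
  have hlt : ∀ a ∈ J, ∀ b ∈ J, β a < β b → a < b := by
    intro a ha b hb hab
    by_contra hc
    exact absurd (hβ hb ha (not_lt.1 hc)) (not_le.2 hab)
  have main := hC s u v
    (fun n _ => ⟨(finite_Icc _ _).subset fun k hk => (hu n k hk).1, fun k hk => (hu n k hk).2.1,
      (finite_Icc _ _).subset fun k hk => (hv n k hk).1, fun k hk => (hv n k hk).2.1⟩)
    (fun n _ a ha b hb => hlt a (hu n a ha).2.1 b (hv n b hb).2.1 (by
      rw [(hu n a ha).2.2, (hv n b hb).2.2]; omega))
    (fun n hn k hk hnk a ha b hb => by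
      have h1 := hs n hn
      have h2 := hs k hk
      have ha' : a ∈ J ∧ β a ≤ n + 1 := by
        rcases ha with ha | ha
        · exact ⟨(hu n a ha).2.1, by rw [(hu n a ha).2.2]; omega⟩
        · exact ⟨(hv n a ha).2.1, by rw [(hv n a ha).2.2]⟩
      have hb' : b ∈ J ∧ k ≤ β b := by
        rcases hb with hb | hb
        · exact ⟨(hu k b hb).2.1, by rw [(hu k b hb).2.2]⟩
        · exact ⟨(hv k b hb).2.1, by rw [(hv k b hb).2.2]; omega⟩
      exact hlt a ha'.1 b hb'.1 (by omega))
    (fun n hn => (hL n (hs n hn)).trans_eq (E.congr fun k hk => by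
      by_cases h1 : k ∈ Icc (-L n : ℤ) (L n) <;> by_cases h2 : β k = n <;>
        simp [u, h1, h2, hk, -mem_Icc]))
  calc _ ≤ E.N (∑ n ∈ s, v n) := by
        refine E.mono _ _ fun k hk => ?_
        by_cases h1 : k ∈ Icc (-m : ℤ) m
        · by_cases h2 : (β k - 1) % 2 = e
          · rw [Finset.sum_apply, Finset.sum_eq_single (β k - 1)]
            · simp [v, h1, h2, hk, -mem_Icc]
            · intro n _ hn
              refine indicator_of_notMem (fun h => hn ?_) _
              have := h.2
              simp only [mem_ofPred_eq] at this
              omega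
            · intro hn
              refine absurd ?_ hn
              simp only [s, Finset.mem_filter, Finset.mem_image]
              exact ⟨⟨k, by simpa using h1, rfl⟩, h2⟩
          · rw [indicator_indicator, indicator_of_notMem (fun h => h2 h.2)]; simp
        · rw [indicator_of_notMem h1]; simp
    _ ≤ C * E.N (∑ n ∈ s, u n) := main
    _ ≤ C * E.N ((2 : ℝ) • h) := by
        gcongr
        refine E.mono _ _ fun k hk => ?_
        rw [Finset.sum_apply]
        by_cases h1 : β k ∈ s
        · rw [Finset.sum_eq_single (β k)]
          · simp only [u, Pi.smul_apply, smul_eq_mul, abs_mul]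
            refine mul_le_mul_of_nonneg_left ?_ (abs_nonneg _)
            by_cases h2 : k ∈ Icc (-L (β k) : ℤ) (L (β k)) ∩ J ∩ {j | β j = β k}
            · rw [indicator_of_mem h2]
            · rw [indicator_of_notMem h2]; simp
          · intro n _ hn
            by_contra hc
            exact hn ((hu n k hc).2.2).symm
          · intro h; exact absurd h1 h
        · rw [Finset.sum_eq_zero]
          · simp
          · intro n hn
            by_contra hc
            exact h1 ((hu n k hc).2.2 ▸ hn)
    _ = _ := by
        rw [E.smul, ← mul_assoc]
        have h2 : ‖(2 : ℝ)‖ₑ = 2 := by rw [Real.enorm_of_nonneg two_pos.le]; simp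
        rw [h2]; push_cast; rfl

/-- The sequences whose left parts lie in `E`. -/
def leftSpace {J : Set ℤ} (E : SeqLattice J) : Submodule ℝ (ℤ → ℝ) where
  carrier := {h | ∀ k ∈ J, E.N ((Iic k).indicator h) ≠ ⊤}
  add_mem' {x y} hx hy k hk := by
    rw [indicator_add']
    exact ((E.add_le _ _).trans_lt (ENNReal.add_lt_top.2
      ⟨lt_top_iff_ne_top.2 (hx k hk), lt_top_iff_ne_top.2 (hy k hk)⟩)).ne
  zero_mem' k _ := by simp [E.zero]
  smul_mem' c x hx k hk := by
    rw [indicator_real_smul, E.smul]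
    exact ENNReal.mul_ne_top enorm_ne_top (hx k hk)

theorem mem_leftSpace_of_E {J : Set ℤ} {E : SeqLattice J} {h : ℤ → ℝ} (hh : E.N h ≠ ⊤) :
    h ∈ leftSpace E := fun k _ => ((E.indicator_le (Iic k) h).trans_lt (lt_top_iff_ne_top.2 hh)).ne

/-- Finiteness of left parts is the common domain on which functionals dominated by `E`-norms of
left parts act, for elements of `E` and of `F` alike. -/
theorem mem_leftSpace_of_F {J : Set ℤ} {E F : SeqLattice J} (P : SepPair E F) {h : ℤ → ℝ}
    (hh : F.N h ≠ ⊤) : h ∈ leftSpace E := by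
  intro k hk htop
  have := P.E_Iic_le h hk
  rw [htop, ENNReal.mul_top (F.single_ne_zero k hk), top_le_iff] at this
  have h1 : F.N ((Iic k).indicator h) ≠ ⊤ :=
    ((F.indicator_le (Iic k) h).trans_lt (lt_top_iff_ne_top.2 hh)).ne
  exact ENNReal.mul_ne_top P.K_ne_top (ENNReal.mul_ne_top (E.single_ne_top k hk) h1) this

/-- If the right-shift property holds in `E`, then every `b` whose left parts are controlled by
those of a sufficiently regular `a` is the image of `a` under an operator bounded on `E`
and on `F`. -/
theorem exists_operator_of_left {J : Set ℤ} {E F : SeqLattice J} (P : SepPair E F) (hE : SeqRSP E)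
    {a b : ℤ → ℝ} {B₀ C₀ : NNReal} (ha0 : ∀ k ∈ J, E.N ((Iic k).indicator a) ≠ 0)
    (hat : ∀ k ∈ J, E.N ((Iic k).indicator a) ≠ ⊤)
    (hreg : ∀ k ∈ J, k + 1 ∈ J →
      E.N ((Iic (k + 1)).indicator a) ≤ B₀ * E.N ((Iic k).indicator a))
    (hb : ∀ k ∈ J, E.N ((Iic k).indicator b) ≤ C₀ * E.N ((Iic k).indicator a)) :
    ∃ (S : (ℤ → ℝ) →ₗ[ℝ] (ℤ → ℝ)) (D : NNReal), (∀ h, E.N (S h) ≤ D * E.N h) ∧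
      (∀ h, F.N (S h) ≤ D * F.N h) ∧ ∀ k ∈ J, S a k = b k := by
  classical
  obtain ⟨CR, hCR⟩ := hE.levels
  set A : ℤ → ℝ := fun k => (E.N ((Iic k).indicator a)).toReal
  have hA : ∀ k ∈ J, E.N ((Iic k).indicator a) = ENNReal.ofReal (A k) := fun k hk =>
    (ENNReal.ofReal_toReal (hat k hk)).symm
  have hApos : ∀ k ∈ J, 0 < A k := fun k hk => ENNReal.toReal_pos (ha0 k hk) (hat k hk)
  -- `Λ ≥ 2 B₀` ensures that, just before level `n` is reached, the left part of `a` already has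
  -- norm at least `2 Λ ^ (n - 1)`.
  set Λ : ℕ := 2 * ⌈(B₀ : ℝ)⌉₊ + 2
  have hΛ : 1 < Λ := by omega
  have hΛ0 : (0 : ℝ) < Λ := by positivity
  have hΛB : 2 * (B₀ : ℝ) ≤ Λ := by
    have := Nat.le_ceil (B₀ : ℝ)
    simp only [Λ]; push_cast; linarith
  set β : ℤ → ℤ := fun k => Int.log Λ (A k)
  set l : ℤ → ℝ≥0∞ := fun n => ENNReal.ofReal ((Λ : ℝ) ^ n)
  have hl0 : ∀ n, l n ≠ 0 := fun n => by simp only [l]; positivity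
  have hlt : ∀ n, l n ≠ ⊤ := fun n => ENNReal.ofReal_ne_top
  have hlsucc : ∀ n, l (n + 1) = Λ * l n := fun n => by
    simp only [l]
    rw [zpow_add_one₀ hΛ0.ne', mul_comm, ENNReal.ofReal_mul hΛ0.le, ENNReal.ofReal_natCast]
  have hβ1 : ∀ k ∈ J, l (β k) ≤ E.N ((Iic k).indicator a) := fun k hk => by
    rw [hA k hk]
    exact ENNReal.ofReal_le_ofReal (Int.zpow_log_le_self hΛ (hApos k hk))
  have hβ2 : ∀ k ∈ J, E.N ((Iic k).indicator a) ≤ l (β k + 1) := fun k hk => by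
    rw [hA k hk]
    exact ENNReal.ofReal_le_ofReal (Int.lt_zpow_succ_log_self hΛ (A k)).le
  have hβm : MonotoneOn β J := fun j hj k hk hjk => by
    refine Int.log_mono_right (hApos j hj) (ENNReal.toReal_mono (hat k hk) ?_)
    exact E.indicator_mono (fun i hi => le_trans hi.1 hjk) _
  have hllt : ∀ k ∈ J, ∀ n, β k < n → A k < (Λ : ℝ) ^ n := fun k hk n hn => by
    refine (Int.lt_zpow_succ_log_self hΛ (A k)).trans_le ?_
    exact zpow_le_zpow_right₀ (by exact_mod_cast hΛ.le) hn
  have hlge : ∀ k ∈ J, ∀ n, n ≤ β k → (Λ : ℝ) ^ n ≤ A k := fun k hk n hn => by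
    refine le_trans ?_ (Int.zpow_log_le_self hΛ (hApos k hk))
    exact zpow_le_zpow_right₀ (by exact_mod_cast hΛ.le) hn
  -- The seminorm of level `n - 1`. If no level lies below `n`, there is nothing to the left to look
  -- at, and the infimum of the norms of left parts takes its place; it is subadditive because left
  -- parts are nested.
  set q : ℤ → (ℤ → ℝ) → ℝ≥0∞ := fun n h =>
    if ∃ k ∈ J, β k < n then E.N ({k | k ∈ J ∧ β k = n - 1}.indicator h)
    else ⨅ k : J, E.N ((Iic (k : ℤ)).indicator h)
  have hq_le : ∀ k ∈ J, ∀ h, q (β k) h ≤ E.N ((Iic k).indicator h) := by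
    intro k hk h
    simp only [q]
    split_ifs with hc
    · refine E.indicator_mono (fun j hj => ?_) h
      by_contra hcon
      have := hβm hk hj.2 (not_le.1 hcon).le
      have h2 := hj.1.2
      omega
    · exact iInf_le _ (⟨k, hk⟩ : J)
  have hq_add : ∀ n x y, q n (x + y) ≤ q n x + q n y := by
    intro n x y
    simp only [q]
    split_ifs with hc
    · rw [indicator_add']; exact E.add_le _ _
    · rw [ENNReal.iInf_add_iInf (fun i j => ?_)]
      · refine le_iInf fun k => ?_
        refine (iInf_le _ k).trans ?_
        rw [indicator_add']; exact E.add_le _ _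
      · rcases le_total (i : ℤ) j with h | h
        · exact ⟨i, by gcongr; exact E.indicator_mono (fun m hm => le_trans hm.1 h) _⟩
        · exact ⟨j, by gcongr; exact E.indicator_mono (fun m hm => le_trans hm.1 h) _⟩
  have hne : Nonempty J := P.nonempty.to_subtype
  have hq_smul : ∀ n (c : ℝ) x, q n (c • x) = ‖c‖ₑ * q n x := by
    intro n c x
    simp only [q]
    split_ifs with hc
    · rw [indicator_real_smul, E.smul]
    · rw [ENNReal.mul_iInf (fun h => absurd h enorm_ne_top)]
      exact iInf_congr fun k => by rw [indicator_real_smul, E.smul]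
  -- At the last `j` below level `n` the left part of `a` has norm at least `2 Λ ^ (n - 1)`, since
  -- the next coordinate is already at level `n` or higher. Levels below `n - 1` contribute at most
  -- `Λ ^ (n - 1)`, so level `n - 1` contributes as much.
  have hq_a : ∀ n, (∃ k ∈ J, β k = n) → l (n - 1) ≤ q n a := by
    rintro n ⟨k₀, hk₀, hk₀n⟩
    simp only [q]
    split_ifs with hc
    · obtain ⟨j, ⟨hj, hjn⟩, hmax⟩ := Int.exists_greatest_of_bdd (P := fun j => j ∈ J ∧ β j < n)
        ⟨k₀, fun z hz => by
          by_contra hcon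
          have := hβm hk₀ hz.1 (not_le.1 hcon).le
          omega⟩ (by obtain ⟨k, hk, hkn⟩ := hc; exact ⟨k, hk, hkn⟩)
      have hjk : j < k₀ := by
        by_contra hcon
        have := hβm hk₀ hj (not_lt.1 hcon)
        omega
      have hj1 : j + 1 ∈ J := P.ordConnected.out hj hk₀ ⟨by omega, by omega⟩
      have hj1n : n ≤ β (j + 1) := by
        by_contra hcon
        have := hmax (j + 1) ⟨hj1, not_le.1 hcon⟩
        omega
      have h1 : 2 * (Λ : ℝ) ^ (n - 1) ≤ A j := by
        have h2 := hlge _ hj1 n hj1n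
        have h3 : A (j + 1) ≤ B₀ * A j := by
          have := hreg j hj hj1
          rw [hA _ hj1, hA _ hj, ← ENNReal.ofReal_coe_nnreal, ← ENNReal.ofReal_mul B₀.coe_nonneg] at this
          exact (ENNReal.ofReal_le_ofReal_iff (mul_nonneg B₀.2 (hApos j hj).le)).1 this
        have h4 : (Λ : ℝ) ^ n = Λ * (Λ : ℝ) ^ (n - 1) := by
          rw [← zpow_one_add₀ hΛ0.ne']; congr 1; ring
        have h5 : B₀ * A j ≤ Λ / 2 * A j := by
          have := hApos j hj
          gcongr; linarith
        have h6 : Λ * (2 * (Λ : ℝ) ^ (n - 1)) ≤ Λ * A j := by linarith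
        exact le_of_mul_le_mul_left h6 hΛ0
      have h2 : E.N ({k | k ∈ J ∧ β k < n - 1}.indicator a) ≤ l (n - 1) := by
        by_cases hex : ∃ k, k ∈ J ∧ β k < n - 1
        · obtain ⟨i, ⟨hi, hin⟩, hmax⟩ := Int.exists_greatest_of_bdd
            (P := fun j => j ∈ J ∧ β j < n - 1)
            ⟨j, fun z hz => hmax z ⟨hz.1, by omega⟩⟩ hex
          refine (E.indicator_mono (A' := Iic i) (fun k hk => hmax k hk.1) a).trans ?_
          rw [hA i hi]
          exact ENNReal.ofReal_le_ofReal (hllt i hi _ hin).le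
        · refine (E.eq_zero fun k hk => ?_).trans_le zero_le
          exact indicator_of_notMem (s := {k | k ∈ J ∧ β k < n - 1}) (fun h => hex ⟨k, h⟩) _
      have h3 : E.N ((Iic j).indicator a) ≤
          E.N ({k | k ∈ J ∧ β k < n - 1}.indicator a) +
            E.N ({k | k ∈ J ∧ β k = n - 1}.indicator a) := by
        refine le_trans (E.mono _ _ fun k hk => ?_) (E.add_le _ _)
        by_cases hkj : k ≤ j
        · have h4 := hβm hk hj hkj
          rcases lt_or_eq_of_le (show β k ≤ n - 1 by omega) with h5 | h5
          · simp [hkj, hk, h5, h5.ne]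
          · simp [hkj, hk, h5]
        · simp [hkj]
      have h4 : l (n - 1) + l (n - 1) ≤ E.N ((Iic j).indicator a) := by
        rw [hA j hj, ← ENNReal.ofReal_add (by positivity) (by positivity), ← two_mul]
        exact ENNReal.ofReal_le_ofReal h1
      exact (ENNReal.add_le_add_iff_left (hlt _)).1 (h4.trans (h3.trans (by gcongr)))
    · push Not at hc
      refine le_iInf fun k => ?_
      rw [hA k k.2]
      exact ENNReal.ofReal_le_ofReal (hlge k k.2 _ (by have := hc k k.2; omega))
  have hbl : ∀ n, E.N ({k | k ∈ J ∧ β k = n}.indicator b) ≤ C₀ * l (n + 1) := by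
    intro n
    -- A level may be unbounded to the right. After truncation it has a last coordinate, whose left
    -- part contains it.
    refine E.fatou _ _ fun m => ?_
    by_cases hex : ∃ k, k ∈ J ∧ β k = n ∧ k ≤ m
    · obtain ⟨i, ⟨hi, hin, him⟩, hmax⟩ := Int.exists_greatest_of_bdd
        (P := fun k => k ∈ J ∧ β k = n ∧ k ≤ m) ⟨m, fun z hz => hz.2.2⟩ hex
      rw [indicator_indicator]
      refine (E.indicator_mono (A' := Iic i) (fun k hk => ?_) b).trans ?_
      · exact hmax k ⟨hk.2, hk.1.2.2, hk.1.1.2⟩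
      · refine (hb i hi).trans ?_
        gcongr
        rw [← hin]; exact hβ2 i hi
    · refine (E.eq_zero fun k hk => ?_).trans_le zero_le
      rw [indicator_indicator]
      exact indicator_of_notMem (fun h => hex ⟨k, hk, h.2.2, h.1.2⟩) _
  have haV : a ∈ leftSpace E := hat
  have hψ : ∀ n, ∃ ψ : (ℤ → ℝ) →ₗ[ℝ] ℝ, (∃ k ∈ J, β k = n) →
      ψ a = 1 ∧ ∀ h ∈ leftSpace E, ‖ψ h‖ₑ * l (n - 1) ≤ q n h := by
    intro n
    by_cases hn : ∃ k ∈ J, β k = n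
    · have hqfin : ∀ h ∈ leftSpace E, q n h ≠ ⊤ := by
        obtain ⟨k, hk, rfl⟩ := hn
        exact fun h hh => ((hq_le k hk h).trans_lt (lt_top_iff_ne_top.2 (hh k hk))).ne
      obtain ⟨φ, hφa, hφ⟩ := exists_norming_functional (leftSpace E) (q n) hqfin (hq_add n)
        (hq_smul n) haV
      have hqa := hq_a n hn
      have hpos : 0 < (q n a).toReal :=
        ENNReal.toReal_pos (fun h => hl0 (n - 1) (nonpos_iff_eq_zero.1 (h ▸ hqa))) (hqfin a haV)
      refine ⟨(q n a).toReal⁻¹ • φ, fun _ => ⟨?_, fun h hh => ?_⟩⟩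
      · simp only [LinearMap.smul_apply, hφa, smul_eq_mul]
        exact inv_mul_cancel₀ hpos.ne'
      · have h1 : ‖((q n a).toReal⁻¹ • φ) h‖ₑ = (q n a)⁻¹ * ‖φ h‖ₑ := by
          rw [LinearMap.smul_apply, smul_eq_mul, enorm_mul, Real.enorm_of_nonneg (by positivity),
            ENNReal.ofReal_inv_of_pos hpos, ENNReal.ofReal_toReal (hqfin a haV)]
        rw [h1]
        calc (q n a)⁻¹ * ‖φ h‖ₑ * l (n - 1) ≤ (q n a)⁻¹ * q n h * q n a := by
              gcongr; exact hφ h hh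
          _ = q n h * ((q n a)⁻¹ * q n a) := by ring
          _ ≤ q n h * 1 := by gcongr; exact ENNReal.inv_mul_le_one _
          _ = q n h := mul_one _
    · exact ⟨0, fun h => absurd h hn⟩
  choose ψ hψ using hψ
  -- On level `n` the image is the multiple `ψ n h` of `b`. As `ψ n` is dominated by the seminorm of
  -- level `n - 1`, the operator transports one level to the right.
  set S : (ℤ → ℝ) →ₗ[ℝ] (ℤ → ℝ) :=
    { toFun := fun h k => ψ (β k) h * b k
      map_add' := fun x y => by ext k; simp [add_mul]
      map_smul' := fun c x => by ext k; simp [mul_assoc] }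
  have hS : ∀ h k, S h k = ψ (β k) h * b k := fun _ _ => rfl
  have hblock : ∀ n h, h ∈ leftSpace E → (∃ k ∈ J, β k = n) →
      E.N ({k | β k = n}.indicator (S h)) ≤ C₀ * Λ ^ 2 * q n h := by
    intro n h hh hn
    have h1 : E.N ({k | β k = n}.indicator (S h)) =
        ‖ψ n h‖ₑ * E.N ({k | k ∈ J ∧ β k = n}.indicator b) := by
      rw [← E.smul]
      refine E.congr fun k hk => ?_
      by_cases h2 : β k = n
      · simp [hk, h2, hS]
      · simp [h2]
    rw [h1]
    calc _ ≤ ‖ψ n h‖ₑ * (C₀ * l (n + 1)) := by gcongr; exact hbl n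
      _ = C₀ * Λ ^ 2 * (‖ψ n h‖ₑ * l (n - 1)) := by
        rw [hlsucc n]
        conv_lhs => rw [show n = n - 1 + 1 by ring, hlsucc (n - 1)]
        rw [sub_add_cancel]; ring
      _ ≤ _ := by gcongr; exact (hψ n hn).2 h hh
  set D₁ : NNReal := C₀ * Λ ^ 2
  have hD₁ : (D₁ : ℝ≥0∞) = C₀ * Λ ^ 2 := by simp [D₁]
  have hEbound : ∀ h, h ∈ leftSpace E → E.N (S h) ≤ (2 * CR * D₁ + D₁) * E.N h := by
    intro h hh
    -- Coordinates that have a level below their own, where the right-shift property applies. The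
    -- complement is at most the lowest level, on which the norm of `h` itself suffices.
    set J₁ : Set ℤ := {k | ∃ j ∈ J, β j < β k}
    set y := J₁.indicator (S h)
    have hpar : ∀ e : ℤ, E.N ({k | (β k - 1) % 2 = e}.indicator y) ≤ CR * (D₁ * E.N h) := by
      intro e
      have h1 : E.N (D₁ • h) = D₁ * E.N h := by
        have : (D₁ • h) = (D₁ : ℝ) • h := rfl
        rw [this, E.smul]; simp
      rw [← h1]
      refine hCR β hβm e y (D₁ • h) fun n _ => ?_
      by_cases hex : ∃ k ∈ J, β k = n + 1 ∧ k ∈ J₁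
      · obtain ⟨k, hk, hkn, hk1⟩ := hex
        have h2 := hblock (n + 1) h hh ⟨k, hk, hkn⟩
        have h3 : q (n + 1) h = E.N ({k | k ∈ J ∧ β k = n}.indicator h) := by
          simp only [q]
          rw [if_pos, add_sub_cancel_right]
          obtain ⟨j, hj, hjk⟩ := hk1
          exact ⟨j, hj, by omega⟩
        rw [h3] at h2
        have h4 : E.N ({k | β k = n}.indicator (D₁ • h)) =
            D₁ * E.N ({k | k ∈ J ∧ β k = n}.indicator h) := by
          have : (D₁ : ℝ≥0∞) = ‖(D₁ : ℝ)‖ₑ := by simp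
          rw [this, ← E.smul]
          refine E.congr fun k hk => ?_
          by_cases h5 : β k = n
          · simp only [mem_ofPred_eq, h5, hk, indicator_of_mem, Pi.smul_apply, true_and]; rfl
          · simp [h5]
        rw [h4, hD₁]
        refine le_trans (E.mono _ _ fun i _ => ?_) h2
        by_cases h5 : β i = n + 1 <;> by_cases h6 : i ∈ J₁ <;> simp [h5, h6, y]
      · refine (E.eq_zero fun k hk => ?_).trans_le zero_le
        by_contra hcon
        refine hex ⟨k, hk, ?_, ?_⟩
        · by_contra h2; exact hcon (indicator_of_notMem (s := {k | β k = n + 1}) h2 _)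
        · by_contra h2
          refine hcon ?_
          simp [y, h2]
    have hmin : E.N (J₁ᶜ.indicator (S h)) ≤ D₁ * E.N h := by
      by_cases hex : ∃ k ∈ J, k ∉ J₁
      · obtain ⟨k, hk, hk1⟩ := hex
        have h1 := hblock (β k) h hh ⟨k, hk, rfl⟩
        rw [hD₁]
        refine le_trans (E.mono _ _ fun i hi => ?_) (h1.trans ?_)
        · by_cases h2 : i ∈ J₁
          · simp [h2]
          · have h3 : β i = β k := by
              refine le_antisymm ?_ ?_
              · by_contra hc; exact h2 ⟨k, hk, not_le.1 hc⟩
              · by_contra hc; exact hk1 ⟨i, hi, not_le.1 hc⟩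
            simp [h2, h3]
        · gcongr
          exact (hq_le k hk h).trans (E.indicator_le _ _)
      · refine (E.eq_zero fun k hk => ?_).trans_le zero_le
        refine indicator_of_notMem (fun h => hex ⟨k, hk, h⟩) _
    calc E.N (S h) ≤ E.N ({k | (β k - 1) % 2 = 0}.indicator y +
          {k | (β k - 1) % 2 = 1}.indicator y + J₁ᶜ.indicator (S h)) := by
          refine E.mono _ _ fun k hk => le_of_eq ?_
          by_cases h1 : k ∈ J₁
          · have h0 : k ∉ J₁ᶜ := fun h => h h1
            rcases Int.emod_two_eq_zero_or_one (β k - 1) with h2 | h2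
            · have h3 : k ∉ {k | (β k - 1) % 2 = 1} := fun h => by
                simp only [mem_ofPred_eq] at h; omega
              rw [Pi.add_apply, Pi.add_apply, indicator_of_notMem h0, indicator_of_notMem h3,
                indicator_of_mem (s := {k | (β k - 1) % 2 = 0}) h2, show y k = S h k from indicator_of_mem h1 _]
              simp
            · have h3 : k ∉ {k | (β k - 1) % 2 = 0} := fun h => by
                simp only [mem_ofPred_eq] at h; omega
              rw [Pi.add_apply, Pi.add_apply, indicator_of_notMem h0, indicator_of_notMem h3,
                indicator_of_mem (s := {k | (β k - 1) % 2 = 1}) h2, show y k = S h k from indicator_of_mem h1 _]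
              simp
          · have hy : y k = 0 := indicator_of_notMem h1 _
            have h2 : ∀ A : Set ℤ, A.indicator y k = 0 := fun A => by
              by_cases h : k ∈ A <;> simp [h, hy]
            simp [h1, h2, -indicator_apply_eq_zero]
      _ ≤ CR * (D₁ * E.N h) + CR * (D₁ * E.N h) + D₁ * E.N h := by
          refine (E.add_le _ _).trans ?_
          gcongr
          exact (E.add_le _ _).trans (add_le_add (hpar 0) (hpar 1))
      _ = _ := by ring
  set D₂ : NNReal := 2 * CR * D₁ + D₁
  set D₃ : NNReal := (4 * (D₁ : ℝ≥0∞) * P.C * P.G).toNNReal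
  have hD₃ : (D₃ : ℝ≥0∞) = 4 * D₁ * P.C * P.G :=
    ENNReal.coe_toNNReal (ENNReal.mul_ne_top (by finiteness) P.G_ne_top)
  refine ⟨S, D₂ + D₃ + 1, fun h => ?_, fun h => ?_, fun k hk => ?_⟩
  · by_cases hh : E.N h = ⊤
    · rw [hh, ENNReal.mul_top (by simp)]; exact le_top
    · refine (hEbound h (mem_leftSpace_of_E hh)).trans ?_
      gcongr
      push_cast
      simp only [D₂]; push_cast
      rw [add_assoc]
      exact le_self_add
  · by_cases hh : F.N h = ⊤
    · rw [hh, ENNReal.mul_top (by simp)]; exact le_top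
    · have hhV := mem_leftSpace_of_F P hh
      -- Each coordinate of the image is controlled by the left part of `h` in `E`, so the bound on
      -- `F` needs separation only and no shift property.
      refine (P.F_le_of_E_Iic (h := h) (D := D₁) (by simp) fun k hk => ?_).trans ?_
      · have h1 := (hblock (β k) h hhV ⟨k, hk, rfl⟩).trans
          (mul_le_mul_right (hq_le k hk h) _)
        rw [← hD₁] at h1
        have h2 := E.mul_single_le ({j | β j = β k}.indicator (S h)) (k := k)
        simp only [mem_ofPred_eq, indicator_of_mem] at h2
        exact h2.trans h1
      · rw [← hD₃]
        gcongr
        rw [add_comm D₂, add_assoc]; exact le_self_add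
  · rw [hS, (hψ (β k) ⟨k, hk, rfl⟩).1, one_mul]

/-! ### Regularization and sufficiency for sequences -/

namespace SeqLattice

variable {J : Set ℤ} (E : SeqLattice J)

/-- Since `J` is order-connected, a coordinate travelling within `J` never leaves it on the way, so
cutting back to `J` after each unit step loses nothing. -/
theorem shift_iterate_le (hJ : J.OrdConnected) {ε : ℤ} (hε : ε = 1 ∨ ε = -1) {B : NNReal}
    (hB : ∀ x, E.N (shift ε (J.indicator x)) ≤ B * E.N x) (d : ℕ) (x : ℤ → ℝ) :
    E.N (shift (ε * d) (J.indicator x)) ≤ B ^ d * E.N x := by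
  induction d with
  | zero =>
    simp only [Nat.cast_zero, mul_zero, pow_zero, one_mul]
    refine E.mono _ _ fun k hk => ?_
    simp [shift, hk]
  | succ d ih =>
    calc E.N (shift (ε * (d + 1 : ℕ)) (J.indicator x))
        ≤ E.N (shift ε (J.indicator (shift (ε * d) (J.indicator x)))) := by
          refine E.mono _ _ fun k hk => ?_
          have h0 : k - ε * ((d + 1 : ℕ) : ℤ) = k - ε - ε * d := by push_cast; ring
          simp only [shift, h0]
          by_cases h1 : k - ε - ε * d ∈ J
          · have h2 : k - ε ∈ J := by
              rcases hε with rfl | rfl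
              · exact hJ.out h1 hk ⟨by omega, by omega⟩
              · exact hJ.out hk h1 ⟨by omega, by omega⟩
            rw [indicator_of_mem h2]; rfl
          · rw [indicator_of_notMem h1]; simp
      _ ≤ B * E.N (shift (ε * d) (J.indicator x)) := hB _
      _ ≤ B * (B ^ d * E.N x) := by gcongr
      _ = _ := by ring

end SeqLattice

namespace SepPair

variable {J : Set ℤ} {E F : SeqLattice J} (P : SepPair E F)

/-- In any decomposition the misplaced pieces, the left part of `y` in `E` and the right part of `x`
in `F`, are absorbed by `E_Iic_le` and `F_Ici_le`. So no decomposition does essentially better than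
cutting at `k`. -/
theorem kappa_add_le (x y : ℤ → ℝ) {k : ℤ} (hk : k ∈ J) :
    kappa E F k (x + y) ≤
      (1 + P.K) * (F.N (Pi.single k 1) * E.N x + E.N (Pi.single k 1) * F.N y) := by
  have h1 := P.E_Iic_le y hk
  have h2 := P.F_Ici_le x hk
  have h3 := E.indicator_le (Iic k) x
  have h4 := F.indicator_le (Ici k) y
  have h5 := F.indicator_le (Iic k) y
  have h6 := E.indicator_le (Ici k) x
  rw [kappa, indicator_add', indicator_add']
  calc _ ≤ F.N (Pi.single k 1) * (E.N ((Iic k).indicator x) + E.N ((Iic k).indicator y)) +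
        E.N (Pi.single k 1) * (F.N ((Ici k).indicator x) + F.N ((Ici k).indicator y)) := by
        gcongr
        · exact E.add_le _ _
        · exact F.add_le _ _
    _ = (F.N (Pi.single k 1) * E.N ((Iic k).indicator x) +
          F.N (Pi.single k 1) * E.N ((Iic k).indicator y)) +
        (E.N (Pi.single k 1) * F.N ((Ici k).indicator x) +
          E.N (Pi.single k 1) * F.N ((Ici k).indicator y)) := by ring
    _ ≤ (F.N (Pi.single k 1) * E.N x + P.K * (E.N (Pi.single k 1) * F.N y)) +
        (P.K * (F.N (Pi.single k 1) * E.N x) + E.N (Pi.single k 1) * F.N y) := by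
        refine add_le_add (add_le_add (by gcongr) (h1.trans ?_)) (add_le_add (h2.trans ?_) (by gcongr))
        · gcongr
        · gcongr
    _ = _ := by ring

/-- `exists_operator_of_left` for `b` restricted to `Q`. Slow variation of the coordinates of `a`
makes the norms of its left parts grow by at most `1 + L B` per step, and the hypothesis on `b` at a
general `k` is inherited from the last element of `Q` up to `k`. -/
theorem exists_operator_half {J : Set ℤ} {E F : SeqLattice J} (P : SepPair E F) (hE : SeqRSP E) {a b : ℤ → ℝ} {L C₀ : NNReal} {Q : Set ℤ}
    (ha0 : ∀ k ∈ J, a k ≠ 0) (hat : ∀ k ∈ J, E.N ((Iic k).indicator a) ≠ ⊤)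
    (hreg : ∀ k ∈ J, k + 1 ∈ J → ‖a (k + 1)‖ₑ ≤ L * ‖a k‖ₑ)
    (hb : ∀ k ∈ J, k ∈ Q → E.N ((Iic k).indicator b) ≤ C₀ * E.N ((Iic k).indicator a)) :
    ∃ (S : (ℤ → ℝ) →ₗ[ℝ] (ℤ → ℝ)) (D : NNReal), (∀ h, E.N (S h) ≤ D * E.N h) ∧
      (∀ h, F.N (S h) ≤ D * F.N h) ∧ ∀ k ∈ J, S a k = Q.indicator b k := by
  refine exists_operator_of_left P hE (B₀ := 1 + L * P.B) (C₀ := C₀)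
    (fun k hk => E.ne_zero_of hk (by simpa using ha0 k hk)) hat (fun k hk hk1 => ?_)
    (fun k hk => ?_)
  · have h1 : E.N ((Iic (k + 1)).indicator a) ≤
        E.N ((Iic k).indicator a + a (k + 1) • Pi.single (k + 1) 1) := by
      refine E.mono _ _ fun j _ => le_of_eq ?_
      rcases lt_trichotomy j (k + 1) with h | rfl | h
      · have h1 : j ≤ k := by omega
        simp [h.le, h1, h.ne]
      · simp
      · have h1 : ¬ j ≤ k := by omega
        simp [h1, h.ne']
        omega
    refine h1.trans ((E.add_le _ _).trans ?_)
    have h2 := E.mul_single_le ((Iic k).indicator a) (k := k)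
    rw [indicator_of_mem (by simp)] at h2
    rw [E.smul]
    calc _ ≤ E.N ((Iic k).indicator a) + (L * ‖a k‖ₑ) * (P.B * E.N (Pi.single k 1)) := by
          gcongr
          · exact hreg k hk hk1
          · exact P.E_single_succ_le hk
      _ = E.N ((Iic k).indicator a) + L * P.B * (‖a k‖ₑ * E.N (Pi.single k 1)) := by ring
      _ ≤ E.N ((Iic k).indicator a) + L * P.B * E.N ((Iic k).indicator a) := by gcongr
      _ = _ := by push_cast; ring
  · by_cases hex : ∃ j, (j ∈ J ∧ j ∈ Q) ∧ j ≤ k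
    · obtain ⟨i, ⟨⟨hi, hiQ⟩, hik⟩, hmax⟩ := Int.exists_greatest_of_bdd
        (P := fun j => (j ∈ J ∧ j ∈ Q) ∧ j ≤ k) ⟨k, fun z hz => hz.2⟩ hex
      calc _ ≤ E.N ((Iic i).indicator b) := by
            rw [indicator_indicator]
            exact E.indicator_mono (fun j hj => hmax j ⟨⟨hj.2, hj.1.2⟩, hj.1.1⟩) b
        _ ≤ C₀ * E.N ((Iic i).indicator a) := hb i hi hiQ
        _ ≤ _ := by gcongr; exact E.indicator_mono (fun j hj => le_trans hj.1 hik) a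
    · refine (E.eq_zero fun j hj => ?_).trans_le zero_le
      rw [indicator_indicator]
      exact indicator_of_notMem (fun h => hex ⟨j, ⟨hj, h.2⟩, h.1⟩) _

theorem tsum_int_half_pow_ne_top : (∑' e : ℤ, (2⁻¹ : ℝ≥0∞) ^ e.natAbs) ≠ ⊤ := by
  have h : (∑' e : ℤ, (2⁻¹ : ℝ≥0∞) ^ e.natAbs) ≤
      ∑' e : ℕ ⊕ ℕ, (2⁻¹ : ℝ≥0∞) ^ (Sum.elim id id e) := by
    have hinj : Function.Injective
        (fun e : ℤ => if 0 ≤ e then (Sum.inl e.natAbs : ℕ ⊕ ℕ) else Sum.inr e.natAbs) := by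
      intro a b hab
      simp only at hab
      split_ifs at hab <;> simp at hab <;> omega
    refine le_trans (le_of_eq ?_) (ENNReal.tsum_comp_le_tsum_of_injective hinj _)
    refine tsum_congr fun e => ?_
    split_ifs <;> simp
  refine (h.trans_lt ?_).ne
  rw [Summable.tsum_sum ENNReal.summable ENNReal.summable]
  simp [ENNReal.tsum_geometric]

/-- Operators choosing one coordinate for each coordinate, with geometric weights, are bounded. -/
theorem selection_le {G : SeqLattice J} (hJ : J.OrdConnected) {B : NNReal}
    (hB : ∀ x, G.N (shift 1 (J.indicator x)) ≤ B * G.N x)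
    (hB' : ∀ x, G.N (shift (-1) (J.indicator x)) ≤ B * G.N x) {η : ℝ} (hη : 0 ≤ η)
    (hηB : ENNReal.ofReal η * B ≤ 2⁻¹) (j : ℤ → ℤ) (hj : ∀ k ∈ J, j k ∈ J) (h : ℤ → ℝ) :
    G.N (fun k => η ^ (k - j k).natAbs * h (j k)) ≤
      2 * (∑' e : ℤ, (2⁻¹ : ℝ≥0∞) ^ e.natAbs) * G.N h := by
  -- Sort the coordinates by their displacement `e = k - j k`. On each class the operator is
  -- dominated by `η ^ |e|` times the translation by `e`, of norm at most `(η B) ^ |e|`.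
  refine (G.le_tsum _ (fun e : ℤ => (η ^ e.natAbs) • shift e (J.indicator h))
    fun k hk => ?_).trans ?_
  · refine le_trans (le_of_eq ?_) (ENNReal.le_tsum (k - j k))
    have : k - (k - j k) = j k := by ring
    simp only [Pi.smul_apply, shift, this, smul_eq_mul, indicator_of_mem (hj k hk)]
  · rw [mul_assoc, ← ENNReal.tsum_mul_right]
    gcongr with e
    rw [G.smul, enorm_pow, Real.enorm_of_nonneg hη]
    have h1 : G.N (shift e (J.indicator h)) ≤ B ^ e.natAbs * G.N h := by
      rcases le_total 0 e with he | he
      · have := G.shift_iterate_le hJ (Or.inl rfl) hB e.natAbs h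
        rwa [one_mul, Int.natAbs_of_nonneg he] at this
      · have := G.shift_iterate_le hJ (Or.inr rfl) hB' e.natAbs h
        rwa [show (-1 : ℤ) * e.natAbs = e by omega] at this
    calc _ ≤ ENNReal.ofReal η ^ e.natAbs * (B ^ e.natAbs * G.N h) := by gcongr
      _ = (ENNReal.ofReal η * B) ^ e.natAbs * G.N h := by rw [mul_pow]; ring
      _ ≤ _ := by gcongr

end SepPair

/-- If `E` has the right-shift property and `F` the left-shift property, the pair is a
Calderón couple. -/
theorem seqCalderon_of_shift {J : Set ℤ} {E F : SeqLattice J} (P : SepPair E F) (hE : SeqRSP E)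
    (hF : SeqRSP F.mirror) : SeqCalderon E F := by
  intro a b ha ⟨C, hC⟩
  have hs0 := fun k hk => F.single_ne_zero k hk
  have hst := fun k hk => F.single_ne_top k hk
  have hp0 := fun k hk => E.single_ne_zero k hk
  have hpt := fun k hk => E.single_ne_top k hk
  by_cases hzero : ∀ k ∈ J, a k = 0
  · refine ⟨0, 0, by simp [E.zero], by simp [F.zero], fun k hk => ?_⟩
    have h1 : kappa E F k a = 0 := by
      have h2 : ∀ A : Set ℤ, ∀ j ∈ J, A.indicator a j = 0 := fun A j hj => by
        by_cases h : j ∈ A <;> simp [h, hzero j hj]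
      simp [kappa, E.eq_zero (h2 _), F.eq_zero (h2 _)]
    have h2 := hC k hk
    rw [h1, mul_zero, nonpos_iff_eq_zero, kappa, add_eq_zero] at h2
    by_contra hb
    have h3 : E.N ((Iic k).indicator b) ≠ 0 := E.ne_zero_of hk (by simpa using fun h => hb h.symm)
    exact mul_ne_zero (hs0 k hk) h3 h2.1
  push Not at hzero
  obtain ⟨k₀, hk₀, hak₀⟩ := hzero
  -- With `η B = 1 / 2` the weights outweigh the growth of translations in both directions and on
  -- both lattices.
  set η : ℝ := (2 * (P.B : ℝ))⁻¹
  have hB1 : (1 : ℝ) ≤ P.B := by exact_mod_cast P.one_le_B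
  have hη0 : 0 < η := by positivity
  have hη1 : η ≤ 1 := inv_le_one_of_one_le₀ (by linarith)
  have hηB : ENNReal.ofReal η * P.B ≤ 2⁻¹ := by
    rw [← ENNReal.ofReal_coe_nnreal, ← ENNReal.ofReal_mul hη0.le]
    have : η * P.B = 2⁻¹ := by simp only [η]; field_simp
    rw [this, ENNReal.ofReal_inv_of_pos two_pos]; simp
  have hηB' : ENNReal.ofReal η * P.B ≤ 1 := hηB.trans (by simp)
  set w : ℤ → ℤ → ℝ≥0∞ := fun k j => ENNReal.ofReal η ^ (k - j).natAbs * ‖a j‖ₑ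
  -- The least majorant of `|a|` on `J` that changes by a factor of at most `η⁻¹` between
  -- neighbours. It is finite because coordinates to the left of `k` are controlled by the `E`-term
  -- of `kappa` and those to the right by the `F`-term.
  set M : ℤ → ℝ≥0∞ := fun k => ⨆ j : J, w k j
  have hcomp : ∀ (G : SeqLattice J) (ε : ℤ) (_ : ε = 1 ∨ ε = -1)
      (_ : ∀ x, G.N (shift ε (J.indicator x)) ≤ P.B * G.N x), ∀ k ∈ J, ∀ (d : ℕ),
      k - ε * d ∈ J → w k (k - ε * d) * G.N (Pi.single k 1) ≤
        ‖a (k - ε * d)‖ₑ * G.N (Pi.single (k - ε * d) 1) := by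
    intro G ε hε hG k hk d hd
    have h1 := G.shift_iterate_le P.ordConnected hε hG d (Pi.single (k - ε * d) 1)
    rw [SepPair.shift_single hd, sub_add_cancel] at h1
    have h2 : (k - (k - ε * d)).natAbs = d := by rcases hε with rfl | rfl <;> omega
    simp only [w, h2]
    calc _ ≤ ENNReal.ofReal η ^ d * ‖a (k - ε * d)‖ₑ *
          (P.B ^ d * G.N (Pi.single (k - ε * d) 1)) := by gcongr
      _ = (ENNReal.ofReal η * P.B) ^ d * (‖a (k - ε * d)‖ₑ * G.N (Pi.single (k - ε * d) 1)) := by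
          rw [mul_pow]; ring
      _ ≤ 1 ^ d * (‖a (k - ε * d)‖ₑ * G.N (Pi.single (k - ε * d) 1)) := by gcongr
      _ = _ := by simp
  have hMt : ∀ k ∈ J, M k ≠ ⊤ := by
    intro k hk
    have hka := ha k hk
    rw [kappa, Ne, ENNReal.add_eq_top, not_or] at hka
    have hE1 : E.N ((Iic k).indicator a) ≠ ⊤ := fun h => hka.1 (by
      rw [h, ENNReal.mul_top (hs0 k hk)])
    have hF1 : F.N ((Ici k).indicator a) ≠ ⊤ := fun h => hka.2 (by
      rw [h, ENNReal.mul_top (hp0 k hk)])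
    have h1 : M k ≤ E.N ((Iic k).indicator a) / E.N (Pi.single k 1) +
        F.N ((Ici k).indicator a) / F.N (Pi.single k 1) := by
      refine iSup_le fun ⟨j, hj⟩ => ?_
      rcases le_total j k with hjk | hjk
      · refine le_trans ?_ le_self_add
        rw [ENNReal.le_div_iff_mul_le (Or.inl (hp0 k hk)) (Or.inl (hpt k hk))]
        have h2 := hcomp E 1 (Or.inl rfl) P.stepE k hk (k - j).toNat
        rw [show k - 1 * ((k - j).toNat : ℤ) = j by omega] at h2
        refine (h2 hj).trans ?_
        have := E.mul_single_le ((Iic k).indicator a) (k := j)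
        rwa [indicator_of_mem (by simpa using hjk)] at this
      · refine le_trans ?_ le_add_self
        rw [ENNReal.le_div_iff_mul_le (Or.inl (hs0 k hk)) (Or.inl (hst k hk))]
        have h2 := hcomp F (-1) (Or.inr rfl) P.stepF' k hk (j - k).toNat
        rw [show k - -1 * ((j - k).toNat : ℤ) = j by omega] at h2
        refine (h2 hj).trans ?_
        have := F.mul_single_le ((Ici k).indicator a) (k := j)
        rwa [indicator_of_mem (by simpa using hjk)] at this
    refine (h1.trans_lt ?_).ne
    exact ENNReal.add_lt_top.2 ⟨ENNReal.div_lt_top hE1 (hp0 k hk),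
      ENNReal.div_lt_top hF1 (hs0 k hk)⟩
  have hM0 : ∀ k, M k ≠ 0 := by
    intro k h
    have h1 : w k k₀ ≤ M k := le_iSup (fun j : J => w k j) ⟨k₀, hk₀⟩
    rw [h, nonpos_iff_eq_zero] at h1
    simp only [w, mul_eq_zero, enorm_eq_zero, hak₀, or_false] at h1
    exact absurd h1 (pow_ne_zero _ (by simpa using hη0))
  -- The majorant is not linear in `a`. Fixing for every `k` one coordinate that almost attains the
  -- supremum gives a linear operator whose value at `a` is comparable with it.
  have hsel : ∀ k, ∃ j, k ∈ J → j ∈ J ∧ M k / 2 ≤ w k j := by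
    intro k
    by_cases hk : k ∈ J
    · obtain ⟨⟨j, hj⟩, h⟩ := lt_iSup_iff.1 (ENNReal.half_lt_self (hM0 k) (hMt k hk))
      exact ⟨j, fun _ => ⟨hj, h.le⟩⟩
    · exact ⟨0, fun h => absurd h hk⟩
  choose j hj using hsel
  set R : (ℤ → ℝ) →ₗ[ℝ] (ℤ → ℝ) :=
    { toFun := fun h k => η ^ (k - j k).natAbs * h (j k)
      map_add' := fun x y => by ext k; simp [mul_add]
      map_smul' := fun c x => by ext k; simp only [Pi.smul_apply, smul_eq_mul, RingHom.id_apply]; ring }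
  set Z : ℝ≥0∞ := 2 * (∑' e : ℤ, (2⁻¹ : ℝ≥0∞) ^ e.natAbs)
  have hZ : Z ≠ ⊤ := ENNReal.mul_ne_top (by simp) SepPair.tsum_int_half_pow_ne_top
  have hRE : ∀ h, E.N (R h) ≤ Z * E.N h :=
    SepPair.selection_le P.ordConnected P.stepE P.stepE' hη0.le hηB j fun k hk => (hj k hk).1
  have hRF : ∀ h, F.N (R h) ≤ Z * F.N h :=
    SepPair.selection_le P.ordConnected P.stepF P.stepF' hη0.le hηB j fun k hk => (hj k hk).1
  set a' := R a
  have ha'w : ∀ k, ‖a' k‖ₑ = w k (j k) := fun k => by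
    simp only [a', R, w, LinearMap.coe_mk, AddHom.coe_mk, enorm_mul, enorm_pow]
    rw [Real.enorm_of_nonneg hη0.le]
  have ha'1 : ∀ k ∈ J, ‖a' k‖ₑ ≤ M k := fun k hk => by
    rw [ha'w]; exact le_iSup (fun j : J => w k j) ⟨j k, (hj k hk).1⟩
  have ha'2 : ∀ k ∈ J, M k ≤ 2 * ‖a' k‖ₑ := fun k hk => by
    rw [ha'w]
    have := (hj k hk).2
    rwa [ENNReal.div_le_iff (by simp) (by simp), mul_comm] at this
  have ha'0 : ∀ k ∈ J, a' k ≠ 0 := fun k hk h => by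
    have := ha'2 k hk
    rw [h] at this
    simp [hM0 k] at this
  have haa' : ∀ k ∈ J, |a k| ≤ 2 * |a' k| := fun k hk => by
    have h1 : ‖a k‖ₑ ≤ M k := by
      refine le_trans (le_of_eq ?_) (le_iSup (fun j : J => w k j) ⟨k, hk⟩)
      simp [w]
    have h2 := h1.trans (ha'2 k hk)
    rw [Real.enorm_eq_ofReal_abs, Real.enorm_eq_ofReal_abs, ← ENNReal.ofReal_ofNat,
      ← ENNReal.ofReal_mul (by norm_num)] at h2
    exact (ENNReal.ofReal_le_ofReal_iff (by positivity)).1 h2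
  set ηi : NNReal := 2 * P.B
  have hηi : ∀ x : ℝ≥0∞, ηi * (ENNReal.ofReal η * x) = x := by
    intro x
    rw [← mul_assoc]
    have : (ηi : ℝ≥0∞) * ENNReal.ofReal η = 1 := by
      rw [← ENNReal.ofReal_coe_nnreal, ← ENNReal.ofReal_mul ηi.coe_nonneg]
      have : (ηi : ℝ) * η = 1 := by simp only [η, ηi]; push_cast; field_simp
      rw [this, ENNReal.ofReal_one]
    rw [this, one_mul]
  have hMreg : ∀ k k' : ℤ, (k - k').natAbs = 1 → M k ≤ ηi * M k' := by
    intro k k' hkk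
    refine iSup_le fun ⟨i, hi⟩ => ?_
    refine le_trans ?_ (mul_le_mul_right (le_iSup (fun j : J => w k' j) ⟨i, hi⟩) _)
    simp only [w]
    have h1 : ENNReal.ofReal η * ENNReal.ofReal η ^ (k - i).natAbs ≤
        ENNReal.ofReal η ^ (k' - i).natAbs := by
      rw [← pow_succ']
      exact pow_le_pow_right_of_le_one' (by simpa using hη1) (by omega)
    calc _ = ηi * (ENNReal.ofReal η * (ENNReal.ofReal η ^ (k - i).natAbs * ‖a i‖ₑ)) :=
          (hηi _).symm
      _ = ηi * ((ENNReal.ofReal η * ENNReal.ofReal η ^ (k - i).natAbs) * ‖a i‖ₑ) := by ring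
      _ ≤ _ := by gcongr
  have hreg : ∀ k ∈ J, ∀ k' ∈ J, (k - k').natAbs = 1 →
      ‖a' k‖ₑ ≤ ((ηi * 2 : NNReal) : ℝ≥0∞) * ‖a' k'‖ₑ := by
    intro k hk k' hk' hkk
    calc _ ≤ M k := ha'1 k hk
      _ ≤ ηi * M k' := hMreg k k' hkk
      _ ≤ ηi * (2 * ‖a' k'‖ₑ) := by gcongr; exact ha'2 k' hk'
      _ = _ := by push_cast; ring
  have hκ' : ∀ k ∈ J, kappa E F k a' ≠ ⊤ := by
    intro k hk
    have hka := ha k hk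
    rw [kappa, Ne, ENNReal.add_eq_top, not_or] at hka
    have h1 : a' = R ((Iic k).indicator a) + R ((Ioi k).indicator a) := by
      rw [← map_add, ← compl_Iic, indicator_self_add_compl]
    rw [h1]
    refine ((P.kappa_add_le _ _ hk).trans_lt ?_).ne
    have hEt : E.N ((Iic k).indicator a) ≠ ⊤ := fun h => hka.1 (by
      rw [h, ENNReal.mul_top (hs0 k hk)])
    have hFt : F.N ((Ioi k).indicator a) ≠ ⊤ := fun h => hka.2 (by
      have : F.N ((Ioi k).indicator a) ≤ F.N ((Ici k).indicator a) :=
        F.indicator_mono (A := Ioi k) (A' := Ici k) (fun x hx => (mem_Ioi.1 hx.1).le) a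
      rw [h, top_le_iff] at this
      rw [this, ENNReal.mul_top (hp0 k hk)])
    refine ENNReal.mul_lt_top (ENNReal.add_lt_top.2 ⟨by simp, lt_top_iff_ne_top.2 P.K_ne_top⟩) ?_
    refine ENNReal.add_lt_top.2 ⟨ENNReal.mul_lt_top (lt_top_iff_ne_top.2 (hst k hk)) ?_,
      ENNReal.mul_lt_top (lt_top_iff_ne_top.2 (hpt k hk)) ?_⟩
    · exact (hRE _).trans_lt (ENNReal.mul_lt_top (lt_top_iff_ne_top.2 hZ)
        (lt_top_iff_ne_top.2 hEt))
    · exact (hRF _).trans_lt (ENNReal.mul_lt_top (lt_top_iff_ne_top.2 hZ)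
        (lt_top_iff_ne_top.2 hFt))
  have hκb : ∀ k ∈ J, kappa E F k b ≤ 2 * C * kappa E F k a' := by
    intro k hk
    refine (hC k hk).trans ?_
    have h2 : ∀ (G : SeqLattice J) (A : Set ℤ), G.N (A.indicator a) ≤ 2 * G.N (A.indicator a') := by
      intro G A
      rw [← ENNReal.ofReal_ofNat]
      refine G.mono_smul two_pos.le fun i hi => ?_
      by_cases h : i ∈ A <;> simp [h, haa' i hi]
    calc _ ≤ C * (F.N (Pi.single k 1) * (2 * E.N ((Iic k).indicator a')) +
          E.N (Pi.single k 1) * (2 * F.N ((Ici k).indicator a'))) := by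
          rw [kappa]; gcongr <;> exact h2 _ _
      _ = _ := by rw [kappa]; ring
  -- On `Q` the `E`-term of the regularized sequence dominates its `kappa`, so left parts of `b` are
  -- controlled in `E`. Off `Q` the `F`-term dominates, and the reflected pair gives the other half
  -- of the operator.
  set Q : Set ℤ := {k | E.N (Pi.single k 1) * F.N ((Ici k).indicator a') ≤
    F.N (Pi.single k 1) * E.N ((Iic k).indicator a')}
  obtain ⟨S₁, D₁, hS₁E, hS₁F, hS₁⟩ := P.exists_operator_half hE (a := a') (b := b)
    (L := ηi * 2) (C₀ := 4 * C) (Q := Q) ha'0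
    (fun k hk h => hκ' k hk (by rw [kappa, h, ENNReal.mul_top (hs0 k hk), top_add]))
    (fun k hk hk1 => hreg _ hk1 _ hk (by simp))
    (fun k hk hkQ => by
      refine (ENNReal.mul_le_mul_iff_right (hs0 k hk) (hst k hk)).1 ?_
      calc _ ≤ kappa E F k b := le_self_add
        _ ≤ 2 * C * (F.N (Pi.single k 1) * E.N ((Iic k).indicator a') +
            F.N (Pi.single k 1) * E.N ((Iic k).indicator a')) := by
            refine (hκb k hk).trans ?_
            rw [kappa]; gcongr 2 * C * (_ + ?_); exact hkQ
        _ = _ := by push_cast; ring)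
  obtain ⟨S₂, D₂, hS₂E, hS₂F, hS₂⟩ := P.mirror.exists_operator_half hF (a := reflect a')
    (b := reflect b) (L := ηi * 2) (C₀ := 4 * C) (Q := Neg.neg ⁻¹' Qᶜ)
    (fun k hk => ha'0 _ hk)
    (fun k hk h => by
      have h1 : F.N ((Ici (-k)).indicator a') = ⊤ := by
        rw [SeqLattice.mirror_indicator, ← neg_neg k, SepPair.neg_preimage_Iic] at h
        simpa [reflect] using h
      exact hκ' (-k) hk (by rw [kappa, h1, ENNReal.mul_top (hp0 _ hk), add_top]))
    (fun k hk hk1 => hreg _ hk1 _ hk (by omega))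
    (fun k hk hkQ => by
      have h1 : ∀ x, F.mirror.N ((Iic k).indicator (reflect x)) = F.N ((Ici (-k)).indicator x) := by
        intro x
        rw [SeqLattice.mirror_indicator, ← neg_neg k, SepPair.neg_preimage_Iic]
        simp [reflect]
      rw [h1, h1]
      refine (ENNReal.mul_le_mul_iff_right (hp0 (-k) hk) (hpt (-k) hk)).1 ?_
      calc _ ≤ kappa E F (-k) b := le_add_self
        _ ≤ 2 * C * (E.N (Pi.single (-k) 1) * F.N ((Ici (-k)).indicator a') +
            E.N (Pi.single (-k) 1) * F.N ((Ici (-k)).indicator a')) := by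
            refine (hκb (-k) hk).trans ?_
            rw [kappa]; gcongr 2 * C * (?_ + _); 
            have h' : -k ∉ Q := hkQ
            simp only [Q, mem_ofPred_eq, not_le] at h'
            exact h'.le
        _ = _ := by push_cast; ring)
  set Zn : NNReal := Z.toNNReal
  have hZn : (Zn : ℝ≥0∞) = Z := ENNReal.coe_toNNReal hZ
  refine ⟨(S₁ + reflect ∘ₗ S₂ ∘ₗ reflect) ∘ₗ R, (D₁ + D₂) * Zn, fun h => ?_, fun h => ?_,
    fun k hk => ?_⟩
  · have h2 : E.N (reflect (S₂ (reflect (R h)))) ≤ D₂ * E.N (R h) := by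
      have := hS₂F (reflect (R h))
      simpa [SeqLattice.mirror_apply, reflect] using this
    refine (E.add_le _ _).trans ((add_le_add (hS₁E _) h2).trans ?_)
    rw [← add_mul]; push_cast; rw [hZn, mul_assoc]; gcongr; exact hRE h
  · have h2 : F.N (reflect (S₂ (reflect (R h)))) ≤ D₂ * F.N (R h) := by
      have := hS₂E (reflect (R h))
      simpa [SeqLattice.mirror_apply, reflect] using this
    refine (F.add_le _ _).trans ((add_le_add (hS₁F _) h2).trans ?_)
    rw [← add_mul]; push_cast; rw [hZn, mul_assoc]; gcongr; exact hRF h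
  · have h2 := hS₂ (-k) (by simpa using hk)
    have h1 := hS₁ k hk
    change S₁ a' k + S₂ (reflect a') (-k) = b k
    rw [h1, h2]
    by_cases h : k ∈ Q
    · have : -k ∉ (Neg.neg ⁻¹' Qᶜ : Set ℤ) := by simpa using h
      rw [indicator_of_mem h, indicator_of_notMem this, add_zero]
    · have : -k ∈ (Neg.neg ⁻¹' Qᶜ : Set ℤ) := by simpa using h
      rw [indicator_of_notMem h, indicator_of_mem this, zero_add]
      simp [reflect]

/-! ### Families of blocks violating the right-shift property -/

/-- The right-shift property for sequences of blocks indexed by intervals of integers. -/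
def SeqRSPInterval {J : Set ℤ} (E : SeqLattice J) : Prop :=
  ∃ C : NNReal, ∀ (I : Set ℤ) (u v : ℤ → ℤ → ℝ), I.OrdConnected →
    (∀ n ∈ I, u n ≠ 0 ∧ v n ≠ 0 ∧ (Function.support (u n)).Finite ∧ Function.support (u n) ⊆ J ∧
      (Function.support (v n)).Finite ∧ Function.support (v n) ⊆ J) →
    (∀ n ∈ I, ∀ a ∈ Function.support (u n), ∀ b ∈ Function.support (v n), a < b) →
    (∀ n ∈ I, n + 1 ∈ I →
      ∀ a ∈ Function.support (v n), ∀ b ∈ Function.support (u (n + 1)), a < b) →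
    (∀ n ∈ I, E.N (v n) ≤ E.N (u n)) →
    ∀ (s : Finset ℤ) (α : ℤ → ℝ), ↑s ⊆ I →
    E.N (∑ n ∈ s, α n • v n) ≤ C * E.N (∑ n ∈ s, α n • u n)

/-- A vector `u` together with a smaller vector `v` supported to the right of it. -/
structure Block {J : Set ℤ} (E : SeqLattice J) where
  l : ℤ
  r : ℤ
  t : ℤ
  u : ℤ → ℝ
  v : ℤ → ℝ
  hl : l ∈ J
  hr : r ∈ J
  ht : t ∈ J
  hlr : l ≤ r
  hrt : r < t
  hu : ∀ k, u k ≠ 0 → l ≤ k ∧ k ≤ r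
  hv : ∀ k, v k ≠ 0 → r < k ∧ k ≤ t
  hle : E.N v ≤ E.N u
  hpos : E.N u ≠ 0

namespace Block

variable {J : Set ℤ} {E : SeqLattice J}

/-- Two blocks at distance more than `p`. -/
def Sep (p : ℤ) (b b' : Block E) : Prop := b.t + p < b'.l ∨ b'.t + p < b.l

theorem u_ne_top (b : Block E) : E.N b.u ≠ ⊤ :=
  (E.single_lt_of_finite ((finite_Icc b.l b.r).subset fun k hk => b.hu k hk.1)).ne

theorem v_ne_top (b : Block E) : E.N b.v ≠ ⊤ :=
  (b.hle.trans_lt (lt_top_iff_ne_top.2 b.u_ne_top)).ne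

/-- A block with another second vector. -/
def replace (b : Block E) (v : ℤ → ℝ) (hv : ∀ k, v k ≠ 0 → b.r < k ∧ k ≤ b.t)
    (hle : E.N v ≤ E.N b.u) : Block E :=
  { b with v := v, hv := hv, hle := hle }

theorem exists_of_support {u v : ℤ → ℝ} (hu0 : u ≠ 0) (hv0 : v ≠ 0)
    (hu : (Function.support u).Finite) (huJ : Function.support u ⊆ J)
    (hv : (Function.support v).Finite) (hvJ : Function.support v ⊆ J)
    (hlt : ∀ a ∈ Function.support u, ∀ b ∈ Function.support v, a < b) (hle : E.N v ≤ E.N u) :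
    ∃ b : Block E, b.u = u ∧ b.v = v ∧ b.l ∈ Function.support u ∧ b.t ∈ Function.support v := by
  have hun : hu.toFinset.Nonempty := by simpa using hu0
  have hvn : hv.toFinset.Nonempty := by simpa using hv0
  have h1 : hu.toFinset.min' hun ∈ Function.support u := by simpa using hu.toFinset.min'_mem hun
  have h2 : hu.toFinset.max' hun ∈ Function.support u := by simpa using hu.toFinset.max'_mem hun
  have h3 : hv.toFinset.max' hvn ∈ Function.support v := by simpa using hv.toFinset.max'_mem hvn
  exact ⟨{  l := hu.toFinset.min' hun
            r := hu.toFinset.max' hun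
            t := hv.toFinset.max' hvn
            u := u
            v := v
            hl := huJ h1
            hr := huJ h2
            ht := hvJ h3
            hlr := Finset.min'_le _ _ (by simpa using h2)
            hrt := hlt _ h2 _ h3
            hu := fun k hk => ⟨Finset.min'_le _ _ (by simpa using hk),
              Finset.le_max' _ _ (by simpa using hk)⟩
            hv := fun k hk => ⟨hlt _ h2 _ hk, Finset.le_max' _ _ (by simpa using hk)⟩
            hle := hle
            hpos := E.ne_zero_of (huJ h1) h1 }, rfl, rfl, h1, h3⟩

theorem sum_u_le {ι : Type*} {s s' : Finset ι} (hs : s' ⊆ s) {b : ι → Block E}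
    (hsep : ∀ i ∈ s, ∀ j ∈ s, i ≠ j → Sep 0 (b i) (b j)) :
    E.N (∑ i ∈ s', (b i).u) ≤ E.N (∑ i ∈ s, (b i).u) := by
  classical
  refine E.mono _ _ fun k _ => ?_
  rw [Finset.sum_apply, Finset.sum_apply]
  by_cases h : ∃ i ∈ s, (b i).u k ≠ 0
  · obtain ⟨i, hi, hik⟩ := h
    have h0 : ∀ j ∈ s, j ≠ i → (b j).u k = 0 := by
      intro j hj hji
      by_contra hc
      have h1 := (b j).hu k hc
      have h2 := (b i).hu k hik
      have h3 := (b j).hrt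
      have h4 := (b i).hrt
      rcases hsep j hj i hi hji with h | h <;> omega
    rw [Finset.sum_eq_single_of_mem i hi h0]
    by_cases hi' : i ∈ s'
    · rw [Finset.sum_eq_single_of_mem i hi' fun j hj => h0 j (hs hj)]
    · rw [Finset.sum_eq_zero fun j hj => h0 j (hs hj) fun h => hi' (h ▸ hj)]
      simp
  · push Not at h
    rw [Finset.sum_eq_zero fun j hj => h j (hs hj)]
    simp

end Block

/-- If the right-shift property fails, it fails for families of widely separated blocks supported
far away from the origin. -/
theorem exists_violating_family {J : Set ℤ} {E : SeqLattice J} (hE : ¬ SeqRSPInterval E)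
    (M p : ℕ) (C : NNReal) :
    ∃ (s : Finset ℤ) (b : ℤ → Block E), (∀ i ∈ s, ∀ j ∈ s, i ≠ j → (b i).Sep p (b j)) ∧
      (∀ i ∈ s, (M : ℤ) < (b i).l ∨ (b i).t < -M) ∧
      C * E.N (∑ i ∈ s, (b i).u) < E.N (∑ i ∈ s, (b i).v) := by
  classical
  by_contra hcon
  push Not at hcon
  -- Far from the origin the indices fall into `p + 1` residue classes, each consisting of blocks
  -- more than `p` apart; at most `2 M + 1` blocks come near the origin, and these are estimated one
  -- by one.
  refine hE ⟨(p + 1) * C + (2 * M + 1), fun I u v hI hfin huv hvu hle s₀ α hs₀ => ?_⟩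
  set s := s₀.filter (α · ≠ 0)
  have hred : ∀ w : ℤ → ℤ → ℝ, ∑ n ∈ s₀, α n • w n = ∑ n ∈ s, α n • w n := by
    intro w
    refine (Finset.sum_filter_of_ne fun n _ h => ?_).symm
    intro h0; simp [h0] at h
  rw [hred, hred]
  have hsI : ∀ n ∈ s, n ∈ I := fun n hn => hs₀ (Finset.mem_filter.1 hn).1
  have hα : ∀ n ∈ s, α n ≠ 0 := fun n hn => (Finset.mem_filter.1 hn).2
  rcases s.eq_empty_or_nonempty with hse | ⟨n₀, hn₀⟩
  · simp [hse, E.zero]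
  have hex0 : ∀ n ∈ I, ∀ c : ℝ, c ≠ 0 → ∃ b : Block E, b.u = c • u n ∧ b.v = c • v n ∧
      b.l ∈ Function.support (u n) ∧ b.t ∈ Function.support (v n) := by
    intro n hn c hc
    obtain ⟨h1, h2, h3, h4, h5, h6⟩ := hfin n hn
    have hsupp : ∀ x : ℤ → ℝ, Function.support (c • x) = Function.support x :=
      fun x => Function.support_const_smul_of_ne_zero c x hc
    have := Block.exists_of_support (E := E) (u := c • u n) (v := c • v n)
      (smul_ne_zero hc h1) (smul_ne_zero hc h2) (by rwa [hsupp]) (by rwa [hsupp])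
      (by rwa [hsupp]) (by rwa [hsupp]) (by rw [hsupp, hsupp]; exact huv n hn)
      (by rw [E.smul, E.smul]; gcongr; exact hle n hn)
    rwa [hsupp, hsupp] at this
  have hex : ∀ n, ∃ b : Block E, n ∈ s → b.u = α n • u n ∧ b.v = α n • v n ∧
      b.l ∈ Function.support (u n) ∧ b.t ∈ Function.support (v n) := by
    intro n
    by_cases hn : n ∈ s
    · obtain ⟨b, hb⟩ := hex0 n (hsI n hn) (α n) (hα n hn)
      exact ⟨b, fun _ => hb⟩
    · obtain ⟨b, -⟩ := hex0 n₀ (hsI n₀ hn₀) 1 one_ne_zero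
      exact ⟨b, fun h => absurd h hn⟩
  choose b hb using hex
  -- The index set is an interval and all vectors are nonzero, so each of the `d` intermediate pairs
  -- takes up coordinates and pushes the later blocks away.
  have horder : ∀ d : ℕ, ∀ n ∈ I, n + d + 1 ∈ I → ∀ a ∈ Function.support (v n),
      ∀ a' ∈ Function.support (u (n + d + 1)), a + d < a' := by
    intro d
    induction d with
    | zero =>
      intro n hn hn1 a ha a' ha'
      simp only [Nat.cast_zero, add_zero] at *
      exact hvu n hn hn1 a ha a' ha'
    | succ d ih =>
      intro n hn hn1 a ha a' ha'
      have hmid : n + d + 1 ∈ I := hI.out hn hn1 ⟨by omega, by push_cast; omega⟩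
      obtain ⟨x, hx⟩ := Function.ne_iff.1 (hfin _ hmid).1
      obtain ⟨y, hy⟩ := Function.ne_iff.1 (hfin _ hmid).2.1
      have h1 := ih n hn hmid a ha x hx
      have h2 := huv _ hmid x hx y hy
      have e : n + (d + 1 : ℕ) + 1 = n + d + 1 + 1 := by push_cast; ring
      rw [e] at hn1 ha'
      have h3 := hvu _ hmid hn1 y hy a' ha'
      push_cast; omega
  have hsepd : ∀ n ∈ s, ∀ m ∈ s, n < m → (b n).t + (m - n - 1) < (b m).l := by
    intro n hn m hm hnm
    have e : n + (m - n - 1).toNat + 1 = m := by omega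
    have := horder (m - n - 1).toNat n (hsI n hn) (by rw [e]; exact hsI m hm) _ (hb n hn).2.2.2 (b m).l
      (by rw [e]; exact (hb m hm).2.2.1)
    omega
  have hsep0 : ∀ i ∈ s, ∀ j ∈ s, i ≠ j → (b i).Sep 0 (b j) := by
    intro i hi j hj hij
    rcases lt_or_gt_of_ne hij with h | h
    · left; have := hsepd i hi j hj h; omega
    · right; have := hsepd j hj i hi h; omega
  have hsu : ∑ n ∈ s, α n • u n = ∑ n ∈ s, (b n).u :=
    Finset.sum_congr rfl fun n hn => (hb n hn).1.symm
  have hsv : ∑ n ∈ s, α n • v n = ∑ n ∈ s, (b n).v :=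
    Finset.sum_congr rfl fun n hn => (hb n hn).2.1.symm
  rw [hsu, hsv]
  set U := E.N (∑ n ∈ s, (b n).u)
  set good : ℤ → Prop := fun n => (M : ℤ) < (b n).l ∨ (b n).t < -M
  set sb := s.filter fun n => ¬ good n
  have hsbcard : sb.card ≤ 2 * M + 1 := by
    have h1 : (Finset.Icc (-M : ℤ) M).card = 2 * M + 1 := by simp; omega
    rw [← h1]
    -- A block near the origin is labelled by its first coordinate, or by `-M` if it starts earlier;
    -- only one block can reach across `-M`.
    refine Finset.card_le_card_of_injOn (fun n => max (b n).l (-M)) (fun n hn => ?_) ?_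
    · have := (Finset.mem_filter.1 hn).2
      simp only [good, not_or, not_lt] at this
      simp only [Finset.coe_Icc, mem_Icc, le_max_iff, max_le_iff]
      omega
    · have key : ∀ n ∈ sb, ∀ m ∈ sb, n < m → max (b n).l (-M) < max (b m).l (-M) := by
        intro n hn m hm hnm
        have h2 := (Finset.mem_filter.1 hn).2
        simp only [good, not_or, not_lt] at h2
        have h3 := hsepd n (Finset.mem_filter.1 hn).1 m (Finset.mem_filter.1 hm).1 hnm
        have h4 := (b n).hlr
        have h5 := (b n).hrt
        omega
      intro n hn m hm hnm
      by_contra hne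
      rcases lt_or_gt_of_ne hne with h | h
      · exact absurd hnm (key n hn m hm h).ne
      · exact absurd hnm (key m hm n hn h).ne'
  have hbad : E.N (∑ n ∈ sb, (b n).v) ≤ (2 * M + 1) * U := by
    refine (E.sum_le _ _).trans ?_
    calc _ ≤ ∑ n ∈ sb, U := by
          refine Finset.sum_le_sum fun n hn => (b n).hle.trans ?_
          have := Block.sum_u_le (s' := {n}) (by simpa using (Finset.mem_filter.1 hn).1) hsep0
          simpa using this
      _ = sb.card * U := by simp
      _ ≤ _ := by gcongr; exact_mod_cast hsbcard
  set cl : ℕ → Finset ℤ := fun c => s.filter fun n => good n ∧ n % ((p : ℤ) + 1) = c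
  have hcl : ∀ c, E.N (∑ n ∈ cl c, (b n).v) ≤ C * U := by
    intro c
    refine (hcon (cl c) b (fun i hi j hj hij => ?_)
      (fun i hi => (Finset.mem_filter.1 hi).2.1)).trans ?_
    · have key : ∀ i ∈ cl c, ∀ j ∈ cl c, i < j → (b i).t + p < (b j).l := by
        intro i hi j hj hij
        have h1 := Finset.mem_filter.1 hi
        have h2 := Finset.mem_filter.1 hj
        have h3 := hsepd i h1.1 j h2.1 hij
        have h4 : ((p : ℤ) + 1) ∣ j - i := by
          apply Int.dvd_of_emod_eq_zero
          rw [Int.sub_emod, h1.2.2, h2.2.2]; simp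
        have h5 := Int.le_of_dvd (by omega) h4
        omega
      rcases lt_or_gt_of_ne hij with h | h
      · exact Or.inl (key i hi j hj h)
      · exact Or.inr (key j hj i hi h)
    · gcongr
      exact Block.sum_u_le (Finset.filter_subset _ _) hsep0
  have hsplit : ∑ n ∈ s, (b n).v = ∑ n ∈ sb, (b n).v +
      ∑ c ∈ Finset.range (p + 1), ∑ n ∈ cl c, (b n).v := by
    rw [← Finset.sum_filter_add_sum_filter_not s (fun n => ¬ good n)]
    congr 1
    simp only [not_not]
    rw [← Finset.sum_fiberwise_of_maps_to (s := s.filter good) (t := Finset.range (p + 1))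
      (g := fun n => (n % ((p : ℤ) + 1)).toNat)]
    · refine Finset.sum_congr rfl fun c hc => ?_
      refine Finset.sum_congr ?_ fun _ _ => rfl
      ext n
      have h1 := Int.emod_nonneg n (show ((p : ℤ) + 1) ≠ 0 by omega)
      simp only [Finset.mem_filter, cl, and_assoc]
      constructor
      · rintro ⟨h2, h3, h4⟩; exact ⟨h2, h3, by omega⟩
      · rintro ⟨h2, h3, h4⟩; exact ⟨h2, h3, by omega⟩
    · intro n _
      have h1 := Int.emod_nonneg n (show ((p : ℤ) + 1) ≠ 0 by omega)
      have h2 := Int.emod_lt_of_pos n (show 0 < ((p : ℤ) + 1) by omega)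
      simp only [Finset.mem_range]; omega
  rw [hsplit]
  calc _ ≤ (2 * M + 1) * U + ∑ c ∈ Finset.range (p + 1), C * U := by
        refine (E.add_le _ _).trans (add_le_add hbad ((E.sum_le _ _).trans ?_))
        exact Finset.sum_le_sum fun c _ => hcl c
    _ = _ := by
        rw [Finset.sum_const, Finset.card_range, nsmul_eq_mul]
        push_cast; ring

/-- The violating families may be chosen almost optimal. -/
theorem exists_violating_family_optimal {J : Set ℤ} {E : SeqLattice J} (hE : ¬ SeqRSPInterval E)
    (M p : ℕ) (C : NNReal) :
    ∃ (s : Finset ℤ) (b : ℤ → Block E), (∀ i ∈ s, ∀ j ∈ s, i ≠ j → (b i).Sep p (b j)) ∧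
      (∀ i ∈ s, (M : ℤ) < (b i).l ∨ (b i).t < -M) ∧
      C * E.N (∑ i ∈ s, (b i).u) < E.N (∑ i ∈ s, (b i).v) ∧
      ∀ v : ℤ → ℤ → ℝ, (∀ i ∈ s, ∀ k, v i k ≠ 0 → (b i).r < k ∧ k ≤ (b i).t) →
        (∀ i ∈ s, E.N (v i) ≤ E.N (b i).u) →
        E.N (∑ i ∈ s, v i) ≤ 2 * E.N (∑ i ∈ s, (b i).v) := by
  classical
  -- The second vectors are replaced by ones attaining at least half of the supremum over all
  -- admissible choices; the doubled constant makes up for that half.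
  obtain ⟨s, b, hsep, hfar, hviol⟩ := exists_violating_family hE M p (2 * C)
  set Adm : (ℤ → ℤ → ℝ) → Prop := fun v =>
    (∀ i ∈ s, ∀ k, v i k ≠ 0 → (b i).r < k ∧ k ≤ (b i).t) ∧ ∀ i ∈ s, E.N (v i) ≤ E.N (b i).u
  set T := ⨆ v : {v // Adm v}, E.N (∑ i ∈ s, v.1 i)
  have h1 : E.N (∑ i ∈ s, (b i).v) ≤ T :=
    le_iSup (fun v : {v // Adm v} => E.N (∑ i ∈ s, v.1 i))
      ⟨fun i => (b i).v, fun i _ => (b i).hv, fun i _ => (b i).hle⟩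
  have htop : T ≠ ⊤ := by
    refine ((iSup_le fun v => ?_ : T ≤ ∑ i ∈ s, E.N (b i).u).trans_lt
      (ENNReal.sum_lt_top.2 fun i _ => lt_top_iff_ne_top.2 (b i).u_ne_top)).ne
    exact (E.sum_le _ _).trans (Finset.sum_le_sum fun i hi => v.2.2 i hi)
  have h0 : T ≠ 0 := fun h => by
    rw [h, nonpos_iff_eq_zero] at h1
    rw [h1] at hviol
    exact absurd hviol (by simp)
  obtain ⟨⟨v, hv⟩, hvlt⟩ := lt_iSup_iff.1 (ENNReal.half_lt_self h0 htop)
  rw [ENNReal.div_lt_iff (by simp) (by simp), mul_comm] at hvlt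
  set b' : ℤ → Block E := fun i => if h : i ∈ s then (b i).replace (v i) (hv.1 i h) (hv.2 i h) else b i
  have hb' : ∀ i, (b' i).l = (b i).l ∧ (b' i).r = (b i).r ∧ (b' i).t = (b i).t ∧
      (b' i).u = (b i).u := by
    intro i
    by_cases h : i ∈ s <;> simp [b', h, Block.replace]
  have hv' : ∑ i ∈ s, (b' i).v = ∑ i ∈ s, v i :=
    Finset.sum_congr rfl fun i hi => by simp [b', hi, Block.replace]
  refine ⟨s, b', fun i hi j hj hij => ?_, fun i hi => ?_, ?_, fun w hw1 hw2 => ?_⟩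
  · have := hsep i hi j hj hij
    simpa only [Block.Sep, hb'] using this
  · simpa only [hb'] using hfar i hi
  · simp only [hb', hv']
    have h2 : 2 * (C * E.N (∑ i ∈ s, (b i).u)) < 2 * E.N (∑ i ∈ s, v i) := by
      refine lt_of_le_of_lt ?_ ((hviol.trans_le h1).trans hvlt)
      push_cast; rw [mul_assoc]
    exact lt_of_mul_lt_mul_left' h2
  · rw [hv']
    refine le_trans ?_ hvlt.le
    refine le_iSup (fun v : {v // Adm v} => E.N (∑ i ∈ s, v.1 i)) ⟨w, ?_, ?_⟩
    · simpa only [hb'] using hw1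
    · simpa only [hb'] using hw2

/-- Infinitely many violating families, far apart from each other. -/
theorem exists_glued_families {J : Set ℤ} {E : SeqLattice J} (hE : ¬ SeqRSPInterval E) :
    ∃ (s : ℕ → Finset ℤ) (b : ℕ → ℤ → Block E),
      (∀ j, ∀ i ∈ s j, ∀ j', ∀ i' ∈ s j', (j, i) ≠ (j', i') →
        (b j i).Sep (max j j' : ℕ) (b j' i')) ∧
      (∀ j : ℕ, (j : ℝ≥0∞) * E.N (∑ i ∈ s j, (b j i).u) < E.N (∑ i ∈ s j, (b j i).v)) ∧
      ∀ j, ∀ v : ℤ → ℤ → ℝ, (∀ i ∈ s j, ∀ k, v i k ≠ 0 → (b j i).r < k ∧ k ≤ (b j i).t) →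
        (∀ i ∈ s j, E.N (v i) ≤ E.N (b j i).u) →
        E.N (∑ i ∈ s j, v i) ≤ 2 * E.N (∑ i ∈ s j, (b j i).v) := by
  classical
  choose s b hsep hfar hviol hopt using fun M p : ℕ => exists_violating_family_optimal hE M p (p : NNReal)
  have hbd : ∀ M p : ℕ, ∃ K : ℕ, ∀ i ∈ s M p, -(K : ℤ) ≤ (b M p i).l ∧ (b M p i).t ≤ K := by
    intro M p
    refine ⟨∑ i ∈ s M p, ((b M p i).l.natAbs + (b M p i).t.natAbs), fun i hi => ?_⟩
    have := Finset.single_le_sum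
      (f := fun i => (b M p i).l.natAbs + (b M p i).t.natAbs) (fun _ _ => Nat.zero_le _) hi
    have h2 := (b M p i).hlr
    have h3 := (b M p i).hrt
    omega
  choose K hK using hbd
  -- Family `j` is taken outside a window that contains all earlier families with a margin of at
  -- least `j`.
  set Mj : ℕ → ℕ := fun j => Nat.rec 0 (fun j M => max M (K M j) + j + 1) j
  have hM : ∀ j, Mj (j + 1) = max (Mj j) (K (Mj j) j) + j + 1 := fun j => rfl
  have hMmono : Monotone Mj := monotone_nat_of_le_succ fun j => by rw [hM]; omega
  have hMK : ∀ j' j, j' < j → K (Mj j') j' + j ≤ Mj j := by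
    intro j' j hjj
    obtain ⟨d, rfl⟩ := Nat.exists_eq_add_one_of_ne_zero (Nat.ne_zero_of_lt hjj)
    have h5 := hM d
    rcases eq_or_lt_of_le (Nat.lt_succ_iff.1 hjj) with rfl | hd
    · omega
    · have h1 : Mj (j' + 1) ≤ Mj d := @hMmono (j' + 1) d (by omega)
      have h2 := hM j'
      omega
  have key : ∀ j, ∀ i ∈ s (Mj j) j, ∀ j', ∀ i' ∈ s (Mj j') j', j' < j →
      (b (Mj j) j i).Sep j (b (Mj j') j' i') := by
    intro j i hi j' i' hi' hlt
    have h1 := hMK j' j hlt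
    have h2 := hK _ _ i' hi'
    rcases hfar _ _ i hi with h | h
    · right; omega
    · left; omega
  refine ⟨fun j => s (Mj j) j, fun j => b (Mj j) j, ?_, fun j => ?_, fun j => hopt _ _⟩
  · intro j i hi j' i' hi' hne
    rcases lt_trichotomy j j' with h | rfl | h
    · rw [max_eq_right h.le]
      have := key j' i' hi' j i hi h
      exact Or.symm this
    · rw [max_self]
      exact hsep _ _ i hi i' hi' fun h => hne (by rw [h])
    · rw [max_eq_left h.le]
      exact key j i hi j' i' hi' h
  · simpa using hviol (Mj j) j

/-! ### Contracting blocks to points -/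

/-- Integration of a `0`-`1` valued function on the integers. -/
theorem exists_counting (G : Set ℤ) :
    ∃ c : ℤ → ℤ, (∀ k ∈ G, c (k + 1) = c k + 1) ∧ ∀ k ∉ G, c (k + 1) = c k := by
  classical
  set g : ℤ → ℤ := G.indicator 1
  set c : ℤ → ℤ := fun k => ∑ j ∈ Finset.Ico 0 k, g j - ∑ j ∈ Finset.Ico k 0, g j
  have hc : ∀ k, c (k + 1) = c k + g k := by
    intro k
    simp only [c]
    rcases le_or_gt 0 k with h | h
    · rw [← Finset.insert_Ico_right_eq_Ico_add_one h, Finset.sum_insert (by simp),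
        Finset.Ico_eq_empty (a := k + 1) (by omega), Finset.Ico_eq_empty (a := k) (by omega)]
      simp; ring
    · rw [← Finset.insert_Ico_add_one_left_eq_Ico h, Finset.sum_insert (by simp),
        Finset.Ico_eq_empty (a := 0) (b := k + 1) (by omega),
        Finset.Ico_eq_empty (a := 0) (b := k) (by omega)]
      simp
  refine ⟨c, fun k hk => ?_, fun k hk => ?_⟩
  · rw [hc]; simp [g, hk]
  · rw [hc]; simp [g, hk]

/-- A coordinate on the integers contracting the blocks of a separated family to points. -/
theorem exists_contraction {J : Set ℤ} {E : SeqLattice J} {ι : Type*} (b : ι → Block E)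
    (lev : ι → ℕ) (hsep : ∀ i i', i ≠ i' → (b i).Sep (max (lev i) (lev i') : ℕ) (b i')) :
    ∃ c : ℤ → ℤ, (∀ k d, k ≤ d → c k ≤ c d) ∧ (∀ k d, k ≤ d → c d - c k ≤ d - k) ∧
      (∀ i k, (b i).l ≤ k → k ≤ (b i).t → c k = c (b i).l) ∧
      ∀ i i', (b i).t < (b i').l → c (b i).l + 1 ≤ c (b i').l ∧
        c (b i).l + lev i ≤ c (b i').l ∧ c (b i).l + lev i' ≤ c (b i').l := by
  -- Counting the integers that lie in none of the half-open blocks `[l, t)` gives a function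
  -- constant along each block, increasing by at most one per step, and growing at full speed in the
  -- gaps.
  obtain ⟨c, hc1, hc0⟩ := exists_counting {k | ∀ i, ¬ ((b i).l ≤ k ∧ k < (b i).t)}
  have hstep : ∀ k, c (k + 1) = c k ∨ c (k + 1) = c k + 1 := fun k => by
    by_cases h : k ∈ {k | ∀ i, ¬ ((b i).l ≤ k ∧ k < (b i).t)}
    · exact Or.inr (hc1 k h)
    · exact Or.inl (hc0 k h)
  have hmono : ∀ k d, k ≤ d → c k ≤ c d := fun k d h =>
    monotone_int_of_le_succ (f := c) (fun k => by rcases hstep k with h | h <;> omega) h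
  have hgap : ∀ (p : ℕ) (k : ℤ), (∀ j, k ≤ j → j < k + p → ∀ i, ¬ ((b i).l ≤ j ∧ j < (b i).t)) →
      c (k + p) = c k + p := by
    intro p
    induction p with
    | zero => intro k _; simp
    | succ p ih =>
      intro k hk
      have h1 := ih k fun j h1 h2 => hk j h1 (by push_cast; omega)
      have h2 := hc1 (k + p) (hk (k + p) (by omega) (by push_cast; omega))
      push_cast
      rw [← add_assoc, h2, h1]; ring
  refine ⟨c, hmono, fun k d h => ?_, fun i k hk1 hk2 => ?_, fun i i' hlt => ?_⟩
  · have h1 : Monotone fun k : ℤ => k - c k :=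
      monotone_int_of_le_succ fun k => by rcases hstep k with h | h <;> omega
    have := h1 h
    simp only at this
    omega
  · have : ∀ d : ℕ, (b i).l + d ≤ (b i).t → c ((b i).l + d) = c (b i).l := by
      intro d
      induction d with
      | zero => intro _; simp
      | succ d ih =>
        intro hd
        push_cast at hd ⊢
        rw [← add_assoc, hc0 _ (fun h => h i ⟨by omega, by omega⟩), ih (by omega)]
    have := this (k - (b i).l).toNat (by omega)
    rwa [show (b i).l + ((k - (b i).l).toNat : ℤ) = k by omega] at this
  · have hne : i ≠ i' := by
      rintro rfl
      have := (b i).hlr; have := (b i).hrt; omega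
    have hss : (b i).t + (max (lev i) (lev i') : ℕ) < (b i').l := by
      rcases hsep i i' hne with h | h
      · exact h
      · have := (b i).hlr; have := (b i).hrt; have := (b i').hlr; have := (b i').hrt; omega
    have h1 : c (b i).t = c (b i).l := by
      have : ∀ d : ℕ, (b i).l + d ≤ (b i).t → c ((b i).l + d) = c (b i).l := by
        intro d
        induction d with
        | zero => intro _; simp
        | succ d ih =>
          intro hd
          push_cast at hd ⊢
          rw [← add_assoc, hc0 _ (fun h => h i ⟨by omega, by omega⟩), ih (by omega)]
      have h2 := this ((b i).t - (b i).l).toNat (by have := (b i).hlr; have := (b i).hrt; omega)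
      rwa [show (b i).l + (((b i).t - (b i).l).toNat : ℤ) = (b i).t by
        have := (b i).hlr; have := (b i).hrt; omega] at h2
    -- The step out of the last point `t` already counts, so `lev i + 1` consecutive free steps
    -- follow block `i`. The extra one gives a strict increase even at level `0`.
    have hright : c ((b i).t + (lev i + 1 : ℕ)) = c (b i).t + (lev i + 1 : ℕ) := by
      refine hgap _ _ fun j hj1 hj2 i'' hi'' => ?_
      push_cast at hj2
      by_cases h : i'' = i
      · subst h; omega
      · have := (b i).hlr; have := (b i).hrt; have := (b i'').hlr; have := (b i'').hrt
        rcases hsep i i'' (Ne.symm h) with h | h <;> omega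
    have hleft : c ((b i').l - lev i' + (lev i' : ℕ)) = c ((b i').l - lev i') + (lev i' : ℕ) := by
      refine hgap _ _ fun j hj1 hj2 i'' hi'' => ?_
      by_cases h : i'' = i'
      · subst h; omega
      · have := (b i').hlr; have := (b i').hrt; have := (b i'').hlr; have := (b i'').hrt
        rcases hsep i' i'' (Ne.symm h) with h | h <;> omega
    rw [sub_add_cancel] at hleft
    have h3 := hmono ((b i).t) ((b i').l - lev i') (by omega)
    have h4 := hmono ((b i).t + (lev i + 1 : ℕ)) (b i').l (by push_cast; omega)
    push_cast at hright h4
    omega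

/-! ### Exponential weights and glued sequences -/

namespace SepPair

variable {J : Set ℤ} {E F : SeqLattice J} (P : SepPair E F)

/-- Exchange norms at `m` by `F_Ici_le`, then go back to `j`: the ratio of the fundamental functions
gains `q ^ (m - j)` on the way. -/
theorem F_far {z : ℤ → ℝ} {j m : ℤ} (hj : j ∈ J) (hm : m ∈ J) (hjm : j ≤ m)
    (hz : ∀ k, z k ≠ 0 → m ≤ k) :
    E.N (Pi.single j 1) * F.N z ≤
      P.K * P.C * P.q ^ (m - j).toNat * (F.N (Pi.single j 1) * E.N z) := by
  have hzi : (Ici m).indicator z = z := indicator_eq_self.2 fun k hk => hz k hk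
  have h1 := P.F_Ici_le z hm
  rw [hzi] at h1
  have h2 := P.single_cross (j := j) (d := (m - j).toNat) hj
    (by rwa [show j + ((m - j).toNat : ℤ) = m by omega])
  rw [show j + ((m - j).toNat : ℤ) = m by omega] at h2
  refine (ENNReal.mul_le_mul_iff_right (E.single_ne_zero m hm) (E.single_ne_top m hm)).1 ?_
  calc _ = E.N (Pi.single j 1) * (E.N (Pi.single m 1) * F.N z) := by ring
    _ ≤ E.N (Pi.single j 1) * (P.K * (F.N (Pi.single m 1) * E.N z)) := by gcongr
    _ = P.K * E.N z * (E.N (Pi.single j 1) * F.N (Pi.single m 1)) := by ring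
    _ ≤ P.K * E.N z * (P.C * P.q ^ (m - j).toNat *
        (E.N (Pi.single m 1) * F.N (Pi.single j 1))) := by gcongr
    _ = _ := by ring

/-- The part of `z` up to `k` is seen by the `E`-term of `kappa`. The part between `k` and `r` is
seen by the `F`-term, after exchanging norms at `r` with `E_Iic_le`. -/
theorem kappa_lower {z f : ℤ → ℝ} {k r : ℤ} (hk : k ∈ J) (hr : r ∈ J) (hkr : k ≤ r)
    (hz : ∀ j, z j ≠ 0 → j ≤ r) (hzf : ∀ j, |z j| ≤ |f j|) :
    E.N z * (E.N (Pi.single k 1) * F.N (Pi.single r 1)) ≤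
      (P.C + P.K) * (E.N (Pi.single r 1) * kappa E F k f) := by
  have h1 : E.N z ≤ E.N ((Iic k).indicator f) + E.N ((Iic r).indicator ((Ici k).indicator z)) := by
    refine le_trans (E.mono _ ((Iic k).indicator z + (Ioi k).indicator z) fun j _ => ?_)
      ((E.add_le _ _).trans (add_le_add (E.mono _ _ fun j _ => ?_) (E.mono _ _ fun j _ => ?_)))
    · rw [← compl_Iic, indicator_self_add_compl]
    · by_cases h : j ≤ k <;> simp [h, hzf]
    · by_cases h : k < j
      · by_cases h' : z j = 0
        · rw [indicator_of_mem (s := Ioi k) h, h']; simp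
        · simp [h, h.le, hz j h']
      · simp [h]
  have h2 := P.E_Iic_le ((Ici k).indicator z) hr
  have h3 : F.N ((Iic r).indicator ((Ici k).indicator z)) ≤ F.N ((Ici k).indicator f) := by
    refine (F.indicator_le _ _).trans (F.mono _ _ fun j _ => ?_)
    by_cases h : k ≤ j <;> simp [h, hzf]
  have h4 := P.single_cross (j := k) (d := (r - k).toNat) hk
    (by rwa [show k + ((r - k).toNat : ℤ) = r by omega])
  rw [show k + ((r - k).toNat : ℤ) = r by omega] at h4
  have h5 : (P.q : ℝ≥0∞) ^ (r - k).toNat ≤ 1 :=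
    pow_le_one' (by exact_mod_cast P.q_lt_one.le) _
  calc _ ≤ (E.N ((Iic k).indicator f) + E.N ((Iic r).indicator ((Ici k).indicator z))) *
        (E.N (Pi.single k 1) * F.N (Pi.single r 1)) := by gcongr
    _ = E.N ((Iic k).indicator f) * (E.N (Pi.single k 1) * F.N (Pi.single r 1)) +
        E.N (Pi.single k 1) *
          (F.N (Pi.single r 1) * E.N ((Iic r).indicator ((Ici k).indicator z))) := by ring
    _ ≤ E.N ((Iic k).indicator f) *
          (P.C * 1 * (E.N (Pi.single r 1) * F.N (Pi.single k 1))) +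
        E.N (Pi.single k 1) * (P.K * (E.N (Pi.single r 1) * F.N ((Ici k).indicator f))) := by
        gcongr ?_ + ?_
        · gcongr E.N ((Iic k).indicator f) * ?_
          exact h4.trans (by gcongr)
        · gcongr E.N (Pi.single k 1) * ?_
          exact h2.trans (by gcongr)
    _ = P.C * (E.N (Pi.single r 1) * (F.N (Pi.single k 1) * E.N ((Iic k).indicator f))) +
        P.K * (E.N (Pi.single r 1) * (E.N (Pi.single k 1) * F.N ((Ici k).indicator f))) := by ring
    _ ≤ P.C * (E.N (Pi.single r 1) * kappa E F k f) +
        P.K * (E.N (Pi.single r 1) * kappa E F k f) := by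
        gcongr
        · exact le_self_add
        · exact le_add_self
    _ = _ := by ring

/-- The square root of the separation ratio. -/
def ρ : NNReal := NNReal.sqrt P.q

theorem ρ_pos : 0 < P.ρ := NNReal.sqrt_pos.2 P.q_pos

theorem ρ_lt_one : P.ρ < 1 := by
  simpa [ρ] using (NNReal.sqrt_lt_sqrt.2 P.q_lt_one)

theorem ρ_mul : P.ρ * P.ρ = P.q := NNReal.mul_self_sqrt _

/-- `∑ ρ ^ d`. -/
def H : ℝ≥0∞ := ∑' d : ℕ, (P.ρ : ℝ≥0∞) ^ d

theorem H_ne_top : P.H ≠ ⊤ := by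
  rw [H, ENNReal.tsum_geometric]
  simpa [tsub_eq_zero_iff_le] using P.ρ_lt_one

/-- Exponential weights. -/
def W (n : ℤ) : NNReal := P.ρ ^ (-n)

theorem W_pos (n : ℤ) : 0 < P.W n := zpow_pos P.ρ_pos _

theorem W_eq (n m : ℤ) (h : n ≤ m) : P.W n = P.ρ ^ (m - n).toNat * P.W m := by
  rw [W, W, ← zpow_natCast, ← zpow_add₀ P.ρ_pos.ne']
  congr 1; omega

/-- The positions are distinct integers, so the weights to the left of `n₀` form part of a geometric
series of ratio `ρ`, and a gap `p` gains `ρ ^ p`. -/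
theorem tsum_W_left {ι : Type*} {n : ι → ℤ} (hn : Function.Injective n) {n₀ : ℤ} {p : ℕ}
    (h : ∀ i, n i + p ≤ n₀) :
    ∑' i, (P.W (n i) : ℝ≥0∞) ≤ P.ρ ^ p * P.H * P.W n₀ := by
  have h1 : ∀ i, (P.W (n i) : ℝ≥0∞) =
      P.ρ ^ p * P.W n₀ * (P.ρ : ℝ≥0∞) ^ (n₀ - p - n i).toNat := by
    intro i
    have := h i
    rw [P.W_eq (n i) n₀ (by omega), show (n₀ - n i).toNat = p + (n₀ - p - n i).toNat by omega,
      pow_add]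
    push_cast; ring
  simp_rw [h1]
  rw [ENNReal.tsum_mul_left, mul_right_comm]
  gcongr
  refine ENNReal.tsum_comp_le_tsum_of_injective (f := fun i => (n₀ - p - n i).toNat)
    (fun i j hij => hn ?_) fun d => (P.ρ : ℝ≥0∞) ^ d
  have := h i; have := h j
  simp only at hij
  omega

/-- To the right the weights grow like `ρ ^ (-d)`, but separation contributes `q ^ d = ρ ^ (2 d)`,
leaving `ρ ^ d`. Taking `ρ` as the square root of `q` makes both sides geometric. -/
theorem tsum_W_right {ι : Type*} {n : ι → ℤ} (hn : Function.Injective n) {n₀ : ℤ} {p : ℕ}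
    (h : ∀ i, n₀ + p ≤ n i) :
    ∑' i, (P.q : ℝ≥0∞) ^ (n i - n₀).toNat * P.W (n i) ≤ P.ρ ^ p * P.H * P.W n₀ := by
  have h1 : ∀ i, (P.q : ℝ≥0∞) ^ (n i - n₀).toNat * P.W (n i) =
      P.ρ ^ p * P.W n₀ * (P.ρ : ℝ≥0∞) ^ (n i - n₀ - p).toNat := by
    intro i
    have := h i
    rw [P.W_eq n₀ (n i) (by omega), ← P.ρ_mul]
    have h2 : (P.ρ : ℝ≥0∞) ^ (n i - n₀).toNat = P.ρ ^ p * P.ρ ^ (n i - n₀ - p).toNat := by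
      rw [← pow_add]; congr 1; omega
    push_cast
    rw [mul_pow, h2]; ring
  simp_rw [h1]
  rw [ENNReal.tsum_mul_left, mul_right_comm]
  gcongr
  refine ENNReal.tsum_comp_le_tsum_of_injective (f := fun i => (n i - n₀ - p).toNat)
    (fun i j hij => hn ?_) fun d => (P.ρ : ℝ≥0∞) ^ d
  have := h i; have := h j
  simp only at hij
  omega

end SepPair

/-- A separated family of blocks with a coordinate contracting the blocks. -/
structure Contracts {J : Set ℤ} {E : SeqLattice J} {ι : Type*} (b : ι → Block E) (lev : ι → ℕ)
    (c : ℤ → ℤ) : Prop where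
  order : ∀ i i', i ≠ i' → (b i).t < (b i').l ∨ (b i').t < (b i).l
  mono : ∀ k d, k ≤ d → c k ≤ c d
  lip : ∀ k d, k ≤ d → c d - c k ≤ d - k
  const : ∀ i k, (b i).l ≤ k → k ≤ (b i).t → c k = c (b i).l
  jump : ∀ i i', (b i).t < (b i').l → c (b i).l + 1 ≤ c (b i').l ∧
    c (b i).l + lev i ≤ c (b i').l ∧ c (b i).l + lev i' ≤ c (b i').l

/-- The sum of vectors `z i` carried by the disjoint blocks `b i`. -/
def glue {J : Set ℤ} {E : SeqLattice J} {ι : Type*} (b : ι → Block E) (z : ι → ℤ → ℝ) (k : ℤ) : ℝ :=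
  open Classical in
  if h : ∃ i, (b i).l ≤ k ∧ k ≤ (b i).t then z h.choose k else 0

namespace Contracts

variable {J : Set ℤ} {E F : SeqLattice J} {ι : Type*} {b : ι → Block E} {lev : ι → ℕ} {c : ℤ → ℤ}
  (hc : Contracts b lev c)

include hc

theorem injective : Function.Injective fun i => c (b i).l := by
  intro i i' h
  by_contra hne
  simp only at h
  rcases hc.order i i' hne with h' | h'
  · have := (hc.jump _ _ h').1; omega
  · have := (hc.jump _ _ h').1; omega

theorem glue_of_mem (z : ι → ℤ → ℝ) {i : ι} {k : ℤ} (h1 : (b i).l ≤ k) (h2 : k ≤ (b i).t) :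
    glue b z k = z i k := by
  have hex : ∃ i, (b i).l ≤ k ∧ k ≤ (b i).t := ⟨i, h1, h2⟩
  rw [glue, dif_pos hex]
  have h3 := hex.choose_spec
  congr 1
  by_contra hne
  rcases hc.order _ _ hne with h | h <;> omega

omit hc in
theorem glue_of_notMem (z : ι → ℤ → ℝ) {k : ℤ} (h : ∀ i, ¬ ((b i).l ≤ k ∧ k ≤ (b i).t)) :
    glue b z k = 0 := by
  rw [glue, dif_neg (by push Not; simpa using h)]

theorem abs_le_abs_glue {z : ι → ℤ → ℝ} {i : ι} (hz : ∀ k, z i k ≠ 0 → (b i).l ≤ k ∧ k ≤ (b i).t)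
    (k : ℤ) : |z i k| ≤ |glue b z k| := by
  by_cases h : z i k = 0
  · simp [h]
  · obtain ⟨h1, h2⟩ := hz k h
    rw [hc.glue_of_mem z h1 h2]

/-- At each coordinate at most one block contributes, so the glued sequence is dominated by the sum
of those pieces that actually meet `A`. -/
theorem N_glue_le (G : SeqLattice J) (z : ι → ℤ → ℝ) (A : Set ℤ) (T : Set ι)
    (hT : ∀ i, ∀ k ∈ A, (b i).l ≤ k → k ≤ (b i).t → z i k ≠ 0 → i ∈ T) :
    G.N (A.indicator (glue b z)) ≤ 2 * ∑' i : T, G.N (A.indicator (z i)) := by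
  refine G.le_tsum _ (fun i : T => A.indicator (z i)) fun k _ => ?_
  by_cases hk : k ∈ A
  · by_cases hex : ∃ i, (b i).l ≤ k ∧ k ≤ (b i).t
    · obtain ⟨i, h1, h2⟩ := hex
      rw [indicator_of_mem hk, hc.glue_of_mem z h1 h2]
      by_cases h0 : z i k = 0
      · simp [h0]
      · refine le_trans (le_of_eq ?_) (ENNReal.le_tsum (⟨i, hT i k hk h1 h2 h0⟩ : T))
        rw [indicator_of_mem hk]
    · push Not at hex
      rw [indicator_of_mem hk, glue_of_notMem z fun i h => absurd h.2 (not_le.2 (hex i h.1))]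
      simp
  · simp [hk]

/-- The `F`-norms of the weighted vectors far to the right of `k`. -/
theorem tail_le (P : SepPair E F) {z : ι → ℤ → ℝ} (hzN : ∀ i, E.N (z i) ≤ P.W (c (b i).l))
    (hz : ∀ i k, z i k ≠ 0 → (b i).l ≤ k) {k : ℤ} (hk : k ∈ J) {p : ℕ} {T : Set ι}
    (hT : ∀ i ∈ T, k ≤ (b i).l ∧ c k + p ≤ c (b i).l) (A : Set ℤ) :
    E.N (Pi.single k 1) * ∑' i : T, F.N (A.indicator (z i)) ≤
      P.K * P.C * F.N (Pi.single k 1) * (P.ρ ^ p * P.H * P.W (c k)) := by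
  have h1 := P.tsum_W_right (ι := T) (n := fun i => c (b i).l) (n₀ := c k) (p := p)
    (hc.injective.comp Subtype.val_injective) fun i => (hT i i.2).2
  refine le_trans ?_ (mul_le_mul_right h1 _)
  rw [← ENNReal.tsum_mul_left, ← ENNReal.tsum_mul_left]
  refine ENNReal.tsum_le_tsum fun i => ?_
  have h2 := hT i i.2
  -- The contracted distance is at most the true one, so decay in the true distance gives decay in
  -- `c`.
  have h3 := hc.lip k (b i).l h2.1
  calc _ ≤ E.N (Pi.single k 1) * F.N (z i) := by gcongr; exact F.indicator_le _ _
    _ ≤ P.K * P.C * P.q ^ ((b i).l - k).toNat * (F.N (Pi.single k 1) * E.N (z i)) :=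
        P.F_far hk (b i).hl h2.1 (hz i)
    _ ≤ P.K * P.C * P.q ^ (c (b i).l - c k).toNat * (F.N (Pi.single k 1) * P.W (c (b i).l)) := by
        gcongr P.K * P.C * ?_ * (F.N (Pi.single k 1) * ?_)
        · exact pow_le_pow_right_of_le_one' (by exact_mod_cast P.q_lt_one.le) (by omega)
        · exact hzN i
    _ = _ := by ring

/-- Blocks starting at or before `k` form a geometric series in `E`; what they leave to the right of
`k` is moved to `F` by `F_Ici_le`. Blocks further right form a geometric series in `F`. -/
theorem kappa_glue_ne_top (P : SepPair E F) {z : ι → ℤ → ℝ}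
    (hzN : ∀ i, E.N (z i) ≤ P.W (c (b i).l)) (hz : ∀ i k, z i k ≠ 0 → (b i).l ≤ k)
    {k : ℤ} (hk : k ∈ J) : kappa E F k (glue b z) ≠ ⊤ := by
  have hH := P.H_ne_top
  have hK := P.K_ne_top
  have hs := F.single_ne_top k hk
  set T : Set ι := {i | (b i).l ≤ k}
  have hsum : ∑' i : T, (P.W (c (b i).l) : ℝ≥0∞) ≤ P.H * P.W (c k) := by
    have := P.tsum_W_left (ι := T) (n := fun i => c (b i).l) (n₀ := c k) (p := 0)
      (hc.injective.comp Subtype.val_injective)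
      fun i => by simpa using hc.mono _ _ i.2
    simpa using this
  have h1 : E.N ((Iic k).indicator (glue b z)) ≤ 2 * (P.H * P.W (c k)) := by
    refine (hc.N_glue_le E z (Iic k) T fun i j hj hj1 _ _ => le_trans hj1 hj).trans ?_
    gcongr
    refine (ENNReal.tsum_le_tsum fun i : T => (E.indicator_le (Iic k) (z i)).trans (hzN i)).trans hsum
  have h2 : E.N (Pi.single k 1) * F.N ((Ici k).indicator (glue b z)) ≤
      2 * (P.K * F.N (Pi.single k 1) * (P.H * P.W (c k)) +
        P.K * P.C * F.N (Pi.single k 1) * (P.ρ ^ 0 * P.H * P.W (c k))) := by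
    refine (mul_le_mul_right (hc.N_glue_le F z (Ici k) univ fun _ _ _ _ _ _ => mem_univ _) _).trans ?_
    rw [tsum_univ (fun i => F.N ((Ici k).indicator (z i))),
      ← ENNReal.summable.tsum_add_tsum_compl (s := T) ENNReal.summable, mul_left_comm]
    gcongr
    rw [mul_add]
    gcongr ?_ + ?_
    · refine le_trans ?_ (mul_le_mul_right hsum _)
      rw [← ENNReal.tsum_mul_left, ← ENNReal.tsum_mul_left]
      refine ENNReal.tsum_le_tsum fun i => ?_
      refine (P.F_Ici_le (z i) hk).trans ?_
      rw [mul_assoc]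
      gcongr
      exact (E.indicator_le _ _).trans (hzN i)
    · refine hc.tail_le P hzN hz hk (p := 0) (fun i hi => ?_) _
      have hi' : k < (b i).l := not_le.1 hi
      exact ⟨hi'.le, by simpa using hc.mono _ _ hi'.le⟩
  rw [kappa]
  refine (lt_of_le_of_lt (add_le_add (mul_le_mul_right h1 _) h2) ?_).ne
  rw [lt_top_iff_ne_top]
  finiteness

end Contracts

/-! ### Block diagonal operators and necessity for sequences -/

/-- A linear operator can be replaced by a block diagonal one without increasing its norm. -/
theorem exists_block_diagonal {J : Set ℤ} (E : SeqLattice J) {ι : Type*} (s : Finset ι)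
    (A B : ι → Set ℤ) (hA : ∀ i ∈ s, ∀ j ∈ s, i ≠ j → Disjoint (A i) (A j))
    (hB : ∀ i ∈ s, ∀ j ∈ s, i ≠ j → Disjoint (B i) (B j))
    (S : (ℤ → ℝ) →ₗ[ℝ] (ℤ → ℝ)) (D : NNReal) (hS : ∀ h, E.N (S h) ≤ D * E.N h) :
    ∃ S' : (ℤ → ℝ) → (ℤ → ℝ), (∀ h, E.N (S' h) ≤ D * E.N h) ∧
      ∀ h, ∀ i ∈ s, ∀ k ∈ A i, S' h k = S ((B i).indicator h) k := by
  classical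
  -- The induction needs linearity and a description outside all the `A i`, both dropped from the
  -- conclusion.
  suffices H : ∃ S' : (ℤ → ℝ) →ₗ[ℝ] (ℤ → ℝ), (∀ h, E.N (S' h) ≤ D * E.N h) ∧
      (∀ h, ∀ i ∈ s, ∀ k ∈ A i, S' h k = S ((B i).indicator h) k) ∧
      ∀ h k, (∀ i ∈ s, k ∉ A i) → S' h k = S ({j | ∀ i ∈ s, j ∉ B i}.indicator h) k by
    obtain ⟨S', h1, h2, -⟩ := H
    exact ⟨S', h1, h2⟩
  induction s using Finset.induction_on with
  | empty => exact ⟨S, hS, by simp, by simp⟩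
  | insert i₀ s hi₀ ih =>
    obtain ⟨S', h1, h2, h3⟩ := ih
      (fun i hi j hj => hA i (Finset.mem_insert_of_mem hi) j (Finset.mem_insert_of_mem hj))
      (fun i hi j hj => hB i (Finset.mem_insert_of_mem hi) j (Finset.mem_insert_of_mem hj))
    let π (A : Set ℤ) : (ℤ → ℝ) →ₗ[ℝ] (ℤ → ℝ) :=
      { toFun := fun h => A.indicator h
        map_add' := fun x y => indicator_add' A x y
        map_smul' := fun c x => indicator_real_smul A c x }
    have hne : ∀ i ∈ s, i ≠ i₀ := fun i hi h => hi₀ (h ▸ hi)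
    refine ⟨π (A i₀) ∘ₗ S' ∘ₗ π (B i₀) + π (A i₀)ᶜ ∘ₗ S' ∘ₗ π (B i₀)ᶜ, fun h => ?_, fun h i hi k hk => ?_,
      fun h k hk => ?_⟩
    · change E.N ((A i₀).indicator (S' ((B i₀).indicator h)) +
        (A i₀)ᶜ.indicator (S' ((B i₀)ᶜ.indicator h))) ≤ _
      set x := (B i₀).indicator h
      set y := (B i₀)ᶜ.indicator h
      have hxy : x + y = h := indicator_self_add_compl _ _
      -- The pinching is the mean of `S'` and of its conjugate by the sign changes on `A i₀` and `B
      -- i₀`. Sign changes preserve a lattice norm, so the mean has no larger norm.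
      have e1 : (A i₀).indicator (S' x) + (A i₀)ᶜ.indicator (S' y) =
          (2⁻¹ : ℝ) • (S' h + ((A i₀).indicator (S' (x - y)) - (A i₀)ᶜ.indicator (S' (x - y)))) := by
        rw [← hxy, map_add, map_sub]
        ext k
        by_cases hk : k ∈ A i₀ <;> simp [hk] <;> ring
      have e2 : E.N ((A i₀).indicator (S' (x - y)) - (A i₀)ᶜ.indicator (S' (x - y))) =
          E.N (S' (x - y)) := E.congr fun k _ => by
        by_cases hk : k ∈ A i₀
        · simp [hk]
        · simp only [Pi.sub_apply, indicator_of_notMem hk, indicator_of_mem (mem_compl hk)]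
          rw [zero_sub, abs_neg]
      have e3 : E.N (x - y) = E.N h := E.congr fun k _ => by
        by_cases hk : k ∈ B i₀ <;> simp [x, y, hk]
      rw [e1, E.smul]
      have e4 : ‖(2⁻¹ : ℝ)‖ₑ = 2⁻¹ := by
        rw [enorm_inv two_ne_zero, Real.enorm_of_nonneg two_pos.le]; simp
      rw [e4]
      calc _ ≤ 2⁻¹ * (D * E.N h + D * E.N h) := by
            gcongr
            refine (E.add_le _ _).trans (add_le_add (h1 _) ?_)
            rw [e2, ← e3]; exact h1 _
        _ = D * E.N h := by
            rw [← two_mul, ← mul_assoc, ENNReal.inv_mul_cancel two_ne_zero (by simp), one_mul]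
    · change (A i₀).indicator (S' ((B i₀).indicator h)) k +
        (A i₀)ᶜ.indicator (S' ((B i₀)ᶜ.indicator h)) k = _
      rcases Finset.mem_insert.1 hi with rfl | hi
      · have hks : ∀ j ∈ s, k ∉ A j := fun j hj hkj => by
          exact disjoint_left.1 (hA _ (Finset.mem_insert_self _ _) j (Finset.mem_insert_of_mem hj)
            (hne j hj).symm) hk hkj
        rw [indicator_of_mem hk, indicator_of_notMem (by simpa using hk), add_zero, h3 _ _ hks,
          indicator_indicator]
        rw [inter_eq_right.2]
        intro j hj i' hi' hji'
        exact disjoint_left.1 (hB _ (Finset.mem_insert_self _ _) i' (Finset.mem_insert_of_mem hi')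
          (hne i' hi').symm) hj hji'
      · have hk0 : k ∉ A i₀ := fun h0 =>
          disjoint_left.1 (hA i (Finset.mem_insert_of_mem hi) i₀ (Finset.mem_insert_self _ _)
            (hne i hi)) hk h0
        rw [indicator_of_notMem hk0, indicator_of_mem (mem_compl hk0), zero_add, h2 _ i hi k hk,
          indicator_indicator]
        rw [inter_eq_left.2]
        intro j hj hj0
        exact disjoint_left.1 (hB i (Finset.mem_insert_of_mem hi) i₀ (Finset.mem_insert_self _ _)
            (hne i hi)) hj hj0
    · change (A i₀).indicator (S' ((B i₀).indicator h)) k +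
        (A i₀)ᶜ.indicator (S' ((B i₀)ᶜ.indicator h)) k = _
      have hk0 : k ∉ A i₀ := hk _ (Finset.mem_insert_self _ _)
      rw [indicator_of_notMem hk0, indicator_of_mem (mem_compl hk0), zero_add,
        h3 _ _ fun i hi => hk i (Finset.mem_insert_of_mem hi), indicator_indicator]
      have : {j | ∀ i ∈ s, j ∉ B i} ∩ (B i₀)ᶜ = {j | ∀ i ∈ insert i₀ s, j ∉ B i} := by
        ext j
        simp [and_comm]
      rw [this]

namespace Contracts

variable {J : Set ℤ} {E F : SeqLattice J} {ι : Type*} {b : ι → Block E} {lev : ι → ℕ} {c : ℤ → ℤ}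
  (hc : Contracts b lev c)

include hc

theorem c_r (i : ι) : c (b i).r = c (b i).l := hc.const i _ (b i).hlr (b i).hrt.le

theorem lt_of_c_lt {i i' : ι} (h : c (b i).l < c (b i').l) : (b i).t < (b i').l := by
  rcases hc.order i i' (by rintro rfl; omega) with h' | h'
  · exact h'
  · have := (hc.jump _ _ h').1; omega

/-- The geometric sum is comparable with its last term, and that term is the norm of a vector lying
entirely before `k`, hence visible in the left part. -/
theorem sum_W_le (P : SepPair E F) {z : ι → ℤ → ℝ} (hzN : ∀ i, E.N (z i) = P.W (c (b i).l))
    (hz : ∀ i k, z i k ≠ 0 → (b i).l ≤ k ∧ k ≤ (b i).r) (k : ℤ) :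
    ∑' i : {i | (b i).r < k}, (P.W (c (b i).l) : ℝ≥0∞) ≤
      P.H * E.N ((Iic k).indicator (glue b z)) := by
  rcases isEmpty_or_nonempty {i | (b i).r < k} with hT | ⟨⟨i', hi'⟩⟩
  · simp
  obtain ⟨-, ⟨i₀, hi₀, rfl⟩, hmax⟩ := Int.exists_greatest_of_bdd
    (P := fun n => ∃ i, (b i).r < k ∧ c (b i).l = n)
    ⟨c k, by rintro - ⟨i, hi, rfl⟩; exact hc.mono _ _ ((b i).hlr.trans hi.le)⟩ ⟨_, i', hi', rfl⟩
  have h1 := P.tsum_W_left (ι := {i | (b i).r < k}) (n := fun i => c (b i).l)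
    (n₀ := c (b i₀).l) (p := 0) (hc.injective.comp Subtype.val_injective)
    fun i => by simpa using hmax _ ⟨i, i.2, rfl⟩
  refine h1.trans ?_
  rw [pow_zero, one_mul, ← hzN]
  gcongr
  refine E.mono _ _ fun j _ => ?_
  by_cases hj : j ≤ k
  · rw [indicator_of_mem (by exact hj)]
    exact hc.abs_le_abs_glue (fun k hk => ⟨(hz i₀ k hk).1, (hz i₀ k hk).2.trans (b i₀).hrt.le⟩) j
  · have : z i₀ j = 0 := by
      by_contra h0
      exact hj ((hz i₀ j h0).2.trans (le_of_lt hi₀))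
    simp [this]

/-- Among the blocks whose first vector is allowed to extend to `k` or beyond, let `i₀` be the
leftmost and `r` the end of its range. Measured from `r`, the `F`-norms of the `y i` are summed
geometrically by `F_far`, and the weight of `i₀` is bounded by `kappa_lower`. -/
theorem sum_F_le (P : SepPair E F) {z y : ι → ℤ → ℝ} (hzN : ∀ i, E.N (z i) = P.W (c (b i).l))
    (hz : ∀ i k, z i k ≠ 0 → (b i).l ≤ k ∧ k ≤ (b i).r)
    (hyN : ∀ i, E.N (y i) ≤ P.W (c (b i).l))
    (hy : ∀ i k, y i k ≠ 0 → (b i).r < k ∧ k ≤ (b i).t) {k : ℤ} (hk : k ∈ J) :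
    E.N (Pi.single k 1) * ∑' i : ({i | (b i).r < k}ᶜ : Set ι), F.N ((Ici k).indicator (y i)) ≤
      P.K * P.C * P.H * (P.C + P.K) * kappa E F k (glue b z) := by
  rcases isEmpty_or_nonempty ({i | (b i).r < k}ᶜ : Set ι) with hT | ⟨⟨i', hi'⟩⟩
  · simp
  have hi'' : k ≤ (b i').r := by simpa using hi'
  obtain ⟨-, ⟨i₀, hi₀, rfl⟩, hmin⟩ := Int.exists_least_of_bdd
    (P := fun n => ∃ i, k ≤ (b i).r ∧ c (b i).l = n)
    ⟨c k, by rintro - ⟨i, hi, rfl⟩; rw [← hc.c_r]; exact hc.mono _ _ hi⟩ ⟨_, i', hi'', rfl⟩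
  set r := (b i₀).r
  have hr : r ∈ J := (b i₀).hr
  have hle : ∀ i : ({i | (b i).r < k}ᶜ : Set ι), r ≤ (b i).r := by
    intro i
    have h1 := hmin _ ⟨i, not_lt.1 i.2, rfl⟩
    rcases eq_or_lt_of_le h1 with h | h
    · rw [← hc.injective h]
    · have := hc.lt_of_c_lt h
      have := (b i₀).hrt; have := (b i.1).hlr
      omega
  have h1 : E.N (Pi.single r 1) *
      ∑' i : ({i | (b i).r < k}ᶜ : Set ι), F.N ((Ici k).indicator (y i)) ≤
      P.K * P.C * F.N (Pi.single r 1) * (P.H * P.W (c (b i₀).l)) := by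
    have h2 := P.tsum_W_right (ι := ({i | (b i).r < k}ᶜ : Set ι)) (n := fun i => c (b i).l)
      (n₀ := c (b i₀).l) (p := 0) (hc.injective.comp Subtype.val_injective)
      fun i => by simpa using hmin _ ⟨i, not_lt.1 i.2, rfl⟩
    rw [pow_zero, one_mul] at h2
    refine le_trans ?_ (mul_le_mul_right h2 _)
    rw [← ENNReal.tsum_mul_left, ← ENNReal.tsum_mul_left]
    refine ENNReal.tsum_le_tsum fun i => ?_
    have h3 := hc.lip r (b i).r (hle i)
    rw [hc.c_r, hc.c_r] at h3
    calc _ ≤ E.N (Pi.single r 1) * F.N (y i) := by gcongr; exact F.indicator_le _ _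
      _ ≤ P.K * P.C * P.q ^ ((b i).r - r).toNat * (F.N (Pi.single r 1) * E.N (y i)) :=
          P.F_far hr (b i).hr (hle i) fun k hk => (hy i k hk).1.le
      _ ≤ P.K * P.C * P.q ^ (c (b i).l - c (b i₀).l).toNat *
          (F.N (Pi.single r 1) * P.W (c (b i).l)) := by
          gcongr P.K * P.C * ?_ * (F.N (Pi.single r 1) * ?_)
          · exact pow_le_pow_right_of_le_one' (by exact_mod_cast P.q_lt_one.le) (by omega)
          · exact hyN i
      _ = _ := by ring
  have h2 := P.kappa_lower (z := z i₀) (f := glue b z) hk hr hi₀ (fun j hj => (hz i₀ j hj).2)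
    (hc.abs_le_abs_glue fun k hk => ⟨(hz i₀ k hk).1, (hz i₀ k hk).2.trans (b i₀).hrt.le⟩)
  rw [hzN] at h2
  refine (ENNReal.mul_le_mul_iff_right (E.single_ne_zero r hr) (E.single_ne_top r hr)).1 ?_
  calc _ = E.N (Pi.single k 1) * (E.N (Pi.single r 1) *
        ∑' i : ({i | (b i).r < k}ᶜ : Set ι), F.N ((Ici k).indicator (y i))) := by ring
    _ ≤ E.N (Pi.single k 1) * (P.K * P.C * F.N (Pi.single r 1) * (P.H * P.W (c (b i₀).l))) := by
        gcongr
    _ = P.K * P.C * P.H * (P.W (c (b i₀).l) * (E.N (Pi.single k 1) * F.N (Pi.single r 1))) := by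
        ring
    _ ≤ P.K * P.C * P.H * ((P.C + P.K) * (E.N (Pi.single r 1) * kappa E F k (glue b z))) := by
        gcongr
    _ = _ := by ring

/-- Moving vectors to the right cannot increase `kappa` much: `y i` meets the left part at `k` only
if `z i` lies wholly before `k`, so `sum_W_le` bounds those blocks in `E`, and in `F` through
`F_Ici_le`. The remaining blocks matter in `F` only and are handled by `sum_F_le`. -/
theorem kappa_glue_le (P : SepPair E F) {z y : ι → ℤ → ℝ}
    (hzN : ∀ i, E.N (z i) = P.W (c (b i).l))
    (hz : ∀ i k, z i k ≠ 0 → (b i).l ≤ k ∧ k ≤ (b i).r)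
    (hyN : ∀ i, E.N (y i) ≤ P.W (c (b i).l))
    (hy : ∀ i k, y i k ≠ 0 → (b i).r < k ∧ k ≤ (b i).t) {k : ℤ} (hk : k ∈ J) :
    kappa E F k (glue b y) ≤
      2 * (P.H + P.K * P.H + P.K * P.C * P.H * (P.C + P.K)) * kappa E F k (glue b z) := by
  have h0 := hc.sum_W_le P hzN hz k
  have h1 : F.N (Pi.single k 1) * E.N ((Iic k).indicator (glue b y)) ≤
      2 * (P.H * kappa E F k (glue b z)) := by
    have h2 : E.N ((Iic k).indicator (glue b y)) ≤ 2 * (P.H * E.N ((Iic k).indicator (glue b z))) := by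
      refine (hc.N_glue_le E y (Iic k) {i | (b i).r < k}
        fun i j hj _ _ h => lt_of_lt_of_le (hy i j h).1 hj).trans ?_
      gcongr
      exact (ENNReal.tsum_le_tsum fun i : {i | (b i).r < k} =>
        (E.indicator_le _ _).trans (hyN i)).trans h0
    calc _ ≤ F.N (Pi.single k 1) * (2 * (P.H * E.N ((Iic k).indicator (glue b z)))) := by gcongr
      _ = 2 * (P.H * (F.N (Pi.single k 1) * E.N ((Iic k).indicator (glue b z)))) := by ring
      _ ≤ _ := by gcongr; exact le_self_add
  have h2 : E.N (Pi.single k 1) * F.N ((Ici k).indicator (glue b y)) ≤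
      2 * (P.K * (P.H * kappa E F k (glue b z)) +
        P.K * P.C * P.H * (P.C + P.K) * kappa E F k (glue b z)) := by
    refine (mul_le_mul_right (hc.N_glue_le F y (Ici k) univ fun _ _ _ _ _ _ => mem_univ _) _).trans ?_
    rw [tsum_univ (fun i => F.N ((Ici k).indicator (y i))),
      ← ENNReal.summable.tsum_add_tsum_compl (s := {i | (b i).r < k}) ENNReal.summable,
      mul_left_comm]
    gcongr
    rw [mul_add]
    gcongr ?_ + ?_
    · calc _ ≤ ∑' i : {i | (b i).r < k}, P.K * F.N (Pi.single k 1) * P.W (c (b i).l) := by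
            rw [← ENNReal.tsum_mul_left]
            refine ENNReal.tsum_le_tsum fun i => (P.F_Ici_le (y i) hk).trans ?_
            rw [mul_assoc]
            gcongr
            exact (E.indicator_le _ _).trans (hyN i)
        _ ≤ P.K * F.N (Pi.single k 1) * (P.H * E.N ((Iic k).indicator (glue b z))) := by
            rw [ENNReal.tsum_mul_left]; gcongr
        _ = P.K * (P.H * (F.N (Pi.single k 1) * E.N ((Iic k).indicator (glue b z)))) := by ring
        _ ≤ _ := by gcongr; exact le_self_add
    · exact hc.sum_F_le P hzN hz hyN hy hk
  rw [kappa]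
  refine (add_le_add h1 h2).trans (le_of_eq ?_)
  ring

/-- An operator mapping `glue b z` to `glue b y` almost maps `z i` to `y i` for blocks of high
level. -/
theorem operator_block_le (P : SepPair E F) {z y : ι → ℤ → ℝ}
    (hzN : ∀ i, E.N (z i) = P.W (c (b i).l))
    (hz : ∀ i k, z i k ≠ 0 → (b i).l ≤ k ∧ k ≤ (b i).r)
    (hy : ∀ i k, y i k ≠ 0 → (b i).r < k ∧ k ≤ (b i).t)
    (S : (ℤ → ℝ) →ₗ[ℝ] (ℤ → ℝ)) (D : NNReal) (hE : ∀ h, E.N (S h) ≤ D * E.N h)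
    (hF : ∀ h, F.N (S h) ≤ D * F.N h) (hS : ∀ k ∈ J, S (glue b z) k = glue b y k) (i : ι) :
    E.N ((Ioc (b i).r (b i).t).indicator (S (z i)) - y i) ≤
      2 * D * (1 + P.K * P.K * P.C) * P.H * P.ρ ^ lev i * E.N (z i) := by
  set f := glue b z
  set A := Ioc (b i).r (b i).t
  set fL := (Iio (b i).l).indicator f
  set fR := (Ioi (b i).t).indicator f
  have hlr := (b i).hlr
  have hrt := (b i).hrt
  have hf : f = fL + z i + fR := by
    ext k
    simp only [Pi.add_apply, fL, fR]
    rcases lt_or_ge k (b i).l with h1 | h1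
    · have : z i k = 0 := by
        by_contra h0; have := hz i k h0; omega
      simp [h1, this, show ¬ (b i).t < k by omega]
    · rcases le_or_gt k (b i).t with h2 | h2
      · rw [indicator_of_notMem (by simpa using h1), indicator_of_notMem (by simpa using h2),
          zero_add, add_zero]
        exact hc.glue_of_mem z h1 h2
      · have : z i k = 0 := by
          by_contra h0; have := hz i k h0; omega
        simp [h2, this, show ¬ k < (b i).l by omega]
  -- Seen from block `i`, every earlier block is at contracted distance at least `lev i`, so their
  -- geometric sum carries `ρ ^ lev i`.
  have hL : E.N (A.indicator (S fL)) ≤ D * (2 * (P.ρ ^ lev i * P.H * P.W (c (b i).l))) := by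
    refine (E.indicator_le _ _).trans ((hE _).trans ?_)
    gcongr
    refine (hc.N_glue_le E z _ {i' | (b i').t < (b i).l} fun i' k hk h1 h2 _ => ?_).trans ?_
    · have hk' : k < (b i).l := hk
      rcases hc.order i' i (by rintro rfl; omega) with h | h
      · exact h
      · omega
    · gcongr
      refine (ENNReal.tsum_le_tsum fun i' : {i' | (b i').t < (b i).l} =>
        (E.indicator_le _ _).trans (hzN i').le).trans ?_
      exact P.tsum_W_left (n := fun i' : {i' | (b i').t < (b i).l} => c (b i').l)
        (hc.injective.comp Subtype.val_injective) fun i' => (hc.jump i' i i'.2).2.2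
  -- The later blocks are small in `F`, not in `E`. Boundedness of `S` on `F` is used, and the image
  -- up to `t` is brought back to `E` by `E_Iic_le`.
  have hR : E.N (A.indicator (S fR)) ≤
      P.K * D * 2 * (P.K * P.C * (P.ρ ^ lev i * P.H * P.W (c (b i).l))) := by
    have ht := (b i).ht
    refine (E.indicator_mono (A' := Iic (b i).t) (fun k hk => hk.1.2) _).trans ?_
    refine (ENNReal.mul_le_mul_iff_right (F.single_ne_zero _ ht) (F.single_ne_top _ ht)).1 ?_
    refine (P.E_Iic_le _ ht).trans ?_
    have h1 := hc.tail_le P (z := z) (fun i => (hzN i).le) (fun i k hk => (hz i k hk).1) ht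
      (p := lev i) (T := {i' | (b i).t < (b i').l}) (fun i' hi' => ⟨le_of_lt hi', by
        rw [hc.const i _ (hlr.trans hrt.le) le_rfl]; exact (hc.jump i i' hi').2.1⟩) (Ioi (b i).t)
    have h2 : F.N fR ≤ 2 * ∑' i' : {i' | (b i).t < (b i').l}, F.N ((Ioi (b i).t).indicator (z i')) := by
      refine hc.N_glue_le F z _ _ fun i' k hk h1 h2 _ => ?_
      have hk' : (b i).t < k := hk
      rcases hc.order i i' (by rintro rfl; omega) with h | h
      · exact h
      · omega
    rw [hc.const i _ (hlr.trans hrt.le) le_rfl] at h1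
    calc _ ≤ P.K * (E.N (Pi.single (b i).t 1) * (D * (2 *
          ∑' i' : {i' | (b i).t < (b i').l}, F.N ((Ioi (b i).t).indicator (z i'))))) := by
          gcongr
          refine (F.indicator_le _ _).trans ((hF _).trans ?_)
          gcongr
      _ = P.K * D * 2 * (E.N (Pi.single (b i).t 1) *
          ∑' i' : {i' | (b i).t < (b i').l}, F.N ((Ioi (b i).t).indicator (z i'))) := by ring
      _ ≤ P.K * D * 2 * (P.K * P.C * F.N (Pi.single (b i).t 1) *
          (P.ρ ^ lev i * P.H * P.W (c (b i).l))) := by gcongr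
      _ = _ := by ring
  have h3 : E.N (A.indicator (S (z i)) - y i) =
      E.N (A.indicator (S fL) + A.indicator (S fR)) := by
    refine E.congr fun k hk => ?_
    by_cases hkA : k ∈ A
    · have h4 := hS k hk
      rw [show glue b y k = y i k from hc.glue_of_mem y (hlr.trans hkA.1.le) hkA.2, hf, map_add,
        map_add] at h4
      simp only [Pi.add_apply, Pi.sub_apply, indicator_of_mem hkA] at h4 ⊢
      rw [← h4, ← abs_neg]
      congr 1; ring
    · have : y i k = 0 := by
        by_contra h0; exact hkA (hy i k h0)
      simp [hkA, this]
  rw [h3, hzN]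
  refine (E.add_le _ _).trans ((add_le_add hL hR).trans (le_of_eq ?_))
  ring

end Contracts

/-- The Calderón property implies the right-shift property. -/
theorem SepPair.seqRSPInterval_of_seqCalderon {J : Set ℤ} {E F : SeqLattice J} (P : SepPair E F)
    (hcal : SeqCalderon E F) : SeqRSPInterval E := by
  classical
  by_contra hE
  obtain ⟨s, b', hsep, hviol, hopt⟩ := exists_glued_families hE
  set b : {x : ℕ × ℤ // x.2 ∈ s x.1} → Block E := fun x => b' x.1.1 x.1.2
  set lev : {x : ℕ × ℤ // x.2 ∈ s x.1} → ℕ := fun x => x.1.1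
  have hsep' : ∀ i i', i ≠ i' → (b i).Sep (max (lev i) (lev i') : ℕ) (b i') := fun i i' h =>
    hsep _ _ i.2 _ _ i'.2 fun h' => h (Subtype.ext h')
  obtain ⟨c, h1, h2, h3, h4⟩ := exists_contraction b lev hsep'
  have hc : Contracts b lev c :=
    ⟨fun i i' h => (hsep' i i' h).imp (fun h => by omega) (fun h => by omega), h1, h2, h3, h4⟩
  -- Scalars giving the first vector of each block the norm prescribed by the exponential weight.
  set a : {x : ℕ × ℤ // x.2 ∈ s x.1} → ℝ := fun i => (P.W (c (b i).l) / E.N (b i).u).toReal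
  have hune : ∀ i, (P.W (c (b i).l) : ℝ≥0∞) / E.N (b i).u ≠ ⊤ := fun i =>
    ENNReal.div_ne_top ENNReal.coe_ne_top (b i).hpos
  have ha : ∀ i, ‖a i‖ₑ = P.W (c (b i).l) / E.N (b i).u := fun i => by
    rw [Real.enorm_of_nonneg ENNReal.toReal_nonneg, ENNReal.ofReal_toReal (hune i)]
  have hane : ∀ i, a i ≠ 0 := fun i h0 => by
    have := ha i
    rw [h0, enorm_zero] at this
    have h5 := ENNReal.div_eq_zero_iff.1 this.symm
    rcases h5 with h5 | h5
    · exact (P.W_pos _).ne' (by exact_mod_cast h5)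
    · exact (b i).u_ne_top h5
  have hzN : ∀ i, E.N (a i • (b i).u) = P.W (c (b i).l) := fun i => by
    rw [E.smul, ha, ENNReal.div_mul_cancel (b i).hpos (b i).u_ne_top]
  have hyN : ∀ i, E.N (a i • (b i).v) ≤ P.W (c (b i).l) := fun i => by
    rw [← hzN, E.smul, E.smul]; gcongr; exact (b i).hle
  have hz : ∀ i k, (a i • (b i).u) k ≠ 0 → (b i).l ≤ k ∧ k ≤ (b i).r := fun i k hk =>
    (b i).hu k (right_ne_zero_of_mul hk)
  have hy : ∀ i k, (a i • (b i).v) k ≠ 0 → (b i).r < k ∧ k ≤ (b i).t := fun i k hk =>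
    (b i).hv k (right_ne_zero_of_mul hk)
  set Cst := 2 * (P.H + P.K * P.H + P.K * P.C * P.H * (P.C + P.K))
  have hCst : Cst ≠ ⊤ := by
    have := P.H_ne_top; have := P.K_ne_top
    finiteness
  obtain ⟨S, D, hSE, hSF, hS⟩ := hcal (glue b fun i => a i • (b i).u) (glue b fun i => a i • (b i).v)
    (fun k hk => hc.kappa_glue_ne_top P (fun i => (hzN i).le) (fun i k hk => (hz i k hk).1) hk)
    ⟨Cst.toNNReal, fun k hk => by
      rw [ENNReal.coe_toNNReal hCst]; exact hc.kappa_glue_le P hzN hz hyN hy hk⟩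
  have hblock : ∀ j, ∀ n ∈ s j, E.N ((Ioc (b' j n).r (b' j n).t).indicator (S (b' j n).u) - (b' j n).v) ≤
      2 * D * (1 + P.K * P.K * P.C) * P.H * P.ρ ^ j * E.N (b' j n).u := by
    intro j n hn
    let i : {x : ℕ × ℤ // x.2 ∈ s x.1} := ⟨(j, n), hn⟩
    have h5 := hc.operator_block_le P hzN hz hy S D hSE hSF hS i
    rw [map_smul, indicator_real_smul, ← smul_sub, E.smul, E.smul] at h5
    rw [← ENNReal.mul_le_mul_iff_right (a := ‖a i‖ₑ) (by simpa using hane i) enorm_ne_top]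
    refine h5.trans (le_of_eq ?_)
    rw [mul_left_comm]
  -- A level so high that each block error is at most a quarter of the block, and that the violated
  -- constant `j` is at least `2 D`.
  have hsmall : ∃ j : ℕ, 2 * D * (1 + P.K * P.K * P.C) * P.H * P.ρ ^ j ≤ 4⁻¹ ∧ 2 * (D : ℝ≥0∞) ≤ j := by
    have hfin : 2 * D * (1 + P.K * P.K * P.C) * P.H ≠ ⊤ := by
      have := P.H_ne_top; have := P.K_ne_top
      finiteness
    have h5 : Tendsto (fun j : ℕ => 2 * D * (1 + P.K * P.K * P.C) * P.H * (P.ρ : ℝ≥0∞) ^ j) atTop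
        (𝓝 (2 * D * (1 + P.K * P.K * P.C) * P.H * 0)) :=
      ENNReal.Tendsto.const_mul (ENNReal.tendsto_pow_atTop_nhds_zero_of_lt_one
        (by exact_mod_cast P.ρ_lt_one)) (Or.inr hfin)
    rw [mul_zero] at h5
    obtain ⟨m, hm⟩ := exists_nat_ge (2 * D)
    obtain ⟨j, hj1, hj2⟩ := ((h5.eventually_le_const (u := 4⁻¹) (by simp)).and
      (eventually_ge_atTop m)).exists
    exact ⟨j, hj1, by
      have : 2 * D ≤ (j : NNReal) := hm.trans (by exact_mod_cast hj2)
      exact_mod_cast this⟩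
  obtain ⟨j, hj1, hj2⟩ := hsmall
  set A : ℤ → Set ℤ := fun n => Ioc (b' j n).r (b' j n).t
  set B : ℤ → Set ℤ := fun n => Icc (b' j n).l (b' j n).r
  have hdis : ∀ n ∈ s j, ∀ m ∈ s j, n ≠ m → (b' j n).t < (b' j m).l ∨ (b' j m).t < (b' j n).l := by
    intro n hn m hm hnm
    exact (hsep j n hn j m hm fun h => hnm (Prod.ext_iff.1 h).2).imp (fun h => by omega)
      (fun h => by omega)
  have hI := fun n => (b' j n).hlr
  have hI' := fun n => (b' j n).hrt
  obtain ⟨S', hS'1, hS'2⟩ := exists_block_diagonal E (s j) A B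
    (fun n hn m hm hnm => disjoint_left.2 fun k hk hk' => by
      have := hdis n hn m hm hnm; have := hk.1; have := hk.2; have := hk'.1; have := hk'.2
      have := hI n; have := hI m; omega)
    (fun n hn m hm hnm => disjoint_left.2 fun k hk hk' => by
      have := hdis n hn m hm hnm; have := hk.1; have := hk.2; have := hk'.1; have := hk'.2
      have := hI' n; have := hI' m; omega) S D hSE
  set U := ∑ n ∈ s j, (b' j n).u
  set V := ∑ n ∈ s j, (b' j n).v
  set e : ℤ → ℤ → ℝ := fun n => (A n).indicator (S (b' j n).u) - (b' j n).v
  have heN : ∀ n ∈ s j, 4 * E.N (e n) ≤ E.N (b' j n).u := fun n hn => by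
    calc _ ≤ 4 * (4⁻¹ * E.N (b' j n).u) := by
          gcongr; exact (hblock j n hn).trans (by gcongr)
      _ = _ := by rw [← mul_assoc, ENNReal.mul_inv_cancel (by simp) (by simp), one_mul]
  have h4 : ‖(4 : ℝ)‖ₑ = 4 := by rw [Real.enorm_of_nonneg (by norm_num)]; simp
  -- Four times the errors are admissible second vectors, so almost optimality of the family bounds
  -- the summed error by half the norm of `V`. With the block diagonal bound, the norm of `V` is at
  -- most `2 D` times that of `U`, contrary to the choice of `j`.
  have hsum : 4 * E.N (∑ n ∈ s j, e n) ≤ 2 * E.N V := by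
    have := hopt j (fun n => (4 : ℝ) • e n) (fun n hn k hk => ?_) (fun n hn => ?_)
    · rwa [← Finset.smul_sum, E.smul, h4] at this
    · have hk0 : e n k ≠ 0 := right_ne_zero_of_mul hk
      by_contra hkA
      refine hk0 ?_
      have : (b' j n).v k = 0 := by
        by_contra h0; exact hkA ((b' j n).hv k h0)
      simp only [e, Pi.sub_apply, this, sub_zero]
      exact indicator_of_notMem (s := Ioc _ _) hkA _
    · rw [E.smul, h4]; exact heN n hn
  have hdiag : E.N (∑ n ∈ s j, (A n).indicator (S (b' j n).u)) ≤ D * E.N U := by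
    refine le_trans (E.mono _ _ fun k _ => ?_) (hS'1 U)
    rw [Finset.sum_apply]
    by_cases hk : ∃ n ∈ s j, k ∈ A n
    · obtain ⟨n, hn, hkn⟩ := hk
      rw [Finset.sum_eq_single_of_mem n hn, indicator_of_mem hkn, hS'2 U n hn k hkn]
      · apply le_of_eq
        suffices h : (b' j n).u = (B n).indicator U by rw [h]
        ext l
        by_cases hl : l ∈ B n
        · rw [indicator_of_mem hl]; simp only [U]
          rw [Finset.sum_apply, Finset.sum_eq_single_of_mem n hn]
          intro m hm hmn
          by_contra h0
          have := (b' j m).hu l h0; have := hl.1; have := hl.2; have := hdis m hm n hn hmn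
          have := hI' n; have := hI' m; omega
        · rw [indicator_of_notMem hl]
          by_contra h0
          exact hl ((b' j n).hu l h0)
      · intro m hm hmn
        refine indicator_of_notMem (fun hkm => ?_) _
        have := hkn.1; have := hkn.2; have := hkm.1; have := hkm.2; have := hdis m hm n hn hmn
        have := hI n; have := hI m; omega
    · push Not at hk
      rw [Finset.sum_eq_zero fun n hn => indicator_of_notMem (hk n hn) _]
      simp
  have hV : E.N V ≤ D * E.N U + E.N (∑ n ∈ s j, e n) := by
    have hVe : V = ∑ n ∈ s j, (A n).indicator (S (b' j n).u) + (-1 : ℝ) • ∑ n ∈ s j, e n := by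
      simp only [e, Finset.sum_sub_distrib, V]
      module
    rw [hVe]
    refine (E.add_le _ _).trans (add_le_add hdiag (le_of_eq ?_))
    rw [E.smul]; simp
  have hVtop : E.N V ≠ ⊤ := by
    refine ((E.sum_le _ _).trans_lt (ENNReal.sum_lt_top.2 fun n _ => ?_)).ne
    exact lt_top_iff_ne_top.2 (b' j n).v_ne_top
  have hUtop : E.N U ≠ ⊤ := by
    refine ((E.sum_le _ _).trans_lt (ENNReal.sum_lt_top.2 fun n _ => ?_)).ne
    exact lt_top_iff_ne_top.2 (b' j n).u_ne_top
  have hviol' := hviol j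
  have hetop : E.N (∑ n ∈ s j, e n) ≠ ⊤ := by
    intro h
    rw [h, ENNReal.mul_top (by simp)] at hsum
    exact (ENNReal.mul_ne_top (by simp) hVtop) (top_le_iff.1 hsum)
  have h5 : (j : ℝ≥0∞) * E.N U < E.N V := hviol'
  have h6 : 2 * (D : ℝ≥0∞) * E.N U ≤ j * E.N U := by gcongr
  have h7 := h6.trans_lt h5
  lift E.N V to NNReal using hVtop with Vn
  lift E.N U to NNReal using hUtop with Un
  lift E.N (∑ n ∈ s j, e n) to NNReal using hetop with en
  norm_cast at hV hsum h7
  have hV' : (Vn : ℝ) ≤ D * Un + en := by exact_mod_cast hV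
  have hsum' : 4 * (en : ℝ) ≤ 2 * Vn := by exact_mod_cast hsum
  have h7' : 2 * (D : ℝ) * Un < Vn := by exact_mod_cast h7
  nlinarith

/-! ## Rearrangements and norms -/

section Kothe

variable {α : Type*} [MeasurableSpace α] {μ : Measure α}

/-- Together with `le_rearr_of_le_measure`, this replaces the supremum over arbitrary sets by
superlevel sets, so that rearrangements can be handled through distribution functions. -/
theorem le_measure_of_lt_rearr {f : α →ₘ[μ] ℝ} {t : ℝ} {s : ℝ≥0∞} (h : s < rearr f t) :
    ENNReal.ofReal t ≤ μ {a | s < ‖f a‖ₑ} := by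
  simp only [rearr, lt_iSup_iff] at h
  obtain ⟨B, -, hB, h⟩ := h
  refine hB.trans (measure_mono fun a ha => ?_)
  exact h.trans_le (iInf₂_le a ha)

theorem measurableSet_lt_enorm (f : α →ₘ[μ] ℝ) (s : ℝ≥0∞) : MeasurableSet {a | s < ‖f a‖ₑ} :=
  measurableSet_lt measurable_const f.stronglyMeasurable.measurable.enorm

theorem le_rearr_of_le_measure {f : α →ₘ[μ] ℝ} {t : ℝ} {s : ℝ≥0∞}
    (h : ENNReal.ofReal t ≤ μ {a | s < ‖f a‖ₑ}) : s ≤ rearr f t :=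
  le_iSup_of_le _ (le_iSup_of_le (measurableSet_lt_enorm f s)
    (le_iSup_of_le h (le_iInf₂ fun _ ha => le_of_lt ha)))

theorem rearr_le_of_measure_le {f g : α →ₘ[μ] ℝ} {t t' : ℝ}
    (h : ∀ s : ℝ≥0∞, ENNReal.ofReal t ≤ μ {a | s < ‖g a‖ₑ} →
      ENNReal.ofReal t' ≤ μ {a | s < ‖f a‖ₑ}) :
    rearr g t ≤ rearr f t' := by
  refine le_of_forall_lt fun s hs => ?_
  obtain ⟨s', h1, h2⟩ := exists_between hs
  exact h1.trans_le (le_rearr_of_le_measure (h s' (le_measure_of_lt_rearr h2)))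

/-- Otherwise, by continuity from below, a slightly higher superlevel set would still have measure
at least `t`, and `f*(t)` would be larger than itself. -/
theorem measure_lt_rearr_le {f : α →ₘ[μ] ℝ} {t : ℝ} :
    μ {a | rearr f t < ‖f a‖ₑ} ≤ ENNReal.ofReal t := by
  by_contra! h
  have hu : {a | rearr f t < ‖f a‖ₑ} =
      ⋃ n : ℕ, {a | rearr f t + (n + 1 : ℝ≥0∞)⁻¹ < ‖f a‖ₑ} := by
    ext a
    simp only [mem_ofPred_eq, mem_iUnion]
    constructor
    · intro ha
      have h0 : ‖f a‖ₑ - rearr f t ≠ 0 := (tsub_pos_of_lt ha).ne'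
      obtain ⟨n, hn⟩ := ENNReal.exists_inv_nat_lt h0
      refine ⟨n, ?_⟩
      rw [add_comm]
      refine lt_tsub_iff_right.1 (lt_of_le_of_lt ?_ hn)
      exact ENNReal.inv_le_inv.2 le_self_add
    · rintro ⟨n, hn⟩
      exact lt_of_le_of_lt le_self_add hn
  have hmono : Monotone fun n : ℕ => {a | rearr f t + (n + 1 : ℝ≥0∞)⁻¹ < ‖f a‖ₑ} := by
    intro n m hnm a ha
    have h4 : ((m : ℝ≥0∞) + 1)⁻¹ ≤ (n + 1 : ℝ≥0∞)⁻¹ := by gcongr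
    exact lt_of_le_of_lt (add_le_add le_rfl h4) ha
  rw [hu, hmono.measure_iUnion] at h
  obtain ⟨n, hn⟩ := lt_iSup_iff.1 h
  have h1 := le_rearr_of_le_measure hn.le
  have h2 : rearr f t ≠ ⊤ := by
    intro htop
    rw [htop] at h
    simp at h
  have h3 : rearr f t + 0 < rearr f t + (n + 1 : ℝ≥0∞)⁻¹ :=
    ENNReal.add_lt_add_left h2 (by
      rw [ENNReal.inv_pos]; finiteness)
  rw [add_zero] at h3
  exact absurd h1 (not_le.2 h3)

/-- On sets of finite measure almost everywhere convergence implies convergence in measure. The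
Fatou axiom concerns the unit ball, so one rescales by `M + ε`, which is positive even when `M = 0`.
-/
theorem KotheSpace.eNorm_le_of_tendsto (X : KotheSpace μ) {f : ℕ → α →ₘ[μ] ℝ} {g : α →ₘ[μ] ℝ}
    {M : ℝ≥0∞} (hf : ∀ n, X.eNorm (f n) ≤ M)
    (h : ∀ᵐ a ∂μ, Tendsto (fun n => f n a) atTop (𝓝 (g a))) : X.eNorm g ≤ M := by
  refine ENNReal.le_of_forall_pos_le_add fun ε hε hM => ?_
  lift M to NNReal using hM.ne
  set c : NNReal := M + ε
  have hc : 0 < c := by positivity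
  have hc' : (c : ℝ) ≠ 0 := by exact_mod_cast hc.ne'
  have hce : ‖(c : ℝ)⁻¹‖ₑ = (c : ℝ≥0∞)⁻¹ := by
    rw [enorm_inv hc']; simp
  have hne : (c : ℝ≥0∞) ≠ 0 := by exact_mod_cast hc.ne'
  have h1 := X.fatou (fun n => (c : ℝ)⁻¹ • f n) ((c : ℝ)⁻¹ • g) (fun n => ?_) fun B hB hμ => ?_
  · rw [X.eNorm_smul, hce] at h1
    have h2 : X.eNorm g = c * ((c : ℝ≥0∞)⁻¹ * X.eNorm g) := by
      rw [← mul_assoc, ENNReal.mul_inv_cancel hne ENNReal.coe_ne_top, one_mul]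
    rw [h2]
    calc _ ≤ (c : ℝ≥0∞) * 1 := by gcongr
      _ = _ := by simp [c]
  · rw [X.eNorm_smul, hce]
    calc _ ≤ (c : ℝ≥0∞)⁻¹ * c := by
          gcongr
          refine (hf n).trans ?_
          simp [c]
      _ = 1 := ENNReal.inv_mul_cancel hne ENNReal.coe_ne_top
  · have : IsFiniteMeasure (μ.restrict B) := ⟨by simpa using hμ⟩
    refine tendstoInMeasure_of_tendsto_ae
      (fun n => ((c : ℝ)⁻¹ • f n).aestronglyMeasurable.mono_measure Measure.restrict_le_self) ?_
    refine ae_restrict_of_ae ?_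
    have h2 : ∀ᵐ a ∂μ, ∀ n, ((c : ℝ)⁻¹ • f n) a = (c : ℝ)⁻¹ • f n a :=
      ae_all_iff.2 fun n => AEEqFun.coeFn_smul _ _
    filter_upwards [h, h2, AEEqFun.coeFn_smul (c : ℝ)⁻¹ g] with a h1 h2 h3
    rw [h3]
    simp only [h2]
    exact h1.const_smul _

theorem KotheSpace.eNorm_congr_enorm (X : KotheSpace μ) {f g : α →ₘ[μ] ℝ}
    (h : ∀ᵐ a ∂μ, ‖f a‖ₑ ≤ ‖g a‖ₑ) : X.eNorm f ≤ X.eNorm g :=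
  X.eNorm_mono f g (h.mono fun a ha => by
    simpa [Real.enorm_eq_ofReal_abs, ENNReal.ofReal_le_ofReal_iff (abs_nonneg (g a))] using ha)

end Kothe

/-! ### Truncations, dyadic blocks and their subdivisions -/

/-- The truncation of `f` at the level `m`. -/
def trunc {α : Type*} [MeasurableSpace α] {μ : Measure α} (f : α →ₘ[μ] ℝ) (m : ℕ) : α →ₘ[μ] ℝ :=
  AEEqFun.mk (fun a => max (-m : ℝ) (min (f a) m))
    (measurable_const.max (f.stronglyMeasurable.measurable.min measurable_const)).aestronglyMeasurable

theorem trunc_ae {α : Type*} [MeasurableSpace α] {μ : Measure α} (f : α →ₘ[μ] ℝ) (m : ℕ) :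
    ∀ᵐ a ∂μ, trunc f m a = max (-m : ℝ) (min (f a) m) := AEEqFun.coeFn_mk _ _

theorem enorm_trunc {α : Type*} [MeasurableSpace α] {μ : Measure α} (f : α →ₘ[μ] ℝ) (m : ℕ) :
    ∀ᵐ a ∂μ, ‖trunc f m a‖ₑ = min ‖f a‖ₑ m := by
  filter_upwards [trunc_ae f m] with a ha
  have : |trunc f m a| = min |f a| m := by
    rw [ha]
    have hm : (0 : ℝ) ≤ m := m.cast_nonneg
    rcases le_total 0 (f a) with h | h
    · rw [max_eq_right (le_trans (by linarith) (le_min h hm)), abs_of_nonneg (le_min h hm),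
        abs_of_nonneg h]
    · rw [min_eq_left (h.trans hm), abs_of_nonpos h, abs_of_nonpos (max_le (by linarith) h),
        ← min_neg_neg, neg_neg, min_comm]
  rw [Real.enorm_eq_ofReal_abs, this, ENNReal.ofReal_min, ENNReal.ofReal_natCast,
    ← Real.enorm_eq_ofReal_abs]

/-- The dyadic logarithm. -/
def lg (t : ℝ) : ℤ := Int.log 2 t

theorem lg_eq_iff {t : ℝ} (ht : 0 < t) (k : ℤ) : lg t = k ↔ t ∈ dyadicBlock k := by
  have h1 := Int.zpow_le_iff_le_log (b := 2) one_lt_two (x := k) ht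
  have h2 := Int.lt_zpow_iff_log_lt (b := 2) one_lt_two (x := k + 1) ht
  rw [dyadicBlock, mem_Ico]
  push_cast at h1 h2
  rw [h1, h2, lg]
  omega

theorem pos_of_mem_block {t : ℝ} {k : ℤ} (h : t ∈ dyadicBlock k) : 0 < t :=
  lt_of_lt_of_le (by positivity) h.1

theorem lg_of_mem {t : ℝ} {k : ℤ} (h : t ∈ dyadicBlock k) : lg t = k :=
  (lg_eq_iff (pos_of_mem_block h) k).2 h

theorem mem_block_lg {t : ℝ} (ht : 0 < t) : t ∈ dyadicBlock (lg t) := (lg_eq_iff ht _).1 rfl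

theorem measurable_lg : Measurable lg := by
  refine measurable_to_countable' fun k => ?_
  -- `Int.log` takes the value `0` at nonpositive arguments, which accounts for the second set.
  have : lg ⁻¹' {k} = (dyadicBlock k) ∪ (Iic 0 ∩ {_t | k = 0}) := by
    ext t
    rcases le_or_gt t 0 with ht | ht
    · have : t ∉ dyadicBlock k := fun h => (pos_of_mem_block h).not_ge ht
      simp [lg, Int.log_of_right_le_zero 2 ht, this, ht, eq_comm]
    · simp [lg_eq_iff ht, ht]
  rw [this]
  exact measurableSet_Ico.union (measurableSet_Iic.inter (MeasurableSet.const _))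

theorem lg_mul_zpow {t : ℝ} (ht : 0 < t) (d : ℤ) : lg (2 ^ d * t) = lg t + d := by
  have h := mem_block_lg ht
  refine (lg_eq_iff (by positivity) _).2 ?_
  rw [dyadicBlock, mem_Ico] at h ⊢
  rw [add_right_comm, zpow_add₀ two_ne_zero, zpow_add₀ two_ne_zero (lg t + 1), mul_comm,
    mul_comm (2 ^ d)]
  have : (0 : ℝ) < 2 ^ d := by positivity
  exact ⟨by nlinarith [h.1], by nlinarith [h.2]⟩

namespace Domain

variable (Ω : Domain)

theorem ae_pos : ∀ᵐ t ∂Ω.measure, 0 < t ∧ lg t ∈ Ω.index := by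
  cases Ω with
  | halfLine =>
    refine (ae_restrict_iff' measurableSet_Ici).2 ?_
    filter_upwards [(measure_eq_zero_iff_ae_notMem (μ := volume)).1 (measure_singleton (0 : ℝ))] with t h1 h2
    exact ⟨lt_of_le_of_ne h2 (Ne.symm h1), mem_univ _⟩
  | unitInterval =>
    refine (ae_restrict_iff' measurableSet_Icc).2 ?_
    filter_upwards [(measure_eq_zero_iff_ae_notMem (μ := volume)).1 (measure_singleton (0 : ℝ)),
      (measure_eq_zero_iff_ae_notMem (μ := volume)).1 (measure_singleton (1 : ℝ))] with t h1 h3 h2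
    have h0 : 0 < t := lt_of_le_of_ne h2.1 (Ne.symm h1)
    refine ⟨h0, ?_⟩
    have := Int.lt_zpow_iff_log_lt (b := 2) one_lt_two (x := 0) h0
    exact this.1 (by simpa using lt_of_le_of_ne h2.2 h3)
  | naturals =>
    refine ae_restrict_of_forall_mem (measurableSet_carrier .naturals) ?_
    rintro t ⟨n, hn, rfl⟩
    have h0 : (0 : ℝ) < n := by exact_mod_cast hn
    refine ⟨h0, ?_⟩
    have := Int.zpow_le_iff_le_log (b := 2) one_lt_two (x := 0) h0
    exact this.1 (by simpa using hn)

theorem naturals_measure_Ico_le (a b : ℕ) :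
    Domain.naturals.measure (Ico (a : ℝ) b) ≤ ((b - a : ℕ) : ℝ≥0∞) := by
  rw [Domain.measure, Measure.restrict_apply measurableSet_Ico, Measure.count_apply
    (measurableSet_Ico.inter (measurableSet_carrier .naturals))]
  have h1 : Ico (a : ℝ) b ∩ carrier .naturals ⊆ (Nat.cast : ℕ → ℝ) '' (Finset.Ico a b) := by
    rintro t ⟨h, n, hn, rfl⟩
    refine ⟨n, ?_, rfl⟩
    simpa using h
  have h2 := encard_le_encard h1
  rw [Nat.cast_injective.encard_image, encard_coe_eq_coe_finsetCard, Nat.card_Ico] at h2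
  exact_mod_cast h2

theorem le_naturals_measure_Ico {a b : ℕ} (ha : 1 ≤ a) :
    ((b - a : ℕ) : ℝ≥0∞) ≤ Domain.naturals.measure (Ico (a : ℝ) b) := by
  rw [Domain.measure, Measure.restrict_apply measurableSet_Ico, Measure.count_apply
    (measurableSet_Ico.inter (measurableSet_carrier .naturals))]
  have h1 : (Nat.cast : ℕ → ℝ) '' (Finset.Ico a b) ⊆ Ico (a : ℝ) b ∩ carrier .naturals := by
    rintro t ⟨n, hn, rfl⟩
    have : a ≤ n ∧ n < b := by simpa using hn
    exact ⟨by simpa using this, n, ha.trans this.1, rfl⟩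
  have h2 := encard_le_encard h1
  rw [Nat.cast_injective.encard_image, encard_coe_eq_coe_finsetCard, Nat.card_Ico] at h2
  exact_mod_cast h2

theorem measure_le_volume (hΩ : Ω ≠ .naturals) : Ω.measure ≤ volume := by
  cases Ω with
  | halfLine => exact Measure.restrict_le_self
  | unitInterval => exact Measure.restrict_le_self
  | naturals => exact absurd rfl hΩ

variable {Ω}

theorem measure_block {k : ℤ} (hk : k ∈ Ω.index) :
    Ω.measure (dyadicBlock k) = ENNReal.ofReal (2 ^ k) := by
  have h2 : (2 : ℝ) ^ (k + 1) - 2 ^ k = 2 ^ k := by rw [zpow_add_one₀ two_ne_zero]; ring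
  cases Ω with
  | halfLine =>
    have h3 : dyadicBlock k ⊆ carrier .halfLine := fun t ht => (pos_of_mem_block ht).le
    rw [Domain.measure, Measure.restrict_eq_self _ h3, dyadicBlock, Real.volume_Ico, h2]
  | unitInterval =>
    have h3 : dyadicBlock k ⊆ carrier .unitInterval := fun t ht =>
      ⟨(pos_of_mem_block ht).le, ht.2.le.trans (zpow_le_one_of_nonpos₀ one_le_two
        (by have : k < 0 := hk; omega))⟩
    rw [Domain.measure, Measure.restrict_eq_self _ h3, dyadicBlock, Real.volume_Ico, h2]
  | naturals =>
    obtain ⟨n, rfl⟩ := Int.eq_ofNat_of_zero_le (show 0 ≤ k from hk)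
    have h3 : dyadicBlock (n : ℤ) = Ico ((2 ^ n : ℕ) : ℝ) ((2 ^ (n + 1) : ℕ) : ℝ) := by
      rw [dyadicBlock]; norm_cast
    have h4 : ENNReal.ofReal (2 ^ (n : ℤ)) = ((2 ^ (n + 1) - 2 ^ n : ℕ) : ℝ≥0∞) := by
      rw [zpow_natCast, pow_succ, mul_two, Nat.add_sub_cancel, ← ENNReal.ofReal_natCast]
      norm_num
    rw [h3, h4]
    exact le_antisymm (naturals_measure_Ico_le _ _) (le_naturals_measure_Ico Nat.one_le_two_pow)

/-- The `j`-th of the `P` equal parts of `[2 ^ k, 2 ^ (k + 1))`. -/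
def piece (k : ℤ) (P j : ℕ) : Set ℝ := Ico (2 ^ k * (1 + j / P)) (2 ^ k * (1 + (j + 1) / P))

variable (Ω) in
/-- The block at `k` can be divided into `P` equal parts. -/
def Divides (k : ℤ) (P : ℕ) : Prop :=
  0 < P ∧ ∀ j, Ω.measure (piece k P j) ≤ ENNReal.ofReal (2 ^ k / P)

theorem divides_of_ne (hΩ : Ω ≠ .naturals) (k : ℤ) {P : ℕ} (hP : 0 < P) : Ω.Divides k P := by
  refine ⟨hP, fun j => (Ω.measure_le_volume hΩ _).trans ?_⟩
  rw [piece, Real.volume_Ico]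
  refine ENNReal.ofReal_le_ofReal (le_of_eq ?_)
  field_simp
  ring

/-- For counting measure the equal parts must contain a whole number of points, which limits the
subdivision to `e ≤ n`. -/
theorem naturals_divides {n e : ℕ} (h : e ≤ n) : Domain.naturals.Divides n (2 ^ e) := by
  refine ⟨by positivity, fun j => ?_⟩
  obtain ⟨d, rfl⟩ := Nat.exists_eq_add_of_le h
  have h1 : ∀ j : ℕ, (2 : ℝ) ^ ((e + d : ℕ) : ℤ) * (1 + j / (2 ^ e : ℕ)) =
      ((2 ^ (e + d) + j * 2 ^ d : ℕ) : ℝ) := by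
    intro j
    push_cast
    rw [zpow_add₀ two_ne_zero, zpow_natCast, zpow_natCast, pow_add]
    field_simp
  have h2 := h1 (j + 1)
  push_cast at h2
  have h3 := h1 j
  rw [piece, h3]
  push_cast
  rw [h2]
  have h4 := naturals_measure_Ico_le (2 ^ (e + d) + j * 2 ^ d) (2 ^ (e + d) + (j + 1) * 2 ^ d)
  push_cast at h4 
  refine h4.trans (le_of_eq ?_)
  have h5 : 2 ^ (e + d) + (j + 1) * 2 ^ d - (2 ^ (e + d) + j * 2 ^ d) = 2 ^ d := by
    rw [Nat.add_sub_add_left, add_mul, Nat.add_sub_cancel_left, one_mul]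
  have h6 : (2 : ℝ) ^ ((e : ℤ) + d) / 2 ^ e = ((2 ^ d : ℕ) : ℝ) := by
    rw [zpow_add₀ two_ne_zero, zpow_natCast, zpow_natCast]
    push_cast
    field_simp
  rw [h6, ENNReal.ofReal_natCast]
  rw [← h5]
  push_cast
  rfl

end Domain

variable {Ω : Domain}

/-- Boundedness makes the rearrangements finite, hence genuine real functions to which rearrangement
invariance applies; truncation removes the assumption afterwards. -/
theorem eNorm_le_of_measure_le_of_bounded (X : RISpace Ω) {f g : Ω.L0}
    (h : ∀ s : ℝ≥0∞, Ω.measure {t | s < ‖g t‖ₑ} ≤ Ω.measure {t | s < ‖f t‖ₑ}) {m : ℕ}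
    (hf : ∀ᵐ t ∂Ω.measure, ‖f t‖ₑ ≤ m) : X.eNorm g ≤ X.eNorm f := by
  have hfin : ∀ (f : Ω.L0), (∀ᵐ t ∂Ω.measure, ‖f t‖ₑ ≤ m) → ∀ t, 0 < t → rearr f t ≤ m := by
    intro f hf t ht
    by_contra! hlt
    have h1 := le_measure_of_lt_rearr hlt
    have h2 : Ω.measure {t | (m : ℝ≥0∞) < ‖f t‖ₑ} = 0 := by
      have := ae_iff.1 hf
      simpa only [not_le] using this
    rw [h2] at h1
    exact absurd (ENNReal.ofReal_eq_zero.1 (le_antisymm h1 zero_le)) (not_le.2 ht)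
  have hg : ∀ᵐ t ∂Ω.measure, ‖g t‖ₑ ≤ m := by
    have h1 := h m
    have h2 : Ω.measure {t | (m : ℝ≥0∞) < ‖f t‖ₑ} = 0 := by
      have := ae_iff.1 hf
      simpa only [not_le] using this
    rw [h2] at h1
    refine ae_iff.2 ?_
    simp only [not_le]
    exact le_antisymm h1 zero_le
  let R (f : Ω.L0) : Ω.L0 := AEEqFun.mk (fun t => (rearr f t).toReal)
    (rearr_antitone f).measurable.ennreal_toReal.aestronglyMeasurable
  have hR : ∀ f : Ω.L0, (∀ᵐ t ∂Ω.measure, ‖f t‖ₑ ≤ m) →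
      ∀ᵐ t ∂Ω.measure, ‖R f t‖ₑ = rearr f t := by
    intro f hf
    filter_upwards [AEEqFun.coeFn_mk (fun t => (rearr f t).toReal)
      (rearr_antitone f).measurable.ennreal_toReal.aestronglyMeasurable, Ω.ae_pos] with t h1 h2
    rw [h1, Real.enorm_of_nonneg ENNReal.toReal_nonneg, ENNReal.ofReal_toReal]
    exact ((hfin f hf t h2.1).trans_lt (ENNReal.natCast_lt_top m)).ne
  rw [← X.eNorm_rearr g (R g) (hR g hg), ← X.eNorm_rearr f (R f) (hR f hf)]
  refine X.eNorm_congr_enorm ?_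
  filter_upwards [hR f hf, hR g hg] with t h1 h2
  rw [h1, h2]
  exact rearr_le_of_measure_le fun s hs => hs.trans (h s)

theorem measure_trunc_eq (f : Ω.L0) (m : ℕ) (s : ℝ≥0∞) :
    Ω.measure {t | s < ‖trunc f m t‖ₑ} = Ω.measure {t | s < ‖f t‖ₑ ∧ s < m} := by
  refine measure_congr ?_
  filter_upwards [enorm_trunc f m] with t ht
  refine propext ?_
  change s < ‖trunc f m t‖ₑ ↔ s < ‖f t‖ₑ ∧ s < m
  rw [ht, lt_min_iff]

/-- The norm depends monotonically on the distribution function. -/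
theorem eNorm_le_of_measure_le (X : RISpace Ω) {f g : Ω.L0}
    (h : ∀ s : ℝ≥0∞, Ω.measure {t | s < ‖g t‖ₑ} ≤ Ω.measure {t | s < ‖f t‖ₑ}) :
    X.eNorm g ≤ X.eNorm f := by
  refine X.eNorm_le_of_tendsto (f := fun m => trunc g m) (fun m => ?_) ?_
  · refine (eNorm_le_of_measure_le_of_bounded X (f := trunc f m) (m := m) (fun s => ?_) ?_).trans ?_
    · rw [measure_trunc_eq, measure_trunc_eq]
      by_cases hs : s < m
      · simpa only [hs, and_true] using h s
      · simp [hs]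
    · filter_upwards [enorm_trunc f m] with t ht
      rw [ht]; exact min_le_right _ _
    · refine X.eNorm_congr_enorm ?_
      filter_upwards [enorm_trunc f m] with t ht
      rw [ht]; exact min_le_left _ _
  · filter_upwards [ae_all_iff.2 fun m => trunc_ae g m] with t ht
    simp only [ht]
    refine tendsto_atTop_of_eventually_const (i₀ := ⌈|g t|⌉₊) fun m hm => ?_
    have h1 : |g t| ≤ m := (Nat.le_ceil _).trans (by exact_mod_cast hm)
    rw [min_eq_left ((le_abs_self _).trans h1), max_eq_right (by linarith [neg_abs_le (g t)])]

/-! ### Step functions and the sequence lattice of an r.i. space -/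

/-- `x ↦ w · (x ∘ φ)`. -/
def compMul (Ω : Domain) (w : ℝ → ℝ) (φ : ℝ → ℤ) (hw : Measurable w) (hφ : Measurable φ) :
    (ℤ → ℝ) →ₗ[ℝ] Ω.L0 where
  toFun x := AEEqFun.mk (fun t => w t * x (φ t))
    (hw.mul ((measurable_of_countable x).comp hφ)).aestronglyMeasurable
  map_add' x y := by
    rw [AEEqFun.mk_add_mk]
    congr 1; ext t; simp [mul_add]
  map_smul' c x := by
    rw [RingHom.id_apply, AEEqFun.smul_mk]
    congr 1; ext t; simp [mul_left_comm]

theorem compMul_ae (w : ℝ → ℝ) (φ : ℝ → ℤ) (hw : Measurable w) (hφ : Measurable φ) (x : ℤ → ℝ) :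
    ∀ᵐ t ∂Ω.measure, compMul Ω w φ hw hφ x t = w t * x (φ t) := AEEqFun.coeFn_mk _ _

/-- The step function with the values `x k` on the dyadic blocks. -/
def iota (Ω : Domain) : (ℤ → ℝ) →ₗ[ℝ] Ω.L0 :=
  compMul Ω (fun _ => 1) lg measurable_const measurable_lg

theorem iota_ae (x : ℤ → ℝ) : ∀ᵐ t ∂Ω.measure, iota Ω x t = x (lg t) := by
  filter_upwards [compMul_ae (Ω := Ω) (fun _ => 1) lg measurable_const measurable_lg x] with t ht
  rw [iota, ht, one_mul]

theorem disjoint_dyadicBlock {k l : ℤ} (h : k ≠ l) : Disjoint (dyadicBlock k) (dyadicBlock l) :=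
  disjoint_left.2 fun _ h1 h2 => h ((lg_of_mem h1).symm.trans (lg_of_mem h2))

theorem tsum_le_measure_iota (c : ℤ → ℝ) (s : ℝ≥0∞) :
    ∑' k : {k | k ∈ Ω.index ∧ s < ‖c k‖ₑ}, ENNReal.ofReal (2 ^ (k : ℤ)) ≤
      Ω.measure {t | s < ‖iota Ω c t‖ₑ} := by
  calc _ = ∑' k : {k | k ∈ Ω.index ∧ s < ‖c k‖ₑ}, Ω.measure (dyadicBlock k) :=
        tsum_congr fun k => (Domain.measure_block k.2.1).symm
    _ = Ω.measure (⋃ k : {k | k ∈ Ω.index ∧ s < ‖c k‖ₑ}, dyadicBlock k) := by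
        refine (measure_iUnion (fun k l h => disjoint_dyadicBlock fun h' => h (Subtype.ext h'))
          fun k => measurableSet_Ico).symm
    _ ≤ _ := by
        refine measure_mono_ae ?_
        filter_upwards [iota_ae (Ω := Ω) c] with t ht h
        obtain ⟨k, hk⟩ := mem_iUnion.1 h
        change s < ‖iota Ω c t‖ₑ
        rw [ht, lg_of_mem hk]
        exact k.2.2

/-- Comparison of a function with a step function through a map of the domain to the set of
blocks that does not increase measure. -/
theorem eNorm_le_eNorm_iota (X : RISpace Ω) {g : Ω.L0} (κ : ℝ → ℤ) (c : ℤ → ℝ)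
    (hg : ∀ᵐ t ∂Ω.measure, g t ≠ 0 → κ t ∈ Ω.index ∧ ‖g t‖ₑ ≤ ‖c (κ t)‖ₑ)
    (hκ : ∀ k ∈ Ω.index, Ω.measure {t | g t ≠ 0 ∧ κ t = k} ≤ ENNReal.ofReal (2 ^ k)) :
    X.eNorm g ≤ X.eNorm (iota Ω c) := by
  refine eNorm_le_of_measure_le X fun s => le_trans ?_ (tsum_le_measure_iota c s)
  calc _ ≤ Ω.measure (⋃ k : {k | k ∈ Ω.index ∧ s < ‖c k‖ₑ}, {t | g t ≠ 0 ∧ κ t = k}) := by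
        refine measure_mono_ae ?_
        filter_upwards [hg] with t ht (h : s < ‖g t‖ₑ)
        have h0 : g t ≠ 0 := fun h0 => by simp [h0] at h
        exact mem_iUnion.2 ⟨⟨κ t, (ht h0).1, h.trans_le (ht h0).2⟩, h0, rfl⟩
    _ ≤ _ := (measure_iUnion_le _).trans (ENNReal.tsum_le_tsum fun k => hκ k k.2.1)

/-- The sequence space of an r.i. space, as a lattice norm on sequences on `ℤ`. -/
def RISpace.seq (X : RISpace Ω) : SeqLattice Ω.index where
  N x := X.eNorm (iota Ω x)
  smul c x := by rw [map_smul, X.eNorm_smul]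
  add_le x y := by rw [map_add]; exact X.eNorm_add_le _ _
  mono x y h := X.eNorm_mono _ _ (by
    filter_upwards [iota_ae (Ω := Ω) x, iota_ae (Ω := Ω) y, Ω.ae_pos] with t h1 h2 h3
    rw [h1, h2]; exact h _ h3.2)
  fatou x M h := by
    refine X.eNorm_le_of_tendsto h ?_
    filter_upwards [ae_all_iff.2 fun n : ℕ => iota_ae (Ω := Ω) ((Icc (-n : ℤ) n).indicator x),
      iota_ae (Ω := Ω) x] with t h1 h2
    simp only [h1, h2]
    refine tendsto_atTop_of_eventually_const (i₀ := (lg t).natAbs) fun m hm => ?_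
    exact indicator_of_mem (s := Icc (-m : ℤ) m) ⟨by omega, by omega⟩ _
  single_ne_zero k hk h := by
    have h1 := (X.eNorm_eq_zero_iff _).1 h
    have h2 := tsum_le_measure_iota (Ω := Ω) (Pi.single k 1) 0
    rw [h1] at h2
    have h3 : Ω.measure {t | 0 < ‖(0 : Ω.L0) t‖ₑ} = 0 := by
      have := AEEqFun.coeFn_zero (μ := Ω.measure) (β := ℝ)
      refine measure_mono_null (t := {t | (0 : Ω.L0) t ≠ (0 : ℝ → ℝ) t}) (fun t ht => ?_) (ae_iff.1 this)
      intro h0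
      change 0 < ‖(0 : Ω.L0) t‖ₑ at ht
      rw [h0] at ht
      simp at ht
    rw [h3] at h2
    have h4 := (ENNReal.le_tsum (f := fun k : {j | j ∈ Ω.index ∧ 0 < ‖(Pi.single k (1 : ℝ) : ℤ → ℝ) j‖ₑ} =>
      ENNReal.ofReal (2 ^ (k : ℤ))) ⟨k, hk, by simp⟩).trans h2
    exact absurd (ENNReal.ofReal_eq_zero.1 (le_antisymm h4 zero_le)) (not_le.2 (by positivity))
  single_ne_top k hk := by
    refine (lt_of_le_of_lt (X.eNorm_mono _ (chi Ω.measure (dyadicBlock k) measurableSet_Ico) ?_)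
      (X.eNorm_chi_lt_top (dyadicBlock k) measurableSet_Ico
        (by rw [Domain.measure_block hk]; exact ENNReal.ofReal_lt_top))).ne
    have hchi : ∀ᵐ t ∂Ω.measure, chi Ω.measure (dyadicBlock k) measurableSet_Ico t =
        (dyadicBlock k).indicator (fun _ => (1 : ℝ)) t := AEEqFun.coeFn_mk _ _
    filter_upwards [iota_ae (Ω := Ω) (Pi.single k 1), hchi, Ω.ae_pos] with t h1 h2 h3
    rw [h1, h2]
    by_cases h : lg t = k
    · rw [indicator_of_mem ((lg_eq_iff h3.1 k).1 h)]
      simp [h]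
    · simp [h]

theorem seq_apply (X : RISpace Ω) (x : ℤ → ℝ) : X.seq.N x = X.eNorm (iota Ω x) := rfl

theorem piece_subset {k : ℤ} {P j : ℕ} (h : j < P) : Domain.piece k P j ⊆ dyadicBlock k := by
  have hP : (0 : ℝ) < P := by exact_mod_cast Nat.zero_lt_of_lt h
  refine Ico_subset_Ico ?_ ?_
  · have : (0 : ℝ) ≤ j / P := by positivity
    have h2 : (0 : ℝ) < 2 ^ k := by positivity
    nlinarith
  · rw [zpow_add_one₀ two_ne_zero]
    gcongr
    have : ((j : ℝ) + 1) / P ≤ 1 := by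
      rw [div_le_one hP]; exact_mod_cast h
    linarith

/-- The index of the part of the block at `k` that contains `t`. -/
def pieceIdx (k : ℤ) (P : ℕ) (t : ℝ) : ℕ := ⌊(t / 2 ^ k - 1) * P⌋₊

theorem measurable_pieceIdx (k : ℤ) (P : ℕ) : Measurable (pieceIdx k P) :=
  Nat.measurable_floor.comp (((measurable_id.div_const _).sub_const _).mul_const _)

theorem mem_piece_pieceIdx {t : ℝ} {k : ℤ} (ht : t ∈ dyadicBlock k) {P : ℕ} (hP : 0 < P) :
    pieceIdx k P t < P ∧ t ∈ Domain.piece k P (pieceIdx k P t) := by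
  have hP' : (0 : ℝ) < P := by exact_mod_cast hP
  have h2 : (0 : ℝ) < 2 ^ k := by positivity
  have h1 := ht.1
  have h3 := ht.2
  rw [zpow_add_one₀ two_ne_zero] at h3
  set u := (t / 2 ^ k - 1) * P
  have hu : 0 ≤ u := mul_nonneg (by rw [sub_nonneg, one_le_div h2]; exact h1) hP'.le
  have ht' : t = 2 ^ k * (1 + u / P) := by simp only [u]; field_simp; ring
  have huP : u < P := by
    have : t / 2 ^ k - 1 < 1 := by rw [sub_lt_iff_lt_add, div_lt_iff₀ h2]; linarith
    calc u < 1 * P := by simp only [u]; gcongr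
      _ = P := one_mul _
  refine ⟨(Nat.floor_lt hu).2 huP, ?_, ?_⟩
  · conv_rhs => rw [ht']
    gcongr; exact Nat.floor_le hu
  · conv_lhs => rw [ht']
    gcongr; exact Nat.lt_floor_add_one u

/-- A left translation places each value on a shorter block, so the distribution function can only
decrease and the constant is 1. -/
theorem shift_left_le (X : RISpace Ω) (d : ℕ) (x : ℤ → ℝ) :
    X.seq.N (shift (-d) (Ω.index.indicator x)) ≤ X.seq.N x := by
  have h0 : ∀ k d : ℤ, (2 : ℝ) ^ k = 2 ^ d * 2 ^ (k - d) := fun k d => by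
    rw [← zpow_add₀ two_ne_zero]; congr 1; ring
  set y := shift (-d) (Ω.index.indicator x)
  refine (X.seq.congr (y := Ω.index.indicator y) fun k hk => by simp [hk]).trans_le ?_
  refine eNorm_le_eNorm_iota X (g := iota Ω (Ω.index.indicator y)) (fun t => lg t + d) x ?_ fun k hk => ?_
  · filter_upwards [iota_ae (Ω := Ω) (Ω.index.indicator y)] with t ht h
    rw [ht] at h ⊢
    have h1 := mem_of_indicator_ne_zero h
    rw [indicator_of_mem h1] at h ⊢
    have h2 : lg t - -d ∈ Ω.index := mem_of_indicator_ne_zero (s := Ω.index) (f := x) h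
    have h3 : lg t - -d = lg t + d := by ring
    simp only [y, shift, indicator_of_mem h2]
    rw [h3] at h2 ⊢
    exact ⟨h2, le_rfl⟩
  · by_cases hk' : k - d ∈ Ω.index
    · calc _ ≤ Ω.measure (dyadicBlock (k - d)) := by
            refine measure_mono_ae ?_
            filter_upwards [Ω.ae_pos] with t ht h
            exact (lg_eq_iff ht.1 _).1 (by have := h.2; omega)
        _ = ENNReal.ofReal (2 ^ (k - d)) := Domain.measure_block hk'
        _ ≤ _ := ENNReal.ofReal_le_ofReal (zpow_le_zpow_right₀ one_le_two (by omega))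
    · refine le_of_eq_of_le (measure_mono_null_ae (t := ∅) ?_ measure_empty) zero_le
      filter_upwards [Ω.ae_pos] with t ht h
      refine (hk' ?_).elim
      rw [← h.2, add_sub_cancel_right]
      exact ht.2

/-- The union of the `i`-th halves of the blocks. -/
def halves (i : ℕ) : Set ℝ := ⋃ k : ℤ, Domain.piece k 2 i

theorem measurableSet_halves (i : ℕ) : MeasurableSet (halves i) :=
  MeasurableSet.iUnion fun _ => measurableSet_Ico

theorem Domain.divides_two {k : ℤ} (hk : k ∈ Ω.index) : Ω.Divides (k + 1) 2 := by
  by_cases hΩ : Ω = .naturals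
  · subst hΩ
    obtain ⟨n, rfl⟩ := Int.eq_ofNat_of_zero_le (show 0 ≤ k from hk)
    exact Domain.naturals_divides (n := n + 1) (e := 1) (by omega)
  · exact Domain.divides_of_ne hΩ _ two_pos

/-- A block is as long as one half of the next. Each of the two families of halves carries a
function whose distribution is dominated by that of `x`, whence the factor 2. -/
theorem shift_right_le (X : RISpace Ω) (x : ℤ → ℝ) :
    X.seq.N (shift 1 (Ω.index.indicator x)) ≤ 2 * X.seq.N x := by
  set y := shift 1 (Ω.index.indicator x)
  let g (i : ℕ) : Ω.L0 := compMul Ω ((halves i).indicator 1) lg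
    (measurable_one.indicator (measurableSet_halves i)) measurable_lg y
  have hg : ∀ i, ∀ᵐ t ∂Ω.measure, g i t = (halves i).indicator 1 t * y (lg t) := fun i =>
    compMul_ae _ _ _ _ _
  have h1 : ∀ i < 2, X.eNorm (g i) ≤ X.seq.N x := by
    intro i hi
    refine eNorm_le_eNorm_iota X (fun t => lg t - 1) x ?_ fun k hk => ?_
    · filter_upwards [hg i] with t ht h
      rw [ht] at h ⊢
      have h1 := left_ne_zero_of_mul h
      have h2 := right_ne_zero_of_mul h
      have h3 : lg t - 1 ∈ Ω.index := mem_of_indicator_ne_zero (s := Ω.index) (f := x) h2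
      refine ⟨h3, ?_⟩
      rw [indicator_of_mem (mem_of_indicator_ne_zero h1)]
      simp [y, shift, h3]
    · refine le_trans ?_ (((Domain.divides_two hk).2 i).trans (ENNReal.ofReal_le_ofReal (le_of_eq ?_)))
      · refine measure_mono_ae ?_
        filter_upwards [hg i] with t ht h
        obtain ⟨h1, h2⟩ : g i t ≠ 0 ∧ lg t - 1 = k := h
        rw [ht] at h1
        have h4 := mem_of_indicator_ne_zero (left_ne_zero_of_mul h1)
        obtain ⟨l, hl⟩ := mem_iUnion.1 h4
        have h5 := lg_of_mem (piece_subset hi hl)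
        rw [show k + 1 = l by omega]
        exact hl
      · rw [zpow_add_one₀ two_ne_zero]; simp
  calc _ ≤ X.eNorm (g 0 + g 1) := by
        refine X.eNorm_mono _ _ ?_
        filter_upwards [iota_ae (Ω := Ω) y, hg 0, hg 1, AEEqFun.coeFn_add (g 0) (g 1), Ω.ae_pos]
          with t h1 h2 h3 h4 h5
        rw [h1, h4, Pi.add_apply, h2, h3, ← add_mul, abs_mul]
        obtain ⟨hj, hjt⟩ := mem_piece_pieceIdx (mem_block_lg h5.1) two_pos
        set j := pieceIdx (lg t) 2 t
        have h6 : t ∈ halves j := mem_iUnion.2 ⟨_, hjt⟩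
        have h7 : ∀ i, 0 ≤ (halves i).indicator (1 : ℝ → ℝ) t := fun i =>
          indicator_nonneg (fun _ _ => zero_le_one) _
        have h8 : (halves j).indicator (1 : ℝ → ℝ) t = 1 := by simp [h6]
        have h9 : 1 ≤ |(halves 0).indicator (1 : ℝ → ℝ) t + (halves 1).indicator (1 : ℝ → ℝ) t| := by
          refine le_trans ?_ (le_abs_self _)
          interval_cases j
          · linarith [h7 1]
          · linarith [h7 0]
        exact le_mul_of_one_le_left (abs_nonneg _) h9
    _ ≤ X.seq.N x + X.seq.N x := (X.eNorm_add_le _ _).trans (add_le_add (h1 0 two_pos) (h1 1 one_lt_two))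
    _ = _ := (two_mul _).symm

variable {Ω : Domain}

/-! ## Averaging -/

theorem sum_range_add_mod {M : Type*} [AddCommMonoid M] {P : ℕ} (hP : 0 < P) (i : ℕ) (φ : ℕ → M) :
    ∑ j ∈ Finset.range P, φ ((j + i) % P) = ∑ j ∈ Finset.range P, φ j := by
  have hmaps : MapsTo (fun j => (j + i) % P) (Finset.range P : Set ℕ) (Finset.range P) := by
    intro j _
    simpa using Nat.mod_lt _ hP
  have hinj : InjOn (fun j => (j + i) % P) (Finset.range P : Set ℕ) := by
    intro j hj j' hj' h
    have h1 : j ≡ j' [MOD P] := Nat.ModEq.add_right_cancel' i h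
    exact Nat.ModEq.eq_of_lt_of_lt h1 (by simpa using hj) (by simpa using hj')
  exact Finset.sum_nbij _ hmaps hinj (Finset.surjOn_of_injOn_of_card_le _ hmaps hinj le_rfl)
    fun _ _ => rfl

theorem sum_range_mul_mod {M : Type*} [AddCommMonoid M] {P : ℕ} (hP : 0 < P) (i m : ℕ) (φ : ℕ → M) :
    ∑ j ∈ Finset.range (P * m), φ ((i + j) % P) = m • ∑ j ∈ Finset.range P, φ j := by
  induction m with
  | zero => simp
  | succ m ih =>
    rw [mul_add, mul_one, Finset.sum_range_add, ih, succ_nsmul]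
    congr 1
    rw [← sum_range_add_mod hP i φ]
    refine Finset.sum_congr rfl fun j _ => ?_
    rw [show i + (P * m + j) = j + i + P * m by ring, Nat.add_mul_mod_self_left]

theorem coeFn_sum {ι : Type*} (s : Finset ι) (f : ι → Ω.L0) :
    ∀ᵐ t ∂Ω.measure, (∑ i ∈ s, f i) t = ∑ i ∈ s, f i t := by
  classical
  induction s using Finset.induction_on with
  | empty =>
    filter_upwards [AEEqFun.coeFn_zero (μ := Ω.measure) (β := ℝ)] with t ht
    simpa using ht
  | insert i s hi ih =>
    simp only [Finset.sum_insert hi]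
    filter_upwards [ih, AEEqFun.coeFn_add (f i) (∑ i ∈ s, f i)] with t h1 h2
    rw [h2, Pi.add_apply, h1]

theorem eNorm_sum_le (X : KotheSpace Ω.measure) {ι : Type*} (s : Finset ι) (f : ι → Ω.L0) :
    X.eNorm (∑ i ∈ s, f i) ≤ ∑ i ∈ s, X.eNorm (f i) := by
  classical
  induction s using Finset.induction_on with
  | empty => simp [(X.eNorm_eq_zero_iff 0).2 rfl]
  | insert i s hi ih =>
    rw [Finset.sum_insert hi, Finset.sum_insert hi]
    exact (X.eNorm_add_le _ _).trans (by gcongr)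

open Classical in
/-- Averages over the blocks of a step function dominated by `h` in distribution. -/
theorem N_average_le (X : RISpace Ω) (s : Finset ℤ) (P : ℤ → ℕ) {Q : ℕ} (hQ : 0 < Q)
    (hdiv : ∀ k ∈ s, Ω.Divides k (P k)) (hPQ : ∀ k ∈ s, P k ∣ Q) (d : ℤ → ℕ → ℝ) (h : Ω.L0)
    (hdist : ∀ σ : ℝ≥0∞, ∑ k ∈ s, ∑ j ∈ Finset.range (P k),
      (if σ < ‖d k j‖ₑ then ENNReal.ofReal (2 ^ k / P k) else 0) ≤ Ω.measure {t | σ < ‖h t‖ₑ}) :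
    X.seq.N (fun k => if k ∈ s then (∑ j ∈ Finset.range (P k), d k j) / P k else 0) ≤ X.eNorm h := by
  -- The values of each block are placed on its equal parts after a cyclic rotation by `i`. Each
  -- rotation is dominated by `h` in distribution, and the mean over a common period `Q` is the
  -- function of block averages.
  let G (i : ℕ) (t : ℝ) : ℝ := ∑ k ∈ s, (dyadicBlock k).indicator
    (fun t => d k ((pieceIdx k (P k) t + i) % P k)) t
  have hGm : ∀ i, Measurable (G i) := fun i => Finset.measurable_sum _ fun k _ =>
    ((measurable_from_top (f := fun j => d k ((j + i) % P k))).comp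
      (measurable_pieceIdx k (P k))).indicator measurableSet_Ico
  have hG : ∀ i t, 0 < t → G i t = if lg t ∈ s then
      d (lg t) ((pieceIdx (lg t) (P (lg t)) t + i) % P (lg t)) else 0 := by
    intro i t ht
    by_cases hs : lg t ∈ s
    · rw [if_pos hs]
      simp only [G]
      rw [Finset.sum_eq_single_of_mem _ hs, indicator_of_mem (mem_block_lg ht)]
      intro k _ hk
      exact indicator_of_notMem (fun h' => hk (lg_of_mem h').symm) _
    · rw [if_neg hs]
      refine Finset.sum_eq_zero fun k hk => indicator_of_notMem (fun h' => hs ?_) _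
      rwa [lg_of_mem h']
  let g (i : ℕ) : Ω.L0 := AEEqFun.mk (G i) (hGm i).aestronglyMeasurable
  have hg : ∀ i, ∀ᵐ t ∂Ω.measure, g i t = G i t := fun i => AEEqFun.coeFn_mk _ _
  have hgN : ∀ i, X.eNorm (g i) ≤ X.eNorm h := by
    intro i
    refine eNorm_le_of_measure_le X fun σ => le_trans ?_ (hdist σ)
    calc Ω.measure {t | σ < ‖g i t‖ₑ}
        ≤ Ω.measure (⋃ k ∈ s, ⋃ j ∈ Finset.range (P k),
          if σ < ‖d k ((j + i) % P k)‖ₑ then Domain.piece k (P k) j else ∅) := by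
          refine measure_mono_ae ?_
          filter_upwards [hg i, Ω.ae_pos] with t h1 h2 h3
          change σ < ‖g i t‖ₑ at h3
          rw [h1, hG i t h2.1] at h3
          by_cases hs : lg t ∈ s
          · rw [if_pos hs] at h3
            have h4 := mem_piece_pieceIdx (mem_block_lg h2.1) (hdiv _ hs).1
            refine mem_iUnion₂.2 ⟨lg t, hs, mem_iUnion₂.2 ⟨_, Finset.mem_range.2 h4.1, ?_⟩⟩
            rw [if_pos h3]; exact h4.2
          · rw [if_neg hs] at h3
            simp at h3
      _ ≤ ∑ k ∈ s, ∑ j ∈ Finset.range (P k), Ω.measure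
          (if σ < ‖d k ((j + i) % P k)‖ₑ then Domain.piece k (P k) j else ∅) :=
          (measure_biUnion_finset_le _ _).trans
            (Finset.sum_le_sum fun k _ => measure_biUnion_finset_le _ _)
      _ ≤ ∑ k ∈ s, ∑ j ∈ Finset.range (P k),
          (if σ < ‖d k ((j + i) % P k)‖ₑ then ENNReal.ofReal (2 ^ k / P k) else 0) := by
          refine Finset.sum_le_sum fun k hk => Finset.sum_le_sum fun j _ => ?_
          split_ifs with hlt
          · exact (hdiv k hk).2 j
          · simp
      _ = _ := by
          refine Finset.sum_congr rfl fun k hk => ?_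
          exact sum_range_add_mod (hdiv k hk).1 i fun j =>
            if σ < ‖d k j‖ₑ then ENNReal.ofReal (2 ^ k / P k) else 0
  have hQ' : (Q : ℝ) ≠ 0 := by exact_mod_cast hQ.ne'
  calc _ ≤ X.eNorm ((Q : ℝ)⁻¹ • ∑ i ∈ Finset.range Q, g i) := by
        refine X.eNorm_mono _ _ (Eventually.mono ?_ fun t => le_of_eq ∘ congr_arg abs)
        filter_upwards [iota_ae (Ω := Ω) fun k => if k ∈ s then
            (∑ j ∈ Finset.range (P k), d k j) / P k else 0, Ω.ae_pos, ae_all_iff.2 hg,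
          coeFn_sum (Finset.range Q) g, AEEqFun.coeFn_smul (Q : ℝ)⁻¹ (∑ i ∈ Finset.range Q, g i)]
          with t h1 h2 h3 h4 h5
        rw [h1, h5, Pi.smul_apply, h4]
        simp only [h3, hG _ t h2.1]
        by_cases hs : lg t ∈ s
        · simp only [if_pos hs]
          obtain ⟨m, hm⟩ := hPQ _ hs
          have hm' : (Q : ℝ) = P (lg t) * m := by exact_mod_cast hm
          have hP0 : (P (lg t) : ℝ) ≠ 0 := by exact_mod_cast (hdiv _ hs).1.ne'
          have hm0 : (m : ℝ) ≠ 0 := fun h0 => hQ' (by rw [hm', h0, mul_zero])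
          conv_rhs => rw [hm]
          rw [sum_range_mul_mod (hdiv _ hs).1 _ m (d (lg t))]
          push_cast
          rw [nsmul_eq_mul, smul_eq_mul]
          field_simp
        · simp [hs]
    _ ≤ (Q : ℝ≥0∞)⁻¹ * ∑ i ∈ Finset.range Q, X.eNorm h := by
        rw [X.eNorm_smul, enorm_inv hQ', Real.enorm_natCast]
        gcongr
        exact (eNorm_sum_le _ _ _).trans (Finset.sum_le_sum fun i _ => hgN i)
    _ = X.eNorm h := by
        rw [Finset.sum_const, Finset.card_range, nsmul_eq_mul, ← mul_assoc,
          ENNReal.inv_mul_cancel (by exact_mod_cast hQ.ne') (ENNReal.natCast_ne_top Q), one_mul]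

/-- For `l < 1`, on a finite window `l x` is dominated by `y n` for all large `n`. The Fatou
property removes the window and `l → 1` the factor. -/
theorem SeqLattice.le_of_liminf {J : Set ℤ} (E : SeqLattice J) {x : ℤ → ℝ} {y : ℕ → ℤ → ℝ}
    {M : ℝ≥0∞} (hy : ∀ n, E.N (y n) ≤ M)
    (hx : ∀ k ∈ J, ‖x k‖ₑ ≤ liminf (fun n => ‖y n k‖ₑ) atTop) : E.N x ≤ M := by
  refine E.fatou x M fun m => ?_
  set z := (Icc (-m : ℤ) m).indicator x
  have key : ∀ l : ℝ, 0 < l → l < 1 → ENNReal.ofReal l * E.N z ≤ M := by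
    intro l hl0 hl1
    have h1 : ∀ k ∈ Finset.Icc (-m : ℤ) m, ∀ᶠ n in atTop, k ∈ J → ‖l * x k‖ₑ ≤ ‖y n k‖ₑ := by
      intro k _
      by_cases hk : k ∈ J
      · by_cases h0 : x k = 0
        · simp [h0]
        · have h2 : ‖l * x k‖ₑ < ‖x k‖ₑ := by
            rw [enorm_mul, Real.enorm_of_nonneg hl0.le]
            calc _ < 1 * ‖x k‖ₑ := by
                  refine (ENNReal.mul_lt_mul_iff_left (by simpa using h0) enorm_ne_top).2 ?_
                  simpa using hl1
              _ = _ := one_mul _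
          filter_upwards [eventually_lt_of_lt_liminf (h2.trans_le (hx k hk))] with n hn _
          exact hn.le
      · simp [hk]
    obtain ⟨n, hn⟩ := ((Filter.eventually_all_finset _).2 h1).exists
    refine le_trans ?_ (hy n)
    rw [← Real.enorm_of_nonneg hl0.le, ← E.smul]
    refine E.mono _ _ fun k hk => ?_
    by_cases hkm : k ∈ Icc (-m : ℤ) m
    · have := hn k (by simpa using hkm) hk
      rw [Pi.smul_apply, smul_eq_mul]
      simp only [z]
      rw [indicator_of_mem hkm]
      rwa [Real.enorm_eq_ofReal_abs, Real.enorm_eq_ofReal_abs,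
        ENNReal.ofReal_le_ofReal_iff (abs_nonneg _)] at this
    · simp [z, indicator_of_notMem hkm]
  have h1 : Tendsto (fun n : ℕ => ENNReal.ofReal (1 - 1 / ((n : ℝ) + 2)) * E.N z) atTop
      (𝓝 (ENNReal.ofReal 1 * E.N z)) := by
    refine ENNReal.Tendsto.mul_const (ENNReal.tendsto_ofReal ?_) (Or.inl (by simp))
    have : Tendsto (fun n : ℕ => 1 / ((n : ℝ) + 2)) atTop (𝓝 0) :=
      tendsto_const_nhds.div_atTop (tendsto_atTop_add_const_right _ _ tendsto_natCast_atTop_atTop)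
    simpa using this.const_sub 1
  rw [ENNReal.ofReal_one, one_mul] at h1
  refine le_of_tendsto' h1 fun n => key _ ?_ ?_
  · have : (0 : ℝ) < n + 2 := by positivity
    rw [sub_pos, div_lt_one this]
    have := n.cast_nonneg (α := ℝ)
    linarith
  · have : (0 : ℝ) < 1 / (n + 2) := by positivity
    linarith

/-! ### Sampling the decreasing rearrangement -/

variable {Ω : Domain}

/-- The restriction of `f` to `S`, extended by `0`. -/
def restr (S : Set ℝ) (hS : MeasurableSet S) (f : Ω.L0) : Ω.L0 :=
  AEEqFun.mk (S.indicator f) (f.stronglyMeasurable.indicator hS).aestronglyMeasurable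

theorem restr_ae (S : Set ℝ) (hS : MeasurableSet S) (f : Ω.L0) :
    ∀ᵐ t ∂Ω.measure, restr S hS f t = S.indicator f t := AEEqFun.coeFn_mk _ _

theorem measure_restr (S : Set ℝ) (hS : MeasurableSet S) (f : Ω.L0) (σ : ℝ≥0∞) :
    Ω.measure {t | σ < ‖restr S hS f t‖ₑ} = Ω.measure (S ∩ {t | σ < ‖f t‖ₑ}) := by
  refine measure_congr ?_
  filter_upwards [restr_ae S hS f] with t ht
  refine propext ?_
  change σ < ‖restr S hS f t‖ₑ ↔ t ∈ S ∧ σ < ‖f t‖ₑ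
  rw [ht]
  by_cases h : t ∈ S <;> simp [h]

namespace Domain

/-- The number of parts of the block at `k` in the `n`-th subdivision. -/
def parts (Ω : Domain) (n : ℕ) (k : ℤ) : ℕ :=
  2 ^ (match Ω with
    | .naturals => min n k.toNat
    | _ => n)

theorem parts_pos (n : ℕ) (k : ℤ) : 0 < Ω.parts n k := by unfold parts; positivity

theorem parts_divides (n : ℕ) {k : ℤ} (hk : k ∈ Ω.index) : Ω.Divides k (Ω.parts n k) := by
  cases Ω with
  | halfLine => exact divides_of_ne (by simp) _ (parts_pos n k)
  | unitInterval => exact divides_of_ne (by simp) _ (parts_pos n k)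
  | naturals =>
    obtain ⟨m, rfl⟩ := Int.eq_ofNat_of_zero_le (show 0 ≤ k from hk)
    exact naturals_divides (min_le_right _ _)

theorem parts_dvd (n : ℕ) (k : ℤ) : Ω.parts n k ∣ 2 ^ n := by
  refine pow_dvd_pow 2 ?_
  cases Ω with
  | naturals => exact min_le_left _ _
  | _ => exact le_rfl

theorem naturals_measure_eq {A : Set ℝ} (hA : MeasurableSet A) :
    ∃ N : ℕ∞, Domain.naturals.measure A = N := by
  rw [Domain.measure, Measure.restrict_apply hA,
    Measure.count_apply (hA.inter (measurableSet_carrier .naturals))]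
  exact ⟨_, rfl⟩

/-- The error of rounding a measure down to a multiple of the mesh. On intervals it is at most the
mesh; on `ℕ` the mesh is eventually 1 and nothing is lost, and until then the value `⊤` makes the
claim void. -/
theorem exists_discretization_error {k : ℤ} (hk : k ∈ Ω.index) :
    ∃ ε : ℕ → ℝ≥0∞, Tendsto ε atTop (𝓝 0) ∧ ∀ n j : ℕ, ∀ A : Set ℝ, MeasurableSet A →
      Ω.measure A < ENNReal.ofReal ((j + 1) * (2 ^ k / Ω.parts n k)) →
      Ω.measure A ≤ ENNReal.ofReal (j * (2 ^ k / Ω.parts n k)) + ε n := by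
  by_cases hΩ : Ω = .naturals
  · subst hΩ
    obtain ⟨m, rfl⟩ := Int.eq_ofNat_of_zero_le (show 0 ≤ k from hk)
    refine ⟨fun n => if m ≤ n then 0 else ⊤,
      tendsto_atTop_of_eventually_const (i₀ := m) fun n hn => if_pos hn, fun n j A hA h => ?_⟩
    by_cases hn : m ≤ n
    · have h1 : (2 : ℝ) ^ (m : ℤ) / parts .naturals n m = 1 := by
        simp only [parts]
        rw [Int.toNat_natCast, min_eq_right hn]
        push_cast
        rw [zpow_natCast, div_self (by positivity)]
      obtain ⟨N, hN⟩ := naturals_measure_eq hA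
      rw [h1, mul_one, hN] at h ⊢
      simp only [if_pos hn]
      rw [add_zero, ENNReal.ofReal_natCast]
      have h2 : ENNReal.ofReal ((j : ℝ) + 1) = ((j + 1 : ℕ) : ℝ≥0∞) := by
        rw [← ENNReal.ofReal_natCast]; push_cast; rfl
      rw [h2] at h
      have h3 : N < (j + 1 : ℕ) := by exact_mod_cast h
      have h4 : N ≤ j := by
        refine Order.le_of_lt_add_one ?_
        exact_mod_cast h3
      exact_mod_cast h4
    · simp [hn]
  · refine ⟨fun n => ENNReal.ofReal (2 ^ k / Ω.parts n k), ?_, fun n j A _ h => ?_⟩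
    · have h1 : ∀ n, (Ω.parts n k : ℝ) = 2 ^ n := by
        intro n
        cases Ω with
        | naturals => exact absurd rfl hΩ
        | _ => simp [parts]
      simp only [h1]
      rw [← ENNReal.ofReal_zero]
      exact ENNReal.tendsto_ofReal (tendsto_const_nhds.div_atTop
        (tendsto_pow_atTop_atTop_of_one_lt one_lt_two))
    · refine h.le.trans ?_
      rw [add_mul, one_mul]
      exact ENNReal.ofReal_add_le

end Domain

/-- The values at equidistant points of the truncated decreasing rearrangement. -/
def sample (g : Ω.L0) (δ : ℝ) (n j : ℕ) : ℝ := (min (rearr g ((j + 1) * δ)) n).toReal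

theorem enorm_sample (g : Ω.L0) (δ : ℝ) (n j : ℕ) :
    ‖sample g δ n j‖ₑ = min (rearr g ((j + 1) * δ)) n := by
  rw [sample, Real.enorm_of_nonneg ENNReal.toReal_nonneg, ENNReal.ofReal_toReal]
  exact ((min_le_right _ _).trans_lt (ENNReal.natCast_lt_top n)).ne

/-- Samples are taken at right end points of a decreasing function, so they underestimate: if the
sample with index `m` exceeds `σ`, then so does `|g|` on a set of measure at least `(m + 1) δ`. -/
theorem sum_sample_le (g : Ω.L0) (δ : ℝ) (n P : ℕ) (σ : ℝ≥0∞) :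
    ∑ j ∈ Finset.range P, (if σ < ‖sample g δ n j‖ₑ then ENNReal.ofReal δ else 0) ≤
      Ω.measure {t | σ < ‖g t‖ₑ} := by
  rw [← Finset.sum_filter]
  set T := (Finset.range P).filter fun j => σ < ‖sample g δ n j‖ₑ
  rcases T.eq_empty_or_nonempty with h | h
  · simp [h]
  · have h1 := T.max'_mem h
    set m := T.max' h
    have h2 : σ < rearr g ((m + 1) * δ) := by
      have := (Finset.mem_filter.1 h1).2
      rw [enorm_sample] at this
      exact this.trans_le (min_le_left _ _)
    refine le_trans ?_ (le_measure_of_lt_rearr h2)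
    have h3 : T ⊆ Finset.range (m + 1) := fun j hj =>
      Finset.mem_range.2 (Nat.lt_succ_of_le (T.le_max' j hj))
    refine (Finset.sum_le_sum_of_subset h3).trans (le_of_eq ?_)
    rw [Finset.sum_const, Finset.card_range, nsmul_eq_mul, ENNReal.ofReal_mul (by positivity)]
    congr 1
    rw [← ENNReal.ofReal_natCast]; push_cast; rfl

/-- Every `j` with `(j + 1) δ` at most the measure of the level set contributes `δ`. The first `j`
that fails leaves only the rounding error `ε`. -/
theorem le_sum_sample (g : Ω.L0) {δ : ℝ} {n P : ℕ} {σ σ' ε : ℝ≥0∞} (hn : σ < n)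
    (hσ : σ < σ') (hP : Ω.measure {t | σ' < ‖g t‖ₑ} ≤ ENNReal.ofReal (P * δ))
    (hε : ∀ j : ℕ, Ω.measure {t | σ' < ‖g t‖ₑ} < ENNReal.ofReal ((j + 1) * δ) →
      Ω.measure {t | σ' < ‖g t‖ₑ} ≤ ENNReal.ofReal (j * δ) + ε) :
    Ω.measure {t | σ' < ‖g t‖ₑ} ≤
      ∑ j ∈ Finset.range P, (if σ < ‖sample g δ n j‖ₑ then ENNReal.ofReal δ else 0) + ε := by
  have hterm : ∀ j : ℕ, ENNReal.ofReal ((j + 1) * δ) ≤ Ω.measure {t | σ' < ‖g t‖ₑ} →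
      σ < ‖sample g δ n j‖ₑ := fun j hj => by
    rw [enorm_sample]
    exact lt_min (hσ.trans_le (le_rearr_of_le_measure hj)) hn
  have hsum : ∀ m ≤ P, (∀ j < m, ENNReal.ofReal ((j + 1) * δ) ≤ Ω.measure {t | σ' < ‖g t‖ₑ}) →
      ENNReal.ofReal (m * δ) ≤
        ∑ j ∈ Finset.range P, (if σ < ‖sample g δ n j‖ₑ then ENNReal.ofReal δ else 0) := by
    intro m hm hj
    calc ENNReal.ofReal (m * δ) = ∑ j ∈ Finset.range m, ENNReal.ofReal δ := by
          rw [Finset.sum_const, Finset.card_range, nsmul_eq_mul, ENNReal.ofReal_mul (by positivity),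
            ENNReal.ofReal_natCast]
      _ = ∑ j ∈ Finset.range m, (if σ < ‖sample g δ n j‖ₑ then ENNReal.ofReal δ else 0) :=
          Finset.sum_congr rfl fun j hjm =>
            (if_pos (hterm j (hj j (Finset.mem_range.1 hjm)))).symm
      _ ≤ _ := Finset.sum_le_sum_of_subset (by simpa using hm)
  classical
  by_cases hall : ∀ j < P, ENNReal.ofReal ((j + 1) * δ) ≤ Ω.measure {t | σ' < ‖g t‖ₑ}
  · exact (hP.trans (hsum P le_rfl hall)).trans le_self_add
  · push Not at hall
    have h1 := Nat.find_spec hall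
    refine (hε _ h1.2).trans ?_
    gcongr
    refine hsum _ h1.1.le fun j hj => ?_
    have := Nat.find_min hall hj
    push Not at this
    exact this (hj.trans h1.1)

theorem measure_lt_le_liminf {k : ℤ} (hk : k ∈ Ω.index) (g : Ω.L0)
    (hg : ∀ σ, Ω.measure {t | σ < ‖g t‖ₑ} ≤ ENNReal.ofReal (2 ^ k)) {σ : ℝ≥0∞} (hσt : σ ≠ ⊤) :
    Ω.measure {t | σ < ‖g t‖ₑ} ≤
      liminf (fun n : ℕ => ∑ j ∈ Finset.range (Ω.parts n k),
        (if σ < ‖sample g (2 ^ k / Ω.parts n k) n j‖ₑ then ENNReal.ofReal (2 ^ k / Ω.parts n k)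
          else 0)) atTop := by
  obtain ⟨ε, hε0, hε⟩ := Domain.exists_discretization_error hk
  have key : ∀ σ', σ < σ' → Ω.measure {t | σ' < ‖g t‖ₑ} ≤
      liminf (fun n : ℕ => ∑ j ∈ Finset.range (Ω.parts n k),
        (if σ < ‖sample g (2 ^ k / Ω.parts n k) n j‖ₑ then ENNReal.ofReal (2 ^ k / Ω.parts n k)
          else 0)) atTop := by
    intro σ' hσ'
    refine le_of_forall_lt_imp_le_of_dense fun a ha => ?_
    refine le_liminf_of_le (by isBoundedDefault) ?_
    obtain ⟨m, hm⟩ := ENNReal.exists_nat_gt hσt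
    have hpos : 0 < Ω.measure {t | σ' < ‖g t‖ₑ} - a := tsub_pos_of_lt ha
    filter_upwards [eventually_ge_atTop m, hε0.eventually_lt_const hpos] with n hn hεn
    have hmn : σ < n := hm.trans_le (by exact_mod_cast hn)
    have hP0 : (Ω.parts n k : ℝ) ≠ 0 := by exact_mod_cast (Domain.parts_pos n k).ne'
    have h1 := le_sum_sample g (δ := 2 ^ k / Ω.parts n k) (P := Ω.parts n k) hmn hσ'
      (by rw [mul_div_cancel₀ _ hP0]; exact hg σ')
      (fun j => hε n j _ (measurableSet_lt_enorm g σ'))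
    have h2 : a + ε n ≤ Ω.measure {t | σ' < ‖g t‖ₑ} := by
      rw [add_comm]
      exact (lt_tsub_iff_right.1 hεn).le
    have h3 : ε n ≠ ⊤ := (hεn.trans_le le_top).ne
    exact (ENNReal.add_le_add_iff_right h3).1 (h2.trans h1)
  have hu : {t | σ < ‖g t‖ₑ} = ⋃ n : ℕ, {t | σ + (n + 1 : ℝ≥0∞)⁻¹ < ‖g t‖ₑ} := by
    ext a
    simp only [mem_ofPred_eq, mem_iUnion]
    constructor
    · intro ha
      have h0 : ‖g a‖ₑ - σ ≠ 0 := (tsub_pos_of_lt ha).ne'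
      obtain ⟨n, hn⟩ := ENNReal.exists_inv_nat_lt h0
      refine ⟨n, ?_⟩
      rw [add_comm]
      refine lt_tsub_iff_right.1 (lt_of_le_of_lt ?_ hn)
      exact ENNReal.inv_le_inv.2 le_self_add
    · rintro ⟨n, hn⟩
      exact lt_of_le_of_lt le_self_add hn
  have hmono : Monotone fun n : ℕ => {t | σ + (n + 1 : ℝ≥0∞)⁻¹ < ‖g t‖ₑ} := by
    intro n m hnm a ha
    have h4 : ((m : ℝ≥0∞) + 1)⁻¹ ≤ (n + 1 : ℝ≥0∞)⁻¹ := by gcongr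
    exact lt_of_le_of_lt (add_le_add le_rfl h4) ha
  rw [hu, hmono.measure_iUnion]
  refine iSup_le fun n => key _ ?_
  have h3 : σ + 0 < σ + (n + 1 : ℝ≥0∞)⁻¹ :=
    ENNReal.add_lt_add_left hσt (by rw [ENNReal.inv_pos]; finiteness)
  rwa [add_zero] at h3

theorem lintegral_enorm_eq {α : Type*} [MeasurableSpace α] {μ : Measure α} {f : α → ℝ}
    (hf : Measurable f) :
    ∫⁻ a, ‖f a‖ₑ ∂μ = ∫⁻ σ in Ioi (0 : ℝ), μ {a | ENNReal.ofReal σ < ‖f a‖ₑ} := by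
  have h1 := lintegral_eq_lintegral_meas_lt μ (f := fun a => |f a|)
    (Eventually.of_forall fun a => abs_nonneg (f a)) hf.abs.aemeasurable
  simp only [← Real.enorm_eq_ofReal_abs] at h1
  rw [h1]
  refine setLIntegral_congr_fun measurableSet_Ioi fun σ hσ => ?_
  congr 1
  ext a
  simp only [mem_ofPred_eq, Real.enorm_eq_ofReal_abs]
  rw [ENNReal.ofReal_lt_ofReal_iff_of_nonneg (le_of_lt hσ)]

/-- The averages of the samples exhaust the average of `|g|`. -/
theorem lintegral_le_liminf {k : ℤ} (hk : k ∈ Ω.index) (g : Ω.L0)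
    (hg : ∀ σ, Ω.measure {t | σ < ‖g t‖ₑ} ≤ ENNReal.ofReal (2 ^ k)) :
    ENNReal.ofReal (2 ^ (-k)) * ∫⁻ t, ‖g t‖ₑ ∂Ω.measure ≤
      liminf (fun n : ℕ => ‖(∑ j ∈ Finset.range (Ω.parts n k),
        sample g (2 ^ k / Ω.parts n k) n j) / Ω.parts n k‖ₑ) atTop := by
  have hint : ∀ d δ : ℝ, 0 ≤ d →
      ∫⁻ σ in Ioi (0 : ℝ), (if ENNReal.ofReal σ < ‖d‖ₑ then ENNReal.ofReal δ else 0) =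
        ENNReal.ofReal δ * ‖d‖ₑ := by
    intro d δ hd
    have h1 : ∀ σ ∈ Ioi (0 : ℝ), (if ENNReal.ofReal σ < ‖d‖ₑ then ENNReal.ofReal δ else 0) =
        (Iio d).indicator (fun _ => ENNReal.ofReal δ) σ := by
      intro σ hσ
      rw [Real.enorm_of_nonneg hd]
      have : ENNReal.ofReal σ < ENNReal.ofReal d ↔ σ ∈ Iio d :=
        ENNReal.ofReal_lt_ofReal_iff_of_nonneg (le_of_lt hσ)
      by_cases h : σ ∈ Iio d
      · rw [indicator_of_mem h, if_pos (this.2 h)]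
      · rw [indicator_of_notMem h, if_neg fun h' => h (this.1 h')]
    rw [setLIntegral_congr_fun measurableSet_Ioi h1, lintegral_indicator measurableSet_Iio,
      lintegral_const, Measure.restrict_apply MeasurableSet.univ, univ_inter,
      Measure.restrict_apply measurableSet_Iio, Iio_inter_Ioi, Real.volume_Ioo, sub_zero,
      Real.enorm_of_nonneg hd]
  rw [lintegral_enorm_eq g.stronglyMeasurable.measurable]
  have hmeas : ∀ n : ℕ, ∀ j, Measurable fun σ : ℝ =>
      (if ENNReal.ofReal σ < ‖sample g (2 ^ k / Ω.parts n k) n j‖ₑ then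
        ENNReal.ofReal (2 ^ k / Ω.parts n k) else 0) := fun n j =>
    Measurable.ite (measurableSet_lt ENNReal.measurable_ofReal measurable_const)
      measurable_const measurable_const
  -- The layer cake formula for `g` and for the samples, with Fatou's lemma in the level `σ`.
  have h1 : ∫⁻ σ in Ioi (0 : ℝ), Ω.measure {a | ENNReal.ofReal σ < ‖g a‖ₑ} ≤
      liminf (fun n : ℕ => ∑ j ∈ Finset.range (Ω.parts n k), ENNReal.ofReal (2 ^ k / Ω.parts n k) *
        ‖sample g (2 ^ k / Ω.parts n k) n j‖ₑ) atTop := by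
    refine (lintegral_mono fun σ => measure_lt_le_liminf hk g hg ENNReal.ofReal_ne_top).trans ?_
    refine (lintegral_liminf_le fun n => Finset.measurable_sum _ fun j _ => hmeas n j).trans
      (le_of_eq ?_)
    congr 1
    ext n
    rw [lintegral_finsetSum _ fun j _ => hmeas n j]
    exact Finset.sum_congr rfl fun j _ => hint _ _ ENNReal.toReal_nonneg
  have h2 : ENNReal.ofReal (2 ^ (-k)) ≠ ⊤ := ENNReal.ofReal_ne_top
  calc _ ≤ ENNReal.ofReal (2 ^ (-k)) * _ := mul_le_mul_right h1 _
    _ = liminf (fun n : ℕ => ENNReal.ofReal (2 ^ (-k)) * ∑ j ∈ Finset.range (Ω.parts n k),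
        ENNReal.ofReal (2 ^ k / Ω.parts n k) * ‖sample g (2 ^ k / Ω.parts n k) n j‖ₑ) atTop :=
        (ENNReal.liminf_const_mul_of_ne_top h2).symm
    _ = _ := by
        congr 1
        ext n
        have h3 : ∀ j, 0 ≤ sample g (2 ^ k / Ω.parts n k) n j := fun _ => ENNReal.toReal_nonneg
        have hP0 : (0 : ℝ) < Ω.parts n k := by exact_mod_cast Domain.parts_pos n k
        rw [Real.enorm_of_nonneg (div_nonneg (Finset.sum_nonneg fun j _ => h3 j) hP0.le),
          ← Finset.mul_sum]
        simp only [Real.enorm_of_nonneg (h3 _)]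
        rw [← ENNReal.ofReal_sum_of_nonneg fun j _ => h3 j, ← ENNReal.ofReal_mul (by positivity),
          ← ENNReal.ofReal_mul (by positivity)]
        congr 1
        rw [zpow_neg]
        field_simp

/-- Averaging over disjoint sets of measure at most `2 ^ k` does not increase the norm. -/
theorem N_le_of_average (X : RISpace Ω) (S : ℤ → Set ℝ) (hS : ∀ k, MeasurableSet (S k))
    (hdisj : Pairwise fun k l => Disjoint (S k) (S l))
    (hμ : ∀ k ∈ Ω.index, Ω.measure (S k) ≤ ENNReal.ofReal (2 ^ k)) (h : Ω.L0) (x : ℤ → ℝ)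
    (hx : ∀ k ∈ Ω.index, ‖x k‖ₑ ≤ ENNReal.ofReal (2 ^ (-k)) * ∫⁻ t in S k, ‖h t‖ₑ ∂Ω.measure) :
    X.seq.N x ≤ X.eNorm h := by
  classical
  let g (k : ℤ) : Ω.L0 := restr (S k) (hS k) h
  let s (n : ℕ) : Finset ℤ := (Finset.Icc (-n : ℤ) n).filter (· ∈ Ω.index)
  -- The restriction of `h` to each `S k` is replaced by samples of its rearrangement, jointly
  -- dominated by `h` in distribution. Their block averages have norm at most that of `h`, and their
  -- lower limits dominate `x`.
  refine X.seq.le_of_liminf (y := fun n k => if k ∈ s n then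
    (∑ j ∈ Finset.range (Ω.parts n k), sample (g k) (2 ^ k / Ω.parts n k) n j) / Ω.parts n k
    else 0) (fun n => ?_) fun k hk => ?_
  · refine N_average_le X (s n) (Ω.parts n) (Q := 2 ^ n) (by positivity)
      (fun k hk => Domain.parts_divides n (Finset.mem_filter.1 hk).2) (fun k _ => Domain.parts_dvd n k)
      (fun k j => sample (g k) (2 ^ k / Ω.parts n k) n j) h fun σ => ?_
    calc _ ≤ ∑ k ∈ s n, Ω.measure (S k ∩ {t | σ < ‖h t‖ₑ}) := by
          refine Finset.sum_le_sum fun k _ => ?_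
          rw [← measure_restr (S k) (hS k) h σ]
          exact sum_sample_le (g k) _ n _ σ
      _ = Ω.measure (⋃ k ∈ s n, S k ∩ {t | σ < ‖h t‖ₑ}) :=
          (measure_biUnion_finset (fun k _ l _ hkl =>
            (hdisj hkl).mono inter_subset_left inter_subset_left)
            fun k _ => (hS k).inter (measurableSet_lt_enorm h σ)).symm
      _ ≤ _ := measure_mono (iUnion₂_subset fun k _ => inter_subset_right)
  · have h1 : ∫⁻ t, ‖g k t‖ₑ ∂Ω.measure = ∫⁻ t in S k, ‖h t‖ₑ ∂Ω.measure := by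
      rw [← lintegral_indicator (hS k)]
      refine lintegral_congr_ae ?_
      filter_upwards [restr_ae (S k) (hS k) h] with t ht
      rw [ht]
      by_cases hts : t ∈ S k <;> simp [hts]
    refine (hx k hk).trans ?_
    rw [← h1]
    refine (lintegral_le_liminf hk (g k) fun σ => ?_).trans (le_of_eq (liminf_congr ?_))
    · rw [measure_restr]
      exact (measure_mono inter_subset_left).trans (hμ k hk)
    · filter_upwards [eventually_ge_atTop k.natAbs] with n hn
      rw [if_pos]
      exact Finset.mem_filter.2 ⟨Finset.mem_Icc.2 ⟨by omega, by omega⟩, hk⟩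

variable {Ω : Domain}

/-! ## Discretization of functions -/

/-- There are no atoms: `a ↦ μ(A ∩ (-∞, a])` is Lipschitz with constant 1, and the intermediate
value theorem applies. -/
theorem Domain.exists_subset_of_ne (hΩ : Ω ≠ .naturals) {A : Set ℝ} (hA : MeasurableSet A) {c : ℝ}
    (hc : 0 ≤ c) (h : ENNReal.ofReal c ≤ Ω.measure A) :
    ∃ C ⊆ A, MeasurableSet C ∧ Ω.measure C = ENNReal.ofReal c := by
  have hvol := Ω.measure_le_volume hΩ
  rcases eq_or_lt_of_le h with h | h
  · exact ⟨A, subset_rfl, hA, h.symm⟩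
  have hneg : Ω.measure (Iic 0) = 0 := by
    rw [measure_eq_zero_iff_ae_notMem]
    filter_upwards [Ω.ae_pos] with t ht h'
    exact absurd ht.1 (not_lt.2 h')
  have hfin : ∀ a, Ω.measure (A ∩ Iic a) ≠ ⊤ := fun a => by
    refine (lt_of_le_of_lt (measure_mono (t := Iic 0 ∪ Ioc 0 a) fun t ht => ?_)
      ((measure_union_le _ _).trans_lt (ENNReal.add_lt_top.2 ⟨by rw [hneg]; exact ENNReal.zero_lt_top,
        (hvol _).trans_lt (by rw [Real.volume_Ioc]; exact ENNReal.ofReal_lt_top)⟩))).ne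
    rcases le_or_gt t 0 with h0 | h0
    · exact Or.inl h0
    · exact Or.inr ⟨h0, ht.2⟩
  let φ : ℝ → ℝ := fun a => (Ω.measure (A ∩ Iic a)).toReal
  have hφ : Continuous φ := by
    refine LipschitzWith.continuous (K := 1) (LipschitzWith.of_le_add fun x y => ?_)
    have h1 : Ω.measure (A ∩ Iic x) ≤ Ω.measure (A ∩ Iic y) + ENNReal.ofReal (dist x y) := by
      calc _ ≤ Ω.measure ((A ∩ Iic y) ∪ Ioc y x) := measure_mono fun t ht => by
            rcases le_or_gt t y with h0 | h0
            · exact Or.inl ⟨ht.1, h0⟩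
            · exact Or.inr ⟨h0, ht.2⟩
        _ ≤ _ := (measure_union_le _ _).trans (by
            gcongr
            refine (hvol _).trans ?_
            rw [Real.volume_Ioc]
            exact ENNReal.ofReal_le_ofReal (le_abs_self _))
    have h2 := ENNReal.toReal_mono (by finiteness [hfin y]) h1
    rwa [ENNReal.toReal_add (hfin y) ENNReal.ofReal_ne_top, ENNReal.toReal_ofReal dist_nonneg] at h2
  have hu : ⋃ n : ℕ, A ∩ Iic (n : ℝ) = A := by
    rw [← inter_iUnion]
    refine inter_eq_left.2 fun t _ => ?_
    obtain ⟨n, hn⟩ := exists_nat_ge t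
    exact mem_iUnion.2 ⟨n, hn⟩
  have hmono : Monotone fun n : ℕ => A ∩ Iic (n : ℝ) := fun n m hnm =>
    inter_subset_inter_right _ (Iic_subset_Iic.2 (by exact_mod_cast hnm))
  rw [← hu, hmono.measure_iUnion] at h
  obtain ⟨n, hn⟩ := lt_iSup_iff.1 h
  have h0 : φ 0 = 0 := by
    simp only [φ]
    rw [measure_mono_null inter_subset_right hneg, ENNReal.toReal_zero]
  have h1 : c ≤ φ n := by
    have := ENNReal.toReal_mono (hfin n) hn.le
    rwa [ENNReal.toReal_ofReal hc] at this
  obtain ⟨a, -, ha⟩ := intermediate_value_Icc n.cast_nonneg hφ.continuousOn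
    (show c ∈ Icc (φ 0) (φ n) from ⟨by rw [h0]; exact hc, h1⟩)
  refine ⟨A ∩ Iic a, inter_subset_left, hA.inter measurableSet_Iic, ?_⟩
  rw [← ha]
  exact (ENNReal.ofReal_toReal (hfin a)).symm

theorem Domain.exists_subset {k : ℤ} (hk : k ∈ Ω.index) {A : Set ℝ} (hA : MeasurableSet A)
    (h : ENNReal.ofReal (2 ^ k) ≤ Ω.measure A) :
    ∃ C ⊆ A, MeasurableSet C ∧ Ω.measure C = ENNReal.ofReal (2 ^ k) := by
  by_cases hΩ : Ω = .naturals
  · subst hΩ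
    obtain ⟨m, rfl⟩ := Int.eq_ofNat_of_zero_le (show 0 ≤ k from hk)
    have h2 : ENNReal.ofReal (2 ^ (m : ℤ)) = ((2 ^ m : ℕ) : ℕ∞) := by
      rw [zpow_natCast, show (2 : ℝ) ^ m = ((2 ^ m : ℕ) : ℝ) by push_cast; rfl,
        ENNReal.ofReal_natCast]
      rfl
    rw [Domain.measure, Measure.restrict_apply hA,
      Measure.count_apply (hA.inter (measurableSet_carrier .naturals)), h2] at h
    obtain ⟨C, hC, hCc⟩ := exists_subset_encard_eq (k := (2 ^ m : ℕ)) (by exact_mod_cast h)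
    have hCm : MeasurableSet C := (Set.finite_of_encard_eq_coe hCc).measurableSet
    refine ⟨C, hC.trans inter_subset_left, hCm, ?_⟩
    rw [Domain.measure, Measure.restrict_apply hCm,
      Measure.count_apply (hCm.inter (measurableSet_carrier .naturals)), h2,
      inter_eq_left.2 (hC.trans inter_subset_right), hCc]
  · exact Domain.exists_subset_of_ne hΩ hA (by positivity) h

/-- `N_le_of_average` with the single set `S` placed at `k`. An infinite integral is approached
through arbitrarily large finite values. -/
theorem lintegral_mul_le (X : RISpace Ω) {k : ℤ} (hk : k ∈ Ω.index) {S : Set ℝ}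
    (hS : MeasurableSet S) (hμ : Ω.measure S ≤ ENNReal.ofReal (2 ^ k)) (h : Ω.L0) :
    ENNReal.ofReal (2 ^ (-k)) * (∫⁻ t in S, ‖h t‖ₑ ∂Ω.measure) * X.seq.N (Pi.single k 1) ≤
      X.eNorm h := by
  classical
  have key : ∀ c : ℝ, ‖c‖ₑ ≤ ENNReal.ofReal (2 ^ (-k)) * (∫⁻ t in S, ‖h t‖ₑ ∂Ω.measure) →
      ‖c‖ₑ * X.seq.N (Pi.single k 1) ≤ X.eNorm h := by
    intro c hc
    rw [← X.seq.smul]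
    refine N_le_of_average X (fun l => if l = k then S else ∅) (fun l => ?_) (fun l l' hl => ?_)
      (fun l hl => ?_) h _ fun l hl => ?_
    · split_ifs
      · exact hS
      · exact MeasurableSet.empty
    · by_cases h1 : l = k
      · simp [h1, show l' ≠ k from fun h' => hl (h1.trans h'.symm)]
      · simp [h1]
    · split_ifs with h1
      · rw [h1]; exact hμ
      · simp
    · by_cases h1 : l = k
      · subst h1; simpa using hc
      · simp [h1]
  set L := ENNReal.ofReal (2 ^ (-k)) * (∫⁻ t in S, ‖h t‖ₑ ∂Ω.measure)
  by_cases hL : L = ⊤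
  · rw [hL, ENNReal.top_mul (X.seq.single_ne_zero k hk), top_le_iff]
    refine ENNReal.eq_top_of_forall_nnreal_le fun r => ?_
    have h0 := X.seq.single_ne_zero k hk
    have ht := X.seq.single_ne_top k hk
    have h1 := key (r / X.seq.N (Pi.single k 1)).toReal (by rw [hL]; exact le_top)
    rwa [Real.enorm_of_nonneg ENNReal.toReal_nonneg, ENNReal.ofReal_toReal
      (ENNReal.div_ne_top ENNReal.coe_ne_top h0), ENNReal.div_mul_cancel h0 ht] at h1
  · have h1 : ‖L.toReal‖ₑ = L := by
      rw [Real.enorm_of_nonneg ENNReal.toReal_nonneg, ENNReal.ofReal_toReal hL]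
    rw [← h1]
    exact key _ h1.le

/-- Functions with uniformly bounded integrals over the sets of measure at most `2 ^ k`. -/
def LocallyIntegrable (f : Ω.L0) : Prop :=
  ∀ k ∈ Ω.index, ∃ M : NNReal, ∀ S, MeasurableSet S → Ω.measure S ≤ ENNReal.ofReal (2 ^ k) →
    ∫⁻ t in S, ‖f t‖ₑ ∂Ω.measure ≤ M

theorem locallyIntegrable_of_lt_top (X : RISpace Ω) {f : Ω.L0} (hf : X.eNorm f < ⊤) :
    LocallyIntegrable f := by
  intro k hk
  have h0 := X.seq.single_ne_zero k hk
  have hfin : ENNReal.ofReal (2 ^ k) * (X.eNorm f / X.seq.N (Pi.single k 1)) ≠ ⊤ :=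
    ENNReal.mul_ne_top ENNReal.ofReal_ne_top (ENNReal.div_ne_top hf.ne h0)
  refine ⟨(ENNReal.ofReal (2 ^ k) * (X.eNorm f / X.seq.N (Pi.single k 1))).toNNReal, fun S hS hμ => ?_⟩
  rw [ENNReal.coe_toNNReal hfin]
  have h1 := lintegral_mul_le X hk hS hμ f
  rw [← ENNReal.le_div_iff_mul_le (Or.inl h0) (Or.inl (X.seq.single_ne_top k hk))] at h1
  calc _ = ENNReal.ofReal (2 ^ k) * (ENNReal.ofReal (2 ^ (-k)) * ∫⁻ t in S, ‖f t‖ₑ ∂Ω.measure) := by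
        rw [← mul_assoc, ← ENNReal.ofReal_mul (by positivity), ← zpow_add₀ two_ne_zero]
        simp
    _ ≤ _ := by gcongr

theorem LocallyIntegrable.add {f g : Ω.L0} (hf : LocallyIntegrable f) (hg : LocallyIntegrable g) :
    LocallyIntegrable (f + g) := by
  intro k hk
  obtain ⟨M, hM⟩ := hf k hk
  obtain ⟨M', hM'⟩ := hg k hk
  refine ⟨M + M', fun S hS hμ => ?_⟩
  calc ∫⁻ t in S, ‖(f + g) t‖ₑ ∂Ω.measure ≤ ∫⁻ t in S, (‖f t‖ₑ + ‖g t‖ₑ) ∂Ω.measure := by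
        refine lintegral_mono_ae (ae_restrict_of_ae ?_)
        filter_upwards [AEEqFun.coeFn_add f g] with t ht
        rw [ht]; exact enorm_add_le _ _
    _ = ∫⁻ t in S, ‖f t‖ₑ ∂Ω.measure + ∫⁻ t in S, ‖g t‖ₑ ∂Ω.measure :=
        lintegral_add_left f.stronglyMeasurable.measurable.enorm _
    _ ≤ _ := by push_cast; exact add_le_add (hM S hS hμ) (hM' S hS hμ)

theorem locallyIntegrable_of_mem_sumSpace (X Y : RISpace Ω) {f : Ω.L0}
    (hf : f ∈ sumSpace X.toKotheSpace Y.toKotheSpace) : LocallyIntegrable f := by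
  obtain ⟨x, hx, y, hy, rfl⟩ := Submodule.mem_sup.1 hf
  exact (locallyIntegrable_of_lt_top X hx).add (locallyIntegrable_of_lt_top Y hy)

/-- An infinite value would provide sets of measure `2 ^ k` on which `|f|` exceeds any prescribed
bound. -/
theorem LocallyIntegrable.rearr_ne_top {f : Ω.L0} (hf : LocallyIntegrable f) {k : ℤ}
    (hk : k ∈ Ω.index) : rearr f (2 ^ k) ≠ ⊤ := by
  intro htop
  obtain ⟨M, hM⟩ := hf k hk
  have h2 : (0 : ℝ) < 2 ^ k := by positivity
  set σ : ℝ≥0∞ := (M + 1) / ENNReal.ofReal (2 ^ k)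
  have h0 : ENNReal.ofReal (2 ^ k) ≠ 0 := by simpa using h2
  have hσ : σ < rearr f (2 ^ k) := by
    rw [htop]; exact lt_top_iff_ne_top.2 (ENNReal.div_ne_top (by finiteness) h0)
  obtain ⟨C, hCs, hCm, hC⟩ := Domain.exists_subset hk (measurableSet_lt_enorm f σ)
    (le_measure_of_lt_rearr hσ)
  have h1 : σ * ENNReal.ofReal (2 ^ k) ≤ M := by
    calc _ = ∫⁻ _ in C, σ ∂Ω.measure := by rw [setLIntegral_const, hC]
      _ ≤ ∫⁻ t in C, ‖f t‖ₑ ∂Ω.measure := setLIntegral_mono' hCm fun t ht => le_of_lt (hCs ht)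
      _ ≤ M := hM C hCm hC.le
  rw [ENNReal.div_mul_cancel h0 ENNReal.ofReal_ne_top] at h1
  have h3 : (M + 1 : NNReal) ≤ M := by exact_mod_cast h1
  exact absurd h3 (by simp)

/-- Averaging operators. -/
theorem exists_average_operator (S : ℤ → Set ℝ) (hS : ∀ k, MeasurableSet (S k))
    (hdisj : ∀ k l, k ≠ l → k % 2 = l % 2 → Disjoint (S k) (S l))
    (hμ : ∀ k ∈ Ω.index, Ω.measure (S k) ≤ ENNReal.ofReal (2 ^ k)) {w : ℝ → ℝ} (hw : Measurable w)
    (hw1 : ∀ t, |w t| ≤ 1) :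
    ∃ A : Ω.L0 →ₗ[ℝ] (ℤ → ℝ), (∀ (X : RISpace Ω) h, X.seq.N (A h) ≤ 2 * X.eNorm h) ∧
      ∀ h, LocallyIntegrable h → ∀ k ∈ Ω.index,
        A h k = 2 ^ (-k) * ∫ t in S k, w t * h t ∂Ω.measure := by
  classical
  -- Integrals are linear only where they converge. The operator is defined on this subspace and
  -- extended algebraically; a function outside it has infinite norm in every r.i. space, so the
  -- norm bound is not affected.
  let V : Submodule ℝ Ω.L0 :=
    { carrier := {h | ∀ k ∈ Ω.index, IntegrableOn (fun t => w t * h t) (S k) Ω.measure}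
      add_mem' := fun {f g} hf hg k hk => ((hf k hk).add (hg k hk)).congr (ae_restrict_of_ae (by
        filter_upwards [AEEqFun.coeFn_add f g] with t ht
        rw [ht]; simp [mul_add]))
      zero_mem' := fun k hk => (integrable_zero _ _ _).congr (ae_restrict_of_ae (by
        filter_upwards [AEEqFun.coeFn_zero (μ := Ω.measure) (β := ℝ)] with t ht
        rw [ht]; simp))
      smul_mem' := fun c f hf k hk => ((hf k hk).const_mul c).congr (ae_restrict_of_ae (by
        filter_upwards [AEEqFun.coeFn_smul c f] with t ht
        rw [ht]; simp; ring)) }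
  have hV : ∀ h, LocallyIntegrable h → h ∈ V := by
    intro h hh k hk
    refine ⟨(hw.mul h.stronglyMeasurable.measurable).aestronglyMeasurable, ?_⟩
    obtain ⟨M, hM⟩ := hh k hk
    refine lt_of_le_of_lt (lintegral_mono fun t => ?_)
      ((hM (S k) (hS k) (hμ k hk)).trans_lt ENNReal.coe_lt_top)
    rw [enorm_mul]
    refine mul_le_of_le_one_left zero_le ?_
    rw [Real.enorm_eq_ofReal_abs]
    simpa using hw1 t
  let A₀ : V →ₗ[ℝ] (ℤ → ℝ) :=
    { toFun := fun h k => if k ∈ Ω.index then 2 ^ (-k) * ∫ t in S k, w t * (h : Ω.L0) t ∂Ω.measure else 0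
      map_add' := fun f g => by
        ext k
        by_cases hk : k ∈ Ω.index
        · simp only [if_pos hk, Pi.add_apply, ← mul_add]
          rw [← integral_add (f.2 k hk) (g.2 k hk)]
          congr 1
          refine integral_congr_ae (ae_restrict_of_ae ?_)
          filter_upwards [AEEqFun.coeFn_add (f : Ω.L0) g] with t ht
          rw [Submodule.coe_add, ht]; simp [mul_add]
        · simp [hk]
      map_smul' := fun c f => by
        ext k
        by_cases hk : k ∈ Ω.index
        · simp only [if_pos hk, Pi.smul_apply, RingHom.id_apply, smul_eq_mul]
          rw [mul_left_comm, ← integral_const_mul c (fun t => w t * (f : Ω.L0) t)]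
          congr 1
          refine integral_congr_ae (ae_restrict_of_ae ?_)
          filter_upwards [AEEqFun.coeFn_smul c (f : Ω.L0)] with t ht
          rw [Submodule.coe_smul, ht]; simp; ring
        · simp [hk] }
  obtain ⟨A, hA⟩ := LinearMap.exists_extend A₀
  have hAV : ∀ h (hh : h ∈ V) k, A h k =
      if k ∈ Ω.index then 2 ^ (-k) * ∫ t in S k, w t * h t ∂Ω.measure else 0 := by
    intro h hh k
    have := LinearMap.congr_fun hA ⟨h, hh⟩
    exact congr_fun this k
  refine ⟨A, fun X h => ?_, fun h hh k hk => by rw [hAV h (hV h hh), if_pos hk]⟩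
  by_cases htop : X.eNorm h = ⊤
  · rw [htop, ENNReal.mul_top two_ne_zero]; exact le_top
  have hh := locallyIntegrable_of_lt_top X (lt_top_iff_ne_top.2 htop)
  -- Sets with indices of one parity are disjoint, so averaging over them is contractive; two
  -- parities give the constant 2.
  have hpar : ∀ i : ℤ, X.seq.N ({k | k % 2 = i}.indicator (A h)) ≤ X.eNorm h := by
    intro i
    refine N_le_of_average X (fun k => if k % 2 = i then S k else ∅) (fun k => ?_)
      (fun k l hkl => ?_) (fun k hk => ?_) h _ fun k hk => ?_
    · split_ifs
      · exact hS k
      · exact MeasurableSet.empty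
    · by_cases h1 : k % 2 = i
      · by_cases h2 : l % 2 = i
        · simp only [h1, h2, if_true]; exact hdisj k l hkl (h1.trans h2.symm)
        · simp [h2]
      · simp [h1]
    · split_ifs
      · exact hμ k hk
      · simp
    · by_cases h1 : k % 2 = i
      · rw [indicator_of_mem (by exact h1), if_pos h1, hAV h (hV h hh), if_pos hk, enorm_mul,
          Real.enorm_of_nonneg (by positivity)]
        gcongr
        refine (enorm_integral_le_lintegral_enorm _).trans (lintegral_mono fun t => ?_)
        rw [enorm_mul]
        refine mul_le_of_le_one_left zero_le ?_
        rw [Real.enorm_eq_ofReal_abs]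
        simpa using hw1 t
      · rw [indicator_of_notMem (s := {k | k % 2 = i}) h1]; simp
  calc _ ≤ X.seq.N ({k | k % 2 = 0}.indicator (A h) + {k | k % 2 = 1}.indicator (A h)) := by
        refine X.seq.mono _ _ fun k _ => le_of_eq ?_
        have h0 : ∀ i : ℤ, {k | k % 2 = i}.indicator (A h) k = if k % 2 = i then A h k else 0 :=
          fun i => indicator_apply _ _ _
        rw [Pi.add_apply, h0, h0]
        rcases Int.emod_two_eq_zero_or_one k with h1 | h1 <;> rw [h1] <;> simp
    _ ≤ X.eNorm h + X.eNorm h := (X.seq.add_le _ _).trans (add_le_add (hpar 0) (hpar 1))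
    _ = _ := (two_mul _).symm

variable {Ω : Domain}

/-- Sets of measures `2 ^ (k - 2)`, `2 ^ (k - 4)`, … use up at most half of a set of measure `2 ^
k`. With indices of both parities they could cover all of it. -/
theorem tsum_ofReal_le (k : ℤ) :
    ∑' i : ℕ, ENNReal.ofReal (2 ^ (k - 2 * (i + 1))) ≤ ENNReal.ofReal (2 ^ k / 2) := by
  have h1 : ∀ i : ℕ, (2 : ℝ) ^ (k - 2 * (i + 1)) = 2 ^ k / 4 * (1 / 4) ^ i := by
    intro i
    rw [show k - 2 * ((i : ℤ) + 1) = k - 2 - 2 * i by ring, zpow_sub₀ two_ne_zero,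
      zpow_sub₀ two_ne_zero, zpow_mul, zpow_natCast]
    norm_num
    field_simp
    rw [← mul_pow]; norm_num
  have h2 : HasSum (fun i : ℕ => (2 : ℝ) ^ k / 4 * (1 / 4) ^ i) (2 ^ k / 4 * (1 - 1 / 4)⁻¹) :=
    (hasSum_geometric_of_lt_one (by norm_num) (by norm_num)).mul_left _
  simp only [h1]
  rw [← ENNReal.ofReal_tsum_of_nonneg (fun i => by positivity) h2.summable, h2.tsum_eq]
  refine ENNReal.ofReal_le_ofReal ?_
  have : (0 : ℝ) < 2 ^ k := by positivity
  norm_num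
  linarith

/-- A bounded averaging operator that does not annihilate the given function. -/
theorem exists_discretization {f : Ω.L0} (hf : LocallyIntegrable f) :
    ∃ A : Ω.L0 →ₗ[ℝ] (ℤ → ℝ), (∀ (X : RISpace Ω) h, X.seq.N (A h) ≤ 2 * X.eNorm h) ∧
      ∀ k ∈ Ω.index, rearr f (2 ^ k) ≤ 4 * ‖A f k‖ₑ := by
  classical
  -- Sets of measure exactly `2 ^ k` on which `|f|` is at least half of `f*(2 ^ k)`; the half is
  -- needed because `f*(2 ^ k)` need not be exceeded on a set of that measure.
  have hex : ∀ k : ℤ, ∃ C : Set ℝ, MeasurableSet C ∧ Ω.measure C ≤ ENNReal.ofReal (2 ^ k) ∧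
      (k ∈ Ω.index → rearr f (2 ^ k) ≠ 0 → Ω.measure C = ENNReal.ofReal (2 ^ k) ∧
        ∀ t ∈ C, rearr f (2 ^ k) / 2 ≤ ‖f t‖ₑ) := by
    intro k
    by_cases h : k ∈ Ω.index ∧ rearr f (2 ^ k) ≠ 0
    · obtain ⟨C, h1, h2, h3⟩ := Domain.exists_subset h.1 (measurableSet_lt_enorm f _)
        (le_measure_of_lt_rearr (ENNReal.half_lt_self h.2 (hf.rearr_ne_top h.1)))
      exact ⟨C, h2, h3.le, fun _ _ => ⟨h3, fun t ht => le_of_lt (h1 ht)⟩⟩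
    · exact ⟨∅, MeasurableSet.empty, by simp, fun h1 h2 => absurd ⟨h1, h2⟩ h⟩
  choose C hCm hCμ hC using hex
  -- Removing the earlier sets of the same parity makes the rest disjoint and keeps at least half of
  -- the measure.
  set U : ℤ → Set ℝ := fun k => ⋃ i : ℕ, C (k - 2 * (i + 1))
  have hUm : ∀ k, MeasurableSet (U k) := fun k => MeasurableSet.iUnion fun i => hCm _
  have hU : ∀ k, Ω.measure (U k) ≤ ENNReal.ofReal (2 ^ k / 2) := fun k =>
    (measure_iUnion_le _).trans ((ENNReal.tsum_le_tsum fun i => hCμ _).trans (tsum_ofReal_le k))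
  -- The weight is the sign of `f`, so the averages do not cancel.
  have hw : Measurable fun t => if 0 ≤ f t then (1 : ℝ) else -1 :=
    Measurable.ite (measurableSet_le measurable_const f.stronglyMeasurable.measurable)
      measurable_const measurable_const
  obtain ⟨A, hA, hAf⟩ := exists_average_operator (Ω := Ω) (fun k => C k \ U k)
    (fun k => (hCm k).diff (hUm k)) (fun k l hkl hpar => by
      have key : ∀ k l : ℤ, k < l → k % 2 = l % 2 → Disjoint (C k \ U k) (C l \ U l) := by
        intro k l hlt hpar
        refine disjoint_left.2 fun t ht ht' => ht'.2 (mem_iUnion.2 ⟨((l - k) / 2 - 1).toNat, ?_⟩)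
        have : l - 2 * ((((l - k) / 2 - 1).toNat : ℤ) + 1) = k := by omega
        rw [this]; exact ht.1
      rcases lt_or_gt_of_ne hkl with h | h
      · exact key k l h hpar
      · exact (key l k h hpar.symm).symm)
    (fun k _ => (measure_mono sdiff_subset).trans (hCμ k)) hw
    (fun t => by split_ifs <;> simp)
  refine ⟨A, hA, fun k hk => ?_⟩
  by_cases h0 : rearr f (2 ^ k) = 0
  · rw [h0]; exact zero_le
  obtain ⟨h1, h2⟩ := hC k hk h0
  have h2k : (0 : ℝ) < 2 ^ k := by positivity
  have h3 : ENNReal.ofReal (2 ^ k / 2) ≤ Ω.measure (C k \ U k) := by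
    have h4 : Ω.measure (C k) ≤ Ω.measure (C k \ U k) + Ω.measure (U k) :=
      (measure_mono fun t ht => by
        by_cases h : t ∈ U k
        · exact Or.inr h
        · exact Or.inl ⟨ht, h⟩).trans (measure_union_le _ _)
    have h5 : ENNReal.ofReal (2 ^ k / 2) + ENNReal.ofReal (2 ^ k / 2) ≤
        Ω.measure (C k \ U k) + ENNReal.ofReal (2 ^ k / 2) := by
      rw [← ENNReal.ofReal_add (by positivity) (by positivity), add_halves, ← h1]
      exact h4.trans (by gcongr; exact hU k)
    exact (ENNReal.add_le_add_iff_right ENNReal.ofReal_ne_top).1 h5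
  obtain ⟨M, hM⟩ := hf k hk
  have hint : IntegrableOn (fun t => f t) (C k \ U k) Ω.measure :=
    ⟨f.aestronglyMeasurable.restrict, (hM _ ((hCm k).diff (hUm k))
      ((measure_mono sdiff_subset).trans (hCμ k))).trans_lt ENNReal.coe_lt_top⟩
  have h6 : ‖A f k‖ₑ = ENNReal.ofReal (2 ^ (-k)) * ∫⁻ t in C k \ U k, ‖f t‖ₑ ∂Ω.measure := by
    rw [hAf f hf k hk, enorm_mul, Real.enorm_of_nonneg (by positivity),
      ← ofReal_integral_norm_eq_lintegral_enorm hint]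
    congr 1
    rw [Real.enorm_of_nonneg]
    · congr 1
      refine integral_congr_ae (Eventually.of_forall fun t => ?_)
      simp only [Real.norm_eq_abs]
      split_ifs with h
      · rw [one_mul, abs_of_nonneg h]
      · rw [neg_one_mul, abs_of_neg (not_le.1 h)]
    · refine integral_nonneg fun t => ?_
      simp only [Pi.zero_apply]
      split_ifs with h
      · rwa [one_mul]
      · rw [neg_one_mul]; linarith [not_le.1 h]
  rw [h6]
  have h7 : rearr f (2 ^ k) / 2 * ENNReal.ofReal (2 ^ k / 2) ≤
      ∫⁻ t in C k \ U k, ‖f t‖ₑ ∂Ω.measure := by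
    calc _ ≤ rearr f (2 ^ k) / 2 * Ω.measure (C k \ U k) := by gcongr
      _ = ∫⁻ _ in C k \ U k, rearr f (2 ^ k) / 2 ∂Ω.measure := (setLIntegral_const _ _).symm
      _ ≤ _ := setLIntegral_mono' ((hCm k).diff (hUm k)) fun t ht => h2 t ht.1
  calc rearr f (2 ^ k) = 4 * (ENNReal.ofReal (2 ^ (-k)) *
        (rearr f (2 ^ k) / 2 * ENNReal.ofReal (2 ^ k / 2))) := by
        have h8 : ENNReal.ofReal (2 ^ (-k)) * ENNReal.ofReal (2 ^ k / 2) = 2⁻¹ := by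
          rw [← ENNReal.ofReal_mul (by positivity), zpow_neg,
            show ((2 : ℝ) ^ k)⁻¹ * (2 ^ k / 2) = 2⁻¹ by field_simp,
            ENNReal.ofReal_inv_of_pos two_pos]
          simp
        rw [mul_left_comm (ENNReal.ofReal (2 ^ (-k))), h8, div_eq_mul_inv]
        have h9 : (4 : ℝ≥0∞) * (2⁻¹ * 2⁻¹) = 1 := by
          rw [show (4 : ℝ≥0∞) = 2 * 2 by norm_num, mul_mul_mul_comm,
            ENNReal.mul_inv_cancel two_ne_zero (by simp), one_mul]
        rw [mul_assoc, mul_left_comm, h9, mul_one]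
    _ ≤ _ := by gcongr

/-! ### Level sets and synthesis of a function -/

/-- The set where `|f|` is between `f*(2 ^ (k + 1))` and `f*(2 ^ k)`. -/
def levelSet (f : Ω.L0) (k : ℤ) : Set ℝ :=
  {t | (k ∈ Ω.index ∧ k + 1 ∈ Ω.index) ∧ ‖f t‖ₑ ≤ rearr f (2 ^ k) ∧ rearr f (2 ^ (k + 1)) < ‖f t‖ₑ}

theorem measurableSet_levelSet (f : Ω.L0) (k : ℤ) : MeasurableSet (levelSet f k) :=
  (MeasurableSet.const _).inter ((measurableSet_le f.stronglyMeasurable.measurable.enorm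
    measurable_const).inter (measurableSet_lt_enorm f _))

theorem levelSet_disjoint (f : Ω.L0) {k l : ℤ} {t : ℝ} (hk : t ∈ levelSet f k)
    (hl : t ∈ levelSet f l) : k = l := by
  have key : ∀ k l : ℤ, k < l → t ∈ levelSet f k → t ∉ levelSet f l := by
    intro k l hlt hk hl
    have h1 := rearr_antitone f (zpow_le_zpow_right₀ one_le_two (show k + 1 ≤ l by omega) :
      (2 : ℝ) ^ (k + 1) ≤ 2 ^ l)
    exact absurd (hk.2.2.trans_le (hl.2.1.trans h1)) (lt_irrefl _)
  rcases lt_trichotomy k l with h | h | h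
  · exact absurd hl (key k l h hk)
  · exact h
  · exact absurd hk (key l k h hl)

theorem Domain.index_ordConnected (Ω : Domain) : Ω.index.OrdConnected := by
  cases Ω with
  | halfLine => exact ordConnected_univ
  | unitInterval => exact ordConnected_Iio
  | naturals => exact ordConnected_Ici

/-- On `ℕ` every point has measure 1, so `j = 0` serves. On the intervals the set where `|f|`
exceeds `f*(2 ^ j)` has measure at most `2 ^ j`, which tends to `0` as `j → -∞`. -/
theorem ae_exists_le_rearr (f : Ω.L0) :
    ∀ᵐ t ∂Ω.measure, ∃ j ∈ Ω.index, ‖f t‖ₑ ≤ rearr f (2 ^ j) := by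
  by_cases hΩ : Ω = .naturals
  · subst hΩ
    refine ae_restrict_of_forall_mem (measurableSet_carrier .naturals) fun t ht => ?_
    refine ⟨0, le_refl (0 : ℤ), ?_⟩
    refine le_iSup_of_le {t} (le_iSup_of_le (measurableSet_singleton t) (le_iSup_of_le ?_ ?_))
    · rw [Domain.measure, Measure.restrict_apply (measurableSet_singleton t),
        inter_eq_left.2 (singleton_subset_iff.2 ht), Measure.count_singleton]
      simp
    · simp
  · rw [ae_iff]
    have h1 : ∀ n : ℕ, Ω.measure {t | ¬∃ j ∈ Ω.index, ‖f t‖ₑ ≤ rearr f (2 ^ j)} ≤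
        ENNReal.ofReal (2 ^ (-(n + 1 : ℤ))) := by
      intro n
      refine (measure_mono fun t ht => ?_).trans (measure_lt_rearr_le (f := f))
      by_contra h
      refine ht ⟨-(n + 1 : ℤ), ?_, not_lt.1 h⟩
      cases Ω with
      | halfLine => exact mem_univ _
      | unitInterval => change -(n + 1 : ℤ) < 0; omega
      | naturals => exact absurd rfl hΩ
    have h2 : Tendsto (fun n : ℕ => ENNReal.ofReal (2 ^ (-(n + 1 : ℤ)))) atTop (𝓝 0) := by
      rw [← ENNReal.ofReal_zero]
      refine ENNReal.tendsto_ofReal ?_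
      have h3 : ∀ n : ℕ, (2 : ℝ) ^ (-(n + 1 : ℤ)) = (1 / 2) ^ (n + 1) := by
        intro n
        rw [zpow_neg, ← Nat.cast_succ, zpow_natCast, one_div, inv_pow]
      simp only [h3]
      exact (tendsto_pow_atTop_nhds_zero_of_lt_one (by norm_num) (by norm_num)).comp
        (tendsto_add_atTop_nat 1)
    exact le_antisymm (ge_of_tendsto' h2 h1) zero_le

/-- If the bound fails at `j`, the largest `m` for which it holds is below `j`; then `m + 1` is an
index and the point lies in the level set of `m`. -/
theorem ae_levelSet (f : Ω.L0) : ∀ᵐ t ∂Ω.measure, t ∉ ⋃ k, levelSet f k →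
    ∀ j ∈ Ω.index, ‖f t‖ₑ ≤ rearr f (2 ^ j) := by
  filter_upwards [ae_exists_le_rearr f] with t ⟨i, hi, hit⟩ hnot j hj
  by_contra! hlt
  have hanti : ∀ a b : ℤ, a ≤ b → rearr f (2 ^ b) ≤ rearr f (2 ^ a) := fun a b hab =>
    rearr_antitone f (zpow_le_zpow_right₀ one_le_two hab)
  obtain ⟨m, ⟨hm, hmt⟩, hmax⟩ := Int.exists_greatest_of_bdd
    (P := fun m => m ∈ Ω.index ∧ ‖f t‖ₑ ≤ rearr f (2 ^ m))
    ⟨j, fun m hm => le_of_not_gt fun h => absurd (hlt.trans_le (hm.2.trans (hanti _ _ h.le)))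
      (lt_irrefl _)⟩ ⟨i, hi, hit⟩
  have hmj : m < j := by
    by_contra! h
    exact absurd (hlt.trans_le (hmt.trans (hanti _ _ h))) (lt_irrefl _)
  have hm1 : m + 1 ∈ Ω.index := Ω.index_ordConnected.out hm hj ⟨by omega, by omega⟩
  refine hnot (mem_iUnion.2 ⟨m, ⟨hm, hm1⟩, hmt, ?_⟩)
  by_contra! h
  have := hmax (m + 1) ⟨hm1, h⟩
  omega

open Classical in
/-- The index of the level set containing `t`, or of the block containing `t`. -/
def levelIdx (f : Ω.L0) (t : ℝ) : ℤ := if h : ∃ k, t ∈ levelSet f k then h.choose else lg t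

theorem levelIdx_of_mem {f : Ω.L0} {k : ℤ} {t : ℝ} (h : t ∈ levelSet f k) : levelIdx f t = k := by
  have hex : ∃ k, t ∈ levelSet f k := ⟨k, h⟩
  rw [levelIdx, dif_pos hex]
  exact levelSet_disjoint f hex.choose_spec h

theorem levelIdx_of_notMem {f : Ω.L0} {t : ℝ} (h : t ∉ ⋃ k, levelSet f k) :
    levelIdx f t = lg t := by
  rw [levelIdx, dif_neg fun hex => h (mem_iUnion.2 hex)]

theorem measurable_levelIdx (f : Ω.L0) : Measurable (levelIdx f) := by
  refine measurable_to_countable' fun k => ?_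
  have : levelIdx f ⁻¹' {k} = levelSet f k ∪ ((⋃ k, levelSet f k)ᶜ ∩ lg ⁻¹' {k}) := by
    ext t
    by_cases h : t ∈ ⋃ k, levelSet f k
    · obtain ⟨l, hl⟩ := mem_iUnion.1 h
      simp only [mem_preimage, levelIdx_of_mem hl, mem_singleton_iff, mem_union, mem_inter_iff,
        mem_compl_iff, h, not_true_eq_false, false_and, or_false]
      exact ⟨fun h' => h' ▸ hl, fun h' => levelSet_disjoint f hl h'⟩
    · have h2 : t ∉ levelSet f k := fun h' => h (mem_iUnion.2 ⟨k, h'⟩)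
      simp only [mem_preimage, levelIdx_of_notMem h, mem_singleton_iff, mem_union, mem_inter_iff,
        mem_compl_iff, h, h2, not_false_eq_true, true_and, false_or]
  rw [this]
  exact (measurableSet_levelSet f k).union ((MeasurableSet.iUnion fun k =>
    measurableSet_levelSet f k).compl.inter (measurable_lg (measurableSet_singleton k)))

theorem ae_enorm_le_rearr_levelIdx (f : Ω.L0) : ∀ᵐ t ∂Ω.measure,
    levelIdx f t ∈ Ω.index ∧ ‖f t‖ₑ ≤ rearr f (2 ^ levelIdx f t) := by
  filter_upwards [ae_levelSet f, Ω.ae_pos] with t h1 h2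
  by_cases h : t ∈ ⋃ k, levelSet f k
  · obtain ⟨l, hl⟩ := mem_iUnion.1 h
    rw [levelIdx_of_mem hl]
    exact ⟨hl.1.1, hl.2.1⟩
  · rw [levelIdx_of_notMem h]
    exact ⟨h2.2, h1 h _ h2.2⟩

/-- Level set `k` has measure at most `2 ^ (k + 1)`, so on the level sets the function is dominated
by the right translate of `x` by one block, at cost 2. Elsewhere the index is that of the dyadic
block, at cost 1. -/
theorem eNorm_compMul_levelIdx_le (X : RISpace Ω) (f : Ω.L0) {w : ℝ → ℝ} (hw : Measurable w)
    {c : NNReal} (hwc : ∀ᵐ t ∂Ω.measure, ‖w t‖ₑ ≤ c) (x : ℤ → ℝ) :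
    X.eNorm (compMul Ω w (levelIdx f) hw (measurable_levelIdx f) x) ≤ 3 * c * X.seq.N x := by
  set U := ⋃ k, levelSet f k
  have hU : MeasurableSet U := MeasurableSet.iUnion fun k => measurableSet_levelSet f k
  set g := compMul Ω w (levelIdx f) hw (measurable_levelIdx f) x
  have hg : ∀ᵐ t ∂Ω.measure, g t = w t * x (levelIdx f t) := compMul_ae _ _ _ _ _
  have hc : ‖(c : ℝ)‖ₑ = c := by simp
  have h1 : X.eNorm (restr U hU g) ≤ c * (2 * X.seq.N x) := by
    refine le_trans ?_ (mul_le_mul_right (shift_right_le X x) _)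
    rw [← hc, ← X.seq.smul]
    refine eNorm_le_eNorm_iota X (fun t => levelIdx f t + 1) _ ?_ fun k hk => ?_
    · filter_upwards [hg, hwc, restr_ae U hU g] with t h1 h2 h3 h4
      have htU : t ∈ U := by
        by_contra h
        rw [h3, indicator_of_notMem h] at h4
        exact h4 rfl
      obtain ⟨l, hl⟩ := mem_iUnion.1 htU
      rw [h3, indicator_of_mem htU, h1, levelIdx_of_mem hl]
      refine ⟨hl.1.2, ?_⟩
      have h5 : shift 1 (Ω.index.indicator x) (l + 1) = x l := by
        simp only [shift, add_sub_cancel_right]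
        exact indicator_of_mem hl.1.1 _
      rw [Pi.smul_apply, h5, smul_eq_mul, enorm_mul, enorm_mul, hc]
      gcongr
    · refine le_trans (measure_mono_ae ?_) (measure_lt_rearr_le (f := f) (t := 2 ^ k))
      filter_upwards [restr_ae U hU g] with t h3 h4
      obtain ⟨h4, h5⟩ : restr U hU g t ≠ 0 ∧ levelIdx f t + 1 = k := h4
      have htU : t ∈ U := by
        by_contra h
        rw [h3, indicator_of_notMem h] at h4
        exact h4 rfl
      obtain ⟨l, hl⟩ := mem_iUnion.1 htU
      rw [levelIdx_of_mem hl] at h5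
      subst h5
      exact hl.2.2
  have h2 : X.eNorm (restr Uᶜ hU.compl g) ≤ c * X.seq.N x := by
    rw [← hc, ← X.seq.smul]
    refine X.eNorm_congr_enorm ?_
    filter_upwards [hg, hwc, restr_ae Uᶜ hU.compl g, iota_ae (Ω := Ω) ((c : ℝ) • x)] with t h1 h2 h3 h4
    rw [h3, h4]
    by_cases h : t ∈ Uᶜ
    · rw [indicator_of_mem h, h1, levelIdx_of_notMem h, Pi.smul_apply, smul_eq_mul, enorm_mul,
        enorm_mul, hc]
      gcongr
    · simp [indicator_of_notMem h]
  have h3 : g = restr U hU g + restr Uᶜ hU.compl g := by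
    refine AEEqFun.ext ?_
    filter_upwards [restr_ae U hU g, restr_ae Uᶜ hU.compl g,
      AEEqFun.coeFn_add (restr U hU g) (restr Uᶜ hU.compl g)] with t h1 h2 h3
    rw [h3, Pi.add_apply, h1, h2]
    by_cases h : t ∈ U <;> simp [h]
  rw [h3]
  refine (X.eNorm_add_le _ _).trans ((add_le_add h1 h2).trans (le_of_eq ?_))
  ring

/-- A bounded operator that recovers a function from its discretization. -/
theorem exists_synthesis (f : Ω.L0) (a : ℤ → ℝ)
    (ha : ∀ k ∈ Ω.index, rearr f (2 ^ k) ≤ 4 * ‖a k‖ₑ) :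
    ∃ V : (ℤ → ℝ) →ₗ[ℝ] Ω.L0, (∀ (X : RISpace Ω) x, X.eNorm (V x) ≤ 12 * X.seq.N x) ∧ V a = f := by
  have hbd : ∀ᵐ t ∂Ω.measure, ‖f t‖ₑ ≤ 4 * ‖a (levelIdx f t)‖ₑ := by
    filter_upwards [ae_enorm_le_rearr_levelIdx f] with t ht
    exact ht.2.trans (ha _ ht.1)
  -- The multiplier is bounded by 4, as `|f|` is at most `f*` at its level index. Where the
  -- denominator vanishes so does `f`, and the convention for division by zero does no harm.
  have hw : Measurable fun t => f t / a (levelIdx f t) :=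
    f.stronglyMeasurable.measurable.div ((measurable_of_countable a).comp (measurable_levelIdx f))
  refine ⟨compMul Ω _ (levelIdx f) hw (measurable_levelIdx f), fun X x => ?_, ?_⟩
  · refine (eNorm_compMul_levelIdx_le X f hw (c := 4) ?_ x).trans (le_of_eq ?_)
    · filter_upwards [hbd] with t ht
      by_cases h0 : a (levelIdx f t) = 0
      · simp [h0]
      · rw [div_eq_mul_inv, enorm_mul, enorm_inv h0, ← div_eq_mul_inv]
        exact ENNReal.div_le_of_le_mul (by exact_mod_cast ht)
    · norm_num
  · refine AEEqFun.ext ?_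
    filter_upwards [compMul_ae (Ω := Ω) _ (levelIdx f) hw (measurable_levelIdx f) a, hbd] with t h1 h2
    rw [h1]
    by_cases h0 : a (levelIdx f t) = 0
    · rw [h0, enorm_zero, mul_zero] at h2
      have h3 : ‖f t‖ₑ = 0 := le_antisymm h2 zero_le
      rw [enorm_eq_zero] at h3
      simp [h3]
    · field_simp

variable {Ω : Domain}

/-! ## Dilations and translations -/

/-- Displacements of equal sign are needed: the intermediate coordinate then lies between the two
end points, hence in `J`. -/
theorem SeqLattice.shift_add_le {J : Set ℤ} (E : SeqLattice J) (hJ : J.OrdConnected) {d e : ℤ}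
    (hde : (0 ≤ d ∧ 0 ≤ e) ∨ (d ≤ 0 ∧ e ≤ 0)) (x : ℤ → ℝ) :
    E.N (shift (d + e) (J.indicator x)) ≤
      E.N (shift d (J.indicator (shift e (J.indicator x)))) := by
  refine E.mono _ _ fun k hk => ?_
  simp only [shift]
  by_cases h : k - (d + e) ∈ J
  · have h1 : k - d ∈ J := by
      rcases hde with h' | h'
      · exact hJ.out h hk ⟨by omega, by omega⟩
      · exact hJ.out hk h ⟨by omega, by omega⟩
    rw [indicator_of_mem h1, shift, show k - d - e = k - (d + e) by ring]
  · rw [indicator_of_notMem h]; simp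

theorem SeqLattice.shift_mul_le {J : Set ℤ} (E : SeqLattice J) (hJ : J.OrdConnected) {e : ℤ}
    {B : ℝ≥0∞} (hB : ∀ x, E.N (shift e (J.indicator x)) ≤ B * E.N x) (j : ℕ) (x : ℤ → ℝ) :
    E.N (shift (e * j) (J.indicator x)) ≤ B ^ j * E.N x := by
  induction j with
  | zero =>
    rw [pow_zero, one_mul]
    refine E.mono _ _ fun k hk => ?_
    simp [shift, hk]
  | succ j ih =>
    have h1 := E.shift_add_le hJ (d := e) (e := e * j) (by
      rcases le_total 0 e with h | h
      · exact Or.inl ⟨h, by positivity⟩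
      · exact Or.inr ⟨h, mul_nonpos_of_nonpos_of_nonneg h (by positivity)⟩) x
    rw [show e * ((j + 1 : ℕ) : ℤ) = e + e * j by push_cast; ring]
    calc _ ≤ _ := h1
      _ ≤ B * (B ^ j * E.N x) := (hB _).trans (by gcongr)
      _ = _ := by rw [pow_succ]; ring

theorem shift_right_pow_le (X : RISpace Ω) (d : ℕ) (x : ℤ → ℝ) :
    X.seq.N (shift d (Ω.index.indicator x)) ≤ 2 ^ d * X.seq.N x := by
  have := X.seq.shift_mul_le Ω.index_ordConnected (shift_right_le X) d x
  rwa [one_mul] at this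

/-- A separated pair from one contracting and one compensating translation. -/
theorem exists_sepPair (X Y : RISpace Ω) {n m : ℕ} (hn : 0 < n) (hm : 0 < m) {θ σ : NNReal}
    (hθ : 0 < θ) (hσ : 0 < σ)
    (hX : ∀ x, X.seq.N (shift (-n) (Ω.index.indicator x)) ≤ θ * X.seq.N x)
    (hY : ∀ x, Y.seq.N (shift m (Ω.index.indicator x)) ≤ σ * Y.seq.N x)
    (h : θ ^ m * σ ^ n < 1) : Nonempty (SepPair X.seq Y.seq) := by
  -- Over `L` steps the two translations together gain `ω = θ ^ m * σ ^ n < 1`, and `q` is the gain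
  -- per step. The remainder modulo `L` costs `2 ^ L` on the right translations; rounding the
  -- exponent down costs `ω⁻¹`.
  set L := n * m
  have hL : 0 < L := Nat.mul_pos hn hm
  set ω := θ ^ m * σ ^ n
  have hω : 0 < ω := by positivity
  set q : NNReal := ω ^ ((L : ℝ)⁻¹)
  have hqL : q ^ L = ω := NNReal.rpow_inv_natCast_pow _ hL.ne'
  have hq1 : q < 1 := NNReal.rpow_lt_one h (by positivity)
  have hJ := Ω.index_ordConnected
  refine ⟨{  B := 2
             C := 2 ^ L * ω⁻¹
             q := q
             α := fun d => (θ ^ m) ^ (d / L)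
             γ := fun d => (σ ^ n) ^ (d / L) * 2 ^ L
             q_pos := NNReal.rpow_pos hω
             q_lt_one := hq1
             one_le_B := one_le_two
             ordConnected := hJ
             nonempty := ?_
             stepE := fun x => shift_right_le X x
             stepE' := fun x => (shift_left_le X 1 x).trans (le_mul_of_one_le_left zero_le (by norm_num))
             stepF := fun x => shift_right_le Y x
             stepF' := fun x => (shift_left_le Y 1 x).trans (le_mul_of_one_le_left zero_le (by norm_num))
             leftE := fun d x => ?_
             rightF := fun d x => ?_
             decay := fun d => ?_ }⟩
  · cases Ω with
    | halfLine => exact ⟨0, mem_univ _⟩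
    | unitInterval => exact ⟨-1, show (-1 : ℤ) < 0 by norm_num⟩
    | naturals => exact ⟨0, le_refl (0 : ℤ)⟩
  · have h1 : (-(d : ℤ)) = -n * (m * (d / L) : ℕ) + -(d % L : ℕ) := by
      conv_lhs => rw [← Nat.div_add_mod d L]
      simp only [L]; push_cast; ring
    rw [h1]
    calc _ ≤ _ := X.seq.shift_add_le hJ (Or.inr ⟨mul_nonpos_of_nonpos_of_nonneg (by omega)
            (by positivity), by omega⟩) x
      _ ≤ (θ : ℝ≥0∞) ^ (m * (d / L)) * X.seq.N (shift (-(d % L : ℕ)) (Ω.index.indicator x)) :=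
          X.seq.shift_mul_le hJ hX _ _
      _ ≤ (θ : ℝ≥0∞) ^ (m * (d / L)) * X.seq.N x := by gcongr; exact shift_left_le X _ x
      _ = _ := by push_cast; rw [pow_mul]
  · have h1 : (d : ℤ) = m * (n * (d / L) : ℕ) + (d % L : ℕ) := by
      conv_lhs => rw [← Nat.div_add_mod d L]
      simp only [L]; push_cast; ring
    rw [h1]
    calc _ ≤ _ := Y.seq.shift_add_le hJ (Or.inl ⟨by positivity, by positivity⟩) x
      _ ≤ (σ : ℝ≥0∞) ^ (n * (d / L)) * Y.seq.N (shift (d % L : ℕ) (Ω.index.indicator x)) :=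
          Y.seq.shift_mul_le hJ hY _ _
      _ ≤ (σ : ℝ≥0∞) ^ (n * (d / L)) * (2 ^ L * Y.seq.N x) := by
          gcongr
          refine (shift_right_pow_le Y _ x).trans ?_
          gcongr
          · exact one_le_two
          · exact (Nat.mod_lt d hL).le
      _ = _ := by push_cast; rw [pow_mul]; ring
  · have h1 : q ^ (L * (d / L)) * q ^ L ≤ q ^ d := by
      rw [← pow_add]
      refine pow_le_pow_of_le_one zero_le hq1.le ?_
      have := Nat.div_add_mod d L
      have := Nat.mod_lt d hL
      omega
    rw [pow_mul, hqL] at h1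
    calc (θ ^ m) ^ (d / L) * ((σ ^ n) ^ (d / L) * 2 ^ L) = 2 ^ L * ω ^ (d / L) := by
          simp only [ω]; rw [mul_pow]; ring
      _ = 2 ^ L * ω⁻¹ * (ω ^ (d / L) * ω) := by field_simp
      _ ≤ _ := by gcongr

theorem volume_preimage_div {a : ℝ} (ha : 0 < a) (s : Set ℝ) :
    volume ((fun t => t / a) ⁻¹' s) = ENNReal.ofReal a * volume s := by
  have := Real.volume_preimage_mul_right (inv_ne_zero ha.ne') s
  simpa [div_eq_mul_inv, abs_of_pos ha] using this

theorem dilate_of_ne (hΩ : Ω ≠ .naturals) (a : ℝ) (f : Ω.L0) :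
    ∀ᵐ t ∂Ω.measure, dilate Ω a f t = Ω.carrier.indicator f (t / a) := by
  cases Ω with
  | naturals => exact absurd rfl hΩ
  | halfLine => exact AEEqFun.coeFn_mk _ _
  | unitInterval => exact AEEqFun.coeFn_mk _ _

theorem Domain.measure_of_ne (hΩ : Ω ≠ .naturals) : Ω.measure = volume.restrict Ω.carrier := by
  cases Ω with
  | naturals => exact absurd rfl hΩ
  | halfLine => rfl
  | unitInterval => rfl

theorem measure_dilate_le (hΩ : Ω ≠ .naturals) {a : ℝ} (ha : 0 < a) (s : Set ℝ) :
    Ω.measure {t | t / a ∈ Ω.carrier ∧ t / a ∈ s} ≤ ENNReal.ofReal a * Ω.measure s := by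
  calc _ ≤ volume {t | t / a ∈ Ω.carrier ∧ t / a ∈ s} := Ω.measure_le_volume hΩ _
    _ = ENNReal.ofReal a * volume (Ω.carrier ∩ s) := volume_preimage_div ha (Ω.carrier ∩ s)
    _ = _ := by
        rw [Domain.measure_of_ne hΩ, Measure.restrict_apply' (measurableSet_carrier Ω), inter_comm]

/-- Let `θ = a / 2 ^ d ≥ 1`. Composing the step function with `u ↦ θ u` compresses it without
increasing the norm, and `D_a` of the compressed function dominates the translate by `d`. -/
theorem le_dilationNorm_of_ne (hΩ : Ω ≠ .naturals) (X : RISpace Ω) {a : ℝ} (ha : 0 < a) {d : ℤ}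
    (hd : 2 ^ d ≤ a) {x : ℤ → ℝ} (hx : X.seq.N x ≤ 1) :
    X.seq.N (shift d (Ω.index.indicator x)) ≤ dilationNorm X a := by
  have h2 : (0 : ℝ) < 2 ^ d := by positivity
  set θ := a / 2 ^ d
  have hθ : 1 ≤ θ := (one_le_div h2).2 hd
  have hθ0 : 0 < θ := one_pos.trans_le hθ
  set f := compMul Ω (fun _ => 1) (fun u => lg (θ * u)) measurable_const
    (measurable_lg.comp (measurable_const_mul θ)) (Ω.index.indicator x)
  have hf : ∀ᵐ u ∂Ω.measure, f u = Ω.index.indicator x (lg (θ * u)) := by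
    filter_upwards [compMul_ae (Ω := Ω) (fun _ => 1) (fun u => lg (θ * u)) measurable_const
      (measurable_lg.comp (measurable_const_mul θ)) (Ω.index.indicator x)] with u hu
    simp only [f]
    rw [hu, one_mul]
  have hf1 : X.eNorm f ≤ 1 := by
    refine le_trans (eNorm_le_eNorm_iota X (fun u => lg (θ * u)) x ?_ fun k _ => ?_) hx
    · filter_upwards [hf] with u hu h
      rw [hu] at h ⊢
      have h1 := mem_of_indicator_ne_zero h
      rw [indicator_of_mem h1]
      exact ⟨h1, le_rfl⟩
    · calc _ ≤ Ω.measure (Ico (2 ^ k / θ) (2 ^ (k + 1) / θ)) := by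
            refine measure_mono_ae ?_
            filter_upwards [Ω.ae_pos] with u hu h
            have h1 := (lg_eq_iff (mul_pos hθ0 hu.1) k).1 h.2
            exact ⟨by rw [div_le_iff₀' hθ0]; exact h1.1, by rw [lt_div_iff₀' hθ0]; exact h1.2⟩
        _ ≤ volume (Ico (2 ^ k / θ) (2 ^ (k + 1) / θ)) := Ω.measure_le_volume hΩ _
        _ ≤ _ := by
            rw [Real.volume_Ico, zpow_add_one₀ two_ne_zero]
            refine ENNReal.ofReal_le_ofReal ?_
            have : (0 : ℝ) < 2 ^ k := by positivity
            calc (2 : ℝ) ^ k * 2 / θ - 2 ^ k / θ = 2 ^ k / θ := by ring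
              _ ≤ 2 ^ k := div_le_self this.le hθ
  refine le_trans ?_ (le_iSup₂_of_le f hf1 le_rfl)
  have hnull : ∀ᵐ t ∂Ω.measure, t / a ∈ Ω.carrier →
      f (t / a) = Ω.index.indicator x (lg (θ * (t / a))) := by
    have h1 := measure_dilate_le hΩ ha {u | f u ≠ Ω.index.indicator x (lg (θ * u))}
    rw [show Ω.measure {u | f u ≠ Ω.index.indicator x (lg (θ * u))} = 0 from ae_iff.1 hf,
      mul_zero] at h1
    rw [ae_iff]
    refine measure_mono_null (fun t ht => ?_) (le_antisymm h1 zero_le)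
    simp only [mem_ofPred_eq, Classical.not_imp] at ht
    exact ht
  refine X.eNorm_mono _ _ ?_
  filter_upwards [iota_ae (Ω := Ω) (shift d (Ω.index.indicator x)), dilate_of_ne hΩ a f, hnull,
    Ω.ae_pos] with t h1 h3 h4 h5
  rw [h1, h3]
  have h6 : θ * (t / a) = 2 ^ (-d) * t := by
    simp only [θ]; rw [zpow_neg]; field_simp
  have h7 : lg (θ * (t / a)) = lg t - d := by rw [h6, lg_mul_zpow h5.1]; ring
  by_cases h8 : lg t - d ∈ Ω.index
  · have h9 : t / a ∈ Ω.carrier := by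
      have h10 : 0 < t / a := div_pos h5.1 ha
      cases Ω with
      | naturals => exact absurd rfl hΩ
      | halfLine => exact h10.le
      | unitInterval =>
        refine ⟨h10.le, ?_⟩
        rw [← h7] at h8
        have h11 := (Int.lt_zpow_iff_log_lt (b := 2) one_lt_two (x := 0) (mul_pos hθ0 h10)).2 h8
        simp only [zpow_zero] at h11
        nlinarith
    rw [indicator_of_mem h9, h4 h9, h7]
    exact le_rfl
  · simp only [shift]
    rw [indicator_of_notMem h8]
    simp

theorem tsum_shift_le (x : ℤ → ℝ) (d : ℤ) (σ : ℝ≥0∞) :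
    Ω.measure {t | σ < ‖iota Ω (shift d (Ω.index.indicator x)) t‖ₑ} ≤
      ENNReal.ofReal (2 ^ d) * Ω.measure {t | σ < ‖iota Ω x t‖ₑ} := by
  refine le_trans ?_ (mul_le_mul_right (tsum_le_measure_iota x σ) _)
  calc _ ≤ Ω.measure (⋃ k : {k | k ∈ Ω.index ∧ σ < ‖x k‖ₑ},
        {t | lg t = (k : ℤ) + d ∧ lg t ∈ Ω.index ∧ 0 < t}) := by
        refine measure_mono_ae ?_
        filter_upwards [iota_ae (Ω := Ω) (shift d (Ω.index.indicator x)), Ω.ae_pos] with t h1 h2 h3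
        change σ < ‖iota Ω (shift d (Ω.index.indicator x)) t‖ₑ at h3
        rw [h1] at h3
        simp only [shift] at h3
        by_cases h4 : lg t - d ∈ Ω.index
        · rw [indicator_of_mem h4] at h3
          exact mem_iUnion.2 ⟨⟨lg t - d, h4, h3⟩, by simp, h2.2, h2.1⟩
        · rw [indicator_of_notMem h4] at h3
          simp at h3
    _ ≤ ∑' k : {k | k ∈ Ω.index ∧ σ < ‖x k‖ₑ}, ENNReal.ofReal (2 ^ d) * ENNReal.ofReal (2 ^ (k : ℤ)) := by
        refine (measure_iUnion_le _).trans (ENNReal.tsum_le_tsum fun k => ?_)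
        rw [← ENNReal.ofReal_mul (by positivity), ← zpow_add₀ two_ne_zero, add_comm d]
        by_cases h : (k : ℤ) + d ∈ Ω.index
        · rw [← Domain.measure_block h]
          exact measure_mono fun t ht => (lg_eq_iff ht.2.2 _).1 ht.1
        · refine le_of_eq_of_le (measure_mono_null (t := ∅) (fun t ht => h ?_) measure_empty) zero_le
          rw [← ht.1]; exact ht.2.1
    _ = _ := ENNReal.tsum_mul_left

variable {Ω : Domain}

theorem dilate_naturals (a : ℝ) (f : Domain.naturals.L0) :
    ∀ᵐ t ∂Domain.naturals.measure, dilate .naturals a f t = (rearr f (t / a)).toReal :=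
  AEEqFun.coeFn_mk _ _

/-- A finitely supported sequence has finitely many values, so the set above `σ` is also the set
above a slightly larger `σ'`. This provides the strict inequality lost when a rearrangement is
bounded from below. -/
theorem exists_gap {x : ℤ → ℝ} (hx : (Function.support x).Finite) (σ : ℝ≥0∞) :
    ∃ σ', σ ≤ σ' ∧ ∀ k, σ < ‖x k‖ₑ → σ < σ' ∧ σ' < ‖x k‖ₑ := by
  classical
  set T := hx.toFinset.filter fun k => σ < ‖x k‖ₑ
  have hT : ∀ k, σ < ‖x k‖ₑ → k ∈ T := fun k hk => by
    refine Finset.mem_filter.2 ⟨hx.mem_toFinset.2 fun h => ?_, hk⟩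
    rw [h] at hk; simp at hk
  rcases T.eq_empty_or_nonempty with h | h
  · exact ⟨σ, le_rfl, fun k hk => by have := hT k hk; simp [h] at this⟩
  · obtain ⟨k₀, hk₀, hmin⟩ := T.exists_min_image (fun k => ‖x k‖ₑ) h
    obtain ⟨σ', h1, h2⟩ := exists_between (Finset.mem_filter.1 hk₀).2
    exact ⟨σ', h1.le, fun k hk => ⟨h1, h2.trans_le (hmin k (hT k hk))⟩⟩

/-- If `f` exceeds `σ` at `N` points, the translate does so at no more than `a N` points, and `D_a
f(j) = f*(j / a)` exceeds `σ` for every `j ≤ a N`. Counting measure being integral, this compares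
the distributions exactly. -/
theorem le_dilationNorm_naturals (X : RISpace .naturals) {a : ℝ} (ha : 0 < a) {d : ℤ}
    (hd : 2 ^ d ≤ a) {x : ℤ → ℝ} (hx : X.seq.N x ≤ 1) (hfin : (Function.support x).Finite) :
    X.seq.N (shift d (Domain.naturals.index.indicator x)) ≤ dilationNorm X a := by
  refine le_trans ?_ (le_iSup₂_of_le (iota .naturals x) hx le_rfl)
  refine eNorm_le_of_measure_le X fun σ => ?_
  set f := iota .naturals x
  have hf : ∀ᵐ t ∂Domain.naturals.measure, f t = x (lg t) := iota_ae x
  obtain ⟨σ', hσσ', hσ'⟩ := exists_gap hfin σ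
  set N := Domain.naturals.measure {t | σ < ‖f t‖ₑ}
  have hN : N ≠ ⊤ := by
    obtain ⟨n, hn⟩ : ∃ n : ℕ, ∀ k, x k ≠ 0 → k < n := by
      obtain ⟨m, hm⟩ := hfin.bddAbove
      exact ⟨(m + 1).toNat, fun k hk => by have := hm hk; omega⟩
    refine ((measure_mono_ae ?_).trans_lt ((Domain.naturals_measure_Ico_le 0 (2 ^ n)).trans_lt
      (ENNReal.natCast_lt_top _))).ne
    filter_upwards [hf, Domain.naturals.ae_pos] with t h1 h2 h3
    change σ < ‖f t‖ₑ at h3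
    have h4 : x (lg t) ≠ 0 := fun h => by rw [h1, h] at h3; simp at h3
    have h5 := (Int.lt_zpow_iff_log_lt (b := 2) one_lt_two (x := n) h2.1).2 (hn _ h4)
    exact ⟨by simpa using h2.1.le, by simpa using h5⟩
  have hN' : N ≤ Domain.naturals.measure {t | σ' < ‖f t‖ₑ} := by
    refine measure_mono_ae ?_
    filter_upwards [hf] with t h1 h2
    change σ < ‖f t‖ₑ at h2
    change σ' < ‖f t‖ₑ
    rw [h1] at h2 ⊢
    exact (hσ' _ h2).2
  have hbd : ∃ M : ℝ≥0∞, M ≠ ⊤ ∧ ∀ k, ‖x k‖ₑ ≤ M :=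
    ⟨∑ k ∈ hfin.toFinset, ‖x k‖ₑ, ENNReal.sum_ne_top.2 fun _ _ => enorm_ne_top, fun k => by
      by_cases h : x k = 0
      · simp [h]
      · exact Finset.single_le_sum (f := fun k => ‖x k‖ₑ) (fun _ _ => zero_le)
          (hfin.mem_toFinset.2 h)⟩
  obtain ⟨M, hM, hxM⟩ := hbd
  have hrf : ∀ t, 0 < t → rearr f t ≠ ⊤ := fun t ht h => by
    have h1 := le_measure_of_lt_rearr (f := f) (t := t) (s := M) (by
      rw [h]; exact lt_top_iff_ne_top.2 hM)
    have h2 : Domain.naturals.measure {t | M < ‖f t‖ₑ} = 0 := by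
      have : ∀ᵐ t ∂Domain.naturals.measure, ‖f t‖ₑ ≤ M := by
        filter_upwards [hf] with t h
        rw [h]; exact hxM _
      simpa only [not_le] using ae_iff.1 this
    rw [h2] at h1
    exact absurd (ENNReal.ofReal_eq_zero.1 (le_antisymm h1 zero_le)) (not_le.2 ht)
  obtain ⟨n, hn⟩ := Domain.naturals_measure_eq (measurableSet_lt_enorm
    (iota .naturals (shift d (Domain.naturals.index.indicator x))) σ)
  have h1 := tsum_shift_le (Ω := .naturals) x d σ
  have h2 : Domain.naturals.measure {t | σ < ‖iota .naturals
      (shift d (Domain.naturals.index.indicator x)) t‖ₑ} ≤ ENNReal.ofReal (a * N.toReal) := by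
    rw [ENNReal.ofReal_mul ha.le, ENNReal.ofReal_toReal hN]
    exact h1.trans (by gcongr)
  by_cases hN0 : N = 0
  · rw [hN0] at h2
    simp only [ENNReal.toReal_zero, mul_zero, ENNReal.ofReal_zero] at h2
    exact h2.trans zero_le
  rw [hn] at h2 ⊢
  lift n to ℕ using fun h => by rw [h] at h2; simp at h2
  have h3 : (n : ℝ) ≤ a * N.toReal := by
    have h4 : ((n : ℕ∞) : ℝ≥0∞) = ENNReal.ofReal (n : ℝ) := by simp
    rw [h4] at h2
    exact (ENNReal.ofReal_le_ofReal_iff (by positivity)).1 h2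
  calc (((n : ℕ∞)) : ℝ≥0∞) = ((n + 1 - 1 : ℕ) : ℝ≥0∞) := by simp
    _ ≤ Domain.naturals.measure (Ico ((1 : ℕ) : ℝ) ((n + 1 : ℕ) : ℝ)) :=
        Domain.le_naturals_measure_Ico le_rfl
    _ ≤ _ := by
        refine measure_mono_ae ?_
        have hcar : ∀ᵐ t ∂Domain.naturals.measure, t ∈ Domain.naturals.carrier :=
          ae_restrict_mem (measurableSet_carrier .naturals)
        filter_upwards [dilate_naturals a f, hcar] with t h4 h5 h6
        obtain ⟨j, hj, rfl⟩ := h5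
        have h7 : j ≤ n := by
          have : (j : ℝ) < (n + 1 : ℕ) := h6.2
          have : j < n + 1 := by exact_mod_cast this
          omega
        have h8 : (0 : ℝ) < j / a := by positivity
        have h9 : σ' ≤ rearr f (j / a) := by
          refine le_rearr_of_le_measure (le_trans ?_ hN')
          rw [← ENNReal.ofReal_toReal hN]
          refine ENNReal.ofReal_le_ofReal ?_
          rw [div_le_iff₀' ha]
          exact le_trans (by exact_mod_cast h7) h3
        change σ < ‖dilate .naturals a f j‖ₑ
        rw [h4, Real.enorm_of_nonneg ENNReal.toReal_nonneg, ENNReal.ofReal_toReal (hrf _ h8)]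
        refine lt_of_lt_of_le ?_ h9
        have h10 : {t | σ < ‖f t‖ₑ} ∩ {t | f t = x (lg t)} ≠ ∅ := by
          intro h
          refine hN0 (measure_mono_null_ae (t := ∅) ?_ measure_empty)
          filter_upwards [hf] with t h1 h2
          have h3 : t ∈ {t | σ < ‖f t‖ₑ} ∩ {t | f t = x (lg t)} := ⟨h2, h1⟩
          rwa [h] at h3
        obtain ⟨t, h11, h12⟩ := nonempty_iff_ne_empty.2 h10
        have h13 : σ < ‖f t‖ₑ := h11
        rw [show f t = x (lg t) from h12] at h13
        exact (hσ' _ h13).1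

/-- Translations are controlled by dilations. -/
theorem shift_le_of_dilationNorm (X : RISpace Ω) {a : ℝ} (ha : 0 < a) {d : ℤ} (hd : 2 ^ d ≤ a)
    {c : NNReal} (hc : dilationNorm X a ≤ c) (x : ℤ → ℝ) :
    X.seq.N (shift d (Ω.index.indicator x)) ≤ c * X.seq.N x := by
  have h0 : ∀ x : ℤ → ℝ, (Function.support x).Finite → X.seq.N x ≤ 1 →
      X.seq.N (shift d (Ω.index.indicator x)) ≤ c := by
    intro x hfin hx
    refine le_trans ?_ hc
    by_cases hΩ : Ω = .naturals
    · subst hΩ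
      exact le_dilationNorm_naturals X ha hd hx hfin
    · exact le_dilationNorm_of_ne hΩ X ha hd hx
  have h1 : ∀ x : ℤ → ℝ, (Function.support x).Finite →
      X.seq.N (shift d (Ω.index.indicator x)) ≤ c * X.seq.N x := by
    intro x hfin
    have htop : X.seq.N x ≠ ⊤ := (X.seq.single_lt_of_finite (hfin.inter_of_left _)).ne
    by_cases hz : X.seq.N x = 0
    · have hxz : Ω.index.indicator x = 0 := by
        ext k
        by_cases hk : k ∈ Ω.index
        · rw [indicator_of_mem hk]
          by_contra h
          exact X.seq.ne_zero_of hk h hz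
        · rw [indicator_of_notMem hk]; rfl
      rw [hxz, show shift d (0 : ℤ → ℝ) = 0 from rfl, X.seq.zero]
      exact zero_le
    · set r := (X.seq.N x).toReal
      have hr : 0 < r := ENNReal.toReal_pos hz htop
      have hre : ENNReal.ofReal r = X.seq.N x := ENNReal.ofReal_toReal htop
      have h2 := h0 (r⁻¹ • x) (hfin.subset (Function.support_const_smul_subset _ _)) (by
        rw [X.seq.smul, enorm_inv hr.ne', Real.enorm_of_nonneg hr.le, hre,
          ENNReal.inv_mul_cancel hz htop])
      have h3 : shift d (Ω.index.indicator (r⁻¹ • x)) = r⁻¹ • shift d (Ω.index.indicator x) := by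
        rw [indicator_real_smul]; rfl
      rw [h3, X.seq.smul, enorm_inv hr.ne', Real.enorm_of_nonneg hr.le, hre,
        ENNReal.inv_mul_le_iff hz htop] at h2
      rwa [mul_comm]
  refine X.seq.fatou _ _ fun n => ?_
  -- The window is enlarged by `|d|` so that translation does not bring its edge inside `[-n, n]`.
  set z := (Icc (-(n + d.natAbs : ℕ) : ℤ) (n + d.natAbs : ℕ)).indicator x
  calc _ ≤ X.seq.N (shift d (Ω.index.indicator z)) := by
        refine X.seq.mono _ _ fun k _ => ?_
        by_cases hk : k ∈ Icc (-n : ℤ) n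
        · have h2 : k - d ∈ Icc (-(n + d.natAbs : ℕ) : ℤ) (n + d.natAbs : ℕ) :=
            ⟨by have := hk.1; omega, by have := hk.2; omega⟩
          rw [indicator_of_mem hk]
          simp only [shift]
          by_cases h3 : k - d ∈ Ω.index
          · rw [indicator_of_mem h3, indicator_of_mem h3]
            simp only [z]
            rw [indicator_of_mem h2]
          · rw [indicator_of_notMem h3, indicator_of_notMem h3]
        · rw [indicator_of_notMem hk]; simp
    _ ≤ c * X.seq.N z := h1 z ((finite_Icc _ _).subset fun k hk => mem_of_indicator_ne_zero hk)
    _ ≤ _ := by gcongr; exact X.seq.indicator_le _ _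

/-- `f*(2 ^ k)` as a real sequence. -/
def rearrSeq (f : Ω.L0) (k : ℤ) : ℝ := (rearr f (2 ^ k)).toReal

theorem N_rearrSeq_le (X : RISpace Ω) {f : Ω.L0} (hf : LocallyIntegrable f) :
    X.seq.N (rearrSeq f) ≤ 8 * X.eNorm f := by
  obtain ⟨A, hA, hAf⟩ := exists_discretization hf
  calc X.seq.N (rearrSeq f) ≤ X.seq.N ((4 : ℝ) • A f) := by
        refine X.seq.mono _ _ fun k hk => ?_
        have h1 := hAf k hk
        rw [Pi.smul_apply, smul_eq_mul, abs_mul, abs_of_nonneg (show (0 : ℝ) ≤ 4 by norm_num),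
          rearrSeq, abs_of_nonneg ENNReal.toReal_nonneg]
        have h2 := ENNReal.toReal_mono (by finiteness) h1
        rwa [ENNReal.toReal_mul, toReal_enorm, Real.norm_eq_abs] at h2
    _ ≤ 4 * (2 * X.eNorm f) := by
        rw [X.seq.smul]
        have : ‖(4 : ℝ)‖ₑ = 4 := by rw [Real.enorm_of_nonneg (by norm_num)]; simp
        rw [this]
        gcongr
        exact hA X f
    _ = _ := by rw [← mul_assoc]; norm_num

theorem naturals_rearr_le {f : Domain.naturals.L0} {t : ℝ} (ht : 0 < t) : rearr f t ≤ rearr f 1 := by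
  refine rearr_le_of_measure_le fun s hs => ?_
  obtain ⟨N, hN⟩ := Domain.naturals_measure_eq (measurableSet_lt_enorm f s)
  rw [hN] at hs ⊢
  have h0 : N ≠ 0 := by
    rintro rfl
    simp only [ENat.toENNReal_zero, nonpos_iff_eq_zero, ENNReal.ofReal_eq_zero] at hs
    exact absurd hs (not_le.2 ht)
  have : 1 ≤ N := Order.one_le_iff_pos.2 (pos_iff_ne_zero.2 h0)
  rw [ENNReal.ofReal_one]
  exact_mod_cast this

-- A dilation by `a ≤ 2 ^ m` enlarges superlevel sets by at most that factor, so the argument of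
-- `f*` moves back by at most `m` blocks. On `ℕ` this may leave the index set; then `f*(1)`, the
-- value at coordinate `0`, is a bound.
open Classical in
theorem rearr_dilate_le {a : ℝ} (ha : 0 < a) {m : ℕ} (hm : a ≤ 2 ^ m) (f : Ω.L0) {k : ℤ}
    (hk : k ∈ Ω.index) :
    (if k - m ∈ Ω.index then k - (m : ℤ) else 0) ∈ Ω.index ∧ rearr (dilate Ω a f) (2 ^ k) ≤
      rearr f (2 ^ (if k - m ∈ Ω.index then k - (m : ℤ) else 0)) := by
  have h2 : (2 : ℝ) ^ (k - m) ≤ 2 ^ k / a := by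
    rw [zpow_sub₀ two_ne_zero, zpow_natCast]
    gcongr
  by_cases hΩ : Ω = .naturals
  · subst hΩ
    have h3 : rearr (dilate .naturals a f) (2 ^ k) ≤ rearr f (2 ^ (k - m)) := by
      refine le_of_forall_lt fun s hs => ?_
      have h4 := le_measure_of_lt_rearr hs
      have h5 : ∃ t : ℝ, 2 ^ k ≤ t ∧ s < rearr f (t / a) := by
        by_contra! hcon
        have hcar : ∀ᵐ t ∂Domain.naturals.measure, t ∈ Domain.naturals.carrier :=
          ae_restrict_mem (measurableSet_carrier .naturals)
        obtain ⟨n, rfl⟩ := Int.eq_ofNat_of_zero_le (show 0 ≤ k from hk)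
        have h6 : Domain.naturals.measure {t | s < ‖dilate .naturals a f t‖ₑ} ≤
            Domain.naturals.measure (Ico ((1 : ℕ) : ℝ) ((2 ^ n : ℕ) : ℝ)) := by
          refine measure_mono_ae ?_
          filter_upwards [dilate_naturals a f, hcar] with t h7 h8 h9
          change s < ‖dilate .naturals a f t‖ₑ at h9
          obtain ⟨j, hj, rfl⟩ := h8
          refine ⟨by exact_mod_cast hj, ?_⟩
          by_contra! h10
          refine absurd (hcon j (by simpa using h10)) (not_le.2 (h9.trans_le ?_))
          rw [h7, Real.enorm_of_nonneg ENNReal.toReal_nonneg]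
          exact ENNReal.ofReal_toReal_le
        have h7 := h4.trans (h6.trans (Domain.naturals_measure_Ico_le _ _))
        have h8 : ENNReal.ofReal (2 ^ (n : ℤ)) = ((2 ^ n : ℕ) : ℝ≥0∞) := by
          rw [zpow_natCast, ← ENNReal.ofReal_natCast]; norm_num
        rw [h8] at h7
        have h9 : 2 ^ n ≤ 2 ^ n - 1 := by exact_mod_cast h7
        have := Nat.one_le_two_pow (n := n)
        omega
      obtain ⟨t, h6, h7⟩ := h5
      refine h7.trans_le (rearr_antitone f (h2.trans ?_))
      gcongr
    split_ifs with h
    · exact ⟨h, h3⟩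
    · refine ⟨le_refl (0 : ℤ), h3.trans ?_⟩
      rw [zpow_zero]
      exact naturals_rearr_le (by positivity)
  · have hkm : k - m ∈ Ω.index := by
      cases Ω with
      | naturals => exact absurd rfl hΩ
      | halfLine => exact mem_univ _
      | unitInterval =>
        change k - m < 0
        have : k < 0 := hk
        omega
    rw [if_pos hkm]
    refine ⟨hkm, rearr_le_of_measure_le fun s hs => ?_⟩
    have h3 : Ω.measure {t | s < ‖dilate Ω a f t‖ₑ} ≤
        ENNReal.ofReal a * Ω.measure {t | s < ‖f t‖ₑ} := by
      refine (measure_mono_ae ?_).trans (measure_dilate_le hΩ ha _)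
      filter_upwards [dilate_of_ne hΩ a f] with t h4 h5
      change s < ‖dilate Ω a f t‖ₑ at h5
      rw [h4] at h5
      have h6 : t / a ∈ Ω.carrier := by
        by_contra h
        rw [indicator_of_notMem h] at h5
        simp at h5
      rw [indicator_of_mem h6] at h5
      exact ⟨h6, h5⟩
    have h4 := hs.trans h3
    have h5 : (0 : ℝ≥0∞) < ENNReal.ofReal a := by simpa using ha
    rw [mul_comm, ← ENNReal.div_le_iff h5.ne' ENNReal.ofReal_ne_top, ← ENNReal.ofReal_div_of_pos ha] at h4
    exact (ENNReal.ofReal_le_ofReal h2).trans h4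

/-- Dilations are bounded. -/
theorem dilationNorm_ne_top (X : RISpace Ω) {a : ℝ} (ha : 0 < a) : dilationNorm X a ≠ ⊤ := by
  classical
  obtain ⟨m, hm⟩ := pow_unbounded_of_one_lt a (one_lt_two (α := ℝ))
  -- The rearrangement of the dilate is dominated by right translates of `f*(2 ^ k)` by `0, …, m`
  -- blocks. The factor 8 comes from `N_rearrSeq_le`, `2 ^ i` from the translations and 3 from
  -- composition with the level index.
  suffices h : dilationNorm X a ≤ 3 * (∑ i ∈ Finset.range (m + 1), 2 ^ i * 8) from
    (h.trans_lt (by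
      rw [lt_top_iff_ne_top]
      refine ENNReal.mul_ne_top (by simp) (ENNReal.sum_ne_top.2 fun i _ => ?_)
      finiteness)).ne
  refine iSup₂_le fun f hf => ?_
  have hfl := locallyIntegrable_of_lt_top X (hf.trans_lt ENNReal.one_lt_top)
  set g := dilate Ω a f
  set c : ℤ → ℤ := fun k => if k - m ∈ Ω.index then k - (m : ℤ) else 0
  have hx : X.seq.N (fun k => rearrSeq f (c k)) ≤ ∑ i ∈ Finset.range (m + 1), 2 ^ i * 8 := by
    calc _ ≤ X.seq.N (∑ i ∈ Finset.range (m + 1), shift i (Ω.index.indicator (rearrSeq f))) := by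
          refine X.seq.mono _ _ fun k hk => ?_
          have hnn : ∀ i : ℕ, 0 ≤ shift i (Ω.index.indicator (rearrSeq f)) k := fun i =>
            indicator_nonneg (fun _ _ => ENNReal.toReal_nonneg) _
          rw [Finset.sum_apply, abs_of_nonneg (a := rearrSeq f (c k)) ENNReal.toReal_nonneg]
          refine le_trans ?_ (le_abs_self _)
          have hcJ : c k ∈ Ω.index := (rearr_dilate_le ha hm.le f hk).1
          have hi : ∃ i : ℕ, i ≤ m ∧ c k = k - i := by
            simp only [c]
            split_ifs with h
            · exact ⟨m, le_rfl, rfl⟩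
            · cases Ω with
              | halfLine => exact absurd (mem_univ _) h
              | unitInterval =>
                have h1 : k < 0 := hk
                exact absurd (show k - m < 0 by omega) h
              | naturals =>
                have h1 : 0 ≤ k := hk
                have h2 : ¬ 0 ≤ k - m := h
                exact ⟨k.toNat, by omega, by omega⟩
          obtain ⟨i, him, hci⟩ := hi
          refine le_trans (le_of_eq ?_) (Finset.single_le_sum (fun i _ => hnn i)
            (Finset.mem_range.2 (Nat.lt_succ_of_le him)))
          rw [hci] at hcJ ⊢
          exact (indicator_of_mem (f := rearrSeq f) hcJ).symm
      _ ≤ ∑ i ∈ Finset.range (m + 1), 2 ^ i * 8 := by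
          refine (X.seq.sum_le _ _).trans (Finset.sum_le_sum fun i _ => ?_)
          refine (shift_right_pow_le X i _).trans ?_
          gcongr
          refine (N_rearrSeq_le X hfl).trans ?_
          calc _ ≤ 8 * (1 : ℝ≥0∞) := by gcongr
            _ = 8 := mul_one _
  calc X.eNorm g ≤ X.eNorm (compMul Ω (fun _ => 1) (levelIdx g) measurable_const
        (measurable_levelIdx g) fun k => rearrSeq f (c k)) := by
        refine X.eNorm_congr_enorm ?_
        filter_upwards [ae_enorm_le_rearr_levelIdx g, compMul_ae (Ω := Ω) (fun _ => 1) (levelIdx g)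
          measurable_const (measurable_levelIdx g) fun k => rearrSeq f (c k)] with t h1 h2
        rw [h2, one_mul]
        have h3 := rearr_dilate_le ha hm.le f h1.1
        refine h1.2.trans (h3.2.trans (le_of_eq ?_))
        rw [rearrSeq, Real.enorm_of_nonneg ENNReal.toReal_nonneg, ENNReal.ofReal_toReal]
        exact hfl.rearr_ne_top h3.1
    _ ≤ 3 * (1 : NNReal) * X.seq.N (fun k => rearrSeq f (c k)) :=
        eNorm_compMul_levelIdx_le X g measurable_const (Eventually.of_forall fun t => by simp) _
    _ ≤ _ := by
        rw [ENNReal.coe_one, mul_one]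
        gcongr

/-! ### From Boyd indices to separated pairs -/

variable {Ω : Domain}

/-- Arbitrarily small `a` satisfy `log a / log ‖D_a‖ < r`. The denominator is then nonzero, as the
quotient would otherwise be infinite, and the inequality can be solved for the norm. -/
theorem exists_dilationNorm_le_of_upperBoydIndex_lt (X : RISpace Ω) {r : NNReal}
    (h : upperBoydIndex X < r) {ε : ℝ} (hε : 0 < ε) (hε1 : ε ≤ 1) :
    ∃ a : ℝ, 0 < a ∧ a < ε ∧ dilationNorm X a ≤ ENNReal.ofReal (a ^ (1 / r : ℝ)) := by
  obtain ⟨a, ha, ha0, haε⟩ := ((frequently_lt_of_liminf_lt (by isBoundedDefault) h).and_eventually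
    (Ioo_mem_nhdsGT hε)).exists
  refine ⟨a, ha0, haε, ?_⟩
  have hr : (0 : ℝ) < r := by
    have : (0 : ℝ≥0∞) < r := zero_le.trans_lt h
    exact_mod_cast this
  have hla : 0 < -Real.log a := neg_pos.2 (Real.log_neg ha0 (haε.trans_le hε1))
  set D := (dilationNorm X a).toReal with hD
  have hlD : 0 < -Real.log D := by
    by_contra! hc
    rw [ENNReal.ofReal_of_nonpos hc, ENNReal.div_zero (by simpa using hla)] at ha
    exact absurd ha (by simp)
  have h1 : -Real.log a < r * -Real.log D := by
    rw [← ENNReal.ofReal_div_of_pos hlD, ← ENNReal.ofReal_coe_nnreal,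
      ENNReal.ofReal_lt_ofReal_iff hr, div_lt_iff₀ hlD] at ha
    exact ha
  have hD0 : 0 < D := by
    rcases (ENNReal.toReal_nonneg (a := dilationNorm X a)).eq_or_lt with h0 | h0
    · rw [hD, ← h0] at hlD; simp at hlD
    · exact h0
  rw [← ENNReal.ofReal_toReal (dilationNorm_ne_top X ha0)]
  refine ENNReal.ofReal_le_ofReal ?_
  rw [Real.le_rpow_iff_log_le hD0 ha0, one_div, inv_mul_eq_div, le_div_iff₀ hr]
  linarith

/-- As for the upper index, at arbitrarily large `a`. When `‖D_a‖ ≤ 1` the quotient carries no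
information, but the bound is then trivial. -/
theorem exists_dilationNorm_le_of_lt_lowerBoydIndex (X : RISpace Ω) {s : NNReal} (hs : 0 < s)
    (h : s < lowerBoydIndex X) {R : ℝ} (hR : 1 ≤ R) :
    ∃ a : ℝ, R < a ∧ dilationNorm X a ≤ ENNReal.ofReal (a ^ (1 / s : ℝ)) := by
  obtain ⟨a, ha, haR⟩ := ((frequently_lt_of_lt_limsup (by isBoundedDefault) h).and_eventually
    (eventually_gt_atTop R)).exists
  have ha1 : 1 < a := hR.trans_lt haR
  have ha0 : 0 < a := one_pos.trans ha1
  refine ⟨a, haR, ?_⟩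
  have hs' : (0 : ℝ) < s := hs
  have hla : 0 < Real.log a := Real.log_pos ha1
  rw [← ENNReal.ofReal_toReal (dilationNorm_ne_top X ha0)]
  refine ENNReal.ofReal_le_ofReal ?_
  set D := (dilationNorm X a).toReal
  rcases le_or_gt (Real.log D) 0 with hlD | hlD
  · have hD1 : D ≤ 1 := (Real.log_nonpos_iff ENNReal.toReal_nonneg).1 hlD
    exact hD1.trans (Real.one_le_rpow ha1.le (by positivity))
  · have hD0 : 0 < D := by
      rcases (ENNReal.toReal_nonneg (a := dilationNorm X a)).eq_or_lt with h0 | h0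
      · exfalso
        have : D = 0 := h0.symm
        rw [this] at hlD; simp at hlD
      · exact h0
    rw [← ENNReal.ofReal_div_of_pos hlD, ← ENNReal.ofReal_coe_nnreal,
      ENNReal.ofReal_lt_ofReal_iff (by positivity), lt_div_iff₀ hlD] at ha
    rw [Real.le_rpow_iff_log_le hD0 ha0, one_div, inv_mul_eq_div, le_div_iff₀ hs']
    linarith

/-- Spaces with separated Boyd indices form a separated pair. -/
theorem exists_sepPair_of_boyd (X Y : RISpace Ω) (h : upperBoydIndex X < lowerBoydIndex Y) :
    Nonempty (SepPair X.seq Y.seq) := by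
  obtain ⟨r, hXr, hrY⟩ := ENNReal.lt_iff_exists_nnreal_btwn.1 h
  obtain ⟨s, hrs, hsY⟩ := ENNReal.lt_iff_exists_nnreal_btwn.1 hrY
  have hr : (0 : ℝ) < r := by
    have : (0 : ℝ≥0∞) < r := zero_le.trans_lt hXr
    exact_mod_cast this
  have hrs' : (r : ℝ) < s := by exact_mod_cast hrs
  have hs : (0 : ℝ) < s := hr.trans hrs'
  set δ : ℝ := 1 / r - 1 / s with hδ
  have hδ0 : 0 < δ := sub_pos.2 (one_div_lt_one_div_of_lt hr hrs')
  -- Rounding the two dilation parameters to powers of 2 costs a bounded amount in each exponent;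
  -- `N` is so large that the gain, proportional to `δ`, exceeds it.
  obtain ⟨N, hN⟩ := exists_nat_gt ((2 / r + 2 / s) / δ)
  rw [div_lt_iff₀ hδ0] at hN
  have hN0 : 0 < N := by
    rcases Nat.eq_zero_or_pos N with h0 | h0
    · rw [h0] at hN
      have : (0 : ℝ) < 2 / r + 2 / s := by positivity
      simp at hN; linarith
    · exact h0
  obtain ⟨a, ha0, haN, hDa⟩ := exists_dilationNorm_le_of_upperBoydIndex_lt X hXr
    (ε := 2 ^ (-N : ℤ)) (by positivity) (zpow_le_one_of_nonpos₀ one_le_two (by omega))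
  obtain ⟨b, hbN, hDb⟩ := exists_dilationNorm_le_of_lt_lowerBoydIndex Y (s := s)
    (by exact_mod_cast hs) hsY (R := 2 ^ (N : ℤ)) (one_le_zpow₀ one_le_two (by omega))
  have hb0 : 0 < b := lt_trans (by positivity) hbN
  have hma := mem_block_lg ha0
  have hmb := mem_block_lg hb0
  have hla : lg a < -N := (zpow_lt_zpow_iff_right₀ one_lt_two).1 (hma.1.trans_lt haN)
  have hlb : (N : ℤ) ≤ lg b := Int.lt_add_one_iff.1
    ((zpow_lt_zpow_iff_right₀ one_lt_two).1 (hbN.trans hmb.2))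
  obtain ⟨n, hn⟩ := Int.eq_ofNat_of_zero_le (show 0 ≤ -lg a by omega)
  obtain ⟨m, hm⟩ := Int.eq_ofNat_of_zero_le (show 0 ≤ lg b by omega)
  have hn' : lg a = -n := by omega
  -- In logarithms to base 2 the condition becomes `m / r + n / s < m n δ`, which holds once both
  -- `n` and `m` are at least `N`.
  refine exists_sepPair X Y (n := n) (m := m) (by omega) (by omega)
    (θ := (a ^ (1 / r : ℝ)).toNNReal) (σ := (b ^ (1 / s : ℝ)).toNNReal)
    (Real.toNNReal_pos.2 (by positivity)) (Real.toNNReal_pos.2 (by positivity))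
    (shift_le_of_dilationNorm X ha0 (hn' ▸ hma.1) hDa)
    (shift_le_of_dilationNorm Y hb0 (hm ▸ hmb.1) hDb) ?_
  rw [← NNReal.coe_lt_coe, NNReal.coe_mul, NNReal.coe_pow, NNReal.coe_pow,
    Real.coe_toNNReal _ (by positivity), Real.coe_toNNReal _ (by positivity), NNReal.coe_one,
    ← Real.log_neg_iff (by positivity), Real.log_mul (by positivity) (by positivity),
    Real.log_pow, Real.log_pow, Real.log_rpow ha0, Real.log_rpow hb0]
  have hl2 := Real.log_pos one_lt_two
  have h1 : Real.log a ≤ (1 - n) * Real.log 2 := by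
    have := Real.log_le_log ha0 hma.2.le
    rw [Real.log_zpow, hn'] at this
    push_cast at this; linarith
  have h2 : Real.log b ≤ (m + 1) * Real.log 2 := by
    have := Real.log_le_log hb0 hmb.2.le
    rw [Real.log_zpow, hm] at this
    push_cast at this; linarith
  have hnN : (N : ℝ) ≤ n := by exact_mod_cast (by omega : N ≤ n)
  have hmN : (N : ℝ) ≤ m := by exact_mod_cast (by omega : N ≤ m)
  have hN1 : (0 : ℝ) < N := by exact_mod_cast hN0
  have hR : (0 : ℝ) < 1 / r := by positivity
  have hS : (0 : ℝ) < 1 / s := by positivity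
  have e1 : (2 : ℝ) / r = 2 * (1 / r) := by ring
  have e2 : (2 : ℝ) / s = 2 * (1 / s) := by ring
  rw [e1, e2] at hN
  have k1 : 2 * (1 / r : ℝ) < n * δ := by nlinarith
  have k2 : 2 * (1 / s : ℝ) < m * δ := by nlinarith
  have hn0 : (0 : ℝ) < n := hN1.trans_le hnN
  have hm0 : (0 : ℝ) < m := hN1.trans_le hmN
  calc _ ≤ m * (1 / r * ((1 - n) * Real.log 2)) + n * (1 / s * ((m + 1) * Real.log 2)) := by gcongr
    _ = (m * (1 / r) + n * (1 / s) - m * n * δ) * Real.log 2 := by rw [hδ]; ring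
    _ < 0 := mul_neg_of_neg_of_pos (by nlinarith [mul_lt_mul_of_pos_left k1 hm0, mul_lt_mul_of_pos_left k2 hn0]) hl2

/-! ## K-functionals -/

section KFunctional

variable {α : Type*} [MeasurableSpace α] {μ : Measure α} (X Y : KotheSpace μ)

theorem kFunctional_le_add {t : ℝ} {f x y : α →ₘ[μ] ℝ} (h : x + y = f) :
    kFunctional X Y t f ≤ X.eNorm x + ENNReal.ofReal t * Y.eNorm y :=
  iInf_le_of_le x (iInf_le_of_le y (iInf_le_of_le h le_rfl))

theorem KotheSpace.eNorm_zero : X.eNorm 0 = 0 := (X.eNorm_eq_zero_iff 0).2 rfl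

theorem kFunctional_mono {t t' : ℝ} (h : t ≤ t') (f : α →ₘ[μ] ℝ) :
    kFunctional X Y t f ≤ kFunctional X Y t' f :=
  iInf_mono fun _ => iInf_mono fun _ => iInf_mono fun _ => by gcongr

theorem le_mul_kFunctional {t : ℝ} {f : α →ₘ[μ] ℝ} {a c : ℝ≥0∞} (hc : c ≠ ⊤) (hc0 : c ≠ 0)
    (h : ∀ x y, x + y = f → a ≤ c * (X.eNorm x + ENNReal.ofReal t * Y.eNorm y)) :
    a ≤ c * kFunctional X Y t f := by
  rw [mul_comm, ← ENNReal.div_le_iff_le_mul (Or.inl hc0) (Or.inl hc)]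
  refine le_iInf fun x => le_iInf fun y => le_iInf fun hxy => ?_
  rw [ENNReal.div_le_iff_le_mul (Or.inl hc0) (Or.inl hc), mul_comm]
  exact h x y hxy

/-- `K(M t) ≤ M K(t)` for `M ≥ 1`. -/
theorem kFunctional_mul_le {M t : ℝ} (hM : 1 ≤ M) (f : α →ₘ[μ] ℝ) :
    kFunctional X Y (M * t) f ≤ ENNReal.ofReal M * kFunctional X Y t f := by
  have hM0 : 0 < M := one_pos.trans_le hM
  refine le_mul_kFunctional X Y ENNReal.ofReal_ne_top (by simpa using hM0) fun x y h => ?_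
  refine (kFunctional_le_add X Y h).trans ?_
  rw [mul_add, ENNReal.ofReal_mul hM0.le, mul_assoc]
  gcongr
  exact le_mul_of_one_le_left zero_le (by simpa using hM)

theorem kFunctional_smul_le {t c : ℝ} (hc : c ≠ 0) (f : α →ₘ[μ] ℝ) :
    kFunctional X Y t (c • f) ≤ ‖c‖ₑ * kFunctional X Y t f := by
  refine le_mul_kFunctional X Y (by simp) (by simpa using hc) fun x y h => ?_
  refine (kFunctional_le_add X Y (x := c • x) (y := c • y) (by rw [← smul_add, h])).trans ?_
  rw [X.eNorm_smul, Y.eNorm_smul, mul_add, mul_left_comm]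

theorem kFunctional_ne_top {t : ℝ} {f : α →ₘ[μ] ℝ} (hf : f ∈ sumSpace X Y) :
    kFunctional X Y t f ≠ ⊤ := by
  obtain ⟨x, hx, y, hy, rfl⟩ := Submodule.mem_sup.1 hf
  refine ((kFunctional_le_add X Y rfl).trans_lt (ENNReal.add_lt_top.2 ⟨hx, ?_⟩)).ne
  exact ENNReal.mul_lt_top ENNReal.ofReal_lt_top hy

theorem mem_sumSpace_of_lt_top {f x y : α →ₘ[μ] ℝ} (h : x + y = f) (hx : X.eNorm x < ⊤)
    (hy : Y.eNorm y < ⊤) : f ∈ sumSpace X Y :=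
  Submodule.mem_sup.2 ⟨x, hx, y, hy, h⟩

theorem le_opNormOn_mul {V : Submodule ℝ (α →ₘ[μ] ℝ)} (T : V →ₗ[ℝ] V) {h : V}
    (hh : X.eNorm h ≠ ⊤) : X.eNorm (T h) ≤ opNormOn X T * X.eNorm h := by
  by_cases h0 : X.eNorm h = 0
  · have : h = 0 := Subtype.ext ((X.eNorm_eq_zero_iff _).1 h0)
    rw [this, map_zero]
    simp [X.eNorm_zero]
  set r := (X.eNorm h).toReal
  have hr : 0 < r := ENNReal.toReal_pos h0 hh
  have hre : ENNReal.ofReal r = X.eNorm h := ENNReal.ofReal_toReal hh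
  have hinv : ‖r⁻¹‖ₑ = (X.eNorm h)⁻¹ := by rw [enorm_inv hr.ne', Real.enorm_of_nonneg hr.le, hre]
  have h1 : X.eNorm (T (r⁻¹ • h)) ≤ opNormOn X T := by
    refine le_iSup₂_of_le (r⁻¹ • h) ?_ le_rfl
    rw [Submodule.coe_smul, X.eNorm_smul, hinv, ENNReal.inv_mul_cancel h0 hh]
  rwa [map_smul, Submodule.coe_smul, X.eNorm_smul, hinv, ENNReal.inv_mul_le_iff h0 hh,
    mul_comm] at h1

end KFunctional

variable {Ω : Domain}

/-- The ratio of the fundamental functions of two spaces at `2 ^ k`. -/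
def ratio (X Y : RISpace Ω) (k : ℤ) : ℝ :=
  (X.seq.N (Pi.single k 1) / Y.seq.N (Pi.single k 1)).toReal

variable {X Y : RISpace Ω}

theorem ofReal_ratio {k : ℤ} (hk : k ∈ Ω.index) :
    ENNReal.ofReal (ratio X Y k) = X.seq.N (Pi.single k 1) / Y.seq.N (Pi.single k 1) :=
  ENNReal.ofReal_toReal (ENNReal.div_ne_top (X.seq.single_ne_top k hk) (Y.seq.single_ne_zero k hk))

theorem mul_ofReal_ratio {k : ℤ} (hk : k ∈ Ω.index) :
    Y.seq.N (Pi.single k 1) * ENNReal.ofReal (ratio X Y k) = X.seq.N (Pi.single k 1) := by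
  rw [ofReal_ratio hk, ENNReal.mul_div_cancel (Y.seq.single_ne_zero k hk) (Y.seq.single_ne_top k hk)]

theorem ratio_pos {k : ℤ} (hk : k ∈ Ω.index) : 0 < ratio X Y k := by
  rw [← ENNReal.ofReal_pos, ofReal_ratio hk]
  exact ENNReal.div_pos (X.seq.single_ne_zero k hk) (Y.seq.single_ne_top k hk)

/-- Every decomposition of `f` is carried by `A` to one of `A f`, to which `kappa_add_le` applies.
At `t = ratio` the coefficients of the two terms agree after multiplication by the fundamental
function of `Y`. -/
theorem SepPair.kappa_le_kFunctional (P : SepPair X.seq Y.seq) {A : Ω.L0 →ₗ[ℝ] (ℤ → ℝ)}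
    (hA : ∀ (X : RISpace Ω) h, X.seq.N (A h) ≤ 2 * X.eNorm h) (f : Ω.L0) {k : ℤ}
    (hk : k ∈ Ω.index) :
    kappa X.seq Y.seq k (A f) ≤ (1 + P.K) * 2 * Y.seq.N (Pi.single k 1) *
      kFunctional X.toKotheSpace Y.toKotheSpace (ratio X Y k) f := by
  have hst := Y.seq.single_ne_top k hk
  have hKt := P.K_ne_top
  refine le_mul_kFunctional _ _ (by finiteness)
    (mul_ne_zero (mul_ne_zero (by simp) (by simp)) (Y.seq.single_ne_zero k hk)) fun x y h => ?_
  rw [← h, map_add]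
  refine (P.kappa_add_le _ _ hk).trans ?_
  rw [← mul_ofReal_ratio (X := X) (Y := Y) hk]
  calc _ ≤ (1 + P.K) * (Y.seq.N (Pi.single k 1) * (2 * X.eNorm x) +
        Y.seq.N (Pi.single k 1) * ENNReal.ofReal (ratio X Y k) * (2 * Y.eNorm y)) := by
        gcongr
        · exact hA X x
        · exact hA Y y
    _ = _ := by ring

theorem kFunctional_le_kappa {V : (ℤ → ℝ) →ₗ[ℝ] Ω.L0} {c : ℝ≥0∞}
    (hV : ∀ (X : RISpace Ω) x, X.eNorm (V x) ≤ c * X.seq.N x) (a : ℤ → ℝ) {k : ℤ}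
    (hk : k ∈ Ω.index) :
    Y.seq.N (Pi.single k 1) * kFunctional X.toKotheSpace Y.toKotheSpace (ratio X Y k) (V a) ≤
      c * kappa X.seq Y.seq k a := by
  have hadd : V ((Iic k).indicator a) + V ((Ioi k).indicator a) = V a := by
    rw [← map_add, ← compl_Iic, indicator_self_add_compl]
  calc _ ≤ Y.seq.N (Pi.single k 1) * (X.eNorm (V ((Iic k).indicator a)) +
        ENNReal.ofReal (ratio X Y k) * Y.eNorm (V ((Ioi k).indicator a))) := by
        gcongr
        exact kFunctional_le_add _ _ hadd
    _ ≤ Y.seq.N (Pi.single k 1) * (c * X.seq.N ((Iic k).indicator a) +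
        ENNReal.ofReal (ratio X Y k) * (c * Y.seq.N ((Ici k).indicator a))) := by
        gcongr
        · exact hV X _
        · refine (hV Y _).trans ?_
          gcongr
          exact Y.seq.indicator_mono (fun j hj => Ioi_subset_Ici_self hj.1) a
    _ = _ := by
        rw [kappa, ← mul_ofReal_ratio (X := X) (Y := Y) hk]; ring

/-- A Calderón couple of sequence spaces gives a Calderón couple of r.i. spaces. -/
theorem SepPair.isCalderonCouple (P : SepPair X.seq Y.seq) (h : SeqCalderon X.seq Y.seq) :
    IsCalderonCouple X.toKotheSpace Y.toKotheSpace := by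
  intro f g hK
  obtain ⟨Af, hAf, haf⟩ := exists_discretization (locallyIntegrable_of_mem_sumSpace X Y f.2)
  obtain ⟨Ag, hAg, hag⟩ := exists_discretization (locallyIntegrable_of_mem_sumSpace X Y g.2)
  obtain ⟨Vf, hVf, hVf'⟩ := exists_synthesis (f : Ω.L0) (Af f) haf
  obtain ⟨Vg, hVg, hVg'⟩ := exists_synthesis (g : Ω.L0) (Ag g) hag
  have hKt := P.K_ne_top
  obtain ⟨S, D, hSX, hSY, hS⟩ := h (Af f) (Ag g) (fun k hk => by
    refine ne_top_of_le_ne_top ?_ (P.kappa_le_kFunctional hAf f hk)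
    have := Y.seq.single_ne_top k hk
    have := kFunctional_ne_top X.toKotheSpace Y.toKotheSpace (t := ratio X Y k) f.2
    finiteness)
    ⟨((1 + P.K) * 2 * 12).toNNReal, fun k hk => by
      rw [ENNReal.coe_toNNReal (by finiteness)]
      have h1 := kFunctional_le_kappa (X := X) (Y := Y) hVf (Af f) hk
      rw [hVf'] at h1
      calc _ ≤ _ := P.kappa_le_kFunctional hAg g hk
        _ ≤ (1 + P.K) * 2 * Y.seq.N (Pi.single k 1) *
            kFunctional X.toKotheSpace Y.toKotheSpace (ratio X Y k) f := by
            gcongr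
            exact hK _ (ratio_pos hk)
        _ = (1 + P.K) * 2 * (Y.seq.N (Pi.single k 1) *
            kFunctional X.toKotheSpace Y.toKotheSpace (ratio X Y k) f) := by ring
        _ ≤ (1 + P.K) * 2 * (12 * kappa X.seq Y.seq k (Af f)) := by gcongr
        _ = _ := by ring⟩
  -- Analysis adapted to `f`, the sequence operator, and synthesis adapted to `g`.
  set T₀ : Ω.L0 →ₗ[ℝ] Ω.L0 := Vg ∘ₗ S ∘ₗ Af
  have hbd : ∀ Z : RISpace Ω, (∀ h, Z.seq.N (S h) ≤ D * Z.seq.N h) →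
      ∀ h, Z.eNorm (T₀ h) ≤ 12 * (D * 2) * Z.eNorm h := fun Z hZ h => by
    calc _ ≤ 12 * Z.seq.N (S (Af h)) := hVg Z _
      _ ≤ 12 * (D * (2 * Z.eNorm h)) := by
          gcongr
          exact (hZ _).trans (mul_le_mul_right (hAf Z h) _)
      _ = _ := by ring
  have hmap : ∀ x ∈ sumSpace X.toKotheSpace Y.toKotheSpace,
      T₀ x ∈ sumSpace X.toKotheSpace Y.toKotheSpace := fun z hz => by
    obtain ⟨x, hx, y, hy, rfl⟩ := Submodule.mem_sup.1 hz
    rw [map_add]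
    exact mem_sumSpace_of_lt_top _ _ rfl
      ((hbd X hSX x).trans_lt (ENNReal.mul_lt_top (by finiteness) hx))
      ((hbd Y hSY y).trans_lt (ENNReal.mul_lt_top (by finiteness) hy))
  have hop : ∀ Z : RISpace Ω, (∀ h, Z.seq.N (S h) ≤ D * Z.seq.N h) →
      opNormOn Z.toKotheSpace (T₀.restrict hmap) < ⊤ := fun Z hZ => by
    refine lt_of_le_of_lt (iSup₂_le fun h hh => (hbd Z hZ h).trans (mul_le_mul_right hh _)) ?_
    rw [lt_top_iff_ne_top]
    finiteness
  refine ⟨T₀.restrict hmap, hop X hSX, hop Y hSY, Subtype.ext ?_⟩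
  change Vg (S (Af f)) = g
  -- The two sequences agree on `J` only. Coordinates off `J` are invisible to the norm, so `Vg`
  -- maps the difference to zero.
  rw [← hVg', ← sub_eq_zero, ← map_sub, ← X.eNorm_eq_zero_iff]
  refine le_antisymm ((hVg X _).trans (le_of_eq ?_)) zero_le
  rw [X.seq.eq_zero fun k hk => by simp [hS k hk], mul_zero]

variable {Ω : Domain} {X Y : RISpace Ω}

/-- Averaging over the dyadic blocks is a bounded left inverse of `iota`. -/
theorem exists_block_average (Ω : Domain) :
    ∃ A : Ω.L0 →ₗ[ℝ] (ℤ → ℝ), (∀ (X : RISpace Ω) h, X.seq.N (A h) ≤ 2 * X.eNorm h) ∧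
      ∀ x, LocallyIntegrable (iota Ω x) → ∀ k ∈ Ω.index, A (iota Ω x) k = x k := by
  obtain ⟨A, hA, h⟩ := exists_average_operator (Ω := Ω) dyadicBlock (fun k => measurableSet_Ico)
    (fun k l hkl _ => disjoint_dyadicBlock hkl) (fun k hk => (Domain.measure_block hk).le)
    (w := fun _ => 1) measurable_const (by simp)
  refine ⟨A, hA, fun x hx k hk => ?_⟩
  have h2 : (0 : ℝ) < 2 ^ k := by positivity
  have h1 : ∀ᵐ t ∂Ω.measure.restrict (dyadicBlock k), 1 * iota Ω x t = x k := by
    filter_upwards [ae_restrict_of_ae (iota_ae (Ω := Ω) x),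
      ae_restrict_mem measurableSet_Ico] with t ht htk
    rw [one_mul, ht, lg_of_mem htk]
  rw [h _ hx k hk, integral_congr_ae h1, setIntegral_const, Measure.real, Domain.measure_block hk,
    ENNReal.toReal_ofReal h2.le, smul_eq_mul, ← mul_assoc, ← zpow_add₀ two_ne_zero]
  simp

theorem iota_mem_sumSpace {f : ℤ → ℝ} {k : ℤ} (hk : k ∈ Ω.index)
    (hf : kappa X.seq Y.seq k f ≠ ⊤) : iota Ω f ∈ sumSpace X.toKotheSpace Y.toKotheSpace := by
  rw [kappa, ENNReal.add_ne_top] at hf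
  have h1 := ENNReal.lt_top_of_mul_ne_top_right hf.1 (Y.seq.single_ne_zero k hk)
  have h2 := ENNReal.lt_top_of_mul_ne_top_right hf.2 (X.seq.single_ne_zero k hk)
  refine mem_sumSpace_of_lt_top _ _ (x := iota Ω ((Iic k).indicator f))
    (y := iota Ω ((Ioi k).indicator f)) ?_ h1 (lt_of_le_of_lt ?_ h2)
  · rw [← map_add, ← compl_Iic, indicator_self_add_compl]
  · exact Y.seq.indicator_mono (fun j hj => Ioi_subset_Ici_self hj.1) f

theorem SepPair.kappa_le_kFunctional_iota (P : SepPair X.seq Y.seq) {f : ℤ → ℝ}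
    (hf : LocallyIntegrable (iota Ω f)) {k : ℤ} (hk : k ∈ Ω.index) :
    kappa X.seq Y.seq k f ≤ (1 + P.K) * 2 * Y.seq.N (Pi.single k 1) *
      kFunctional X.toKotheSpace Y.toKotheSpace (ratio X Y k) (iota Ω f) := by
  obtain ⟨A, hA, hAf⟩ := exists_block_average Ω
  refine le_trans (le_of_eq ?_) (P.kappa_le_kFunctional hA _ hk)
  have h : ∀ (Z : SeqLattice Ω.index) (B : Set ℤ),
      Z.N (B.indicator f) = Z.N (B.indicator (A (iota Ω f))) := fun Z B =>
    Z.congr fun j hj => by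
      by_cases hjB : j ∈ B
      · rw [indicator_of_mem hjB, indicator_of_mem hjB, hAf f hf j hj]
      · rw [indicator_of_notMem hjB, indicator_of_notMem hjB]
  rw [kappa, kappa, h, h]

/-- Exponential growth: the ratios tend to `0` or to infinity along an infinite end of the index
set, so there they pass every `t > 0`. -/
theorem SepPair.ratio_le (P : SepPair X.seq Y.seq) {j : ℤ} {d : ℕ} (hj : j ∈ Ω.index)
    (hk : j + d ∈ Ω.index) : ratio X Y j ≤ P.C * P.q ^ d * ratio X Y (j + d) := by
  have h := P.single_cross hj hk
  have hs := ENNReal.toReal_pos (Y.seq.single_ne_zero _ hj) (Y.seq.single_ne_top _ hj)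
  have hs' := ENNReal.toReal_pos (Y.seq.single_ne_zero _ hk) (Y.seq.single_ne_top _ hk)
  have h1 := Y.seq.single_ne_top _ hj
  have h2 := X.seq.single_ne_top _ hk
  have h' := ENNReal.toReal_mono (by finiteness) h
  simp only [ENNReal.toReal_mul, ENNReal.toReal_pow, ENNReal.coe_toReal] at h'
  rw [ratio, ratio, ENNReal.toReal_div, ENNReal.toReal_div, div_le_iff₀ hs, mul_div_assoc',
    div_mul_eq_mul_div, le_div_iff₀ hs']
  linarith

theorem SepPair.ratio_succ_le (P : SepPair X.seq Y.seq) {j : ℤ} (hj : j ∈ Ω.index)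
    (hk : j + 1 ∈ Ω.index) : ratio X Y (j + 1) ≤ (P.B : ℝ) ^ 2 * ratio X Y j := by
  have h1 := P.E_single_succ_le hj
  have h2 : Y.seq.N (Pi.single j 1) ≤ P.B * Y.seq.N (Pi.single (j + 1) 1) := by
    have := P.stepF' (Pi.single (j + 1) 1)
    rwa [shift_single hk, add_neg_cancel_right] at this
  have hs := ENNReal.toReal_pos (Y.seq.single_ne_zero _ hj) (Y.seq.single_ne_top _ hj)
  have hs' := ENNReal.toReal_pos (Y.seq.single_ne_zero _ hk) (Y.seq.single_ne_top _ hk)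
  have h3 := Y.seq.single_ne_top _ hk
  have h4 := X.seq.single_ne_top _ hj
  have h1' := ENNReal.toReal_mono (by finiteness) h1
  have h2' := ENNReal.toReal_mono (by finiteness) h2
  rw [ENNReal.toReal_mul, ENNReal.coe_toReal] at h1' h2'
  rw [ratio, ratio, ENNReal.toReal_div, ENNReal.toReal_div, div_le_iff₀ hs', mul_div_assoc',
    div_mul_eq_mul_div, le_div_iff₀ hs]
  calc _ ≤ (P.B * (X.seq.N (Pi.single j 1)).toReal) *
        (P.B * (Y.seq.N (Pi.single (j + 1) 1)).toReal) := by gcongr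
    _ = _ := by ring

/-- Every `t > 0` is comparable with some `ratio`, or lies beyond the ratio at an end point of
the index set. -/
theorem SepPair.ratio_cases (P : SepPair X.seq Y.seq) {t : ℝ} (ht : 0 < t) :
    (∃ k ∈ Ω.index, ratio X Y k ≤ t ∧ t ≤ (P.B : ℝ) ^ 2 * ratio X Y k) ∨
    (∃ k ∈ Ω.index, ratio X Y k ≤ t ∧ ∀ j ∈ Ω.index, j ≤ k) ∨
    (∃ k ∈ Ω.index, t ≤ ratio X Y k ∧ ∀ j ∈ Ω.index, k ≤ j) := by
  have hJ := P.ordConnected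
  obtain ⟨j₀, hj₀⟩ := P.nonempty
  have hq : ∀ r : ℝ, 0 < r → ∃ d : ℕ, ∀ e : ℕ, d ≤ e → P.C * (P.q : ℝ) ^ e < r := fun r hr => by
    have h1 : Tendsto (fun e : ℕ => (P.C : ℝ) * (P.q : ℝ) ^ e) atTop (𝓝 (P.C * 0)) :=
      (tendsto_pow_atTop_nhds_zero_of_lt_one P.q.2 (by exact_mod_cast P.q_lt_one)).const_mul _
    rw [mul_zero] at h1
    exact eventually_atTop.1 (h1.eventually_lt_const hr)
  by_cases hA : ∃ k, k ∈ Ω.index ∧ ratio X Y k ≤ t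
  · obtain ⟨k₁, hk₁, hk₁t⟩ := hA
    obtain ⟨d, hd⟩ := hq (ratio X Y k₁ / t) (div_pos (ratio_pos hk₁) ht)
    obtain ⟨k, ⟨hk, hkt⟩, hmax⟩ := Int.exists_greatest_of_bdd
      (P := fun k => k ∈ Ω.index ∧ ratio X Y k ≤ t) ⟨k₁ + d, fun k hk => by
        by_contra! hlt
        obtain ⟨e, he⟩ := Int.eq_ofNat_of_zero_le (show 0 ≤ k - k₁ by omega)
        have hke : k = k₁ + e := by omega
        subst hke
        have h1 := P.ratio_le hk₁ hk.1
        have h2 := hd e (by omega)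
        rw [lt_div_iff₀ ht] at h2
        have h3 : P.C * (P.q : ℝ) ^ e * ratio X Y (k₁ + e) ≤ P.C * (P.q : ℝ) ^ e * t := by
          gcongr; exact hk.2
        linarith⟩ ⟨k₁, hk₁, hk₁t⟩
    by_cases hk' : k + 1 ∈ Ω.index
    · refine Or.inl ⟨k, hk, hkt, le_trans ?_ (P.ratio_succ_le hk hk')⟩
      by_contra! hlt
      have := hmax (k + 1) ⟨hk', hlt.le⟩
      omega
    · refine Or.inr (Or.inl ⟨k, hk, hkt, fun j hj => ?_⟩)
      by_contra! hlt
      exact hk' (hJ.out hk hj ⟨by omega, by omega⟩)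
  · push Not at hA
    obtain ⟨d, hd⟩ := hq (t / ratio X Y j₀) (div_pos ht (ratio_pos hj₀))
    obtain ⟨k, hk, hmin⟩ := Int.exists_least_of_bdd (P := fun k => k ∈ Ω.index)
      ⟨j₀ - d, fun k hk => by
        by_contra! hlt
        obtain ⟨e, he⟩ := Int.eq_ofNat_of_zero_le (show 0 ≤ j₀ - k by omega)
        have hke : j₀ = k + e := by omega
        subst hke
        have h1 := P.ratio_le hk hj₀
        have h2 := hd e (by omega)
        rw [lt_div_iff₀ (ratio_pos hj₀)] at h2
        linarith [hA k hk]⟩ ⟨j₀, hj₀⟩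
    exact Or.inr (Or.inr ⟨k, hk, (hA k hk).le, hmin⟩)

/-- For `t` comparable with a ratio, monotonicity and `K(M t) ≤ M K(t)` suffice. Beyond the ratio at
a last coordinate, `kappa` there contains all of `g` in `X`, and the trivial decomposition into `X`
is used; before that at a first coordinate, likewise with `Y` and rescaling in `t`. -/
theorem SepPair.kFunctional_iota_le (P : SepPair X.seq Y.seq) {f g : ℤ → ℝ} {C : NNReal}
    (hf : LocallyIntegrable (iota Ω f))
    (hC : ∀ k ∈ Ω.index, kappa X.seq Y.seq k g ≤ C * kappa X.seq Y.seq k f) {t : ℝ} (ht : 0 < t) :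
    kFunctional X.toKotheSpace Y.toKotheSpace t (iota Ω g) ≤
      P.B ^ 2 * (C * ((1 + P.K) * 2)) *
        kFunctional X.toKotheSpace Y.toKotheSpace t (iota Ω f) := by
  have hB : (1 : ℝ) ≤ (P.B : ℝ) ^ 2 := one_le_pow₀ (by exact_mod_cast P.one_le_B)
  have hB' : (1 : ℝ≥0∞) ≤ P.B ^ 2 := one_le_pow₀ (by exact_mod_cast P.one_le_B)
  have hBe : ENNReal.ofReal ((P.B : ℝ) ^ 2) = P.B ^ 2 := by
    rw [ENNReal.ofReal_pow P.B.coe_nonneg, ENNReal.ofReal_coe_nnreal]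
  set D : ℝ≥0∞ := C * ((1 + P.K) * 2)
  have hDB : D ≤ P.B ^ 2 * D := le_mul_of_one_le_left zero_le hB'
  have hgf : ∀ k ∈ Ω.index, kappa X.seq Y.seq k g ≤ Y.seq.N (Pi.single k 1) *
      (D * kFunctional X.toKotheSpace Y.toKotheSpace (ratio X Y k) (iota Ω f)) := fun k hk => by
    calc _ ≤ _ := hC k hk
      _ ≤ C * ((1 + P.K) * 2 * Y.seq.N (Pi.single k 1) * kFunctional X.toKotheSpace
          Y.toKotheSpace (ratio X Y k) (iota Ω f)) := by
          gcongr; exact P.kappa_le_kFunctional_iota hf hk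
      _ = _ := by simp only [D]; ring
  have hcancel : ∀ k ∈ Ω.index, ∀ a b : ℝ≥0∞,
      Y.seq.N (Pi.single k 1) * a ≤ Y.seq.N (Pi.single k 1) * b → a ≤ b := fun k hk a b h =>
    (ENNReal.mul_le_mul_iff_right (Y.seq.single_ne_zero k hk) (Y.seq.single_ne_top k hk)).1 h
  rcases P.ratio_cases ht with ⟨k, hk, h1, h2⟩ | ⟨k, hk, h1, h2⟩ | ⟨k, hk, h1, h2⟩
  · have h3 : kFunctional X.toKotheSpace Y.toKotheSpace (ratio X Y k) (iota Ω g) ≤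
        D * kFunctional X.toKotheSpace Y.toKotheSpace (ratio X Y k) (iota Ω f) := by
      refine hcancel k hk _ _ (le_trans ?_ (hgf k hk))
      have := kFunctional_le_kappa (X := X) (Y := Y) (V := iota Ω) (c := 1)
        (fun X x => by rw [one_mul, seq_apply]) g hk
      rwa [one_mul] at this
    calc _ ≤ _ := kFunctional_mono _ _ h2 _
      _ ≤ _ := kFunctional_mul_le _ _ hB _
      _ ≤ P.B ^ 2 * (D * kFunctional X.toKotheSpace Y.toKotheSpace t (iota Ω f)) := by
          rw [hBe]
          gcongr
          exact h3.trans (mul_le_mul_right (kFunctional_mono _ _ h1 _) _)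
      _ = _ := by ring
  · have h3 : X.seq.N g ≤
        D * kFunctional X.toKotheSpace Y.toKotheSpace (ratio X Y k) (iota Ω f) := by
      refine hcancel k hk _ _ (le_trans ?_ (hgf k hk))
      refine le_trans ?_ le_self_add
      gcongr
      exact (X.seq.congr fun j hj => by rw [indicator_of_mem (show j ∈ Iic k from h2 j hj)]).le
    calc _ ≤ X.eNorm (iota Ω g) + ENNReal.ofReal t * Y.eNorm 0 :=
          kFunctional_le_add _ _ (add_zero _)
      _ = X.seq.N g := by rw [Y.eNorm_zero, mul_zero, add_zero, seq_apply]
      _ ≤ _ := h3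
      _ ≤ _ := mul_le_mul' hDB (kFunctional_mono _ _ h1 _)
  · have hr := ratio_pos (X := X) (Y := Y) hk
    have h3 : ENNReal.ofReal (ratio X Y k) * Y.seq.N g ≤
        D * kFunctional X.toKotheSpace Y.toKotheSpace (ratio X Y k) (iota Ω f) := by
      refine hcancel k hk _ _ (le_trans ?_ (hgf k hk))
      refine le_trans ?_ le_add_self
      rw [← mul_assoc, mul_ofReal_ratio hk]
      gcongr
      exact (Y.seq.congr fun j hj => by rw [indicator_of_mem (show j ∈ Ici k from h2 j hj)]).le
    have hM : 1 ≤ ratio X Y k / t := (one_le_div ht).2 h1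
    have h4 := kFunctional_mul_le X.toKotheSpace Y.toKotheSpace (t := t) hM (iota Ω f)
    rw [div_mul_cancel₀ _ ht.ne'] at h4
    have hre : ENNReal.ofReal (ratio X Y k / t) * ENNReal.ofReal t = ENNReal.ofReal (ratio X Y k) := by
      rw [← ENNReal.ofReal_mul (by positivity), div_mul_cancel₀ _ ht.ne']
    rw [← hre] at h3
    have hM0 : ENNReal.ofReal (ratio X Y k / t) ≠ 0 := by
      simpa using div_pos hr ht
    calc _ ≤ X.eNorm 0 + ENNReal.ofReal t * Y.eNorm (iota Ω g) :=
          kFunctional_le_add _ _ (zero_add _)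
      _ = ENNReal.ofReal t * Y.seq.N g := by rw [X.eNorm_zero, zero_add, seq_apply]
      _ ≤ D * kFunctional X.toKotheSpace Y.toKotheSpace t (iota Ω f) := by
          refine (ENNReal.mul_le_mul_iff_right hM0 ENNReal.ofReal_ne_top).1 ?_
          rw [← mul_assoc]
          refine h3.trans ((mul_le_mul_right h4 _).trans (le_of_eq ?_))
          ring
      _ ≤ _ := by gcongr

/-- A Calderón couple of r.i. spaces gives a Calderón couple of sequence spaces. -/
theorem SepPair.seqCalderon (P : SepPair X.seq Y.seq)
    (h : IsCalderonCouple X.toKotheSpace Y.toKotheSpace) : SeqCalderon X.seq Y.seq := by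
  intro f g hf ⟨C, hC⟩
  obtain ⟨k₀, hk₀⟩ := P.nonempty
  have hKt := P.K_ne_top
  have hF := iota_mem_sumSpace hk₀ (hf k₀ hk₀)
  have hG : iota Ω g ∈ sumSpace X.toKotheSpace Y.toKotheSpace :=
    iota_mem_sumSpace hk₀ (ne_top_of_le_ne_top
      (ENNReal.mul_ne_top ENNReal.coe_ne_top (hf k₀ hk₀)) (hC k₀ hk₀))
  have hFl := locallyIntegrable_of_mem_sumSpace X Y hF
  have hGl := locallyIntegrable_of_mem_sumSpace X Y hG
  set D : ℝ≥0∞ := P.B ^ 2 * (C * ((1 + P.K) * 2))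
  have hDt : D ≠ ⊤ := by finiteness
  -- Dividing `g` by `c` turns the estimate with a constant into the exact comparison of
  -- K-functionals; the summand 1 keeps `c` positive.
  set c : ℝ := D.toReal + 1
  have hc : 0 < c := by positivity
  have hDc : D ≤ ENNReal.ofReal c := by
    rw [← ENNReal.ofReal_toReal hDt]
    exact ENNReal.ofReal_le_ofReal (le_add_of_nonneg_right zero_le_one)
  have hinv : ‖c⁻¹‖ₑ = (ENNReal.ofReal c)⁻¹ := by rw [enorm_inv hc.ne', Real.enorm_of_nonneg hc.le]
  obtain ⟨T, hTX, hTY, hT⟩ := h ⟨_, hF⟩ (c⁻¹ • ⟨_, hG⟩) fun t ht => by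
    rw [Submodule.coe_smul]
    refine (kFunctional_smul_le _ _ (inv_ne_zero hc.ne') _).trans ?_
    rw [hinv, ENNReal.inv_mul_le_iff (by simpa using hc) ENNReal.ofReal_ne_top]
    exact (P.kFunctional_iota_le hFl hC ht).trans (mul_le_mul_left hDc _)
  obtain ⟨A, hA, hAi⟩ := exists_block_average Ω
  -- `T` lives on the sum space only, whereas the sequence operator must act on all sequences. Where
  -- the algebraic extension is arbitrary, the norms of the argument in `X` and `Y` are infinite.
  obtain ⟨T₁, hT₁⟩ := LinearMap.exists_extend
    ((sumSpace X.toKotheSpace Y.toKotheSpace).subtype ∘ₗ T)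
  have hT₁' : ∀ x (hx : x ∈ sumSpace X.toKotheSpace Y.toKotheSpace), T₁ x = T ⟨x, hx⟩ :=
    fun x hx => LinearMap.congr_fun hT₁ ⟨x, hx⟩
  set M := opNormOn X.toKotheSpace T + opNormOn Y.toKotheSpace T + 1
  have hMt : M ≠ ⊤ := by
    have := hTX.ne; have := hTY.ne
    finiteness
  have hbd : ∀ Z : RISpace Ω, opNormOn Z.toKotheSpace T ≤ M →
      (∀ x, Z.eNorm x < ⊤ → x ∈ sumSpace X.toKotheSpace Y.toKotheSpace) → ∀ x,
      Z.seq.N ((c • (A ∘ₗ T₁ ∘ₗ iota Ω)) x) ≤ (ENNReal.ofReal c * (2 * M)).toNNReal * Z.seq.N x := by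
    intro Z hZ hmem x
    rw [ENNReal.coe_toNNReal (by finiteness)]
    by_cases hx : Z.seq.N x = ⊤
    · rw [hx, ENNReal.mul_top]
      · exact le_top
      · simp [M, hc]
    · have hx' := hmem _ (lt_top_iff_ne_top.2 hx)
      change Z.seq.N (c • A (T₁ (iota Ω x))) ≤ _
      rw [Z.seq.smul, Real.enorm_of_nonneg hc.le, hT₁' _ hx']
      calc _ ≤ ENNReal.ofReal c * (2 * Z.eNorm (T ⟨_, hx'⟩)) := by gcongr; exact hA Z _
        _ ≤ ENNReal.ofReal c * (2 * (M * Z.seq.N x)) := by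
            gcongr
            exact (le_opNormOn_mul Z.toKotheSpace T (h := ⟨_, hx'⟩) hx).trans (mul_le_mul_left hZ _)
        _ = _ := by ring
  refine ⟨c • (A ∘ₗ T₁ ∘ₗ iota Ω), (ENNReal.ofReal c * (2 * M)).toNNReal,
    hbd X (le_self_add.trans le_self_add) fun x hx => Submodule.mem_sup_left hx,
    hbd Y (le_add_self.trans le_self_add) fun x hx => Submodule.mem_sup_right hx, fun k hk => ?_⟩
  change c * A (T₁ (iota Ω f)) k = g k
  rw [hT₁' _ hF, hT, Submodule.coe_smul, map_smul, Pi.smul_apply, smul_eq_mul, hAi g hGl k hk,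
    mul_inv_cancel_left₀ hc.ne']

/-! ## Comparison of the shift properties -/

theorem seqNorm_restrict {Ω : Domain} (X : RISpace Ω) (z : ℤ → ℝ) :
    seqNorm X (fun k => z k) = X.seq.N z := by
  rw [seq_apply, seqNorm]
  congr 1
  refine AEEqFun.ext ((AEEqFun.coeFn_mk _ _).trans ?_)
  filter_upwards [iota_ae (Ω := Ω) z, Ω.ae_pos] with t h1 h2
  rw [h1, stepFun, tsum_eq_single ⟨lg t, h2.2⟩]
  · rw [indicator_of_mem (mem_block_lg h2.1), mul_one]
  · intro k hk
    rw [indicator_of_notMem, mul_zero]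
    exact fun h => hk (Subtype.ext (lg_of_mem h).symm)

/-- Interlaced pairs are indexed by intervals and ordered by consecutive indices, so the gaps of a
finite index set have to be closed. -/
theorem exists_enumeration (s : Finset ℤ) :
    ∃ f : ℤ → ℤ, (∀ m n : ℤ, 0 ≤ m → m < n → n < s.card → f m < f n) ∧
      (Finset.Ico 0 (s.card : ℤ)).image f = s := by
  classical
  induction s using Finset.induction_on_max with
  | empty => exact ⟨id, fun _ _ _ h _ => h, by simp⟩
  | insert a s ha ih =>
    obtain ⟨f, hf, hfs⟩ := ih
    have has : a ∉ s := fun h => lt_irrefl _ (ha a h)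
    have hmem : ∀ m : ℤ, 0 ≤ m → m < s.card → f m ∈ s := fun m h0 h1 =>
      hfs ▸ Finset.mem_image_of_mem f (Finset.mem_Ico.2 ⟨h0, h1⟩)
    refine ⟨Function.update f s.card a, fun m n hm hmn hn => ?_, ?_⟩
    · rw [Finset.card_insert_of_notMem has] at hn
      push_cast at hn
      rw [Function.update_of_ne (by omega)]
      by_cases h : n = s.card
      · rw [h, Function.update_self]
        exact ha _ (hmem m hm (by omega))
      · rw [Function.update_of_ne h]
        exact hf m n hm hmn (by omega)
    · rw [Finset.card_insert_of_notMem has]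
      have h1 : Finset.Ico 0 ((s.card + 1 : ℕ) : ℤ) =
          insert (s.card : ℤ) (Finset.Ico 0 (s.card : ℤ)) := by
        ext m; simp only [Finset.mem_Ico, Finset.mem_insert]; omega
      rw [h1, Finset.image_insert, Function.update_self]
      congr 1
      refine (Finset.image_congr fun m hm => ?_).trans hfs
      have := Finset.mem_Ico.1 hm
      exact Function.update_of_ne (by omega) _ _

section Properties

variable {J : Set ℤ}

theorem SeqLattice.sum_subset_le (E : SeqLattice J) {s s' : Finset ℤ} (hs : s' ⊆ s) {u : ℤ → ℤ → ℝ}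
    (hu : ∀ n ∈ s, ∀ m ∈ s, ∀ k, u n k ≠ 0 → u m k ≠ 0 → n = m) :
    E.N (∑ n ∈ s', u n) ≤ E.N (∑ n ∈ s, u n) := by
  classical
  refine E.mono _ _ fun k _ => ?_
  rw [Finset.sum_apply, Finset.sum_apply]
  by_cases h : ∃ n ∈ s', u n k ≠ 0
  · obtain ⟨n, hn, hnk⟩ := h
    rw [Finset.sum_eq_single_of_mem n hn, Finset.sum_eq_single_of_mem n (hs hn)]
    · intro m hm hmn
      by_contra h0
      exact hmn (hu m hm n (hs hn) k h0 hnk)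
    · intro m hm hmn
      by_contra h0
      exact hmn (hu m (hs hm) n (hs hn) k h0 hnk)
  · push Not at h
    rw [Finset.sum_eq_zero h, abs_zero]
    exact abs_nonneg _

/-- Pairs with `v n = 0` are dropped, which only decreases the sum of the `u n`; the remaining ones
are reindexed by an interval and normalized, and the norms of the `u n` become the scalars. -/
theorem SeqRSP.of_rightShiftProperty {E : SeqLattice J} {N : (J → ℝ) → ℝ≥0∞}
    (hN : ∀ z : ℤ → ℝ, N (fun k => z k) = E.N z) (h : RightShiftProperty N) : SeqRSP E := by
  classical
  obtain ⟨C, hC⟩ := h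
  refine ⟨C.toNNReal, fun s u v hfin huv hlt hle => ?_⟩
  set s' := s.filter fun n => v n ≠ 0
  have hs' : s' ⊆ s := Finset.filter_subset _ _
  have hv : ∑ n ∈ s, v n = ∑ n ∈ s', v n :=
    (Finset.sum_subset hs' fun n hn hn' => by
      by_contra h0; exact hn' (Finset.mem_filter.2 ⟨hn, h0⟩)).symm
  have hu : E.N (∑ n ∈ s', u n) ≤ E.N (∑ n ∈ s, u n) := by
    refine E.sum_subset_le hs' fun n hn m hm k hnk hmk => ?_
    rcases lt_trichotomy n m with h | h | h
    · exact absurd (hlt n hn m hm h k (Or.inl hnk) k (Or.inl hmk)) (lt_irrefl _)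
    · exact h
    · exact absurd (hlt m hm n hn h k (Or.inl hmk) k (Or.inl hnk)) (lt_irrefl _)
  rw [hv]
  refine le_trans ?_ (mul_le_mul_right hu _)
  obtain ⟨f, hf, hfs⟩ := exists_enumeration s'
  set c : ℤ := (s'.card : ℤ)
  have hmem : ∀ n, 0 ≤ n → n < c → f n ∈ s ∧ v (f n) ≠ 0 := fun n h0 h1 =>
    Finset.mem_filter.1 (hfs ▸ Finset.mem_image_of_mem f (Finset.mem_Ico.2 ⟨h0, h1⟩))
  have hinj : InjOn f (Finset.Ico 0 c) := fun m hm n hn hmn => by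
    have hm' := Finset.mem_Ico.1 hm
    have hn' := Finset.mem_Ico.1 hn
    rcases lt_trichotomy m n with h | h | h
    · exact absurd hmn (hf m n hm'.1 h hn'.2).ne
    · exact h
    · exact absurd hmn (hf n m hn'.1 h hm'.2).ne'
  set r : ℤ → ℝ := fun n => (E.N (u (f n))).toReal
  have hne : ∀ z : ℤ → ℝ, z ≠ 0 → Function.support z ⊆ J → E.N z ≠ 0 := fun z hz hzJ => by
    obtain ⟨k, hk⟩ := Function.ne_iff.1 hz
    exact E.ne_zero_of (hzJ hk) hk
  have hN0 : ∀ n, 0 ≤ n → n < c → E.N (u (f n)) ≠ 0 := fun n h0 h1 => by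
    obtain ⟨h2, h3⟩ := hmem n h0 h1
    have := hne _ h3 (hfin _ h2).2.2.2
    exact (pos_iff_ne_zero.2 this |>.trans_le (hle _ h2)).ne'
  have hNt : ∀ n, 0 ≤ n → n < c → E.N (u (f n)) ≠ ⊤ := fun n h0 h1 =>
    (E.single_lt_of_finite ((hfin _ (hmem n h0 h1).1).1.inter_of_left _)).ne
  have hr : ∀ n, 0 ≤ n → n < c → 0 < r n := fun n h0 h1 =>
    ENNReal.toReal_pos (hN0 n h0 h1) (hNt n h0 h1)
  have hrN : ∀ n, 0 ≤ n → n < c → ∀ z : ℤ → ℝ, E.N ((r n)⁻¹ • z) = (E.N (u (f n)))⁻¹ * E.N z :=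
    fun n h0 h1 z => by
    rw [E.smul, enorm_inv (hr n h0 h1).ne', Real.enorm_of_nonneg (hr n h0 h1).le,
      ENNReal.ofReal_toReal (hNt n h0 h1)]
  set α : ℤ →₀ ℝ := Finsupp.onFinset (Finset.Ico 0 c) (fun n => if n ∈ Finset.Ico 0 c then r n else 0)
    fun n hn => by by_contra h; exact hn (if_neg h)
  have hα : α.support ⊆ Finset.Ico 0 c := Finsupp.support_onFinset_subset
  have hsum : ∀ w : ℤ → ℤ → ℝ, N (α.sum fun n a => a • fun k : J => ((r n)⁻¹ • w (f n)) k) =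
      E.N (∑ n ∈ s', w n) := fun w => by
    rw [Finsupp.sum_of_support_subset α hα (fun n a => a • fun k : J => ((r n)⁻¹ • w (f n)) k)
      (fun n _ => zero_smul _ _), ← hN, ← hfs,
      Finset.sum_image hinj]
    congr 1
    ext k
    rw [Finset.sum_apply, Finset.sum_apply]
    refine Finset.sum_congr rfl fun n hn => ?_
    have hn' := Finset.mem_Ico.1 hn
    simp only [α, Finsupp.onFinset_apply, if_pos hn, Pi.smul_apply, smul_eq_mul]
    rw [mul_inv_cancel_left₀ (hr n hn'.1 hn'.2).ne']
  have hnz : ∀ n, 0 ≤ n → n < c → ∀ z : ℤ → ℝ, z ≠ 0 → Function.support z ⊆ J →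
      (fun k : J => ((r n)⁻¹ • z) k) ≠ 0 := fun n h0 h1 z hz hzJ => by
    obtain ⟨k, hk⟩ := Function.ne_iff.1 hz
    refine Function.ne_iff.2 ⟨⟨k, hzJ hk⟩, ?_⟩
    exact mul_ne_zero (inv_ne_zero (hr n h0 h1).ne') hk
  have hsupp : ∀ n (z : ℤ → ℝ) (k : J), k ∈ Function.support (fun k : J => ((r n)⁻¹ • z) k) →
      (k : ℤ) ∈ Function.support z := fun n z k hk h0 => hk (by simp [h0])
  have hf' : ∀ n (z : ℤ → ℝ), (Function.support z).Finite →
      (Function.support (fun k : J => ((r n)⁻¹ • z) k)).Finite := fun n z hz =>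
    (hz.preimage Subtype.val_injective.injOn).subset fun k hk => hsupp n z k hk
  have hmain := hC (Ico 0 c) (fun n => fun k : J => ((r n)⁻¹ • u (f n)) k)
    (fun n => fun k : J => ((r n)⁻¹ • v (f n)) k) ordConnected_Ico
    { ne_zero_left := fun n hn => hnz n hn.1 hn.2 _ (fun h0 => hN0 n hn.1 hn.2 (by rw [h0, E.zero]))
        (hfin _ (hmem n hn.1 hn.2).1).2.1
      ne_zero_right := fun n hn => hnz n hn.1 hn.2 _ (hmem n hn.1 hn.2).2
        (hfin _ (hmem n hn.1 hn.2).1).2.2.2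
      finite_left := fun n hn => hf' n _ (hfin _ (hmem n hn.1 hn.2).1).1
      finite_right := fun n hn => hf' n _ (hfin _ (hmem n hn.1 hn.2).1).2.2.1
      lt := fun n hn a ha b hb =>
        huv _ (hmem n hn.1 hn.2).1 a (hsupp n _ a ha) b (hsupp n _ b hb)
      lt_succ := fun n hn hn1 a ha b hb =>
        hlt _ (hmem n hn.1 hn.2).1 _ (hmem _ hn1.1 hn1.2).1 (hf n (n + 1) hn.1 (by omega) hn1.2)
          a (Or.inr (hsupp n _ a ha)) b (Or.inl (hsupp _ _ b hb)) }
    (fun n hn => by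
      rw [hN, hN, hrN n hn.1 hn.2, hrN n hn.1 hn.2]
      exact ⟨mul_le_mul_right (hle _ (hmem n hn.1 hn.2).1) _,
        ENNReal.inv_mul_cancel (hN0 n hn.1 hn.2) (hNt n hn.1 hn.2)⟩)
    α (fun n hn => Finset.mem_Ico.1 (hα hn))
  rw [hsum v, hsum u] at hmain
  exact hmain

/-- Extension by zero of a sequence on `J`. -/
def zeroExtend (x : J → ℝ) : ℤ → ℝ := Function.extend Subtype.val x 0

theorem zeroExtend_apply (x : J → ℝ) (k : J) : zeroExtend x k = x k :=
  Subtype.val_injective.extend_apply x 0 k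

theorem support_zeroExtend (x : J → ℝ) :
    Function.support (zeroExtend x) = Subtype.val '' Function.support x := by
  ext k
  constructor
  · intro hk
    by_cases h : k ∈ J
    · exact ⟨⟨k, h⟩, by rwa [Function.mem_support, ← zeroExtend_apply x ⟨k, h⟩], rfl⟩
    · exact absurd (Function.extend_apply' x (0 : ℤ → ℝ) k (by rintro ⟨a, rfl⟩; exact h a.2)) hk
  · rintro ⟨a, ha, rfl⟩
    rwa [Function.mem_support, zeroExtend_apply]

theorem SeqRSPInterval.rightShiftProperty {E : SeqLattice J} {N : (J → ℝ) → ℝ≥0∞}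
    (hN : ∀ z : ℤ → ℝ, N (fun k => z k) = E.N z) (h : SeqRSPInterval E) : RightShiftProperty N := by
  obtain ⟨C, hC⟩ := h
  have hN' : ∀ x : J → ℝ, N x = E.N (zeroExtend x) := fun x => by
    rw [← hN]; congr 1; ext k; exact (zeroExtend_apply x k).symm
  have hlt : ∀ x y : J → ℝ, SuppLT x y → ∀ a ∈ Function.support (zeroExtend x),
      ∀ b ∈ Function.support (zeroExtend y), a < b := fun x y hxy a ha b hb => by
    rw [support_zeroExtend] at ha hb
    obtain ⟨a, ha, rfl⟩ := ha
    obtain ⟨b, hb, rfl⟩ := hb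
    exact hxy a ha b hb
  have hne : ∀ x : J → ℝ, x ≠ 0 → zeroExtend x ≠ 0 := fun x hx h0 => hx (by
    ext k; exact (zeroExtend_apply x k).symm.trans (congrFun h0 k))
  have hJ : ∀ x : J → ℝ, Function.support (zeroExtend x) ⊆ J := fun x => by
    rw [support_zeroExtend]; rintro _ ⟨a, -, rfl⟩; exact a.2
  have hf : ∀ x : J → ℝ, (Function.support x).Finite → (Function.support (zeroExtend x)).Finite :=
    fun x hx => by rw [support_zeroExtend]; exact hx.image _
  refine ⟨C, fun I x y hI hxy hle α hα => ?_⟩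
  have hsum : ∀ w : ℤ → J → ℝ, N (α.sum fun n c => c • w n) =
      E.N (∑ n ∈ α.support, α n • zeroExtend (w n)) := fun w => by
    rw [← hN]
    congr 1
    ext k
    rw [Finsupp.sum, Finset.sum_apply, Finset.sum_apply]
    refine Finset.sum_congr rfl fun n _ => ?_
    rw [Pi.smul_apply, Pi.smul_apply, zeroExtend_apply]
  rw [hsum, hsum, ENNReal.ofReal_coe_nnreal]
  exact hC I (fun n => zeroExtend (x n)) (fun n => zeroExtend (y n)) hI
    (fun n hn => ⟨hne _ (hxy.ne_zero_left n hn), hne _ (hxy.ne_zero_right n hn),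
      hf _ (hxy.finite_left n hn), hJ _, hf _ (hxy.finite_right n hn), hJ _⟩)
    (fun n hn => hlt _ _ (hxy.lt n hn)) (fun n hn hn1 => hlt _ _ (hxy.lt_succ n hn hn1))
    (fun n hn => by rw [← hN', ← hN']; exact (hle n hn).1) α.support α hα

/-- Reflection of a sequence on `J`. -/
def flip (x : J → ℝ) : (Neg.neg ⁻¹' J : Set ℤ) → ℝ := fun k => x ⟨-k, k.2⟩

/-- Reflection of a sequence on `-J`. -/
def unflip (x : (Neg.neg ⁻¹' J : Set ℤ) → ℝ) : J → ℝ := fun k => x ⟨-k, by simp⟩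

theorem unflip_flip (x : J → ℝ) : unflip (flip x) = x := by
  ext k; simp [flip, unflip]

theorem flip_unflip (x : (Neg.neg ⁻¹' J : Set ℤ) → ℝ) : flip (unflip x) = x := by
  ext k; simp [flip, unflip]

theorem suppLT_flip {x y : J → ℝ} (h : SuppLT x y) : SuppLT (flip y) (flip x) :=
  fun a ha b hb => by
    have := h ⟨-b, b.2⟩ hb ⟨-a, a.2⟩ ha
    change -(b : ℤ) < -(a : ℤ) at this
    exact (by omega : (a : ℤ) < b)

theorem suppLT_unflip {x y : (Neg.neg ⁻¹' J : Set ℤ) → ℝ} (h : SuppLT x y) :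
    SuppLT (unflip y) (unflip x) :=
  fun a ha b hb => by
    have := h ⟨-b, by simp⟩ hb ⟨-a, by simp⟩ ha
    change -(b : ℤ) < -(a : ℤ) at this
    exact (by omega : (a : ℤ) < b)

theorem finite_support_flip {x : J → ℝ} (h : (Function.support x).Finite) :
    (Function.support (flip x)).Finite :=
  h.preimage (f := fun k : (Neg.neg ⁻¹' J : Set ℤ) => (⟨-k, k.2⟩ : J)) fun _ _ _ _ hab =>
    Subtype.ext (neg_injective (congrArg Subtype.val hab))

theorem finite_support_unflip {x : (Neg.neg ⁻¹' J : Set ℤ) → ℝ} (h : (Function.support x).Finite) :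
    (Function.support (unflip x)).Finite :=
  h.preimage (f := fun k : J => (⟨-k, by simp⟩ : (Neg.neg ⁻¹' J : Set ℤ))) fun _ _ _ _ hab =>
    Subtype.ext (neg_injective (congrArg Subtype.val hab))

theorem sum_neg_support (α : ℤ →₀ ℝ) {V : Type*} [AddCommGroup V] [Module ℝ V] (w : ℤ → V) :
    ((α.equivMapDomain (Equiv.neg ℤ)).sum fun n c => c • w (-n)) = α.sum fun n c => c • w n := by
  rw [Finsupp.sum_equivMapDomain]
  simp

theorem neg_mem_of_support {α : ℤ →₀ ℝ} {I : Set ℤ} (hα : ↑α.support ⊆ I) :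
    ↑(α.equivMapDomain (Equiv.neg ℤ)).support ⊆ (Neg.neg ⁻¹' I : Set ℤ) := fun n hn => by
  refine hα (Finset.mem_coe.2 (Finsupp.mem_support_iff.2 fun h => ?_))
  refine Finsupp.mem_support_iff.1 (Finset.mem_coe.1 hn) ?_
  rw [Finsupp.equivMapDomain_apply]
  exact h

theorem neg_preimage_ordConnected {I : Set ℤ} (hI : I.OrdConnected) :
    (Neg.neg ⁻¹' I : Set ℤ).OrdConnected :=
  ⟨fun _ ha _ hb _ hc => hI.out hb ha ⟨neg_le_neg hc.2, neg_le_neg hc.1⟩⟩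

/-- Reflection reverses the order of supports, so the two vectors of each pair change roles and the
indices change sign. -/
theorem LeftShiftProperty.mirror {N : (J → ℝ) → ℝ≥0∞} (h : LeftShiftProperty N) :
    RightShiftProperty fun x : (Neg.neg ⁻¹' J : Set ℤ) → ℝ => N (unflip x) := by
  obtain ⟨C, hC⟩ := h
  refine ⟨C, fun I x y hI hxy hle α hα => ?_⟩
  have hsum : ∀ w : ℤ → (Neg.neg ⁻¹' J : Set ℤ) → ℝ, unflip (α.sum fun n c => c • w n) =
      (α.equivMapDomain (Equiv.neg ℤ)).sum fun n c => c • unflip (w (-n)) := fun w => by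
    rw [sum_neg_support α fun n => unflip (w n)]
    ext k
    simp [unflip, Finsupp.sum, Finset.sum_apply]
  have hne : ∀ x : (Neg.neg ⁻¹' J : Set ℤ) → ℝ, x ≠ 0 → unflip x ≠ 0 := fun x hx h0 => hx (by
    rw [← flip_unflip x, h0]; rfl)
  change N (unflip _) ≤ _ * N (unflip _)
  rw [hsum x, hsum y]
  exact hC (Neg.neg ⁻¹' I) (fun n => unflip (y (-n))) (fun n => unflip (x (-n)))
    (neg_preimage_ordConnected hI)
    { ne_zero_left := fun n hn => hne _ (hxy.ne_zero_right _ hn)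
      ne_zero_right := fun n hn => hne _ (hxy.ne_zero_left _ hn)
      finite_left := fun n hn => finite_support_unflip (hxy.finite_right _ hn)
      finite_right := fun n hn => finite_support_unflip (hxy.finite_left _ hn)
      lt := fun n hn => suppLT_unflip (hxy.lt _ hn)
      lt_succ := fun n hn hn1 => by
        have e : -(n + 1) + 1 = -n := by ring
        have := hxy.lt_succ (-(n + 1)) hn1 (by rw [e]; exact hn)
        rw [e] at this
        exact suppLT_unflip this }
    (fun n hn => hle _ hn) _ (neg_mem_of_support hα)

theorem LeftShiftProperty.of_mirror {N : (J → ℝ) → ℝ≥0∞}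
    (h : RightShiftProperty fun x : (Neg.neg ⁻¹' J : Set ℤ) → ℝ => N (unflip x)) :
    LeftShiftProperty N := by
  obtain ⟨C, hC⟩ := h
  refine ⟨C, fun I x y hI hxy hle α hα => ?_⟩
  have hsum : ∀ w : ℤ → J → ℝ, (α.sum fun n c => c • w n) =
      unflip ((α.equivMapDomain (Equiv.neg ℤ)).sum fun n c => c • flip (w (-n))) := fun w => by
    rw [sum_neg_support α fun n => flip (w n)]
    ext k
    simp [unflip, flip, Finsupp.sum, Finset.sum_apply]
  have hne : ∀ x : J → ℝ, x ≠ 0 → flip x ≠ 0 := fun x hx h0 => hx (by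
    rw [← unflip_flip x, h0]; rfl)
  rw [hsum x, hsum y]
  exact hC (Neg.neg ⁻¹' I) (fun n => flip (y (-n))) (fun n => flip (x (-n)))
    (neg_preimage_ordConnected hI)
    { ne_zero_left := fun n hn => hne _ (hxy.ne_zero_right _ hn)
      ne_zero_right := fun n hn => hne _ (hxy.ne_zero_left _ hn)
      finite_left := fun n hn => finite_support_flip (hxy.finite_right _ hn)
      finite_right := fun n hn => finite_support_flip (hxy.finite_left _ hn)
      lt := fun n hn => suppLT_flip (hxy.lt _ hn)
      lt_succ := fun n hn hn1 => by
        have e : -(n + 1) + 1 = -n := by ring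
        have := hxy.lt_succ (-(n + 1)) hn1 (by rw [e]; exact hn)
        rw [e] at this
        exact suppLT_flip this }
    (fun n hn => by simpa only [unflip_flip] using hle _ hn) _ (neg_mem_of_support hα)

theorem restrict_mirror {E : SeqLattice J} {N : (J → ℝ) → ℝ≥0∞}
    (hN : ∀ z : ℤ → ℝ, N (fun k => z k) = E.N z) (z : ℤ → ℝ) :
    N (unflip fun k => z k) = E.mirror.N z := hN fun k => z (-k)

end Properties

end Calderon

end

/-! ### The equivalence -/

theorem theorem5p3 (Ω : Calderon.Domain) (X Y : Calderon.RISpace Ω)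
    (h : Calderon.upperBoydIndex X < Calderon.lowerBoydIndex Y) :
    Calderon.IsCalderonCouple X.toKotheSpace Y.toKotheSpace ↔
      Calderon.IsStretchable X ∧ Calderon.IsCompressible Y := by
  obtain ⟨P⟩ := Calderon.exists_sepPair_of_boyd X Y h
  constructor
  · intro hcal
    have hs := P.seqCalderon hcal
    exact ⟨(P.seqRSPInterval_of_seqCalderon hs).rightShiftProperty (Calderon.seqNorm_restrict X),
      Calderon.LeftShiftProperty.of_mirror
        ((P.mirror.seqRSPInterval_of_seqCalderon hs.mirror).rightShiftProperty
          (Calderon.restrict_mirror (Calderon.seqNorm_restrict Y)))⟩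
  · rintro ⟨hX, hY⟩
    exact P.isCalderonCouple (Calderon.seqCalderon_of_shift P
      (Calderon.SeqRSP.of_rightShiftProperty (Calderon.seqNorm_restrict X) hX)
      (Calderon.SeqRSP.of_rightShiftProperty
        (Calderon.restrict_mirror (Calderon.seqNorm_restrict Y)) hY.mirror))
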